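/- **Setting.** Let $k$ be a field of characteristic $p>0$, let $\mathcal O$ be a complete discrete valuation ring of characteristic $0$ with residue field $k$ (equivalently, a finite totally ramified extension of a Cohen ring of $k$), and let $\pi$ be a uniformizer of $\mathcal O$. Let $v_p$ be the valuation on $\mathcal O[1/p]$ with $v_p(p)=1$. Let $\Gamma^{k((t))}$ be the ring of bidirectional series $\sum_{i\in\mathbb Z}x_iu^i$ with $x_i\in\mathcal O$ and $|x_i|\to0$ as $i\to-\infty$; its residue field is $k((t))$, with $u\mapsto t$. Fix a ring endomorphism $\sigma_0$ of $\Gamma^{k((t))}$ that lifts the $p$-power Frobenius of $k((t))$, maps $\mathcal O$ into itself, is continuous for the levelwise topology (a basis of neighbourhoods of $0$ is given by the sets $\{x: v_p(x_i)>n \text{ for all } i\le c\}$), and maps $\Gamma^{k((t))}_{\mathrm{con}}=\{x:\liminf_{i\to-\infty}v_p(x_i)/(-i)>0\}$ into itself. **Valued fields.** A *valued field* is an algebraic extension $K$ of $k((t))$ (inside a fixed algebraic closure) with subextensions $k((t))\subseteq L\subseteq M\subseteq N\subseteq K$ such that $L=k^{1/p^m}((t))$ for some $m\in\{0,1,\dots,\infty\}$;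 $M=k_M((t))$ with $k_M/k^{1/p^m}$ separable algebraic; $N=M^{1/p^n}$ for some $n\in\{0,1,\dots,\infty\}$; and $K/N$ is separable algebraic with no residue field extension. (For infinite extensions of constants, these Laurent series fields are understood as unions over the finite levels: $k^{1/p^\infty}((t))=\bigcup_m k^{1/p^m}((t))$, and $M$ is the compositum of $L$ and $k_M$.) Let $v_K$ be the valuation on $k((t))^{\mathrm{alg}}$ with $v_K(t)=1$. **The rings $\Gamma^K$ and $\Gamma^K_r$.** Let $\Gamma^{\mathrm{perf}}$ be the $p$-adically completed direct limit of $\Gamma^{k((t))}\to\Gamma^{k((t))}\to\cdots$ along $\sigma_0$; it is a complete discrete valuation ring with residue field $k((t))^{\mathrm{perf}}$. Let $\Gamma^{\mathrm{alg}}=W(k((t))^{\mathrm{alg}})\otimes_{W(k((t))^{\mathrm{perf}})}\Gamma^{\mathrm{perf}}$; it is a complete discrete valuation ring with uniformizer $\pi$ and residue field $k((t))^{\mathrm{alg}}$, and $\sigma_0$ extends to an automorphism of it. For a valued field $K$ with $L,M,N,m,n$ as above, let $\Gamma^L\subseteq\Gamma^{\mathrm{alg}}$ be the ring of series in $u$ with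 coefficients in $\sigma_0^{-m}(\mathcal O)$ (the union over finite levels if $m=\infty$), and let $\Gamma^K\subseteq\Gamma^{\mathrm{alg}}$ be the complete discrete valuation ring with residue field $K$ that is the completed unramified extension of $\sigma_0^{-n}(\Gamma^L)$ (of $\bigcup_i\sigma_0^{-i}(\Gamma^L)$ if $n=\infty$). For $x=\sum_i\pi^i[\overline{x_i}]\in\Gamma^{\mathrm{alg}}[1/p]$ with $\overline{x_i}\in k((t))^{\mathrm{alg}}$, and for $n$ in the value group of $\mathcal O$, put $$v_n(x)=\min_{v_p(\pi^i)\le n}v_K(\overline{x_i}),\qquad w_s(x)=\min_n\{s\,v_n(x)+n\},\qquad |x|_s=p^{-w_s(x)}.$$ For $r>0$ let $\Gamma^K_r$ be the ring of $x\in\Gamma^K$ with $r\,v_n(x)+n\to\infty$ as $n\to\infty$. Let $\Gamma^K_{\mathrm{an},r}$ be the Fréchet completion of $\Gamma^K_r[1/p]$ for the norms $|\cdot|_s$, $0<s\le r$, that is, the ring of sequences in $\Gamma^K_r[1/p]$ that are Cauchy for all these norms, modulo the sequences that tend to $0$ for all of them. Let $\Gamma^K_{\mathrm{an},\mathrm{con}}=\bigcup_{r>0}\Gamma^K_{\mathrm{an},r}$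 (direct limit as $r\to0$). **Theorem.** Let $K$ be a valued field that is either finite over $k((t))$ or perfect, and let $r>0$ be a real number such that for every nonzero $a\in K$ there is a unit of $\Gamma^K_r$ whose reduction in $K$ is $a$. Then every finitely generated ideal of $\Gamma^K_{\mathrm{an},r}$ is principal. In particular, every finitely generated ideal of $\Gamma^K_{\mathrm{an},\mathrm{con}}$ is principal, that is, $\Gamma^K_{\mathrm{an},\mathrm{con}}$ is a Bézout ring. -/

import Mathlib

open Filter Topology
open scoped TensorProduct

universe u

set_option linter.unusedSectionVars false

noncomputable section Gamma

/-! ## Valued fields -/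

section ValuedFields

variable (p : ℕ) (k : Type u) [Field k]

/-- The fixed algebraic closure `k((t))^alg` of the Laurent series field `k((t))`. All algebraic
extensions of `k((t))` are realised inside it. -/
abbrev LaurentAlg : Type u := AlgebraicClosure (LaurentSeries k)

variable {k}

/-- The valuation `v_K` on `k((t))^alg` that extends the `t`-adic valuation of the complete field
`k((t))`, with `v_K(t) = 1` and `v_K(0) = ∞`: by uniqueness of the extension, `v_K(x)` is the
order in `t` of the constant term of the minimal polynomial of `x`, divided by its degree. -/
def laurentVal (x : LaurentAlg k) : EReal :=
  open Classical in
  if x = 0 then ⊤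
  else ((((((minpoly (LaurentSeries k) x).coeff 0).order : ℤ) : ℝ) /
    ((minpoly (LaurentSeries k) x).natDegree : ℝ) : ℝ) : EReal)

/-- A presentation of an algebraic extension `K` of `k((t))` as a valued field: subextensions
`k((t)) ⊆ L ⊆ M ⊆ N ⊆ K` with
* `L = k^{1/p^m}((t))`, `m ∈ {0, 1, …, ∞}` (for `m = ∞` this is the union over all finite `m`);
* `M = k_M((t))` with `k_M / k^{1/p^m}` separable algebraic (for infinite `k_M / k^{1/p^m}` this
  is the union over finite subextensions; thus in all cases `M` is the compositum of `L` and
  `k_M`);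
* `N = M^{1/p^n}`, `n ∈ {0, 1, …, ∞}`;
* `K / N` separable algebraic and totally ramified (no residue field extension). -/
structure ValuedFieldChain (K : IntermediateField (LaurentSeries k) (LaurentAlg k)) where
  /-- the exponent `m` -/
  m : ℕ∞
  /-- the exponent `n` -/
  n : ℕ∞
  /-- the constant field `k^{1/p^m}` -/
  kL : IntermediateField k (LaurentAlg k)
  /-- the constant field `k_M` -/
  kM : IntermediateField k (LaurentAlg k)
  /-- the subextension `L` -/
  L : IntermediateField (LaurentSeries k) (LaurentAlg k)
  /-- the subextension `M` -/
  M : IntermediateField (LaurentSeries k) (LaurentAlg k)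
  /-- the subextension `N` -/
  N : IntermediateField (LaurentSeries k) (LaurentAlg k)
  mem_kL : ∀ x : LaurentAlg k, x ∈ kL ↔
    ∃ i : ℕ, (i : ℕ∞) ≤ m ∧ ∃ a : k, x ^ p ^ i = algebraMap k (LaurentAlg k) a
  /- a series in `k^{1/p^i}((t))` is a `p^i`-th root of a series in `k((t^{p^i}))` -/
  mem_L : ∀ x : LaurentAlg k, x ∈ L ↔
    ∃ i : ℕ, (i : ℕ∞) ≤ m ∧ ∃ g : LaurentSeries k,
      (∀ j : ℤ, g.coeff j ≠ 0 → (p : ℤ) ^ i ∣ j) ∧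
        x ^ p ^ i = algebraMap (LaurentSeries k) (LaurentAlg k) g
  kL_le_kM : kL ≤ kM
  separable_kM : ∀ x ∈ kM, IsSeparable kL x
  M_eq : M = L ⊔ IntermediateField.adjoin (LaurentSeries k) (kM : Set (LaurentAlg k))
  mem_N : ∀ x : LaurentAlg k, x ∈ N ↔ ∃ i : ℕ, (i : ℕ∞) ≤ n ∧ x ^ p ^ i ∈ M
  N_le_K : N ≤ K
  separable_K : ∀ x ∈ K, IsSeparable N x
  totallyRamified : ∀ x ∈ K, 0 ≤ laurentVal x → ∃ y ∈ N, 0 < laurentVal (x - y)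

end ValuedFields

/-! ## The ring `Γ` of the field `k((t))` and its Frobenius lift -/

section Classical

variable {O : Type u} [CommRing O]

/-- The ideal generated by `ϖ` in the ring of Laurent series `O((u))`. -/
def laurentIdeal (ϖ : O) : Ideal (LaurentSeries O) := Ideal.span {HahnSeries.C ϖ}

/-- The ring `Γ^{k((t))}` of bidirectional power series `∑_{i ∈ ℤ} x_i u^i` over the complete
discrete valuation ring `O` with `|x_i| → 0` as `i → -∞`, that is, the `ϖ`-adic completion of
`O((u))`. -/
abbrev GammaLaurent (ϖ : O) : Type u := AdicCompletion (laurentIdeal ϖ) (LaurentSeries O)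

/-- The inclusion `O((u)) → Γ^{k((t))}`. -/
def GammaLaurent.of (ϖ : O) : LaurentSeries O →+* GammaLaurent ϖ :=
  algebraMap (LaurentSeries O) (GammaLaurent ϖ)

/-- The constants `O → Γ^{k((t))}`. -/
def GammaLaurent.const (ϖ : O) : O →+* GammaLaurent ϖ :=
  (GammaLaurent.of ϖ).comp HahnSeries.C

/-- The power `u ^ j` of the series parameter, for `j ∈ ℤ`. -/
def GammaLaurent.uPow (ϖ : O) (j : ℤ) : GammaLaurent ϖ :=
  GammaLaurent.of ϖ (HahnSeries.single j 1)

/-- `ϖ ^ N` divides the coefficient `x_i` of `x = ∑ x_i u^i`. -/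
def GammaLaurent.DvdCoeff {ϖ : O} (N : ℕ) (i : ℤ) (x : GammaLaurent ϖ) : Prop :=
  ∃ f : LaurentSeries O,
    AdicCompletion.evalₐ (laurentIdeal ϖ) N x = Ideal.Quotient.mk (laurentIdeal ϖ ^ N) f ∧
      ϖ ^ N ∣ f.coeff i

/-- The basic neighbourhoods of zero of the levelwise topology: the set of `x = ∑ x_i u^i` whose
naive partial valuation at level `v(ϖ^n)` exceeds `c`, i.e. such that `v(x_i) > v(ϖ^n)` for all
`i ≤ c`. -/
def GammaLaurent.levelNhd (ϖ : O) (n : ℕ) (c : ℤ) : Set (GammaLaurent ϖ) :=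
  {x | ∀ i ≤ c, GammaLaurent.DvdCoeff (n + 1) i x}

/-- The closure of a set for the levelwise topology. -/
def GammaLaurent.levelClosure {ϖ : O} (S : Set (GammaLaurent ϖ)) : Set (GammaLaurent ϖ) :=
  {x | ∀ (n : ℕ) (c : ℤ), ∃ y ∈ S, x - y ∈ GammaLaurent.levelNhd ϖ n c}

/-- `Γ_con^{k((t))}`: the series `∑ x_i u^i` with `liminf_{i → -∞} v(x_i) / (-i) > 0`. -/
def GammaLaurent.con (ϖ : O) : Set (GammaLaurent ϖ) :=
  {x | ∃ c : ℝ, 0 < c ∧ ∃ i₀ : ℤ, ∀ i ≤ i₀, ∀ N : ℕ, (N : ℝ) ≤ c * (-(i : ℝ)) →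
    GammaLaurent.DvdCoeff N i x}

variable [IsLocalRing O]

/-- Reduction of coefficients `O((u)) → k((t))`, `u ↦ t`. -/
def laurentReduction (O : Type u) [CommRing O] [IsLocalRing O] :
    LaurentSeries O →+* LaurentSeries (IsLocalRing.ResidueField O) where
  toFun f := f.map (IsLocalRing.residue O)
  map_zero' := HahnSeries.map_zero (IsLocalRing.residue O).toAddMonoidHom.toZeroHom
  map_one' := HahnSeries.map_one (IsLocalRing.residue O).toMonoidWithZeroHom
  map_add' _ _ := HahnSeries.map_add (IsLocalRing.residue O).toAddMonoidHom
  map_mul' _ _ := HahnSeries.map_mul (IsLocalRing.residue O).toNonUnitalRingHom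

/-- The reduction map `Γ^{k((t))} → k((t))`, `∑ x_i u^i ↦ ∑ x̄_i t^i`. -/
def GammaLaurent.residue (ϖ : O) [hϖ : Fact (Irreducible ϖ)] :
    GammaLaurent ϖ →+* LaurentSeries (IsLocalRing.ResidueField O) :=
  (Ideal.Quotient.lift (laurentIdeal ϖ) (laurentReduction O) (by
    intro a ha
    have h : laurentIdeal ϖ ≤ RingHom.ker (laurentReduction O) := by
      rw [laurentIdeal, Ideal.span_singleton_le_iff_mem, RingHom.mem_ker]
      have h1 : laurentReduction O (HahnSeries.C ϖ)
          = HahnSeries.C (IsLocalRing.residue O ϖ) := HahnSeries.map_C ϖ _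
      rw [h1, (IsLocalRing.residue_eq_zero_iff ϖ).2
        ((IsLocalRing.mem_maximalIdeal ϖ).2 hϖ.out.not_isUnit), map_zero]
    exact RingHom.mem_ker.1 (h ha))).comp (AdicCompletion.evalOneₐ (laurentIdeal ϖ)).toRingHom

/-- A Frobenius lift `σ_0` on `Γ^{k((t))}`: a levelwise continuous ring endomorphism that lifts
the `p`-power Frobenius of `k((t))`, restricts to an endomorphism of `O`, and carries
`Γ_con^{k((t))}` into itself. -/
structure FrobeniusLift (p : ℕ) (ϖ : O) [Fact (Irreducible ϖ)] where
  /-- the endomorphism of `Γ^{k((t))}` -/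
  hom : GammaLaurent ϖ →+* GammaLaurent ϖ
  /-- its restriction to `O` -/
  base : O →+* O
  hom_const : ∀ a : O, hom (GammaLaurent.const ϖ a) = GammaLaurent.const ϖ (base a)
  residue_hom : ∀ x, GammaLaurent.residue ϖ (hom x) = GammaLaurent.residue ϖ x ^ p
  levelwise_continuous : ∀ (n : ℕ) (c : ℤ), ∃ (n' : ℕ) (c' : ℤ),
    ∀ x ∈ GammaLaurent.levelNhd ϖ n' c', hom x ∈ GammaLaurent.levelNhd ϖ n c
  hom_con : ∀ x ∈ GammaLaurent.con ϖ, hom x ∈ GammaLaurent.con ϖ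

end Classical

/-! ## The ring `Γ^alg` -/

section GammaAlg

variable {p : ℕ} [Fact p.Prime] {O : Type u} [CommRing O] [IsLocalRing O]
  [CharP (IsLocalRing.ResidueField O) p] {ϖ : O} [Fact (Irreducible ϖ)]

instance instCharPLaurentSeries (k : Type u) [Field k] [CharP k p] : CharP (LaurentSeries k) p :=
  charP_of_injective_ringHom (f := (HahnSeries.C : k →+* LaurentSeries k))
    HahnSeries.C_injective p

instance instExpCharLaurentAlg (k : Type u) [Field k] [CharP k p] : ExpChar (LaurentAlg k) p :=
  ExpChar.prime Fact.out

instance instPerfectRingLaurentAlg (k : Type u) [Field k] [CharP k p] :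
    PerfectRing (LaurentAlg k) p := PerfectField.toPerfectRing p

namespace FrobeniusLift

variable (σ : FrobeniusLift p ϖ)

/-- The transition maps `σ_0^{j-i}` of the direct system
`Γ^{k((t))} → Γ^{k((t))} → Γ^{k((t))} → ⋯` with all maps equal to `σ_0`. -/
def trans (i j : ℕ) (_ : i ≤ j) : GammaLaurent ϖ →+* GammaLaurent ϖ := σ.hom ^ (j - i)

/-- The direct limit of `Γ^{k((t))} → Γ^{k((t))} → ⋯` along `σ_0`. The `i`-th copy plays the role
of `σ_0^{-i}(Γ^{k((t))})`, with residue field `k((t))^{1/p^i}`. -/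
def GammaColim : Type u := Ring.DirectLimit (fun _ : ℕ ↦ GammaLaurent ϖ) (fun i j h ↦ σ.trans i j h)

instance : CommRing σ.GammaColim :=
  inferInstanceAs (CommRing (Ring.DirectLimit (fun _ : ℕ ↦ GammaLaurent ϖ)
    (fun i j h ↦ σ.trans i j h)))

/-- The `i`-th copy of `Γ^{k((t))}` in the direct limit. -/
def toColim (i : ℕ) : GammaLaurent ϖ →+* σ.GammaColim :=
  Ring.DirectLimit.of (fun _ : ℕ ↦ GammaLaurent ϖ) (fun i j h ↦ σ.trans i j h) i

/-- The reduction map of the `i`-th copy of `Γ^{k((t))}`, with values in `k((t))^{1/p^i}`. -/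
def residueLevel (ϖ : O) [Fact (Irreducible ϖ)] (i : ℕ) :
    GammaLaurent ϖ →+* LaurentAlg (IsLocalRing.ResidueField O) :=
  (((iterateFrobeniusEquiv (LaurentAlg (IsLocalRing.ResidueField O)) p i).symm :
      LaurentAlg (IsLocalRing.ResidueField O) →+* LaurentAlg (IsLocalRing.ResidueField O)).comp
    (algebraMap (LaurentSeries (IsLocalRing.ResidueField O)) _)).comp (GammaLaurent.residue ϖ)

theorem residue_hom_pow (n : ℕ) (x : GammaLaurent ϖ) :
    GammaLaurent.residue ϖ ((σ.hom ^ n) x) = GammaLaurent.residue ϖ x ^ p ^ n := by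
  induction n with
  | zero => simp
  | succ n ih =>
    rw [pow_succ' σ.hom, RingHom.mul_def, RingHom.comp_apply, σ.residue_hom, ih, ← pow_mul,
      pow_succ]

theorem residueLevel_trans (i j : ℕ) (hij : i ≤ j) (x : GammaLaurent ϖ) :
    residueLevel (p := p) ϖ j (σ.trans i j hij x) = residueLevel (p := p) ϖ i x := by
  obtain ⟨d, rfl⟩ := Nat.exists_eq_add_of_le hij
  simp only [residueLevel, RingHom.comp_apply, trans, σ.residue_hom_pow, map_pow]
  simp only [RingHom.coe_coe]
  rw [← map_pow, RingEquiv.symm_apply_eq, iterateFrobeniusEquiv_def, Nat.add_sub_cancel_left,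
    pow_add, pow_mul, ← iterateFrobeniusEquiv_def _ p i, RingEquiv.apply_symm_apply]

/-- The reduction map of the direct limit, with image `k((t))^perf`. -/
def residueColim : σ.GammaColim →+* LaurentAlg (IsLocalRing.ResidueField O) :=
  Ring.DirectLimit.lift _ _ _ (fun i ↦ residueLevel (p := p) ϖ i) (σ.residueLevel_trans)

/-- `Γ^perf`: the completed direct limit, a complete discrete valuation ring with residue field
`k((t))^perf`. -/
def GammaPerf : Type u := AdicCompletion (Ideal.span {(p : σ.GammaColim)}) σ.GammaColim

instance : CommRing σ.GammaPerf :=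
  inferInstanceAs (CommRing (AdicCompletion (Ideal.span {(p : σ.GammaColim)}) σ.GammaColim))

/-- The map from the direct limit to its completion. -/
def colimToPerf : σ.GammaColim →+* σ.GammaPerf :=
  algebraMap σ.GammaColim (AdicCompletion (Ideal.span {(p : σ.GammaColim)}) σ.GammaColim)

instance : IsAdicComplete (Ideal.span {(p : σ.GammaPerf)}) σ.GammaPerf := by
  have h := AdicCompletion.isAdicComplete (I := Ideal.span {(p : σ.GammaColim)})
    (M := σ.GammaColim) ⟨{(p : σ.GammaColim)}, by simp⟩
  rw [← IsAdicComplete.map_algebraMap_iff (S := AdicCompletion (Ideal.span {(p : σ.GammaColim)})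
    σ.GammaColim), Ideal.map_span, Set.image_singleton, map_natCast] at h
  exact h

theorem cast_residueAlg :
    ((p : ℕ) : LaurentAlg (IsLocalRing.ResidueField O)) = 0 :=
  CharP.cast_eq_zero _ p

/-- The reduction map of `Γ^perf`, with image `k((t))^perf`. -/
def residuePerf : σ.GammaPerf →+* LaurentAlg (IsLocalRing.ResidueField O) :=
  (Ideal.Quotient.lift (Ideal.span {(p : σ.GammaColim)}) σ.residueColim (by
    intro a ha
    have h : Ideal.span {(p : σ.GammaColim)} ≤ RingHom.ker σ.residueColim := by
      rw [Ideal.span_singleton_le_iff_mem, RingHom.mem_ker, map_natCast, cast_residueAlg]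
    exact RingHom.mem_ker.1 (h ha))).comp
    (AdicCompletion.evalOneₐ (Ideal.span {(p : σ.GammaColim)})).toRingHom

instance : Fact (¬ IsUnit ((p : ℕ) : σ.GammaPerf)) := ⟨fun h ↦ by
  have := h.map σ.residuePerf
  rw [map_natCast, cast_residueAlg] at this
  exact not_isUnit_zero this⟩

/-- The reduction map on `Γ^perf / p`. -/
def residueModP : ModP σ.GammaPerf p →+* LaurentAlg (IsLocalRing.ResidueField O) :=
  Ideal.Quotient.lift (Ideal.span {(p : σ.GammaPerf)}) σ.residuePerf (by
    intro a ha
    have h : Ideal.span {(p : σ.GammaPerf)} ≤ RingHom.ker σ.residuePerf := by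
      rw [Ideal.span_singleton_le_iff_mem, RingHom.mem_ker, map_natCast, cast_residueAlg]
    exact RingHom.mem_ker.1 (h ha))

/-- `W(k((t))^perf)`. The tilt of `Γ^perf`, i.e. the inverse limit perfection of `Γ^perf / p`, is
the field `k((t))^perf`, because `Γ^perf / p` is a nilpotent thickening of this perfect field. -/
abbrev WittPerf : Type u := WittVector p (PreTilt σ.GammaPerf p)

/-- The canonical map `W(k((t))^perf) → Γ^perf` lifting the identity of the residue field, which
carries Teichmüller lifts to Teichmüller lifts. -/
instance algebraPerf : Algebra σ.WittPerf σ.GammaPerf :=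
  (WittVector.fontaineTheta σ.GammaPerf p).toAlgebra

/-- The map `W(k((t))^perf) → W(k((t))^alg)` induced by the inclusion of fields. -/
instance algebraWitt :
    Algebra σ.WittPerf (WittVector p (LaurentAlg (IsLocalRing.ResidueField O))) :=
  (WittVector.map (σ.residueModP.comp (PreTilt.coeff (p := p) 0))).toAlgebra

/-- `Γ^alg = W(k((t))^alg) ⊗_{W(k((t))^perf)} Γ^perf`: the complete discrete valuation ring,
unramified over `O`, with residue field `k((t))^alg`, attached to `k((t))^alg` (if `ϖ = p`, this
is `W(k((t))^alg)`). -/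
def GammaAlg : Type u :=
  WittVector p (LaurentAlg (IsLocalRing.ResidueField O)) ⊗[σ.WittPerf] σ.GammaPerf

instance : CommRing σ.GammaAlg :=
  inferInstanceAs (CommRing
    (WittVector p (LaurentAlg (IsLocalRing.ResidueField O)) ⊗[σ.WittPerf] σ.GammaPerf))

/-- The map `Γ^perf → Γ^alg`. -/
def perfToAlg : σ.GammaPerf →+* σ.GammaAlg :=
  (Algebra.TensorProduct.includeRight.toRingHom : σ.GammaPerf →+*
    WittVector p (LaurentAlg (IsLocalRing.ResidueField O)) ⊗[σ.WittPerf] σ.GammaPerf)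

/-- The map `W(k((t))^alg) → Γ^alg`. -/
def wittToAlg : WittVector p (LaurentAlg (IsLocalRing.ResidueField O)) →+* σ.GammaAlg :=
  (Algebra.TensorProduct.includeLeftRingHom :
    WittVector p (LaurentAlg (IsLocalRing.ResidueField O)) →+*
      WittVector p (LaurentAlg (IsLocalRing.ResidueField O)) ⊗[σ.WittPerf] σ.GammaPerf)

/-- The embedding of the `i`-th copy of `Γ^{k((t))}` in `Γ^alg`; it is the composition of the
canonical embedding `Γ^{k((t))} → Γ^alg` (the case `i = 0`) with `σ_0^{-i}`. -/
def emb (i : ℕ) : GammaLaurent ϖ →+* σ.GammaAlg :=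
  (σ.perfToAlg.comp σ.colimToPerf).comp (σ.toColim i)

/-- The Teichmüller lift `[a] ∈ Γ^alg` of `a ∈ k((t))^alg`. -/
def teich (a : LaurentAlg (IsLocalRing.ResidueField O)) : σ.GammaAlg :=
  σ.wittToAlg (WittVector.teichmuller p a)

/-- The uniformizer `ϖ` of `O` as an element of `Γ^alg`. -/
def unif : σ.GammaAlg := σ.emb 0 (GammaLaurent.const ϖ ϖ)

theorem residue_compatible (w : σ.WittPerf) :
    σ.residuePerf (WittVector.fontaineTheta σ.GammaPerf p w) =
      WittVector.constantCoeff
        (WittVector.map (σ.residueModP.comp (PreTilt.coeff (p := p) 0)) w) := by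
  have h := congrArg σ.residueModP (WittVector.mk_fontaineTheta (R := σ.GammaPerf) (p := p) w)
  calc σ.residuePerf (WittVector.fontaineTheta σ.GammaPerf p w)
      = σ.residueModP (Ideal.Quotient.mk _ (WittVector.fontaineTheta σ.GammaPerf p w)) := rfl
    _ = σ.residueModP (PreTilt.coeff 0 (w.coeff 0)) := h
    _ = _ := by rw [WittVector.constantCoeff_apply, WittVector.map_coeff]; rfl

/-- The structure of `W(k((t))^perf)`-algebra on the residue field `k((t))^alg`. -/
@[reducible] def algebraResidue :
    Algebra σ.WittPerf (LaurentAlg (IsLocalRing.ResidueField O)) :=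
  ((WittVector.constantCoeff (p := p)).comp
    (WittVector.map (σ.residueModP.comp (PreTilt.coeff (p := p) 0)))).toAlgebra

/-- The reduction map `Γ^alg → k((t))^alg`, `x ⊗ y ↦ x̄ ȳ`. -/
def residueAlg : σ.GammaAlg →+* LaurentAlg (IsLocalRing.ResidueField O) :=
  letI := σ.algebraResidue
  (Algebra.TensorProduct.productMap
    (A := WittVector p (LaurentAlg (IsLocalRing.ResidueField O))) (B := σ.GammaPerf)
    (R := σ.WittPerf) (S := LaurentAlg (IsLocalRing.ResidueField O))
    { (WittVector.constantCoeff : WittVector p (LaurentAlg (IsLocalRing.ResidueField O)) →+* _)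
      with commutes' := fun _ ↦ rfl }
    { σ.residuePerf with commutes' := fun w ↦ σ.residue_compatible w }).toRingHom

/-! ## The rings `Γ^K`, `Γ^K_r` -/

/-- The closure of a subring of `Γ^alg` for the `ϖ`-adic topology. -/
def adicClosure (S : Subring σ.GammaAlg) : Subring σ.GammaAlg where
  carrier := {x | ∀ N : ℕ, ∃ y ∈ S, σ.unif ^ N ∣ x - y}
  mul_mem' := by
    intro a b ha hb N
    obtain ⟨y, hy, c, hc⟩ := ha N
    obtain ⟨z, hz, d, hd⟩ := hb N
    exact ⟨y * z, S.mul_mem hy hz, c * b + y * d, by linear_combination b * hc + y * hd⟩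
  one_mem' := fun N ↦ ⟨1, S.one_mem, by simp⟩
  add_mem' := by
    intro a b ha hb N
    obtain ⟨y, hy, c, hc⟩ := ha N
    obtain ⟨z, hz, d, hd⟩ := hb N
    exact ⟨y + z, S.add_mem hy hz, c + d, by linear_combination hc + hd⟩
  zero_mem' := fun N ↦ ⟨0, S.zero_mem, by simp⟩
  neg_mem' := by
    intro a ha N
    obtain ⟨y, hy, c, hc⟩ := ha N
    exact ⟨-y, S.neg_mem hy, -c, by linear_combination -hc⟩

/-- The series `∑ a_l (σ_0^j u)^l ∈ Γ^{k((t))}` in the parameter `σ_0^j(u)` with coefficients in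
`O`: the levelwise closure of the Laurent polynomial ring `O[σ_0^j(u), σ_0^j(u)^{-1}]`. -/
def seriesIn (j : ℕ) : Set (GammaLaurent ϖ) :=
  GammaLaurent.levelClosure (Subring.closure
    (Set.range (GammaLaurent.const ϖ) ∪
      Set.range (fun l : ℤ ↦ (σ.hom ^ j) (GammaLaurent.uPow ϖ l))) : Set (GammaLaurent ϖ))

/-- `σ_0^{-i}(Γ^L) ⊆ Γ^alg` for `L = k^{1/p^m}((t))`. Here `Γ^L` consists of the series in `u` with
coefficients in `O_m = σ_0^{-m}(O)`, that is, of the images under `σ_0^{-m}` of the series in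
`σ_0^m(u)` with coefficients in `O`; for `m = ∞`, the union over all finite `m` is taken. It has
residue field `L^{1/p^i}`. -/
def levelL (m : ℕ∞) (i : ℕ) : Set σ.GammaAlg :=
  {x | ∃ j : ℕ, (j : ℕ∞) ≤ m ∧ ∃ a ∈ σ.seriesIn j, x = σ.emb (i + j) a}

/-- `x` is a simple root, modulo `ϖ`, of a monic polynomial with coefficients in `B`. -/
def IsEtaleOver (B : Set σ.GammaAlg) (x : σ.GammaAlg) : Prop :=
  ∃ f : Polynomial σ.GammaAlg, f.Monic ∧ (∀ i, f.coeff i ∈ B) ∧ f.eval x = 0 ∧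
    IsUnit (f.derivative.eval x)

variable {K : IntermediateField (LaurentSeries (IsLocalRing.ResidueField O))
    (LaurentAlg (IsLocalRing.ResidueField O))}
  (V : ValuedFieldChain p K)

/-- The ring `Γ^K ⊆ Γ^alg` of a valued field `K`, with `k((t)) ⊆ L ⊆ M ⊆ N ⊆ K` as in the
definition of valued fields. The field `K` is separable algebraic over `L^{1/p^n}`, since `K / N`
and `N / L^{1/p^n} = M^{1/p^n} / L^{1/p^n}` are; accordingly `Γ^K` is the completed unramified
extension with residue field `K` of `σ_0^{-n}(Γ^L)` (of the union of all `σ_0^{-i}(Γ^L)`, if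
`n = ∞`). -/
def GammaK : Subring σ.GammaAlg :=
  σ.adicClosure (Subring.closure
    {x | σ.residueAlg x ∈ K ∧ ∃ i : ℕ, (i : ℕ∞) ≤ V.n ∧ σ.IsEtaleOver (σ.levelL V.m i) x})

/-- `Γ^alg[1/p]`. -/
abbrev GammaAlgP : Type u := Localization.Away ((p : ℕ) : σ.GammaAlg)

/-- `x = ∑_i ϖ^i [c_i]` in `Γ^alg[1/p]`, the sum having finitely many terms of negative index. -/
def IsTeichExpansion (x : σ.GammaAlgP)
    (c : ℤ → LaurentAlg (IsLocalRing.ResidueField O)) : Prop :=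
  ∃ m : ℕ, (∀ i : ℤ, i < -(m : ℤ) → c i = 0) ∧ ∀ N : ℕ, ∃ y : σ.GammaAlg,
    algebraMap σ.GammaAlg σ.GammaAlgP (σ.unif ^ m) * x -
      algebraMap σ.GammaAlg σ.GammaAlgP
        (∑ i ∈ Finset.range N, σ.unif ^ i * σ.teich (c ((i : ℤ) - m))) =
      algebraMap σ.GammaAlg σ.GammaAlgP (σ.unif ^ N * y)

/-- The sequence `(x̄_i)_{i ∈ ℤ}` with `x = ∑_i ϖ^i [x̄_i]`; it exists and is unique because
`Γ^alg` is a complete discrete valuation ring with perfect residue field. -/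
def teichCoeff (x : σ.GammaAlgP) : ℤ → LaurentAlg (IsLocalRing.ResidueField O) :=
  Classical.epsilon (σ.IsTeichExpansion x)

/-- The partial valuation `v_n(x) = min {v_K(x̄_i) : v_p(ϖ^i) ≤ n}` at `n = v_p(ϖ^l)`. -/
def partialVal (l : ℤ) (x : σ.GammaAlgP) : EReal :=
  ⨅ (i : ℤ) (_ : i ≤ l), laurentVal (σ.teichCoeff x i)

/-- `v_p(ϖ) = 1 / e`, for `v_p` normalised by `v_p(p) = 1`. -/
def vUnif (p : ℕ) (ϖ : O) : ℝ := 1 / (multiplicity ϖ ((p : ℕ) : O) : ℝ)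

/-- `s v_n(x) + n` at `n = v_p(ϖ^l)`. -/
def lineVal (s : ℝ) (l : ℤ) (x : σ.GammaAlgP) : EReal :=
  (s : EReal) * σ.partialVal l x + (((l : ℝ) * vUnif p ϖ : ℝ) : EReal)

/-- `w_s(x) = min_n {s v_n(x) + n}`, with `n` running over the value group of `O`; the
corresponding norm is `|x|_s = p^{-w_s(x)}`. -/
def w (s : ℝ) (x : σ.GammaAlgP) : EReal := ⨅ l : ℤ, σ.lineVal s l x

/-- `Γ^alg_r`: the `x ∈ Γ^alg` with `r v_n(x) + n → ∞` as `n → ∞`. (These `x` already form a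
subring: the closure only serves to record the ring structure.) -/
def GammaAlgR (r : ℝ) : Subring σ.GammaAlg :=
  Subring.closure {x | Tendsto
    (fun l : ℕ ↦ σ.lineVal r l (algebraMap σ.GammaAlg σ.GammaAlgP x)) atTop (𝓝 ⊤)}

/-- `Γ^K_r = Γ^alg_r ∩ Γ^K`. -/
def GammaKR (r : ℝ) : Subring σ.GammaAlg := σ.GammaAlgR r ⊓ σ.GammaK V

/-- The subset `Γ^K_r[1/p]` of `Γ^alg[1/p]`. -/
def GammaKRP (r : ℝ) : Set σ.GammaAlgP :=
  {x | ∃ m : ℕ, ∃ y ∈ σ.GammaKR V r,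
    ((p : ℕ) : σ.GammaAlgP) ^ m * x = algebraMap σ.GammaAlg σ.GammaAlgP y}

/-! ## The analytic rings `Γ^K_{an,r}` and `Γ^K_{an,con}` -/

/-- `x` is a Cauchy sequence for each of the norms `|·|_s`, `0 < s ≤ r`. -/
def IsFrechetCauchy (r : ℝ) (x : ℕ → σ.GammaAlgP) : Prop :=
  ∀ s : ℝ, 0 < s → s ≤ r →
    Tendsto (fun ij : ℕ × ℕ ↦ σ.w s (x ij.1 - x ij.2)) atTop (𝓝 ⊤)

/-- `x` converges to `0` for each of the norms `|·|_s`, `0 < s ≤ r`. -/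
def IsFrechetNull (r : ℝ) (x : ℕ → σ.GammaAlgP) : Prop :=
  ∀ s : ℝ, 0 < s → s ≤ r → Tendsto (fun i ↦ σ.w s (x i)) atTop (𝓝 ⊤)

/-- The ring of sequences in `Γ^K_r[1/p]` that are simultaneously Cauchy for all the norms `|·|_s`,
`0 < s ≤ r`. (These sequences already form a subring.) -/
def cauchySeq (r : ℝ) : Subring (ℕ → σ.GammaAlgP) :=
  Subring.closure {x | (∀ i, x i ∈ σ.GammaKRP V r) ∧ σ.IsFrechetCauchy r x}

/-- `Γ^K_{an,r}`: the Fréchet completion of `Γ^K_r[1/p]` for the norms `|·|_s`, `0 < s ≤ r`, that is,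
the ring of Cauchy sequences modulo the ideal of null sequences. -/
abbrev GammaAnR (r : ℝ) : Type u :=
  σ.cauchySeq V r ⧸
    (Ideal.span {x : σ.cauchySeq V r | σ.IsFrechetNull r x} : Ideal (σ.cauchySeq V r))

/-- The sequences that are Cauchy sequences in `Γ^K_r[1/p]` for some `r > 0`. (The rings
`cauchySeq V r` grow as `r` decreases, so their supremum is their union.) -/
def cauchySeqCon : Subring (ℕ → σ.GammaAlgP) := ⨆ (r : ℝ) (_ : 0 < r), σ.cauchySeq V r

/-- `Γ^K_{an,con} = ⋃_{r > 0} Γ^K_{an,r}`, the direct limit of the rings `Γ^K_{an,r}` as `r`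
decreases to `0`: two sequences are identified if for some `r > 0` their difference is a null
sequence for all the norms `|·|_s`, `0 < s ≤ r`. -/
abbrev GammaAnCon : Type u :=
  σ.cauchySeqCon V ⧸
    (Ideal.span {x : σ.cauchySeqCon V | ∃ r : ℝ, 0 < r ∧ σ.IsFrechetNull r x} :
      Ideal (σ.cauchySeqCon V))

end FrobeniusLift

end GammaAlg

end Gamma

noncomputable section Gamma

section LaurentNorm

variable {k : Type u} [Field k]

open WithZero in
theorem LaurentSeries.valued_eq_exp_order {f : LaurentSeries k} (hf : f ≠ 0) :
    (Valued.v f : WithZero (Multiplicative ℤ)) = WithZero.exp (-f.order) := by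
  refine le_antisymm ((LaurentSeries.valuation_le_iff_coeff_lt_eq_zero k).2
    fun n hn ↦ HahnSeries.coeff_eq_zero_of_lt_order hn) (le_of_not_gt fun h ↦ ?_)
  have hv : (Valued.v f : WithZero (Multiplicative ℤ)) ≠ 0 := by simpa using hf
  have h2 : (Valued.v f : WithZero (Multiplicative ℤ)) ≤ WithZero.exp (-(f.order + 1)) := by
    rw [← WithZero.exp_log hv] at h ⊢
    rw [WithZero.exp_lt_exp] at h
    rw [WithZero.exp_le_exp]
    omega
  exact (HahnSeries.coeff_order_eq_zero.not.2 hf)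
    ((LaurentSeries.valuation_le_iff_coeff_lt_eq_zero k).1 h2 _ (by omega))

/-- The norm `exp (-v_K)` on the algebraic closure of `k((t))`. -/
def lnorm (x : LaurentAlg k) : ℝ :=
  open Classical in
  if x = 0 then 0
  else Real.exp (-((((minpoly (LaurentSeries k) x).coeff 0).order : ℤ) : ℝ) /
    ((minpoly (LaurentSeries k) x).natDegree : ℝ))

theorem LaurentSeries.valued_surjective (k : Type u) [Field k] :
    Function.Surjective (Valued.v : Valuation (LaurentSeries k)
      (WithZero (Multiplicative ℤ))) := by
  intro y
  by_cases hy : y = 0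
  · exact ⟨0, by simp [hy]⟩
  · refine ⟨HahnSeries.single (-WithZero.log y) 1, ?_⟩
    rw [LaurentSeries.valuation_single_zpow, neg_neg, WithZero.exp_log hy]

instance LaurentSeries.instIsRankOneDiscrete (k : Type u) [Field k] :
    (Valued.v : Valuation (LaurentSeries k) (WithZero (Multiplicative ℤ))).IsRankOneDiscrete := by
  have : (Valued.v : Valuation (LaurentSeries k)
      (WithZero (Multiplicative ℤ))).IsNontrivial := by
    obtain ⟨x, hx⟩ := LaurentSeries.valued_surjective k (WithZero.exp 1)
    exact ⟨x, by rw [hx]; simp, by rw [hx]; decide⟩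
  exact Valuation.IsRankOneDiscrete.mk' _

/-- The valuation of `k((t))` as a rank one valuation, normalised by `|t| = exp (-1)`. -/
@[reducible] def LaurentSeries.rankOne (k : Type u) [Field k] :
    (Valued.v : Valuation (LaurentSeries k) (WithZero (Multiplicative ℤ))).RankOne :=
  Valuation.IsRankOneDiscrete.rankOne _ (e := (Real.exp 1).toNNReal) (Real.one_lt_toNNReal.2 (Real.one_lt_exp_iff.2 one_pos))

/-- `k((t))` as a normed field, with the norm `exp (-order)`. -/
@[reducible] def LaurentSeries.normedField (k : Type u) [Field k] :
    NormedField (LaurentSeries k) :=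
  letI := LaurentSeries.rankOne k
  Valued.toNormedField (LaurentSeries k) (WithZero (Multiplicative ℤ))

theorem LaurentSeries.norm_eq {f : LaurentSeries k} (hf : f ≠ 0) :
    (LaurentSeries.normedField k).norm f = Real.exp (-(f.order : ℝ)) := by
  let _ := LaurentSeries.rankOne k
  have he : (1 : NNReal) < (Real.exp 1).toNNReal :=
    Real.one_lt_toNNReal.2 (Real.one_lt_exp_iff.2 one_pos)
  have h1 := Valuation.IsRankOneDiscrete.valueGroup₀_equiv_withZeroMulInt_restrict_apply_of_surjective
    (LaurentSeries.valued_surjective k) f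
  have h2 : (LaurentSeries.normedField k).norm f =
    WithZeroMulInt.toNNReal (ne_of_gt (lt_trans zero_lt_one he))
      ((Valuation.IsRankOneDiscrete.valueGroup₀_equiv_withZeroMulInt Valued.v)
        (Valued.v.restrict f)) := rfl
  rw [h2, h1, LaurentSeries.valued_eq_exp_order hf, WithZeroMulInt.toNNReal_neg_apply _ (by simp),
    NNReal.coe_zpow, Real.coe_toNNReal _ (Real.exp_pos 1).le]
  change Real.exp 1 ^ (-f.order : ℤ) = _
  rw [← Real.rpow_intCast, Real.exp_one_rpow]
  push_cast
  rfl

/-- `k((t))` as a nontrivially normed field. -/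
@[reducible] def LaurentSeries.nontriviallyNormedField (k : Type u) [Field k] :
    NontriviallyNormedField (LaurentSeries k) :=
  { LaurentSeries.normedField k with
    non_trivial := ⟨HahnSeries.single (-1) 1, by
      refine lt_of_lt_of_eq ?_ (LaurentSeries.norm_eq (by simp)).symm
      rw [HahnSeries.order_single one_ne_zero]
      simp⟩ }

section Instances

attribute [local instance] LaurentSeries.nontriviallyNormedField

instance LaurentSeries.instCompleteSpaceNormed : CompleteSpace (LaurentSeries k) :=
  LaurentSeries.instLaurentSeriesComplete

instance LaurentSeries.instIsUltrametricDistNormed : IsUltrametricDist (LaurentSeries k) :=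
  letI := LaurentSeries.rankOne k
  Valued.instIsUltrametricDist _ _

theorem lnorm_eq_spectralNorm (x : LaurentAlg k) :
    lnorm x = spectralNorm (LaurentSeries k) (LaurentAlg k) x := by
  rw [lnorm, spectralNorm.spectralNorm_eq_norm_coeff_zero_rpow]
  have hint : IsIntegral (LaurentSeries k) x := Algebra.IsIntegral.isIntegral x
  split_ifs with h
  · subst h
    simp
  · rw [LaurentSeries.norm_eq (minpoly.coeff_zero_ne_zero hint h), ← Real.exp_mul]
    congr 1
    ring

theorem lnorm_mul (x y : LaurentAlg k) : lnorm (x * y) = lnorm x * lnorm y := by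
  simp only [lnorm_eq_spectralNorm]
  exact spectralAlgNorm_mul x y

theorem lnorm_add_le (x y : LaurentAlg k) : lnorm (x + y) ≤ max (lnorm x) (lnorm y) := by
  simp only [lnorm_eq_spectralNorm]
  exact isNonarchimedean_spectralNorm x y

theorem lnorm_algebraMap {f : LaurentSeries k} (hf : f ≠ 0) :
    lnorm (algebraMap (LaurentSeries k) (LaurentAlg k) f) = Real.exp (-(f.order : ℝ)) := by
  rw [lnorm_eq_spectralNorm, spectralNorm_extends, LaurentSeries.norm_eq hf]

theorem lnorm_neg (x : LaurentAlg k) : lnorm (-x) = lnorm x := by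
  simp only [lnorm_eq_spectralNorm]
  exact spectralNorm_neg (Algebra.IsAlgebraic.isAlgebraic x)

end Instances

@[simp] theorem lnorm_zero : lnorm (0 : LaurentAlg k) = 0 := by simp [lnorm]

theorem lnorm_pos {x : LaurentAlg k} (hx : x ≠ 0) : 0 < lnorm x := by
  rw [lnorm, if_neg hx]
  exact Real.exp_pos _

theorem lnorm_nonneg (x : LaurentAlg k) : 0 ≤ lnorm x := by
  by_cases hx : x = 0
  · simp [hx]
  · exact (lnorm_pos hx).le

@[simp] theorem lnorm_eq_zero {x : LaurentAlg k} : lnorm x = 0 ↔ x = 0 :=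
  ⟨fun h ↦ by_contra fun hx ↦ (lnorm_pos hx).ne' h, fun h ↦ by simp [h]⟩

@[simp] theorem lnorm_one : lnorm (1 : LaurentAlg k) = 1 := by
  have := lnorm_algebraMap (k := k) one_ne_zero
  simpa using this

/-- `lnorm` as a monoid homomorphism. -/
def lnormHom (k : Type u) [Field k] : LaurentAlg k →*₀ ℝ where
  toFun := lnorm
  map_zero' := lnorm_zero
  map_one' := lnorm_one
  map_mul' := lnorm_mul

theorem lnorm_pow (x : LaurentAlg k) (n : ℕ) : lnorm (x ^ n) = lnorm x ^ n :=
  map_pow (lnormHom k) x n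

theorem lnorm_zpow (x : LaurentAlg k) (n : ℤ) : lnorm (x ^ n) = lnorm x ^ n :=
  map_zpow₀ (lnormHom k) x n

theorem lnorm_inv (x : LaurentAlg k) : lnorm x⁻¹ = (lnorm x)⁻¹ :=
  map_inv₀ (lnormHom k) x

theorem lnorm_div (x y : LaurentAlg k) : lnorm (x / y) = lnorm x / lnorm y :=
  map_div₀ (lnormHom k) x y

theorem lnorm_sub_le (x y : LaurentAlg k) : lnorm (x - y) ≤ max (lnorm x) (lnorm y) := by
  rw [sub_eq_add_neg, ← lnorm_neg y]
  exact lnorm_add_le _ _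

theorem laurentVal_zero : laurentVal (0 : LaurentAlg k) = ⊤ := by simp [laurentVal]

theorem laurentVal_eq {x : LaurentAlg k} (hx : x ≠ 0) :
    laurentVal x = ((-Real.log (lnorm x) : ℝ) : EReal) := by
  rw [laurentVal, lnorm, if_neg hx, if_neg hx, Real.log_exp, neg_div, neg_neg]

theorem exists_lnorm_eq_exp {x : LaurentAlg k} (hx : x ≠ 0) :
    ∃ q : ℚ, lnorm x = Real.exp q := by
  refine ⟨-((((minpoly (LaurentSeries k) x).coeff 0).order : ℤ) : ℚ) /
    ((minpoly (LaurentSeries k) x).natDegree : ℚ), ?_⟩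
  rw [lnorm, if_neg hx]
  push_cast
  rfl

theorem lnorm_const {a : k} (ha : a ≠ 0) :
    lnorm (algebraMap (LaurentSeries k) (LaurentAlg k) (HahnSeries.C a)) = 1 := by
  rw [lnorm_algebraMap (by simpa using ha), HahnSeries.order_C]
  simp

end LaurentNorm

/-- The field `k((t))^alg`, for `k` the residue field of `O`. -/
abbrev ResAlg (O : Type u) [CommRing O] [IsLocalRing O] : Type u :=
  LaurentAlg (IsLocalRing.ResidueField O)

theorem tendsto_zero_of_le_max {b t : ℕ → ℝ} {θ : ℝ} (hθ : 0 ≤ θ) (hθ1 : θ < 1) (hb : ∀ i, 0 ≤ b i)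
    (h : ∀ i, b (i + 1) ≤ max (θ * b i) (t (i + 1))) (ht : Tendsto t atTop (𝓝 0)) :
    Tendsto b atTop (𝓝 0) := by
  rw [Metric.tendsto_atTop] at ht ⊢
  intro ε hε
  obtain ⟨N, hN⟩ := ht ε hε
  have ht2 : ∀ i ≥ N, t i < ε := fun i hi ↦ (le_abs_self _).trans_lt (by simpa using hN i hi)
  have h1 : ∀ j, b (N + j) < ε ∨ b (N + j) ≤ θ ^ j * b N := by
    intro j
    induction j with
    | zero => right; simp
    | succ j ih =>
      rcases le_max_iff.1 (h (N + j)) with h2 | h2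
      · rcases ih with h3 | h3
        · left
          exact h2.trans_lt ((mul_le_of_le_one_left (hb _) hθ1.le).trans_lt h3)
        · right
          refine h2.trans ((mul_le_mul_of_nonneg_left h3 hθ).trans (le_of_eq ?_))
          ring
      · left
        exact h2.trans_lt (ht2 _ (by omega))
  have h2 : Tendsto (fun j ↦ θ ^ j * b N) atTop (𝓝 (0 * b N)) :=
    (tendsto_pow_atTop_nhds_zero_of_lt_one hθ hθ1).mul_const _
  rw [zero_mul] at h2
  obtain ⟨M, hM⟩ := (h2.eventually (gt_mem_nhds hε)).exists_forall_of_atTop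
  refine ⟨N + M, fun n hn ↦ ?_⟩
  obtain ⟨j, rfl⟩ := Nat.exists_eq_add_of_le ((Nat.le_add_right N M).trans hn)
  rw [Real.dist_0_eq_abs, abs_of_nonneg (hb _)]
  exact (h1 j).elim id fun h3 ↦ h3.trans_lt (hM j (by omega))

theorem exists_forall_le_of_tendsto_zero {a : ℕ → ℝ} (ha : ∀ i, 0 ≤ a i)
    (h : Tendsto a atTop (𝓝 0)) : ∃ i, ∀ j, a j ≤ a i := by
  by_cases h0 : ∀ j, a j = 0
  · exact ⟨0, fun j ↦ by rw [h0, h0]⟩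
  push Not at h0
  obtain ⟨k, hk⟩ := h0
  have hk' : 0 < a k := (ha k).lt_of_ne hk.symm
  obtain ⟨N, hN⟩ := (h.eventually (gt_mem_nhds hk')).exists_forall_of_atTop
  have hkN : k < N := by
    by_contra! h1
    exact lt_irrefl _ (hN k h1)
  obtain ⟨i, hi, him⟩ := Finset.exists_max_image (Finset.range N) a ⟨k, by simpa using hkN⟩
  refine ⟨i, fun j ↦ ?_⟩
  by_cases hj : j < N
  · exact him j (by simpa using hj)
  · exact (hN j (by omega)).le.trans (him k (by simpa using hkN))

/-- A complete ring with a multiplicative nonarchimedean norm in which every element is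
approximated by finite sums `∑ ϖ^i c_i` with coefficients in a set of units and zero that is closed
under multiplication, inversion, and, up to smaller elements, subtraction. -/
structure EuclideanNorm (B : Type u) [CommRing B] where
  /-- the norm -/
  N : B → ℝ
  nonneg : ∀ x, 0 ≤ N x
  map_zero : N 0 = 0
  map_mul : ∀ x y, N (x * y) = N x * N y
  add_le : ∀ x y, N (x + y) ≤ max (N x) (N y)
  neg : ∀ x, N (-x) = N x
  eq_zero : ∀ x, N x = 0 → x = 0
  complete : ∀ x : ℕ → B, (∀ ε > 0, ∃ M, ∀ m ≥ M, ∀ n ≥ M, N (x m - x n) ≤ ε) →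
    ∃ y, Tendsto (fun n ↦ N (x n - y)) atTop (𝓝 0)
  /-- the parameter of the finite sums -/
  ϖ : B
  /-- the coefficients of the finite sums -/
  G : Set B
  zero_mem : 0 ∈ G
  mul_mem : ∀ x ∈ G, ∀ y ∈ G, x * y ∈ G
  inv_mem : ∀ x ∈ G, x ≠ 0 → ∃ y ∈ G, x * y = 1
  exact' : ∀ (m : ℕ) (c : ℕ → B), (∀ i, c i ∈ G) → ∀ i < m,
    N (ϖ ^ i * c i) ≤ N (∑ i ∈ Finset.range m, ϖ ^ i * c i)
  /-- the precision of subtraction -/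
  θ : ℝ
  θ_lt_one : θ < 1
  sub_mem : ∀ x ∈ G, ∀ y ∈ G, ∃ z ∈ G, N (x - y - z) ≤ θ * max (N x) (N y)
  dense : ∀ x, ∀ ε > 0, ∃ (m : ℕ) (c : ℕ → B), (∀ i, c i ∈ G) ∧
    N (x - ∑ i ∈ Finset.range m, ϖ ^ i * c i) ≤ ε

namespace EuclideanNorm

variable {B : Type u} [CommRing B] (D : EuclideanNorm B)

theorem sub_le (x y : B) : D.N (x - y) ≤ max (D.N x) (D.N y) := by
  rw [sub_eq_add_neg, ← D.neg y]
  exact D.add_le _ _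

theorem sum_le {ι : Type*} (s : Finset ι) (f : ι → B) {C : ℝ} (hC : 0 ≤ C)
    (h : ∀ i ∈ s, D.N (f i) ≤ C) : D.N (∑ i ∈ s, f i) ≤ C := by
  classical
  induction s using Finset.induction_on with
  | empty => simpa [D.map_zero]
  | insert a s ha ih =>
    rw [Finset.sum_insert ha]
    exact (D.add_le _ _).trans (max_le (h a (by simp)) (ih fun i hi ↦ h i (by simp [hi])))

theorem eq_of_sub_lt {x y : B} (h : D.N (x - y) < D.N x) : D.N y = D.N x := by
  have h1 : D.N y ≤ max (D.N x) (D.N (x - y)) := by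
    have := D.sub_le x (x - y)
    rwa [sub_sub_cancel] at this
  have h2 : D.N x ≤ max (D.N (x - y)) (D.N y) := by
    have := D.add_le (x - y) y
    rwa [sub_add_cancel] at this
  refine le_antisymm (h1.trans (max_le le_rfl h.le)) ((le_max_iff.1 h2).resolve_left h.not_ge)

/-- `x` is congruent to a finite sum with indices below `n`, up to an element of smaller norm. -/
def HtLT (x : B) (n : ℕ) : Prop :=
  ∃ c : ℕ → B, (∀ i, c i ∈ D.G) ∧ D.N (x - ∑ i ∈ Finset.range n, D.ϖ ^ i * c i) < D.N x

theorem exists_htLT {x : B} (hx : x ≠ 0) : ∃ n, D.HtLT x n := by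
  have h0 : 0 < D.N x := (D.nonneg x).lt_of_ne fun h ↦ hx (D.eq_zero x h.symm)
  obtain ⟨m, c, hc, h⟩ := D.dense x _ (half_pos h0)
  exact ⟨m, c, hc, h.trans_lt (half_lt_self h0)⟩

/-- `x` is congruent to a finite sum with indices below `m` and terms of norm at most `M`, up to an
element of norm at most `ρ * M`. -/
def Approx (ρ M : ℝ) (x : B) (m : ℕ) : Prop :=
  ∃ c : ℕ → B, (∀ i, c i ∈ D.G) ∧ (∀ i < m, D.N (D.ϖ ^ i * c i) ≤ M) ∧
    D.N (x - ∑ i ∈ Finset.range m, D.ϖ ^ i * c i) ≤ ρ * M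

theorem Approx.step {ρ M : ℝ} (hθ : D.θ ≤ ρ) (hρ1 : ρ ≤ 1) (hM : 0 ≤ M) {x y : B} {m n : ℕ}
    (hmn : n ≤ m) {h : ℕ → B} (hG : ∀ i, h i ∈ D.G) (hy : 0 < D.N y)
    (htop : D.N (D.ϖ ^ n * h n) = D.N y) (hle : ∀ i < n + 1, D.N (D.ϖ ^ i * h i) ≤ D.N y)
    (herr : D.N (y - ∑ i ∈ Finset.range (n + 1), D.ϖ ^ i * h i) ≤ ρ * D.N y)
    (hx : D.Approx ρ M x (m + 1)) :
    ∃ q, D.N q ≤ M / D.N y ∧ D.Approx ρ M (x - q * y) m := by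
  obtain ⟨g, hgG, hgM, hgx⟩ := hx
  have hn0 : h n ≠ 0 := fun h0 ↦ by
    rw [h0, mul_zero, D.map_zero] at htop
    exact hy.ne htop
  obtain ⟨h', hh'G, hh'⟩ := D.inv_mem _ (hG n) hn0
  set q := D.ϖ ^ (m - n) * (g m * h') with hq
  have hqe : q * (D.ϖ ^ n * h n) = D.ϖ ^ m * g m := by
    have : D.ϖ ^ m = D.ϖ ^ (m - n) * D.ϖ ^ n := by rw [← pow_add, Nat.sub_add_cancel hmn]
    rw [this, hq]
    linear_combination D.ϖ ^ (m - n) * D.ϖ ^ n * g m * hh'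
  have hqN : D.N q ≤ M / D.N y := by
    rw [le_div_iff₀ hy, ← htop, ← D.map_mul, hqe]
    exact hgM m (Nat.lt_succ_self m)
  have hqG : g m * h' ∈ D.G := D.mul_mem _ (hgG m) _ hh'G
  -- the coefficients of `q * ∑ ϖ^i h_i`
  set k : ℕ → B := fun i ↦ if m - n ≤ i then g m * h' * h (i - (m - n)) else 0 with hk
  have hkG : ∀ i, k i ∈ D.G := fun i ↦ by
    rw [hk]
    dsimp only
    split_ifs
    · exact D.mul_mem _ hqG _ (hG _)
    · exact D.zero_mem
  have hksum : q * ∑ i ∈ Finset.range (n + 1), D.ϖ ^ i * h i =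
      ∑ i ∈ Finset.range (m + 1), D.ϖ ^ i * k i := by
    rw [Finset.mul_sum, show m + 1 = (m - n) + (n + 1) by omega,
      Finset.sum_range_add (fun i ↦ D.ϖ ^ i * k i)]
    rw [Finset.sum_eq_zero (s := Finset.range (m - n)), zero_add]
    · refine Finset.sum_congr rfl fun i _ ↦ ?_
      rw [hk]
      dsimp only
      rw [if_pos (by omega), Nat.add_sub_cancel_left, pow_add]
      ring
    · intro i hi
      rw [hk]
      dsimp only
      rw [if_neg (not_le.2 (Finset.mem_range.1 hi)), mul_zero]
  have hkM : ∀ i < m + 1, D.N (D.ϖ ^ i * k i) ≤ M := by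
    intro i hi
    rw [hk]
    dsimp only
    split_ifs with h1
    · have h2 : D.ϖ ^ i * (g m * h' * h (i - (m - n))) =
          q * (D.ϖ ^ (i - (m - n)) * h (i - (m - n))) := by
        have : D.ϖ ^ i = D.ϖ ^ (m - n) * D.ϖ ^ (i - (m - n)) := by
          rw [← pow_add, Nat.add_sub_cancel' h1]
        rw [this, hq]
        ring
      rw [h2, D.map_mul]
      refine (mul_le_mul hqN (hle _ (by omega)) (D.nonneg _) (div_nonneg hM hy.le)).trans ?_
      rw [div_mul_cancel₀ _ hy.ne']
    · rw [mul_zero, D.map_zero]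
      exact hM
  have hkm : D.ϖ ^ m * k m = D.ϖ ^ m * g m := by
    rw [hk]
    dsimp only
    rw [if_pos (Nat.sub_le _ _), Nat.sub_sub_self hmn]
    linear_combination D.ϖ ^ m * g m * hh'
  choose z hzG hz using fun i ↦ D.sub_mem _ (hgG i) _ (hkG i)
  have hz' : ∀ i < m, D.N (D.ϖ ^ i * (g i - k i - z i)) ≤ ρ * M := by
    intro i hi
    have h1 : D.N (D.ϖ ^ i * (g i - k i - z i)) ≤
        D.θ * max (D.N (D.ϖ ^ i * g i)) (D.N (D.ϖ ^ i * k i)) := by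
      rw [D.map_mul, D.map_mul, D.map_mul, ← mul_max_of_nonneg _ _ (D.nonneg _), mul_left_comm]
      exact mul_le_mul_of_nonneg_left (hz i) (D.nonneg _)
    have h2 : max (D.N (D.ϖ ^ i * g i)) (D.N (D.ϖ ^ i * k i)) ≤ M :=
      max_le (hgM i (by omega)) (hkM i (by omega))
    have h3 : 0 ≤ max (D.N (D.ϖ ^ i * g i)) (D.N (D.ϖ ^ i * k i)) :=
      le_max_of_le_left (D.nonneg _)
    refine h1.trans ((mul_le_mul_of_nonneg_right hθ h3).trans ?_)
    rcases le_or_gt 0 ρ with h4 | h4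
    · exact mul_le_mul_of_nonneg_left h2 h4
    · have h5 : 0 ≤ D.θ * max (D.N (D.ϖ ^ i * g i)) (D.N (D.ϖ ^ i * k i)) :=
        (D.nonneg _).trans h1
      have h6 : ρ * D.N y < 0 := mul_neg_of_neg_of_pos h4 hy
      exact absurd ((D.nonneg _).trans herr) h6.not_ge
  have hρM : 0 ≤ ρ * M := (D.nonneg _).trans hgx
  refine ⟨q, hqN, z, hzG, fun i hi ↦ ?_, ?_⟩
  · have h1 : D.ϖ ^ i * z i = D.ϖ ^ i * g i - D.ϖ ^ i * k i - D.ϖ ^ i * (g i - k i - z i) := by ring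
    rw [h1]
    refine (D.sub_le _ _).trans (max_le ((D.sub_le _ _).trans (max_le (hgM i (by omega))
      (hkM i (by omega)))) ((hz' i hi).trans (mul_le_of_le_one_left hM hρ1)))
  · have h1 : x - q * y - ∑ i ∈ Finset.range m, D.ϖ ^ i * z i =
        (x - ∑ i ∈ Finset.range (m + 1), D.ϖ ^ i * g i) -
          q * (y - ∑ i ∈ Finset.range (n + 1), D.ϖ ^ i * h i) +
          ∑ i ∈ Finset.range m, D.ϖ ^ i * (g i - k i - z i) := by
      rw [mul_sub, hksum, Finset.sum_range_succ, Finset.sum_range_succ, hkm]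
      simp only [mul_sub, Finset.sum_sub_distrib]
      ring
    rw [h1]
    refine (D.add_le _ _).trans (max_le ((D.sub_le _ _).trans (max_le hgx ?_))
      (D.sum_le _ _ hρM fun i hi ↦ hz' i (by simpa using hi)))
    rw [D.map_mul]
    refine (mul_le_mul hqN herr (D.nonneg _) (div_nonneg hM hy.le)).trans (le_of_eq ?_)
    field_simp

theorem Approx.eliminate {ρ M : ℝ} (hθ : D.θ ≤ ρ) (hρ1 : ρ ≤ 1) (hM : 0 ≤ M) {y : B} {n : ℕ}
    {h : ℕ → B} (hG : ∀ i, h i ∈ D.G) (hy : 0 < D.N y)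
    (htop : D.N (D.ϖ ^ n * h n) = D.N y) (hle : ∀ i < n + 1, D.N (D.ϖ ^ i * h i) ≤ D.N y)
    (herr : D.N (y - ∑ i ∈ Finset.range (n + 1), D.ϖ ^ i * h i) ≤ ρ * D.N y) (j : ℕ) {x : B}
    (hx : D.Approx ρ M x (n + j)) : ∃ q, D.N q ≤ M / D.N y ∧ D.Approx ρ M (x - q * y) n := by
  induction j generalizing x with
  | zero => exact ⟨0, by rw [D.map_zero]; positivity, by simpa using hx⟩
  | succ j ih =>
    obtain ⟨q, hq, h1⟩ := Approx.step D hθ hρ1 hM (Nat.le_add_right n j) hG hy htop hle herr hx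
    obtain ⟨q', hq', h2⟩ := ih h1
    refine ⟨q + q', (D.add_le _ _).trans (max_le hq hq'), ?_⟩
    rwa [add_mul, ← sub_sub]

theorem exists_approx {x : B} (hx : x ≠ 0) {ρ : ℝ} (hρ0 : 0 < ρ) (hρ1 : ρ < 1) (n : ℕ) :
    ∃ j, D.Approx ρ (D.N x) x (n + j) := by
  have h0 : 0 < D.N x := (D.nonneg x).lt_of_ne fun h ↦ hx (D.eq_zero x h.symm)
  obtain ⟨m, c, hc, h⟩ := D.dense x _ (mul_pos hρ0 h0)
  have hlt : ρ * D.N x < D.N x := mul_lt_of_lt_one_left h0 hρ1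
  have hsum : ∑ i ∈ Finset.range (n + m), D.ϖ ^ i * (if i < m then c i else 0) =
      ∑ i ∈ Finset.range m, D.ϖ ^ i * c i := by
    rw [← Finset.sum_subset (Finset.range_mono (Nat.le_add_left m n))]
    · exact Finset.sum_congr rfl fun i hi ↦ by rw [if_pos (by simpa using hi)]
    · intro i _ hi
      rw [if_neg (by simpa using hi), mul_zero]
  refine ⟨m, fun i ↦ if i < m then c i else 0, fun i ↦ ?_, fun i _ ↦ ?_, ?_⟩
  · dsimp only
    split_ifs
    · exact hc i
    · exact D.zero_mem
  · dsimp only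
    split_ifs with hi
    · rw [← D.eq_of_sub_lt (h.trans_lt hlt)]
      exact D.exact' m c hc i hi
    · rw [mul_zero, D.map_zero]
      exact h0.le
  · rwa [hsum]

theorem exists_seq_limit {x : ℕ → B} {C ρ : ℝ} (hρ0 : 0 < ρ) (hρ1 : ρ < 1)
    (h : ∀ k, D.N (x (k + 1) - x k) ≤ C * ρ ^ k) :
    ∃ y, Tendsto (fun n ↦ D.N (x n - y)) atTop (𝓝 0) := by
  have hC : 0 ≤ C := by
    have := (D.nonneg _).trans (h 0)
    simpa using this
  have h1 : ∀ M j, D.N (x (M + j) - x M) ≤ C * ρ ^ M := by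
    intro M j
    induction j with
    | zero => simp only [add_zero, sub_self, D.map_zero]; positivity
    | succ j ih =>
      have := D.add_le (x (M + j + 1) - x (M + j)) (x (M + j) - x M)
      rw [sub_add_sub_cancel] at this
      exact this.trans (max_le ((h _).trans (mul_le_mul_of_nonneg_left
        (pow_le_pow_of_le_one hρ0.le hρ1.le (Nat.le_add_right M j)) hC)) ih)
  refine D.complete x fun ε hε ↦ ?_
  have h2 : Tendsto (fun k ↦ C * ρ ^ k) atTop (𝓝 (C * 0)) :=
    (tendsto_pow_atTop_nhds_zero_of_lt_one hρ0.le hρ1).const_mul C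
  rw [mul_zero] at h2
  obtain ⟨M, hM⟩ := (h2.eventually (gt_mem_nhds hε)).exists
  refine ⟨M, fun m hm n hn ↦ ?_⟩
  obtain ⟨i, rfl⟩ := Nat.exists_eq_add_of_le hm
  obtain ⟨j, rfl⟩ := Nat.exists_eq_add_of_le hn
  have := D.sub_le (x (M + i) - x M) (x (M + j) - x M)
  rw [sub_sub_sub_cancel_right] at this
  exact this.trans (max_le ((h1 M i).trans hM.le) ((h1 M j).trans hM.le))

theorem dvd_or_exists_htLT (x : B) {y : B} {n : ℕ} (hy1 : D.HtLT y (n + 1)) (hy2 : ¬ D.HtLT y n) :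
    y ∣ x ∨ ∃ q, D.HtLT (x - q * y) n := by
  obtain ⟨h, hG, herr⟩ := hy1
  have hy : 0 < D.N y := (D.nonneg _).trans_lt herr
  have hNs := D.eq_of_sub_lt herr
  have hle : ∀ i < n + 1, D.N (D.ϖ ^ i * h i) ≤ D.N y := fun i hi ↦
    (D.exact' (n + 1) h hG i hi).trans hNs.le
  have htop : D.N (D.ϖ ^ n * h n) = D.N y := by
    refine le_antisymm (hle n (Nat.lt_succ_self n)) (le_of_not_gt fun hlt ↦ hy2 ⟨h, hG, ?_⟩)
    have h1 : y - ∑ i ∈ Finset.range n, D.ϖ ^ i * h i =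
        (y - ∑ i ∈ Finset.range (n + 1), D.ϖ ^ i * h i) + D.ϖ ^ n * h n := by
      rw [Finset.sum_range_succ]
      ring
    rw [h1]
    exact (D.add_le _ _).trans_lt (max_lt herr hlt)
  set e := D.N (y - ∑ i ∈ Finset.range (n + 1), D.ϖ ^ i * h i) / D.N y with he
  set ρ : ℝ := max (max D.θ e) (1 / 2) with hρ
  have hρ0 : 0 < ρ := lt_max_of_lt_right (by norm_num)
  have hρ1 : ρ < 1 := max_lt (max_lt D.θ_lt_one ((div_lt_one hy).2 herr)) (by norm_num)
  have hθ : D.θ ≤ ρ := (le_max_left _ _).trans (le_max_left _ _)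
  have herr' : D.N (y - ∑ i ∈ Finset.range (n + 1), D.ϖ ^ i * h i) ≤ ρ * D.N y := by
    rw [← div_le_iff₀ hy]
    exact (le_max_right _ _).trans (le_max_left _ _)
  by_contra! hcon
  obtain ⟨hndvd, hcon⟩ := hcon
  have hstep : ∀ q, ∃ q', D.N q' ≤ D.N (x - q * y) / D.N y ∧
      D.N (x - q * y - q' * y) ≤ ρ * D.N (x - q * y) := by
    intro q
    have hne : x - q * y ≠ 0 := fun h0 ↦ hndvd ⟨q, by linear_combination h0⟩
    obtain ⟨j, hj⟩ := D.exists_approx hne hρ0 hρ1 n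
    obtain ⟨q', hq', c, hc, -, hcx⟩ :=
      Approx.eliminate D hθ hρ1.le (D.nonneg _) hG hy htop hle herr' j hj
    refine ⟨q', hq', le_of_not_gt fun hlt ↦ hcon (q + q') ⟨c, hc, ?_⟩⟩
    rw [add_mul, ← sub_sub]
    exact hcx.trans_lt hlt
  choose f hf1 hf2 using hstep
  let s : ℕ → B := fun k ↦ Nat.rec 0 (fun _ q ↦ q + f q) k
  have hs : ∀ k, s (k + 1) = s k + f (s k) := fun _ ↦ rfl
  have hs1 : ∀ k, D.N (x - s k * y) ≤ ρ ^ k * D.N x := by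
    intro k
    induction k with
    | zero => simp [s]
    | succ k ih =>
      rw [hs, add_mul, ← sub_sub, pow_succ', mul_assoc]
      exact (hf2 _).trans (mul_le_mul_of_nonneg_left ih hρ0.le)
  obtain ⟨q, hq⟩ := D.exists_seq_limit (x := s) (C := D.N x / D.N y) hρ0 hρ1 fun k ↦ by
    rw [hs, add_sub_cancel_left]
    refine (hf1 _).trans ((div_le_div_of_nonneg_right (hs1 k) hy.le).trans (le_of_eq ?_))
    ring
  refine hndvd ⟨q, ?_⟩
  have h2 : Tendsto (fun k ↦ max (ρ ^ k * D.N x) (D.N (s k - q) * D.N y)) atTop (𝓝 0) := by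
    have := ((tendsto_pow_atTop_nhds_zero_of_lt_one hρ0.le hρ1).mul_const (D.N x)).max
      (hq.mul_const (D.N y))
    simpa using this
  have h3 : D.N (x - q * y) ≤ 0 := by
    refine ge_of_tendsto' h2 fun k ↦ ?_
    rw [← D.map_mul]
    have := D.add_le (x - s k * y) ((s k - q) * y)
    rw [sub_mul, sub_add_sub_cancel] at this
    refine this.trans (max_le_max (hs1 k) ?_)
    rw [sub_mul]
  have h4 := D.eq_zero _ (le_antisymm h3 (D.nonneg _))
  linear_combination h4

theorem span_pair_isPrincipal (D : EuclideanNorm B) (x y : B) : (Ideal.span {x, y}).IsPrincipal := by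
  classical
  by_cases hy : y = 0
  · exact ⟨x, by rw [hy, Ideal.span_pair_zero]⟩
  obtain ⟨n, hn⟩ := D.exists_htLT hy
  induction n using Nat.strong_induction_on generalizing x y with
  | _ n ih =>
    by_cases hlt : ∃ m < n, D.HtLT y m
    · obtain ⟨m, hm, hm2⟩ := hlt
      exact ih m hm x y hy hm2
    cases n with
    | zero =>
      obtain ⟨c, -, hc⟩ := hn
      simp at hc
    | succ n =>
      rcases D.dvd_or_exists_htLT x hn fun h ↦ hlt ⟨n, Nat.lt_succ_self n, h⟩ with h | ⟨q, hq⟩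
      · exact ⟨y, by
          exact Ideal.span_pair_eq_span_right_iff_dvd.2 h⟩
      · have h0 : x - q * y ≠ 0 := by
          obtain ⟨c, -, hc⟩ := hq
          intro h0
          rw [h0, D.map_zero] at hc
          exact (D.nonneg _).not_gt hc
        have := ih n (Nat.lt_succ_self n) y (x - q * y) h0 hq
        have he : Ideal.span {x, y} = Ideal.span {y, x - q * y} := by
          ext t
          rw [Ideal.mem_span_pair, Ideal.mem_span_pair]
          exact ⟨fun ⟨a, b, hab⟩ ↦ ⟨a * q + b, a, by linear_combination hab⟩,
            fun ⟨a, b, hab⟩ ↦ ⟨b, a - b * q, by linear_combination hab⟩⟩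
        rw [he]
        exact this

end EuclideanNorm

/-- A ring of analytic functions on a punctured disc of radius `r`: it is complete for a family of
multiplicative nonarchimedean norms `N s`, `0 < s ≤ r`, and every element is approximated by finite
sums `∑ ϖ^i c_i` with coefficients in a set `G` of units and zero. The elements of `A` are those
that are approximated by sums without terms of negative index. -/
structure AnnulusRing (R : Type u) [CommRing R] where
  /-- the outer radius -/
  r : ℝ
  /-- the norms -/
  N : ℝ → R → ℝ
  nonneg : ∀ s x, 0 ≤ N s x
  map_zero : ∀ s, 0 < s → s ≤ r → N s 0 = 0
  map_one : ∀ s, 0 < s → s ≤ r → N s 1 = 1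
  map_mul : ∀ s, 0 < s → s ≤ r → ∀ x y, N s (x * y) = N s x * N s y
  add_le : ∀ s, 0 < s → s ≤ r → ∀ x y, N s (x + y) ≤ max (N s x) (N s y)
  neg : ∀ s, 0 < s → s ≤ r → ∀ x, N s (-x) = N s x
  eq_zero : ∀ s, 0 < s → s ≤ r → ∀ x, N s x = 0 → x = 0
  convex : ∀ s t, 0 < s → s ≤ t → t ≤ r → ∀ x, N t x ≤ max (N s x) (N r x)
  complete : ∀ x : ℕ → R,
    (∀ s, 0 < s → s ≤ r → ∀ ε > 0, ∃ M, ∀ m ≥ M, ∀ n ≥ M, N s (x m - x n) ≤ ε) →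
    ∃ y, ∀ s, 0 < s → s ≤ r → Tendsto (fun n ↦ N s (x n - y)) atTop (𝓝 0)
  /-- the parameter of the finite sums -/
  ϖ : Rˣ
  /-- the valuation of the parameter -/
  κ : ℚ
  κ_pos : 0 < κ
  norm_ϖ : ∀ s, 0 < s → s ≤ r → N s (ϖ : R) = Real.exp (-κ)
  /-- the coefficients of the finite sums -/
  G : Set R
  zero_mem : 0 ∈ G
  one_mem : 1 ∈ G
  mul_mem : ∀ x ∈ G, ∀ y ∈ G, x * y ∈ G
  inv_mem : ∀ x ∈ G, x ≠ 0 → ∃ y ∈ G, x * y = 1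
  norm_G : ∀ x ∈ G, x ≠ 0 → ∃ l : ℚ, ∀ s, 0 < s → s ≤ r → N s x = Real.exp (-(s * l))
  /-- the subring generated by the parameter and the coefficients -/
  A : Subring R
  ϖ_mem : (ϖ : R) ∈ A
  G_le : G ⊆ A
  norm_A : ∀ x ∈ A, ∀ s, 0 < s → s ≤ r → N s x ≤ N r x ^ (s / r)
  exact' : ∀ s, 0 < s → s ≤ r → ∀ (F : Finset ℤ) (c : ℤ → R), (∀ i, c i ∈ G) → ∀ i ∈ F,
    N s (((ϖ ^ i : Rˣ) : R) * c i) ≤ N s (∑ i ∈ F, ((ϖ ^ i : Rˣ) : R) * c i)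
  /-- the precision of subtraction -/
  θ : ℝ
  θ_lt_one : θ < 1
  sub_mem : ∀ x ∈ G, ∀ y ∈ G, ∃ z ∈ G, N r (x - y - z) ≤ θ * max (N r x) (N r y)
  dense : ∀ x s, 0 < s → s ≤ r → ∀ ε > 0, ∃ (F : Finset ℤ) (c : ℤ → R), (∀ i, c i ∈ G) ∧
    N s (x - ∑ i ∈ F, ((ϖ ^ i : Rˣ) : R) * c i) ≤ ε ∧
    N r (x - ∑ i ∈ F, ((ϖ ^ i : Rˣ) : R) * c i) ≤ ε
  denseA : ∀ x ∈ A, ∀ ε > 0, ∃ (m : ℕ) (c : ℕ → R), (∀ i, c i ∈ G) ∧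
    N r (x - ∑ i ∈ Finset.range m, (ϖ : R) ^ i * c i) ≤ ε

namespace AnnulusRing

variable {R : Type u} [CommRing R] (D : AnnulusRing R)

/-- The possible inner radii. -/
abbrev Radius : Type := {a : ℝ // 0 < a ∧ a ≤ D.r}

/-- The ring `R` with the norm `max (N a) (N r)`. -/
def Ann (_ : D.Radius) : Type u := R

variable (a : D.Radius)

theorem r_pos (a : D.Radius) : 0 < D.r := a.2.1.trans_le a.2.2

/-- The norm `max (N a) (N r)`. -/
def annNorm : RingNorm R where
  toFun x := max (D.N a x) (D.N D.r x)
  map_zero' := by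
    rw [D.map_zero a a.2.1 a.2.2, D.map_zero D.r (D.r_pos a) le_rfl, max_self]
  add_le' x y := by
    have h1 := D.add_le a a.2.1 a.2.2 x y
    have h2 := D.add_le D.r (D.r_pos a) le_rfl x y
    refine max_le (h1.trans (max_le ?_ ?_)) (h2.trans (max_le ?_ ?_))
    · exact (le_max_left _ _).trans (le_add_of_nonneg_right (le_max_of_le_left (D.nonneg _ _)))
    · exact (le_max_left _ _).trans (le_add_of_nonneg_left (le_max_of_le_left (D.nonneg _ _)))
    · exact (le_max_right _ _).trans (le_add_of_nonneg_right (le_max_of_le_left (D.nonneg _ _)))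
    · exact (le_max_right _ _).trans (le_add_of_nonneg_left (le_max_of_le_left (D.nonneg _ _)))
  neg' x := by
    rw [D.neg a a.2.1 a.2.2, D.neg D.r (D.r_pos a) le_rfl]
  mul_le' x y := by
    rw [D.map_mul a a.2.1 a.2.2, D.map_mul D.r (D.r_pos a) le_rfl]
    exact max_le (mul_le_mul (le_max_left _ _) (le_max_left _ _) (D.nonneg _ _)
      (le_max_of_le_left (D.nonneg _ _))) (mul_le_mul (le_max_right _ _) (le_max_right _ _)
      (D.nonneg _ _) (le_max_of_le_left (D.nonneg _ _)))
  eq_zero_of_map_eq_zero' x h := D.eq_zero a a.2.1 a.2.2 x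
    (le_antisymm ((le_max_left _ _).trans h.le) (D.nonneg _ _))

instance : CommRing (D.Ann a) := inferInstanceAs (CommRing R)

instance : NormedCommRing (D.Ann a) :=
  { RingNorm.toNormedRing (R := D.Ann a) (D.annNorm a) with mul_comm := mul_comm }

/-- The completion of `R` for the norm `max (N a) (N r)`. -/
abbrev T : Type u := UniformSpace.Completion (D.Ann a)

/-- The map from `R` to its completion. -/
def toT : R →+* D.T a := (UniformSpace.Completion.coeRingHom : D.Ann a →+* D.T a)

theorem norm_toT (x : R) : ‖D.toT a x‖ = max (D.N a x) (D.N D.r x) :=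
  UniformSpace.Completion.norm_coe (E := D.Ann a) x

theorem denseRange_toT : DenseRange (D.toT a) :=
  UniformSpace.Completion.denseRange_coe (α := D.Ann a)

theorem sub_le {s : ℝ} (hs : 0 < s) (hsr : s ≤ D.r) (x y : R) :
    D.N s (x - y) ≤ max (D.N s x) (D.N s y) := by
  rw [sub_eq_add_neg, ← D.neg s hs hsr y]
  exact D.add_le s hs hsr _ _

theorem lipschitz_N {s : ℝ} (h1 : a ≤ s) (h2 : s ≤ D.r) :
    LipschitzWith 1 (fun x : D.Ann a ↦ D.N s x) := by
  have hs := a.2.1.trans_le h1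
  refine LipschitzWith.of_le_add fun x y ↦ ?_
  have key : ∀ x y : R, D.N s x ≤ D.N s y + max (D.N a (x - y)) (D.N D.r (x - y)) := by
    intro x y
    have h3 := D.add_le s hs h2 (x - y) y
    rw [sub_add_cancel] at h3
    refine h3.trans (max_le ((D.convex a s a.2.1 h1 h2 _).trans
      (le_add_of_nonneg_left (D.nonneg _ _)))
      (le_add_of_nonneg_right (le_max_of_le_left (D.nonneg _ _))))
  exact (key x y).trans_eq (congrArg _ (dist_eq_norm x y).symm)

/-- The extension of the norm `N s`, `a ≤ s ≤ r`, to the completion. -/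
def M (s : ℝ) : D.T a → ℝ := UniformSpace.Completion.extension (fun x : D.Ann a ↦ D.N s x)

variable {a} {s : ℝ}

theorem M_toT (h1 : a ≤ s) (h2 : s ≤ D.r) (x : R) : D.M a s (D.toT a x) = D.N s x :=
  UniformSpace.Completion.extension_coe (D.lipschitz_N a h1 h2).uniformContinuous x

theorem continuous_M : Continuous (D.M a s) := UniformSpace.Completion.continuous_extension

theorem M_nonneg (h1 : a ≤ s) (h2 : s ≤ D.r) (x : D.T a) : 0 ≤ D.M a s x :=
  (D.denseRange_toT a).induction_on (p := fun x ↦ 0 ≤ D.M a s x) x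
    (isClosed_le continuous_const D.continuous_M)
    fun x ↦ (D.nonneg s x).trans_eq (D.M_toT h1 h2 x).symm

theorem M_mul (h1 : a ≤ s) (h2 : s ≤ D.r) (x y : D.T a) :
    D.M a s (x * y) = D.M a s x * D.M a s y :=
  (D.denseRange_toT a).induction_on₂ (p := fun x y ↦ D.M a s (x * y) = D.M a s x * D.M a s y)
    (isClosed_eq (D.continuous_M.comp (continuous_mul (M := D.T a)))
      ((D.continuous_M.comp continuous_fst).mul (D.continuous_M.comp continuous_snd)))
    (fun x y ↦ by
      rw [← _root_.map_mul, D.M_toT h1 h2, D.M_toT h1 h2, D.M_toT h1 h2,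
        D.map_mul s (a.2.1.trans_le h1) h2]) x y

theorem M_add_le (h1 : a ≤ s) (h2 : s ≤ D.r) (x y : D.T a) :
    D.M a s (x + y) ≤ max (D.M a s x) (D.M a s y) :=
  (D.denseRange_toT a).induction_on₂ (p := fun x y ↦ D.M a s (x + y) ≤ max (D.M a s x) (D.M a s y))
    (isClosed_le (D.continuous_M.comp (continuous_add (M := D.T a)))
      ((D.continuous_M.comp continuous_fst).max (D.continuous_M.comp continuous_snd)))
    (fun x y ↦ by
      rw [← _root_.map_add, D.M_toT h1 h2, D.M_toT h1 h2, D.M_toT h1 h2]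
      exact D.add_le s (a.2.1.trans_le h1) h2 x y) x y

theorem M_neg (h1 : a ≤ s) (h2 : s ≤ D.r) (x : D.T a) : D.M a s (-x) = D.M a s x :=
  (D.denseRange_toT a).induction_on (p := fun x ↦ D.M a s (-x) = D.M a s x) x
    (isClosed_eq (D.continuous_M.comp (continuous_neg (G := D.T a))) D.continuous_M)
    fun x ↦ by
      rw [← _root_.map_neg, D.M_toT h1 h2, D.M_toT h1 h2, D.neg s (a.2.1.trans_le h1) h2]

theorem M_sub_le (h1 : a ≤ s) (h2 : s ≤ D.r) (x y : D.T a) :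
    D.M a s (x - y) ≤ max (D.M a s x) (D.M a s y) := by
  rw [sub_eq_add_neg, ← D.M_neg h1 h2 y]
  exact D.M_add_le h1 h2 _ _

theorem M_zero (h1 : a ≤ s) (h2 : s ≤ D.r) : D.M a s 0 = 0 := by
  rw [← _root_.map_zero (D.toT a), D.M_toT h1 h2, D.map_zero s (a.2.1.trans_le h1) h2]

theorem M_one (h1 : a ≤ s) (h2 : s ≤ D.r) : D.M a s 1 = 1 := by
  rw [← _root_.map_one (D.toT a), D.M_toT h1 h2, D.map_one s (a.2.1.trans_le h1) h2]

theorem norm_T (x : D.T a) : ‖x‖ = max (D.M a a x) (D.M a D.r x) :=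
  (D.denseRange_toT a).induction_on (p := fun x ↦ ‖x‖ = max (D.M a a x) (D.M a D.r x)) x
    (isClosed_eq continuous_norm (D.continuous_M.max D.continuous_M))
    fun x ↦ by rw [D.norm_toT a x, D.M_toT le_rfl a.2.2, D.M_toT a.2.2 le_rfl]

theorem M_a_le_norm (x : D.T a) : D.M a a x ≤ ‖x‖ := by rw [norm_T]; exact le_max_left _ _

theorem M_r_le_norm (x : D.T a) : D.M a D.r x ≤ ‖x‖ := by rw [norm_T]; exact le_max_right _ _

theorem norm_add_le_max (x y : D.T a) : ‖x + y‖ ≤ max ‖x‖ ‖y‖ := by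
  rw [norm_T D (x + y)]
  exact max_le ((D.M_add_le le_rfl a.2.2 x y).trans (max_le_max (D.M_a_le_norm x)
    (D.M_a_le_norm y))) ((D.M_add_le a.2.2 le_rfl x y).trans (max_le_max (D.M_r_le_norm x)
    (D.M_r_le_norm y)))

theorem M_eq_of_sub_lt (h1 : a ≤ s) (h2 : s ≤ D.r) {x y : D.T a}
    (h : D.M a s (x - y) < D.M a s x) : D.M a s y = D.M a s x := by
  have h3 : D.M a s y ≤ max (D.M a s x) (D.M a s (x - y)) := by
    have := D.M_sub_le h1 h2 x (x - y)
    rwa [sub_sub_cancel] at this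
  have h4 : D.M a s x ≤ max (D.M a s (x - y)) (D.M a s y) := by
    have := D.M_add_le h1 h2 (x - y) y
    rwa [sub_add_cancel] at this
  exact le_antisymm (h3.trans (max_le le_rfl h.le)) ((le_max_iff.1 h4).resolve_left h.not_ge)

/-! ### Elements close to one -/

theorem M_eq_one (h1 : a ≤ s) (h2 : s ≤ D.r) {x : D.T a} (hx : D.M a s (x - 1) < 1) :
    D.M a s x = 1 := by
  have h : D.M a s (1 - x) < D.M a s 1 := by
    rwa [← D.M_neg h1 h2, neg_sub, D.M_one h1 h2]
  rw [D.M_eq_of_sub_lt h1 h2 h, D.M_one h1 h2]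

theorem M_le_norm_of (h1 : a ≤ s) (h2 : s ≤ D.r) (x : D.T a) : D.M a s x ≤ ‖x‖ :=
  (D.denseRange_toT a).induction_on (p := fun x ↦ D.M a s x ≤ ‖x‖) x
    (isClosed_le D.continuous_M continuous_norm)
    fun x ↦ by
      rw [D.M_toT h1 h2, D.norm_toT a]
      exact D.convex a s a.2.1 h1 h2 x

theorem norm_eq_one {x : D.T a} (hx : ‖x - 1‖ < 1) : ‖x‖ = 1 := by
  rw [norm_T, D.M_eq_one le_rfl a.2.2 ((D.M_a_le_norm _).trans_lt hx),
    D.M_eq_one a.2.2 le_rfl ((D.M_r_le_norm _).trans_lt hx), max_self]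

theorem isUnit_of_norm_sub_one_lt {x : D.T a} (hx : ‖x - 1‖ < 1) : IsUnit x := by
  have h : ‖1 - x‖ < 1 := by rwa [norm_sub_rev]
  have := (Units.oneSub (1 - x) h).isUnit
  rwa [Units.val_oneSub, sub_sub_cancel] at this

theorem norm_inv_sub_one {x y : D.T a} (hxy : x * y = 1) {ε : ℝ} (hx : ‖x - 1‖ ≤ ε) (hε : ε < 1) :
    ‖y - 1‖ ≤ ε := by
  have hx1 := hx.trans_lt hε
  have h : ∀ s : ℝ, a ≤ s → s ≤ D.r → D.M a s (y - 1) = D.M a s (x - 1) := by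
    intro s h1 h2
    have hx2 := D.M_eq_one h1 h2 ((D.M_le_norm_of h1 h2 _).trans_lt hx1)
    have h3 : D.M a s (x * (y - 1)) = D.M a s (-(x - 1)) := by
      congr 1
      linear_combination hxy
    rwa [D.M_mul h1 h2, hx2, one_mul, D.M_neg h1 h2] at h3
  rw [norm_T, h a le_rfl a.2.2, h D.r a.2.2 le_rfl, ← norm_T]
  exact hx

theorem norm_mul_sub_one {x y : D.T a} {ε : ℝ} (hx : ‖x - 1‖ ≤ ε) (hy : ‖y - 1‖ ≤ ε) (hε : ε < 1) :
    ‖x * y - 1‖ ≤ ε := by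
  have h : x * y - 1 = x * (y - 1) + (x - 1) := by ring
  rw [h]
  refine (D.norm_add_le_max _ _).trans (max_le ?_ hx)
  refine (norm_mul_le _ _).trans ?_
  rwa [D.norm_eq_one (hx.trans_lt hε), one_mul]

end AnnulusRing

theorem exists_seq_of_step {α : Type*} (P : ℕ → α → Prop) (Q : ℕ → α → α → Prop)
    (h0 : ∃ a, P 0 a) (step : ∀ n a, P n a → ∃ b, P (n + 1) b ∧ Q n a b) :
    ∃ f : ℕ → α, ∀ n, P n (f n) ∧ Q n (f n) (f (n + 1)) := by
  classical
  choose! g hg using step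
  obtain ⟨a, ha⟩ := h0
  have h : ∀ n, P n (Nat.rec (motive := fun _ ↦ α) a (fun n b ↦ g n b) n) := by
    intro n
    induction n with
    | zero => exact ha
    | succ n ih => exact (hg n _ ih).1
  exact ⟨fun n ↦ Nat.rec (motive := fun _ ↦ α) a (fun n b ↦ g n b) n,
    fun n ↦ ⟨h n, (hg n _ (h n)).2⟩⟩

namespace AnnulusRing

variable {R : Type u} [CommRing R] (D : AnnulusRing R)

/-- The finite sums `∑ ϖ^i c_i`. -/
def laurentSum (F : Finset ℤ) (c : ℤ → R) : R := ∑ i ∈ F, ((D.ϖ ^ i : Rˣ) : R) * c i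

variable {a : D.Radius} {s : ℝ}

theorem N_sum_le (hs : 0 < s) (hsr : s ≤ D.r) {ι : Type*} (F : Finset ι) (f : ι → R) {C : ℝ}
    (hC : 0 ≤ C) (h : ∀ i ∈ F, D.N s (f i) ≤ C) : D.N s (∑ i ∈ F, f i) ≤ C := by
  classical
  induction F using Finset.induction_on with
  | empty => simpa [D.map_zero s hs hsr]
  | insert a s ha ih =>
    rw [Finset.sum_insert ha]
    exact (D.add_le _ hs hsr _ _).trans
      (max_le (h a (by simp)) (ih fun i hi ↦ h i (by simp [hi])))

theorem N_pow (hs : 0 < s) (hsr : s ≤ D.r) (x : R) (n : ℕ) : D.N s (x ^ n) = D.N s x ^ n := by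
  induction n with
  | zero => rw [pow_zero, pow_zero, D.map_one s hs hsr]
  | succ n ih => rw [pow_succ, D.map_mul s hs hsr, ih, pow_succ]

theorem N_mul_inv (hs : 0 < s) (hsr : s ≤ D.r) (x : Rˣ) :
    D.N s (x : R) * D.N s ((x⁻¹ : Rˣ) : R) = 1 := by
  rw [← D.map_mul s hs hsr, Units.mul_inv, D.map_one s hs hsr]

theorem N_unit_pos (hs : 0 < s) (hsr : s ≤ D.r) (x : Rˣ) : 0 < D.N s (x : R) := by
  refine (D.nonneg s _).lt_of_ne fun h ↦ ?_
  have := D.N_mul_inv hs hsr x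
  rw [← h, zero_mul] at this
  exact zero_ne_one this

theorem N_inv (hs : 0 < s) (hsr : s ≤ D.r) (x : Rˣ) :
    D.N s ((x⁻¹ : Rˣ) : R) = (D.N s (x : R))⁻¹ :=
  eq_inv_of_mul_eq_one_right (D.N_mul_inv hs hsr x)

theorem N_zpow (hs : 0 < s) (hsr : s ≤ D.r) (i : ℤ) :
    D.N s ((D.ϖ ^ i : Rˣ) : R) = Real.exp (-(D.κ * i)) := by
  have key : ∀ n : ℕ, D.N s ((D.ϖ ^ n : Rˣ) : R) = Real.exp (-(D.κ * n)) := by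
    intro n
    rw [Units.val_pow_eq_pow_val, D.N_pow hs hsr, D.norm_ϖ s hs hsr, ← Real.exp_nat_mul]
    ring_nf
  obtain ⟨n, rfl | rfl⟩ := i.eq_nat_or_neg
  · rw [zpow_natCast, key, Int.cast_natCast]
  · rw [zpow_neg, zpow_natCast, D.N_inv hs hsr, key, ← Real.exp_neg]
    push_cast
    ring_nf

/-- The norm of a term of a finite sum. -/
theorem exists_N_term {c : R} (hc : c ∈ D.G) (h0 : c ≠ 0) (i : ℤ) :
    ∃ l : ℚ, ∀ s, 0 < s → s ≤ D.r →
      D.N s (((D.ϖ ^ i : Rˣ) : R) * c) = Real.exp (-(D.κ * i + s * l)) := by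
  obtain ⟨l, hl⟩ := D.norm_G c hc h0
  refine ⟨l, fun s hs hsr ↦ ?_⟩
  rw [D.map_mul s hs hsr, D.N_zpow hs hsr, hl s hs hsr, ← Real.exp_add]
  ring_nf

/-- A term of negative index which is at most one on the inner circle decreases with the radius. -/
theorem N_term_le_of_neg {c : R} (hc : c ∈ D.G) {i : ℤ} (hi : i < 0) {s t : ℝ} (hs : 0 < s)
    (hst : s ≤ t) (ht : t ≤ D.r) (h : D.N s (((D.ϖ ^ i : Rˣ) : R) * c) ≤ 1) :
    D.N t (((D.ϖ ^ i : Rˣ) : R) * c) ≤ D.N s (((D.ϖ ^ i : Rˣ) : R) * c) := by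
  rcases eq_or_ne c 0 with rfl | h0
  · rw [mul_zero, D.map_zero s hs (hst.trans ht), D.map_zero t (hs.trans_le hst) ht]
  obtain ⟨l, hl⟩ := D.exists_N_term hc h0 i
  rw [hl s hs (hst.trans ht), hl t (hs.trans_le hst) ht]
  rw [hl s hs (hst.trans ht), Real.exp_le_one_iff] at h
  have hκ : (0 : ℝ) < D.κ := by exact_mod_cast D.κ_pos
  have hi' : (i : ℝ) < 0 := by exact_mod_cast hi
  have h1 : (D.κ : ℝ) * i < 0 := mul_neg_of_pos_of_neg hκ hi'
  have h2 : (0 : ℝ) < l := by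
    by_contra! h3
    have := mul_nonpos_of_nonneg_of_nonpos hs.le h3
    linarith
  rw [Real.exp_le_exp]
  nlinarith

theorem isUnit_term {c : R} (hc : c ∈ D.G) (h0 : c ≠ 0) (i : ℤ) :
    IsUnit (((D.ϖ ^ i : Rˣ) : R) * c) := by
  obtain ⟨y, _, hy⟩ := D.inv_mem c hc h0
  exact (Units.isUnit _).mul (IsUnit.of_mul_eq_one y hy)

theorem laurentSum_mem_A {F : Finset ℤ} {c : ℤ → R} (hc : ∀ i, c i ∈ D.G) (hF : ∀ i ∈ F, 0 ≤ i) :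
    D.laurentSum F c ∈ D.A := by
  refine sum_mem fun i hi ↦ D.A.mul_mem ?_ (D.G_le (hc i))
  obtain ⟨n, rfl⟩ := Int.eq_ofNat_of_zero_le (hF i hi)
  rw [zpow_natCast, Units.val_pow_eq_pow_val]
  exact D.A.pow_mem D.ϖ_mem n

theorem exists_laurentSum (z : D.T a) {ε : ℝ} (hε : 0 < ε) :
    ∃ (F : Finset ℤ) (c : ℤ → R), (∀ i, c i ∈ D.G) ∧
      ‖z - D.toT a (D.laurentSum F c)‖ ≤ ε := by
  obtain ⟨x, hx⟩ := (D.denseRange_toT a).exists_dist_lt z hε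
  obtain ⟨F, c, hc, h1, h2⟩ := D.dense x a a.2.1 a.2.2 ε hε
  refine ⟨F, c, hc, ?_⟩
  have h : z - D.toT a (D.laurentSum F c) =
      (z - D.toT a x) + D.toT a (x - D.laurentSum F c) := by
    rw [_root_.map_sub]
    ring
  rw [h]
  refine (D.norm_add_le_max _ _).trans (max_le ?_ ?_)
  · rw [← dist_eq_norm]
    exact hx.le
  · rw [D.norm_toT]
    exact max_le h1 h2

theorem N_laurentSum_le_of_subset (hs : 0 < s) (hsr : s ≤ D.r) {F F' : Finset ℤ} {c : ℤ → R}
    (hc : ∀ i, c i ∈ D.G) (h : F' ⊆ F) :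
    D.N s (D.laurentSum F' c) ≤ D.N s (D.laurentSum F c) :=
  D.N_sum_le hs hsr _ _ (D.nonneg _ _) fun i hi ↦ D.exact' s hs hsr F c hc i (h hi)

theorem laurentSum_split (F : Finset ℤ) (c : ℤ → R) :
    D.laurentSum F c = D.laurentSum (F.filter (· < 0)) c + D.laurentSum (F.filter (¬ · < 0)) c :=
  (Finset.sum_filter_add_sum_filter_not F (· < 0) _).symm

variable (a) in
/-- The closure of `A` in the completion. -/
def B : Subring (D.T a) := (D.A.map (D.toT a)).topologicalClosure

theorem toT_mem_B {x : R} (hx : x ∈ D.A) : D.toT a x ∈ D.B a :=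
  Subring.le_topologicalClosure _ ⟨x, hx, rfl⟩

theorem isClosed_B : IsClosed (D.B a : Set (D.T a)) := Subring.isClosed_topologicalClosure _

theorem exists_split {z : D.T a} {ε : ℝ} (h0 : 0 < ε) (h1 : ε ≤ 1) (hz : D.M a a z ≤ ε) :
    ∃ m q, z = m + q ∧ ‖m‖ ≤ ε ∧ q ∈ D.B a ∧ D.M a a q ≤ ε ∧ D.M a D.r q ≤ max (D.M a D.r z) ε := by
  obtain ⟨F, c, hc, hY⟩ := D.exists_laurentSum z h0
  have ha := a.2.1
  have hr := D.r_pos a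
  have hYa : D.N a (D.laurentSum F c) ≤ ε := by
    rw [← D.M_toT le_rfl a.2.2]
    have := D.M_sub_le le_rfl a.2.2 z (z - D.toT a (D.laurentSum F c))
    rw [sub_sub_cancel] at this
    exact this.trans (max_le hz ((D.M_a_le_norm _).trans hY))
  have hYr : D.N D.r (D.laurentSum F c) ≤ max (D.M a D.r z) ε := by
    rw [← D.M_toT a.2.2 le_rfl]
    have := D.M_sub_le a.2.2 le_rfl z (z - D.toT a (D.laurentSum F c))
    rw [sub_sub_cancel] at this
    exact this.trans (max_le_max le_rfl ((D.M_r_le_norm _).trans hY))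
  have hterm : ∀ i ∈ F, D.N a (((D.ϖ ^ i : Rˣ) : R) * c i) ≤ ε := fun i hi ↦
    (D.exact' a ha a.2.2 F c hc i hi).trans hYa
  refine ⟨z - D.toT a (D.laurentSum F c) + D.toT a (D.laurentSum (F.filter (· < 0)) c),
    D.toT a (D.laurentSum (F.filter (¬ · < 0)) c), ?_, ?_, ?_, ?_, ?_⟩
  · rw [D.laurentSum_split F c, _root_.map_add]
    ring
  · refine (D.norm_add_le_max _ _).trans (max_le hY ?_)
    rw [D.norm_toT]
    refine max_le (D.N_sum_le ha a.2.2 _ _ h0.le fun i hi ↦ hterm i (Finset.mem_filter.1 hi).1)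
      (D.N_sum_le hr le_rfl _ _ h0.le fun i hi ↦ ?_)
    obtain ⟨hi1, hi2⟩ := Finset.mem_filter.1 hi
    exact (D.N_term_le_of_neg (hc i) hi2 ha a.2.2 le_rfl ((hterm i hi1).trans h1)).trans
      (hterm i hi1)
  · exact D.toT_mem_B (D.laurentSum_mem_A hc fun i hi ↦ not_lt.1 (Finset.mem_filter.1 hi).2)
  · rw [D.M_toT le_rfl a.2.2]
    exact (D.N_laurentSum_le_of_subset ha a.2.2 hc (Finset.filter_subset _ _)).trans hYa
  · rw [D.M_toT a.2.2 le_rfl]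
    exact (D.N_laurentSum_le_of_subset hr le_rfl hc (Finset.filter_subset _ _)).trans hYr

theorem N_sum_lt (hs : 0 < s) (hsr : s ≤ D.r) {ι : Type*} (F : Finset ι) (f : ι → R) {C : ℝ}
    (hC : 0 < C) (h : ∀ i ∈ F, D.N s (f i) < C) : D.N s (∑ i ∈ F, f i) < C := by
  rcases F.eq_empty_or_nonempty with rfl | he
  · rwa [Finset.sum_empty, D.map_zero s hs hsr]
  · obtain ⟨j, hj, hjmax⟩ := F.exists_max_image (fun i ↦ D.N s (f i)) he
    exact (D.N_sum_le hs hsr _ _ (D.nonneg _ _) hjmax).trans_lt (h j hj)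

/-- On a circle of irrational radius, terms of equal norm have equal index. -/
theorem eq_of_N_term_eq (hirr : Irrational a) {c c' : R} (hc : c ∈ D.G) (h0 : c ≠ 0)
    (hc' : c' ∈ D.G) (h0' : c' ≠ 0) {i j : ℤ}
    (h : D.N a (((D.ϖ ^ i : Rˣ) : R) * c) = D.N a (((D.ϖ ^ j : Rˣ) : R) * c')) :
    i = j ∧ ∀ t, 0 < t → t ≤ D.r → D.N t c = D.N t c' := by
  have ha := a.2.1
  obtain ⟨l, hl⟩ := D.norm_G _ hc h0
  obtain ⟨l', hl'⟩ := D.norm_G _ hc' h0'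
  rw [D.map_mul a ha a.2.2, D.map_mul a ha a.2.2, D.N_zpow ha a.2.2, D.N_zpow ha a.2.2,
    hl a ha a.2.2, hl' a ha a.2.2, ← Real.exp_add, ← Real.exp_add, Real.exp_eq_exp] at h
  have hκ : (D.κ : ℝ) ≠ 0 := by exact_mod_cast D.κ_pos.ne'
  rcases eq_or_ne l l' with h1 | h1
  · subst h1
    have : (D.κ : ℝ) * j = D.κ * i := by linarith
    exact ⟨(by exact_mod_cast mul_left_cancel₀ hκ this : j = i).symm,
      fun t ht htr ↦ by rw [hl t ht htr, hl' t ht htr]⟩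
  · refine absurd ⟨D.κ * (j - i) / (l - l'), ?_⟩ hirr
    have h2 : ((l : ℝ) - l') ≠ 0 := sub_ne_zero.2 (by exact_mod_cast h1)
    push_cast
    rw [div_eq_iff h2]
    linarith

/-- On a circle of irrational radius, every element has a unique dominant term. -/
theorem exists_dominant_sum (hirr : Irrational a) {x : D.T a} (hx : D.M a a x ≠ 0) {δ : ℝ}
    (hδ : 0 < δ) : ∃ (i : ℤ) (g : R) (C : Rˣ) (F : Finset ℤ) (c : ℤ → R), g ∈ D.G ∧
      (C : R) = ((D.ϖ ^ i : Rˣ) : R) * g ∧ (∀ j, c j ∈ D.G) ∧ 0 ∈ F ∧ c 0 = 1 ∧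
      (∀ j ∈ F, j ≠ 0 → D.N a (((D.ϖ ^ j : Rˣ) : R) * c j) < 1) ∧
      ‖x - D.toT a (C * D.laurentSum F c)‖ ≤ δ ∧ D.N a (C : R) = D.M a a x := by
  have ha := a.2.1
  have hx0 : 0 < D.M a a x := (D.M_nonneg le_rfl a.2.2 x).lt_of_ne hx.symm
  obtain ⟨F, c, hc, hY⟩ := D.exists_laurentSum x (lt_min hδ (half_pos hx0))
  have hY' : D.M a a (x - D.toT a (D.laurentSum F c)) < D.M a a x :=
    ((D.M_a_le_norm _).trans (hY.trans (min_le_right _ _))).trans_lt (half_lt_self hx0)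
  have hYx : D.N a (D.laurentSum F c) = D.M a a x := by
    rw [← D.M_toT le_rfl a.2.2, D.M_eq_of_sub_lt le_rfl a.2.2 hY']
  have hne : F.Nonempty := by
    rw [Finset.nonempty_iff_ne_empty]
    rintro rfl
    rw [laurentSum, Finset.sum_empty, D.map_zero a ha a.2.2] at hYx
    exact hx hYx.symm
  obtain ⟨i, hi, hmax⟩ := F.exists_max_image (fun i ↦ D.N a (((D.ϖ ^ i : Rˣ) : R) * c i)) hne
  have hle : D.N a (((D.ϖ ^ i : Rˣ) : R) * c i) = D.M a a x := by
    rw [← hYx]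
    exact le_antisymm (D.exact' a ha a.2.2 F c hc i hi)
      (D.N_sum_le ha a.2.2 _ _ (D.nonneg _ _) hmax)
  have hci : c i ≠ 0 := fun h ↦ by
    rw [h, mul_zero, D.map_zero a ha a.2.2] at hle
    exact hx0.ne hle
  have hstrict : ∀ j ∈ F, j ≠ i → D.N a (((D.ϖ ^ j : Rˣ) : R) * c j) < D.M a a x := by
    intro j hj hji
    refine ((hmax j hj).trans_eq hle).lt_of_ne fun h ↦ ?_
    rcases eq_or_ne (c j) 0 with h0 | h0
    · rw [h0, mul_zero, D.map_zero a ha a.2.2] at h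
      exact hx0.ne h
    · exact hji (D.eq_of_N_term_eq hirr (hc j) h0 (hc i) hci (h.trans hle.symm)).1
  obtain ⟨h, hhG, hh⟩ := D.inv_mem _ (hc i) hci
  obtain ⟨C, hC⟩ := D.isUnit_term (hc i) hci i
  have hterm : ∀ j : ℤ, (C : R) * (((D.ϖ ^ (j - i) : Rˣ) : R) * (c j * h)) =
      ((D.ϖ ^ j : Rˣ) : R) * c j := by
    intro j
    have h1 : ((D.ϖ ^ j : Rˣ) : R) = ((D.ϖ ^ i : Rˣ) : R) * ((D.ϖ ^ (j - i) : Rˣ) : R) := by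
      rw [← Units.val_mul, ← zpow_add, add_sub_cancel]
    rw [hC, h1]
    linear_combination ((D.ϖ ^ i : Rˣ) : R) * ((D.ϖ ^ (j - i) : Rˣ) : R) * c j * hh
  refine ⟨i, c i, C, F.map ⟨fun j ↦ j - i, sub_left_injective⟩, fun j ↦ c (j + i) * h, hc i, hC,
    fun j ↦ D.mul_mem _ (hc _) _ hhG, Finset.mem_map.2 ⟨i, hi, sub_self i⟩, ?_, ?_, ?_, ?_⟩
  · dsimp only
    rw [zero_add, hh]
  · intro j hj hj0
    obtain ⟨j, hjF, rfl⟩ := Finset.mem_map.1 hj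
    simp only [Function.Embedding.coeFn_mk, sub_add_cancel] at hj0 ⊢
    have h1 := hstrict j hjF (sub_ne_zero.1 hj0)
    rw [← hterm, D.map_mul a ha a.2.2, hC, hle] at h1
    exact (mul_lt_iff_lt_one_right hx0).1 h1
  · have h1 : (C : R) * D.laurentSum (F.map ⟨fun j ↦ j - i, sub_left_injective⟩)
        (fun j ↦ c (j + i) * h) = D.laurentSum F c := by
      rw [laurentSum, Finset.sum_map, Finset.mul_sum, laurentSum]
      refine Finset.sum_congr rfl fun j _ ↦ ?_
      simp only [Function.Embedding.coeFn_mk, sub_add_cancel]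
      exact hterm j
    rw [h1]
    exact hY.trans (min_le_left _ _)
  · rw [hC, hle]

theorem laurentSum_eq_one_add {F : Finset ℤ} {c : ℤ → R} (h0 : 0 ∈ F) (hc : c 0 = 1) :
    D.laurentSum F c = 1 + ∑ j ∈ F.erase 0, ((D.ϖ ^ j : Rˣ) : R) * c j := by
  rw [laurentSum, ← Finset.add_sum_erase F _ h0, hc, zpow_zero, Units.val_one, one_mul]

theorem exists_dominant (hirr : Irrational a) {x : D.T a} (hx : D.M a a x ≠ 0) :
    ∃ C : Rˣ, D.M a a (x - D.toT a C) < D.M a a x := by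
  have ha := a.2.1
  have hx0 : 0 < D.M a a x := (D.M_nonneg le_rfl a.2.2 x).lt_of_ne hx.symm
  obtain ⟨i, g, C, F, c, -, -, -, h0, hc0, hlt, hxC, hC⟩ :=
    D.exists_dominant_sum hirr hx (half_pos hx0)
  refine ⟨C, ?_⟩
  have h : x - D.toT a C = (x - D.toT a (C * D.laurentSum F c)) +
      D.toT a (C * ∑ j ∈ F.erase 0, ((D.ϖ ^ j : Rˣ) : R) * c j) := by
    rw [D.laurentSum_eq_one_add h0 hc0, mul_add, mul_one, _root_.map_add]
    ring
  rw [h]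
  refine (D.M_add_le le_rfl a.2.2 _ _).trans_lt (max_lt ?_ ?_)
  · exact ((D.M_a_le_norm _).trans hxC).trans_lt (half_lt_self hx0)
  · rw [D.M_toT le_rfl a.2.2, D.map_mul a ha a.2.2, hC]
    refine (mul_lt_iff_lt_one_right hx0).2 (D.N_sum_lt ha a.2.2 _ _ one_pos fun j hj ↦ ?_)
    exact hlt j (Finset.mem_erase.1 hj).2 (Finset.mem_erase.1 hj).1

end AnnulusRing

namespace AnnulusRing

variable {R : Type u} [CommRing R] (D : AnnulusRing R) {a : D.Radius} {s : ℝ}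

/-- An element that is close to one on the inner circle is a product of a unit and a limit of
elements of `A`. -/
theorem exists_unit_mul_of_near_one {x : D.T a} (hx : D.M a a (x - 1) < 1) :
    ∃ u q, IsUnit u ∧ q ∈ D.B a ∧ x = u * q := by
  set ρ := max (D.M a a (x - 1)) (1 / 2) with hρ
  have hρ0 : 0 < ρ := lt_max_of_lt_right (by norm_num)
  have hρ1 : ρ < 1 := max_lt hx (by norm_num)
  set K := max (D.M a D.r (x - 1)) ρ with hK
  have hρK : ρ ≤ K := le_max_right _ _
  have hK0 : 0 < K := hρ0.trans_le hρK
  obtain ⟨f, hf⟩ := exists_seq_of_step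
    (P := fun k (S : D.T a × D.T a × D.T a) ↦ x = S.1 * (1 + S.2.1 + S.2.2) ∧ ‖S.1 - 1‖ ≤ ρ ∧
      ‖S.2.1‖ ≤ ρ ^ (k + 1) ∧ S.2.2 ∈ D.B a ∧ D.M a a S.2.2 ≤ ρ ∧ D.M a D.r S.2.2 ≤ K)
    (Q := fun k S S' ↦ ‖S'.1 - S.1‖ ≤ ρ ^ (k + 1) ∧ ‖S'.2.2 - S.2.2‖ ≤ max ρ K * ρ ^ (k + 1))
    (by
      obtain ⟨m, q, h1, h2, h3, h4, h5⟩ := D.exists_split hρ0 hρ1.le (le_max_left _ _ : _ ≤ ρ)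
      refine ⟨⟨1, m, q⟩, ?_, ?_, ?_, h3, h4, h5⟩
      · linear_combination h1
      · rw [sub_self, norm_zero]
        exact hρ0.le
      · rwa [zero_add, pow_one])
    (by
      rintro k ⟨u, m, q⟩ ⟨h1, h2, h3, h4, h5, h6⟩
      dsimp only at h1 h2 h3 h4 h5 h6
      have hk1 : ρ ^ (k + 1) ≤ ρ := pow_le_of_le_one hρ0.le hρ1.le (by omega)
      have hm : ‖(1 + m) - 1‖ ≤ ρ ^ (k + 1) := by rwa [add_sub_cancel_left]
      have hm1 : ρ ^ (k + 1) < 1 := hk1.trans_lt hρ1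
      obtain ⟨v, hv⟩ := (D.isUnit_of_norm_sub_one_lt (hm.trans_lt hm1)).exists_right_inv
      have hv1 := D.norm_inv_sub_one hv hm hm1
      have hz : D.M a a ((v - 1) * q) ≤ ρ ^ (k + 2) := by
        rw [D.M_mul le_rfl a.2.2, pow_succ]
        exact mul_le_mul ((D.M_a_le_norm _).trans hv1) h5 (D.M_nonneg le_rfl a.2.2 _)
          (pow_nonneg hρ0.le _)
      have hzr : D.M a D.r ((v - 1) * q) ≤ ρ ^ (k + 1) * K := by
        rw [D.M_mul a.2.2 le_rfl]
        exact mul_le_mul ((D.M_r_le_norm _).trans hv1) h6 (D.M_nonneg a.2.2 le_rfl _)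
          (pow_nonneg hρ0.le _)
      obtain ⟨m', q', g1, g2, g3, g4, g5⟩ := D.exists_split (pow_pos hρ0 (k + 2))
        (pow_le_one₀ hρ0.le hρ1.le) hz
      have hq'r : D.M a D.r q' ≤ ρ ^ (k + 1) * K := by
        refine g5.trans (max_le hzr ?_)
        rw [pow_succ]
        exact mul_le_mul_of_nonneg_left hρK (pow_nonneg hρ0.le _)
      refine ⟨⟨u * (1 + m), m', q + q'⟩, ⟨?_, ?_, g2, (D.B a).add_mem h4 g3, ?_, ?_⟩, ?_, ?_⟩
      · dsimp only
        linear_combination h1 + u * (1 + m) * g1 - u * q * hv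
      · exact D.norm_mul_sub_one h2 (hm.trans hk1) hρ1
      · refine (D.M_add_le le_rfl a.2.2 _ _).trans (max_le h5 (g4.trans ?_))
        exact pow_le_of_le_one hρ0.le hρ1.le (by omega)
      · refine (D.M_add_le a.2.2 le_rfl _ _).trans (max_le h6 (hq'r.trans ?_))
        exact mul_le_of_le_one_left hK0.le hm1.le
      · dsimp only
        rw [mul_add, mul_one, add_sub_cancel_left]
        refine (norm_mul_le _ _).trans ?_
        rw [D.norm_eq_one (h2.trans_lt hρ1), one_mul]
        exact h3
      · dsimp only
        rw [add_sub_cancel_left, norm_T, mul_comm]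
        refine max_le (g4.trans ?_) (hq'r.trans ?_)
        · rw [pow_succ]
          exact mul_le_mul_of_nonneg_left (le_max_left _ _) (pow_nonneg hρ0.le _)
        · exact mul_le_mul_of_nonneg_left (le_max_right _ _) (pow_nonneg hρ0.le _))
  have hcu : CauchySeq fun k ↦ (f k).1 := cauchySeq_of_le_geometric ρ ρ hρ1 fun n ↦ by
    rw [dist_comm, dist_eq_norm, ← pow_succ']
    exact (hf n).2.1
  have hcq : CauchySeq fun k ↦ (f k).2.2 :=
    cauchySeq_of_le_geometric ρ (max ρ K * ρ) hρ1 fun n ↦ by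
      rw [dist_comm, dist_eq_norm, mul_assoc, ← pow_succ']
      exact (hf n).2.2
  obtain ⟨u, hu⟩ := cauchySeq_tendsto_of_complete hcu
  obtain ⟨q, hq⟩ := cauchySeq_tendsto_of_complete hcq
  have hm : Tendsto (fun k ↦ (f k).2.1) atTop (𝓝 0) := by
    refine squeeze_zero_norm (fun k ↦ (hf k).1.2.2.1) ?_
    exact (tendsto_pow_atTop_nhds_zero_of_lt_one hρ0.le hρ1).comp (tendsto_add_atTop_nat 1)
  have hu1 : ‖u - 1‖ ≤ ρ :=
    le_of_tendsto (hu.sub_const 1).norm (Eventually.of_forall fun k ↦ (hf k).1.2.1)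
  refine ⟨u, 1 + q, D.isUnit_of_norm_sub_one_lt (hu1.trans_lt hρ1), (D.B a).add_mem
    (D.B a).one_mem (D.isClosed_B.mem_of_tendsto hq (Eventually.of_forall fun k ↦
      (hf k).1.2.2.2.1)), ?_⟩
  have h1 := hu.mul ((hm.const_add 1).add hq)
  rw [add_zero] at h1
  refine tendsto_nhds_unique ?_ h1
  exact tendsto_const_nhds.congr fun k ↦ (hf k).1.1

theorem exists_unit_mul_mem_B (hirr : Irrational a) {x : D.T a} (hx : D.M a a x ≠ 0) :
    ∃ u q, IsUnit u ∧ q ∈ D.B a ∧ x = u * q := by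
  obtain ⟨C, hC⟩ := D.exists_dominant hirr hx
  have h1 : D.toT a C * D.toT a ((C⁻¹ : Rˣ) : R) = 1 := by
    rw [← _root_.map_mul, Units.mul_inv, _root_.map_one]
  have hCx : D.N a (C : R) = D.M a a x := by
    rw [← D.M_toT le_rfl a.2.2, D.M_eq_of_sub_lt le_rfl a.2.2 hC]
  have hC0 := D.N_unit_pos a.2.1 a.2.2 C
  obtain ⟨u, q, hu, hq, h⟩ := D.exists_unit_mul_of_near_one (x := x * D.toT a ((C⁻¹ : Rˣ) : R)) (by
    have h2 : x * D.toT a ((C⁻¹ : Rˣ) : R) - 1 = (x - D.toT a C) * D.toT a ((C⁻¹ : Rˣ) : R) := by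
      rw [sub_mul, h1]
    rw [h2, D.M_mul le_rfl a.2.2, D.M_toT le_rfl a.2.2, D.N_inv a.2.1 a.2.2, ← div_eq_mul_inv,
      div_lt_one hC0, hCx]
    exact hC)
  refine ⟨D.toT a C * u, q, (IsUnit.of_mul_eq_one _ h1).mul hu, hq, ?_⟩
  linear_combination D.toT a C * h - x * h1

/-! ### The ring of functions without terms of negative index -/

theorem M_a_le_rpow {x : D.T a} (hx : x ∈ D.B a) : D.M a a x ≤ D.M a D.r x ^ ((a : ℝ) / D.r) := by
  have hexp : 0 ≤ (a : ℝ) / D.r := (div_pos a.2.1 (D.r_pos a)).le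
  have hc : IsClosed {x : D.T a | D.M a a x ≤ D.M a D.r x ^ ((a : ℝ) / D.r)} :=
    isClosed_le D.continuous_M ((Real.continuous_rpow_const hexp).comp D.continuous_M)
  refine hc.closure_subset_iff.2 ?_ hx
  rintro _ ⟨y, hy, rfl⟩
  rw [Set.mem_ofPred_eq, D.M_toT le_rfl a.2.2, D.M_toT a.2.2 le_rfl]
  exact D.norm_A y hy a a.2.1 a.2.2

theorem eq_zero_of_M {x : D.T a} (h1 : D.M a a x = 0) (h2 : D.M a D.r x = 0) : x = 0 := by
  rw [← norm_eq_zero, norm_T, h1, h2, max_self]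

variable (a) in
/-- The structure on the closure of `A` that makes it Bézout. -/
def euclideanNorm : EuclideanNorm (D.B a) where
  N x := D.M a D.r x
  nonneg x := D.M_nonneg a.2.2 le_rfl x
  map_zero := D.M_zero a.2.2 le_rfl
  map_mul x y := D.M_mul a.2.2 le_rfl x y
  add_le x y := D.M_add_le a.2.2 le_rfl x y
  neg x := D.M_neg a.2.2 le_rfl x
  eq_zero x h := by
    refine Subtype.ext (D.eq_zero_of_M (le_antisymm ?_ (D.M_nonneg le_rfl a.2.2 _)) h)
    have := D.M_a_le_rpow x.2
    rwa [h, Real.zero_rpow (div_pos a.2.1 (D.r_pos a)).ne'] at this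
  complete x hx := by
    have hexp : 0 < (a : ℝ) / D.r := div_pos a.2.1 (D.r_pos a)
    have hC : CauchySeq fun n ↦ (x n : D.T a) := by
      rw [Metric.cauchySeq_iff]
      intro ε hε
      obtain ⟨M, hM⟩ := hx (min (ε / 2) ((ε / 2) ^ ((a : ℝ) / D.r)⁻¹))
        (lt_min (half_pos hε) (Real.rpow_pos_of_pos (half_pos hε) _))
      refine ⟨M, fun m hm n hn ↦ ?_⟩
      rw [dist_eq_norm, norm_T]
      refine (max_le ?_ ?_).trans_lt (half_lt_self hε)
      · refine (D.M_a_le_rpow (x m - x n).2).trans ?_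
        refine (Real.rpow_le_rpow (D.M_nonneg a.2.2 le_rfl _)
          ((hM m hm n hn).trans (min_le_right _ _)) hexp.le).trans_eq ?_
        rw [← Real.rpow_mul (half_pos hε).le, inv_mul_cancel₀ hexp.ne', Real.rpow_one]
      · exact (hM m hm n hn).trans (min_le_left _ _)
    obtain ⟨y, hy⟩ := cauchySeq_tendsto_of_complete hC
    refine ⟨⟨y, D.isClosed_B.mem_of_tendsto hy (Eventually.of_forall fun n ↦ (x n).2)⟩, ?_⟩
    have h1 := (D.continuous_M (a := a) (s := D.r)).tendsto (y - y)
    rw [sub_self, D.M_zero a.2.2 le_rfl] at h1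
    have h2 := hy.sub_const y
    rw [sub_self] at h2
    exact h1.comp h2
  ϖ := ⟨D.toT a D.ϖ, D.toT_mem_B D.ϖ_mem⟩
  G := {x | ∃ g ∈ D.G, (x : D.T a) = D.toT a g}
  zero_mem := ⟨0, D.zero_mem, (_root_.map_zero _).symm⟩
  mul_mem := by
    rintro x ⟨g, hg, h⟩ y ⟨g', hg', h'⟩
    exact ⟨g * g', D.mul_mem g hg g' hg', by rw [Subring.coe_mul, h, h', _root_.map_mul]⟩
  inv_mem := by
    rintro x ⟨g, hg, h⟩ hx
    obtain ⟨g', hg', h'⟩ := D.inv_mem g hg (fun h0 ↦ hx (Subtype.ext (by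
      rw [h, h0, _root_.map_zero, Subring.coe_zero])))
    exact ⟨⟨D.toT a g', D.toT_mem_B (D.G_le hg')⟩, ⟨g', hg', rfl⟩, Subtype.ext (by
      rw [Subring.coe_mul, h, ← _root_.map_mul, h', _root_.map_one, Subring.coe_one])⟩
  exact' m c hc i hi := by
    choose g hg h using hc
    have h1 : ∀ i, ((⟨D.toT a D.ϖ, D.toT_mem_B D.ϖ_mem⟩ ^ i * c i : D.B a) : D.T a) =
        D.toT a (((D.ϖ ^ (i : ℤ) : Rˣ) : R) * g i) := fun i ↦ by
      rw [Subring.coe_mul, Subring.coe_pow, h i, zpow_natCast, Units.val_pow_eq_pow_val,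
        _root_.map_mul, _root_.map_pow]
    have h2 := D.exact' D.r (D.r_pos a) le_rfl ((Finset.range m).map Nat.castEmbedding)
      (fun i ↦ g i.toNat) (fun i ↦ hg _) i (Finset.mem_map.2 ⟨i, Finset.mem_range.2 hi, rfl⟩)
    rw [Finset.sum_map] at h2
    simp only [Nat.castEmbedding_apply, Int.toNat_natCast] at h2
    rw [← D.M_toT a.2.2 le_rfl, ← D.M_toT a.2.2 le_rfl, _root_.map_sum, ← h1] at h2
    simp only [← h1] at h2
    rw [AddSubmonoidClass.coe_finsetSum]
    exact h2
  θ := D.θ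
  θ_lt_one := D.θ_lt_one
  sub_mem := by
    rintro x ⟨g, hg, h⟩ y ⟨g', hg', h'⟩
    obtain ⟨z, hz, hz'⟩ := D.sub_mem g hg g' hg'
    refine ⟨⟨D.toT a z, D.toT_mem_B (D.G_le hz)⟩, ⟨z, hz, rfl⟩, ?_⟩
    rw [AddSubgroupClass.coe_sub, AddSubgroupClass.coe_sub, h, h', ← _root_.map_sub, ← _root_.map_sub,
      D.M_toT a.2.2 le_rfl, D.M_toT a.2.2 le_rfl, D.M_toT a.2.2 le_rfl]
    exact hz'
  dense x ε hε := by
    obtain ⟨_, ⟨y, hy, rfl⟩, hxy⟩ := Metric.mem_closure_iff.1 x.2 ε hε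
    obtain ⟨m, c, hc, h⟩ := D.denseA y hy ε hε
    refine ⟨m, fun i ↦ ⟨D.toT a (c i), D.toT_mem_B (D.G_le (hc i))⟩, fun i ↦ ⟨c i, hc i, rfl⟩, ?_⟩
    have h1 : (x : D.T a) - D.toT a (∑ i ∈ Finset.range m, (D.ϖ : R) ^ i * c i) =
        (x - D.toT a y) + D.toT a (y - ∑ i ∈ Finset.range m, (D.ϖ : R) ^ i * c i) := by
      rw [_root_.map_sub]
      ring
    have h2 : D.M a D.r ((x : D.T a) - D.toT a (∑ i ∈ Finset.range m, (D.ϖ : R) ^ i * c i)) ≤ ε := by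
      rw [h1]
      refine (D.M_add_le a.2.2 le_rfl _ _).trans (max_le ((D.M_r_le_norm _).trans ?_) ?_)
      · rw [← dist_eq_norm]
        exact hxy.le
      · rwa [D.M_toT a.2.2 le_rfl]
    simp only [_root_.map_sum, _root_.map_mul, _root_.map_pow] at h2
    rw [AddSubgroupClass.coe_sub, AddSubmonoidClass.coe_finsetSum]
    exact h2

theorem exists_generator (hirr : Irrational a) {x y : D.T a} (hx : D.M a a x ≠ 0)
    (hy : D.M a a y ≠ 0) : ∃ d p q α β, x = p * d ∧ y = q * d ∧ d = α * x + β * y := by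
  obtain ⟨u, x', ⟨u, rfl⟩, hx', rfl⟩ := D.exists_unit_mul_mem_B hirr hx
  obtain ⟨v, y', ⟨v, rfl⟩, hy', rfl⟩ := D.exists_unit_mul_mem_B hirr hy
  obtain ⟨d, hd⟩ := (D.euclideanNorm a).span_pair_isPrincipal ⟨x', hx'⟩ ⟨y', hy'⟩
  rw [Ideal.submodule_span_eq] at hd
  have h1 : (⟨x', hx'⟩ : D.B a) ∈ Ideal.span {d} := hd ▸ Ideal.subset_span (by simp)
  have h2 : (⟨y', hy'⟩ : D.B a) ∈ Ideal.span {d} := hd ▸ Ideal.subset_span (by simp)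
  have h3 : d ∈ Ideal.span {(⟨x', hx'⟩ : D.B a), ⟨y', hy'⟩} := by
    rw [hd]
    exact Ideal.mem_span_singleton_self d
  obtain ⟨p, hp⟩ := Ideal.mem_span_singleton'.1 h1
  obtain ⟨q, hq⟩ := Ideal.mem_span_singleton'.1 h2
  obtain ⟨α, β, hαβ⟩ := Ideal.mem_span_pair.1 h3
  have hp' : (p : D.T a) * d = x' := congrArg Subtype.val hp
  have hq' : (q : D.T a) * d = y' := congrArg Subtype.val hq
  have hαβ' : (α : D.T a) * x' + β * y' = d := congrArg Subtype.val hαβ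
  refine ⟨d, u * p, v * q, α * ((u⁻¹ : (D.T a)ˣ) : D.T a), β * ((v⁻¹ : (D.T a)ˣ) : D.T a), ?_, ?_, ?_⟩
  · linear_combination -u.1 * hp'
  · linear_combination -v.1 * hq'
  · linear_combination -hαβ' - α * x' * Units.inv_mul u - β * y' * Units.inv_mul v

end AnnulusRing

namespace AnnulusRing

variable {R : Type u} [CommRing R] (D : AnnulusRing R) {a a' a'' : D.Radius} {s : ℝ}

/-! ### Restriction to smaller annuli -/

variable (a a') in
/-- The identity of `R`. -/
def idAnn : D.Ann a' →+* D.Ann a := RingHom.id R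

theorem lipschitz_id (h : a' ≤ a) : LipschitzWith 1 (D.idAnn a a') := by
  refine LipschitzWith.mk_one fun x y ↦ ?_
  rw [dist_eq_norm, dist_eq_norm]
  exact max_le (D.convex a' a a'.2.1 h a.2.2 _) (le_max_right _ _)

/-- The restriction map between completions. -/
def res (h : a' ≤ a) : D.T a' →+* D.T a :=
  UniformSpace.Completion.mapRingHom (D.idAnn a a') (D.lipschitz_id h).continuous

theorem res_toT (h : a' ≤ a) (x : R) : D.res h (D.toT a' x) = D.toT a x :=
  UniformSpace.Completion.map_coe (D.lipschitz_id h).uniformContinuous x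

theorem continuous_res (h : a' ≤ a) : Continuous (D.res h) :=
  UniformSpace.Completion.continuous_map

theorem M_res (h : a' ≤ a) (h1 : a ≤ s) (h2 : s ≤ D.r) (x : D.T a') :
    D.M a s (D.res h x) = D.M a' s x :=
  (D.denseRange_toT a').induction_on (p := fun x ↦ D.M a s (D.res h x) = D.M a' s x) x
    (isClosed_eq (D.continuous_M.comp (D.continuous_res h)) D.continuous_M)
    fun x ↦ by rw [D.res_toT, D.M_toT h1 h2, D.M_toT (le_trans (Subtype.coe_le_coe.2 h) h1) h2]

theorem norm_res_le (h : a' ≤ a) (x : D.T a') : ‖D.res h x‖ ≤ ‖x‖ := by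
  rw [norm_T, D.M_res h le_rfl a.2.2, D.M_res h a.2.2 le_rfl]
  exact max_le (D.M_le_norm_of h a.2.2 x) (D.M_le_norm_of a'.2.2 le_rfl x)

theorem denseRange_res (h : a' ≤ a) : DenseRange (D.res h) := by
  refine (D.denseRange_toT a).mono ?_
  rintro _ ⟨x, rfl⟩
  exact ⟨D.toT a' x, D.res_toT h x⟩

/-- An element of `A` with constant term near one is a unit. -/
theorem isUnit_one_add {x : R} (hx : x ∈ D.A) (h : D.N D.r x < 1) (hr : 0 < D.r) :
    IsUnit (1 + x) := by
  have hs1 : ∀ s, 0 < s → s ≤ D.r → D.N s x < 1 := fun s hs hsr ↦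
    (D.norm_A x hx s hs hsr).trans_lt (Real.rpow_lt_one (D.nonneg _ _) h (div_pos hs hr))
  obtain ⟨y, hy⟩ := D.complete (fun n ↦ ∑ i ∈ Finset.range n, (-x) ^ i) (by
    intro s hs hsr ε hε
    obtain ⟨M, hM⟩ := exists_pow_lt_of_lt_one hε (hs1 s hs hsr)
    have key : ∀ m n : ℕ, M ≤ m → m ≤ n → D.N s (∑ i ∈ Finset.range n, (-x) ^ i -
        ∑ i ∈ Finset.range m, (-x) ^ i) ≤ ε := by
      intro m n hMm hmn
      rw [← Finset.sum_Ico_eq_sub _ hmn]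
      refine D.N_sum_le hs hsr _ _ hε.le fun i hi ↦ ?_
      rw [D.N_pow hs hsr, D.neg s hs hsr]
      exact (pow_le_pow_of_le_one (D.nonneg _ _) (hs1 s hs hsr).le
        (hMm.trans (Finset.mem_Ico.1 hi).1)).trans hM.le
    refine ⟨M, fun m hm n hn ↦ ?_⟩
    rcases le_total m n with h1 | h1
    · rw [← D.neg s hs hsr, neg_sub]
      exact key m n hm h1
    · exact key n m hn h1)
  refine IsUnit.of_mul_eq_one y (sub_eq_zero.1 (D.eq_zero D.r hr le_rfl _ ?_))
  refine le_antisymm (ge_of_tendsto' (f := fun n : ℕ ↦ D.N D.r (1 + x) *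
    D.N D.r (∑ i ∈ Finset.range n, (-x) ^ i - y) + D.N D.r x ^ n) (x := atTop) ?_ fun n ↦ ?_)
    (D.nonneg _ _)
  · have h1 := ((hy D.r hr le_rfl).const_mul (D.N D.r (1 + x))).add
      (tendsto_pow_atTop_nhds_zero_of_lt_one (D.nonneg _ _) h)
    rwa [mul_zero, add_zero] at h1
  · have h1 : (1 + x) * y - 1 = -((1 + x) * (∑ i ∈ Finset.range n, (-x) ^ i - y)) - (-x) ^ n := by
      have := mul_neg_geom_sum (-x) n
      linear_combination this
    rw [h1]
    refine (D.sub_le hr le_rfl _ _).trans (max_le ?_ ?_)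
    · rw [D.neg D.r hr le_rfl, D.map_mul D.r hr le_rfl]
      exact le_add_of_nonneg_right (pow_nonneg (D.nonneg _ _) _)
    · rw [D.N_pow hr le_rfl, D.neg D.r hr le_rfl]
      exact le_add_of_nonneg_left (mul_nonneg (D.nonneg _ _) (D.nonneg _ _))

/-- A term of negative index which is at most one on a small circle is small on larger circles. -/
theorem N_term_le_of_lt_one {c : R} (hc : c ∈ D.G) {i : ℤ} (hi : i < 0) {s t : ℝ} (hs : 0 < s)
    (hst : s ≤ t) (ht : t ≤ D.r) (h : D.N s (((D.ϖ ^ i : Rˣ) : R) * c) ≤ 1) :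
    D.N t (((D.ϖ ^ i : Rˣ) : R) * c) ≤ Real.exp (-(D.κ * (t / s - 1))) := by
  rcases eq_or_ne c 0 with rfl | h0
  · rw [mul_zero, D.map_zero t (hs.trans_le hst) ht]
    exact (Real.exp_pos _).le
  obtain ⟨l, hl⟩ := D.exists_N_term hc h0 i
  rw [hl t (hs.trans_le hst) ht, Real.exp_le_exp, neg_le_neg_iff]
  rw [hl s hs (hst.trans ht), Real.exp_le_one_iff, neg_nonpos] at h
  have hκ : (0 : ℝ) < D.κ := by exact_mod_cast D.κ_pos
  have hi' : (i : ℝ) ≤ -1 := by exact_mod_cast Int.le_sub_one_of_lt hi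
  have hts : 1 ≤ t / s := (one_le_div hs).2 hst
  have h1 : (D.κ : ℝ) * i + t * l = D.κ * (-i) * (t / s - 1) + t / s * (D.κ * i + s * l) := by
    field_simp
    ring
  rw [h1]
  have h2 : 0 ≤ t / s * (D.κ * i + s * l) := mul_nonneg (by linarith) h
  have h3 : D.κ * (t / s - 1) ≤ D.κ * (-i) * (t / s - 1) := by
    have : (D.κ : ℝ) * 1 ≤ D.κ * (-i) := mul_le_mul_of_nonneg_left (by linarith) hκ.le
    rw [mul_one] at this
    exact mul_le_mul_of_nonneg_right this (by linarith)
  linarith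

/-- If a finite sum with constant term one is bounded by one on both circles then, on smaller
annuli, it is close to its part without terms of negative index. -/
theorem N_negPart_le {F : Finset ℤ} {c : ℤ → R} (hc : ∀ j, c j ∈ D.G)
    (hlt : ∀ j ∈ F, j ≠ 0 → D.N a' (((D.ϖ ^ j : Rˣ) : R) * c j) < 1) {ε : ℝ} (hε : 0 < ε)
    (h : a' ≤ a) (hκ : Real.exp (-(D.κ * ((a : ℝ) / a' - 1))) ≤ ε) (hs : a ≤ s) (hsr : s ≤ D.r) :
    D.N s (D.laurentSum (F.filter (· < 0)) c) ≤ ε := by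
  have ha' := a'.2.1
  have has : (a' : ℝ) ≤ s := le_trans (Subtype.coe_le_coe.2 h) hs
  refine D.N_sum_le (a.2.1.trans_le hs) hsr _ _ hε.le fun i hi ↦ ?_
  obtain ⟨hi1, hi2⟩ := Finset.mem_filter.1 hi
  refine (D.N_term_le_of_lt_one (hc i) hi2 ha' has hsr (hlt i hi1 hi2.ne).le).trans
    (le_trans ?_ hκ)
  rw [Real.exp_le_exp, neg_le_neg_iff]
  have : (0 : ℝ) ≤ D.κ := by exact_mod_cast D.κ_pos.le
  exact mul_le_mul_of_nonneg_left (sub_le_sub_right (div_le_div_of_nonneg_right hs ha'.le) 1) this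

/-- Units on a large annulus are approximated on smaller annuli by units of `R`. -/
theorem exists_global_unit (hirr : Irrational a') (h : a' ≤ a) {ε : ℝ} (hε : 0 < ε) (hε1 : ε < 1)
    (hκ : Real.exp (-(D.κ * ((a : ℝ) / a' - 1))) ≤ ε) {u v : D.T a'} (huv : u * v = 1) :
    ∃ U : Rˣ, ‖D.res h u * D.toT a ((U⁻¹ : Rˣ) : R) - 1‖ ≤ ε := by
  have ha' := a'.2.1
  have ha := a.2.1
  have hr := D.r_pos a
  have huv' : D.M a' a' u * D.M a' a' v = 1 := by
    rw [← D.M_mul le_rfl a'.2.2, huv, D.M_one le_rfl a'.2.2]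
  have hu0 : D.M a' a' u ≠ 0 := left_ne_zero_of_mul_eq_one huv'
  have hv0 : D.M a' a' v ≠ 0 := right_ne_zero_of_mul_eq_one huv'
  have hδ : 0 < ε / (‖u‖ + ‖v‖ + 1) := by positivity
  have key : ∀ u v : D.T a', u * v = 1 → ∀ y : D.T a', ‖v‖ ≤ ‖u‖ + ‖v‖ →
      ∀ C, 0 ≤ C → ‖v‖ ≤ C → ‖u - y‖ ≤ ε / (C + 1) → ‖v * y - 1‖ ≤ ε := by
    intro u v huv y _ C hC hv hy
    have h1 : v * y - 1 = -(v * (u - y)) := by linear_combination huv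
    rw [h1, norm_neg]
    refine (norm_mul_le _ _).trans ((mul_le_mul hv hy (norm_nonneg _) hC).trans ?_)
    rw [mul_div_assoc', div_le_iff₀ (by positivity)]
    nlinarith
  obtain ⟨i, g, C, F, c, hg, hCg, hc, h0, hc0, hlt, hxC, hC⟩ := D.exists_dominant_sum hirr hu0 hδ
  obtain ⟨i', g', C', F', c', hg', hCg', hc', h0', hc0', hlt', hxC', hC'⟩ :=
    D.exists_dominant_sum hirr hv0 hδ
  have hη := key u v huv _ (le_add_of_nonneg_left (norm_nonneg _)) (‖u‖ + ‖v‖) (by positivity)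
    (le_add_of_nonneg_left (norm_nonneg _)) hxC
  have hη' := key v u (by rw [mul_comm, huv]) _ (le_add_of_nonneg_left (norm_nonneg _))
    (‖u‖ + ‖v‖) (by positivity) (le_add_of_nonneg_right (norm_nonneg _)) hxC'
  set S := D.laurentSum F c with hS
  set S' := D.laurentSum F' c' with hS'
  -- the product of the leading terms is one on all circles
  have hprod : ‖D.toT a' ((C * S) * (C' * S')) - 1‖ ≤ ε := by
    have h1 := D.norm_mul_sub_one hη hη' hε1
    have h2 : v * D.toT a' (C * S) * (u * D.toT a' (C' * S')) = D.toT a' ((C * S) * (C' * S')) := by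
      rw [_root_.map_mul (D.toT a') (C * S) (C' * S')]
      linear_combination D.toT a' (C * S) * D.toT a' (C' * S') * huv
    rwa [h2] at h1
  have hge : ∀ s, 0 < s → s ≤ D.r → 1 ≤ D.N s S := fun s hs hsr ↦ by
    have := D.exact' s hs hsr F c hc 0 h0
    rwa [hc0, zpow_zero, Units.val_one, one_mul, D.map_one s hs hsr] at this
  have hge' : ∀ s, 0 < s → s ≤ D.r → 1 ≤ D.N s S' := fun s hs hsr ↦ by
    have := D.exact' s hs hsr F' c' hc' 0 h0'
    rwa [hc0', zpow_zero, Units.val_one, one_mul, D.map_one s hs hsr] at this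
  set G := ((D.ϖ ^ (i + i') : Rˣ) : R) * (g * g') with hG
  have hGC : G = C * C' := by
    rw [hG, hCg, hCg', zpow_add, Units.val_mul]
    ring
  have hGG : g * g' ∈ D.G := D.mul_mem _ hg _ hg'
  have hga : D.N a' G = 1 := by
    rw [hGC, D.map_mul a' ha' a'.2.2, hC, hC', huv']
  have hR : Nontrivial R := by
    refine nontrivial_of_ne (1 : R) 0 fun h ↦ ?_
    have := D.map_one D.r hr le_rfl
    rw [h, D.map_zero D.r hr le_rfl] at this
    exact zero_ne_one this
  have hgg0 : g * g' ≠ 0 := fun h ↦ by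
    rw [hG, h, mul_zero, D.map_zero a' ha' a'.2.2] at hga
    exact zero_ne_one hga
  obtain ⟨hi0, hgr⟩ := D.eq_of_N_term_eq hirr hGG hgg0 D.one_mem one_ne_zero
    (i := i + i') (j := 0) (by
      rw [← hG, hga, zpow_zero, Units.val_one, one_mul, D.map_one a' ha' a'.2.2])
  have hGA : G ∈ D.A := by
    rw [hG, hi0, zpow_zero, Units.val_one, one_mul]
    exact D.G_le hGG
  have hGr : D.N D.r G = 1 := by
    rw [hG, hi0, zpow_zero, Units.val_one, one_mul, hgr _ hr le_rfl, D.map_one D.r hr le_rfl]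
  have hprod' : D.N D.r (G * (S * S') - 1) ≤ ε := by
    have h1 := (D.M_r_le_norm _).trans hprod
    rw [← _root_.map_one (D.toT a'), ← _root_.map_sub, D.M_toT a'.2.2 le_rfl] at h1
    rwa [hGC, mul_mul_mul_comm]
  have hSS : D.N D.r S * D.N D.r S' = 1 := by
    have h1 : D.M a' D.r (D.toT a' (G * (S * S')) - 1) < 1 := by
      rw [← _root_.map_one (D.toT a'), ← _root_.map_sub, D.M_toT a'.2.2 le_rfl]
      exact hprod'.trans_lt hε1
    have h2 := D.M_eq_one a'.2.2 le_rfl h1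
    rwa [D.M_toT a'.2.2 le_rfl, D.map_mul D.r hr le_rfl, hGr, one_mul, D.map_mul D.r hr le_rfl]
      at h2
  have hSr : D.N D.r S ≤ 1 := by
    have := hge' D.r hr le_rfl
    nlinarith [D.nonneg D.r S]
  have hSr' : D.N D.r S' ≤ 1 := by
    have := hge D.r hr le_rfl
    nlinarith [D.nonneg D.r S']
  set P := D.laurentSum (F.filter (¬ · < 0)) c with hP
  set P' := D.laurentSum (F'.filter (¬ · < 0)) c' with hP'
  set Q := D.laurentSum (F.filter (· < 0)) c with hQ
  set Q' := D.laurentSum (F'.filter (· < 0)) c' with hQ'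
  have hSP : S = Q + P := D.laurentSum_split F c
  have hSP' : S' = Q' + P' := D.laurentSum_split F' c'
  have hPA : P ∈ D.A := D.laurentSum_mem_A hc fun i hi ↦ not_lt.1 (Finset.mem_filter.1 hi).2
  have hPA' : P' ∈ D.A := D.laurentSum_mem_A hc' fun i hi ↦ not_lt.1 (Finset.mem_filter.1 hi).2
  have hQr : D.N D.r Q ≤ ε := D.N_negPart_le hc hlt hε h hκ a.2.2 le_rfl
  have hQr' : D.N D.r Q' ≤ ε := D.N_negPart_le hc' hlt' hε h hκ a.2.2 le_rfl
  have hPr : D.N D.r P ≤ 1 :=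
    (D.N_laurentSum_le_of_subset hr le_rfl hc (Finset.filter_subset _ _)).trans hSr
  have hunit : IsUnit (1 + (G * (P * P') - 1)) := by
    refine D.isUnit_one_add (D.A.sub_mem (D.A.mul_mem hGA (D.A.mul_mem hPA hPA')) D.A.one_mem)
      (lt_of_le_of_lt ?_ hε1) hr
    have h1 : G * (P * P') - 1 = (G * (S * S') - 1) - G * (Q * S' + P * Q') := by
      rw [hSP, hSP']
      ring
    rw [h1]
    refine (D.sub_le hr le_rfl _ _).trans (max_le hprod' ?_)
    rw [D.map_mul D.r hr le_rfl, hGr, one_mul]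
    refine (D.add_le D.r hr le_rfl _ _).trans (max_le ?_ ?_)
    · rw [D.map_mul D.r hr le_rfl]
      exact (mul_le_mul hQr hSr' (D.nonneg _ _) hε.le).trans_eq (mul_one _)
    · rw [D.map_mul D.r hr le_rfl]
      exact (mul_le_mul hPr hQr' (D.nonneg _ _) zero_le_one).trans_eq (one_mul _)
  rw [add_sub_cancel, mul_comm G, mul_assoc] at hunit
  obtain ⟨W, hW⟩ := isUnit_of_mul_isUnit_left hunit
  refine ⟨C * W, ?_⟩
  have hge1 : ∀ s, 0 < s → s ≤ D.r → 1 ≤ D.N s (W : R) := fun s hs hsr ↦ by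
    have := D.exact' s hs hsr (F.filter (¬ · < 0)) c hc 0 (Finset.mem_filter.2 ⟨h0, lt_irrefl 0⟩)
    rw [hc0, zpow_zero, Units.val_one, one_mul, D.map_one s hs hsr] at this
    rw [hW]
    exact this
  have hQW : ∀ s : ℝ, a ≤ s → s ≤ D.r → D.N s (Q * ((W⁻¹ : Rˣ) : R)) ≤ ε := fun s hs hsr ↦ by
    have hs0 := ha.trans_le hs
    rw [D.map_mul s hs0 hsr, D.N_inv hs0 hsr]
    exact (mul_le_mul (D.N_negPart_le hc hlt hε h hκ hs hsr) (inv_le_one_of_one_le₀ (hge1 s hs0 hsr))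
      (inv_nonneg.2 (D.nonneg _ _)) hε.le).trans_eq (mul_one _)
  have hfac1 : ‖D.toT a (S * ((W⁻¹ : Rˣ) : R)) - 1‖ ≤ ε := by
    have h1 : S * ((W⁻¹ : Rˣ) : R) - 1 = Q * ((W⁻¹ : Rˣ) : R) := by
      rw [hSP, ← hW]
      linear_combination W.mul_inv
    rw [← _root_.map_one (D.toT a), ← _root_.map_sub, h1, D.norm_toT]
    exact max_le (hQW a le_rfl a.2.2) (hQW D.r a.2.2 le_rfl)
  have hηu : ‖D.res h v * D.toT a (C * S) - 1‖ ≤ ε := by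
    rw [← D.res_toT h, ← _root_.map_mul, ← _root_.map_one (D.res h), ← _root_.map_sub]
    exact (D.norm_res_le h _).trans hη
  obtain ⟨w, hw⟩ := (D.isUnit_of_norm_sub_one_lt (hηu.trans_lt hε1)).exists_right_inv
  have hw1 := D.norm_inv_sub_one hw hηu hε1
  have hfin := D.norm_mul_sub_one hfac1 hw1 hε1
  convert hfin using 2
  have h2 : D.res h u * D.res h v = 1 := by rw [← _root_.map_mul, huv, _root_.map_one]
  have h3 : D.toT a C * D.toT a ((C⁻¹ : Rˣ) : R) = 1 := by
    rw [← _root_.map_mul, Units.mul_inv, _root_.map_one]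
  rw [mul_inv_rev, Units.val_mul, _root_.map_mul, _root_.map_mul]
  rw [_root_.map_mul] at hw
  linear_combination (-D.res h u * D.toT a ((W⁻¹ : Rˣ) : R) * D.toT a ((C⁻¹ : Rˣ) : R)) * hw +
    (D.toT a ((W⁻¹ : Rˣ) : R) * D.toT a ((C⁻¹ : Rˣ) : R) * D.toT a C * D.toT a S * w) * h2 +
    (D.toT a ((W⁻¹ : Rˣ) : R) * D.toT a S * w) * h3

end AnnulusRing

/-- A sequence that is almost compatible with transition maps is close to a compatible one. -/
theorem exists_compatible_near {X : ℕ → Type*} [∀ n, MetricSpace (X n)] [∀ n, CompleteSpace (X n)]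
    (Φ : ∀ n, X (n + 1) → X n) (hΦ : ∀ n, LipschitzWith 1 (Φ n)) (x : ∀ n, X n)
    (hx : ∀ n, dist (Φ n (x (n + 1))) (x n) ≤ (1 / 4) ^ (n + 1)) :
    ∃ w : ∀ n, X n, (∀ n, Φ n (w (n + 1)) = w n) ∧ ∀ n, dist (w n) (x n) < 1 := by
  let y : ℕ → ∀ n, X n := fun m ↦ Nat.rec x (fun _ Y n ↦ Φ n (Y (n + 1))) m
  have hstep : ∀ m n, dist (y (m + 1) n) (y m n) ≤ (1 / 4) ^ (n + m + 1) := by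
    intro m
    induction m with
    | zero => exact hx
    | succ m ih =>
      intro n
      refine ((hΦ n).dist_le_mul _ _).trans ?_
      rw [NNReal.coe_one, one_mul]
      refine (ih (n + 1)).trans_eq ?_
      ring_nf
  have hgeo : ∀ n m, dist (y m n) (y (m + 1) n) ≤ (1 / 4 : ℝ) ^ (n + 1) * (1 / 4) ^ m := by
    intro n m
    rw [dist_comm]
    refine (hstep m n).trans_eq ?_
    ring
  have hcau : ∀ n, CauchySeq fun m ↦ y m n := fun n ↦
    cauchySeq_of_le_geometric (1 / 4) ((1 / 4) ^ (n + 1)) (by norm_num) (hgeo n)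
  choose w hw using fun n ↦ cauchySeq_tendsto_of_complete (hcau n)
  refine ⟨w, fun n ↦ ?_, fun n ↦ ?_⟩
  · refine tendsto_nhds_unique (((hΦ n).continuous.tendsto _).comp (hw (n + 1))) ?_
    exact (hw n).comp (tendsto_add_atTop_nat 1)
  · have h1 := dist_le_of_le_geometric_of_tendsto₀ (1 / 4) ((1 / 4) ^ (n + 1)) (by norm_num)
      (hgeo n) (hw n)
    rw [dist_comm]
    refine lt_of_le_of_lt h1 ?_
    have h2 : (1 / 4 : ℝ) ^ (n + 1) ≤ 1 / 4 := pow_le_of_le_one (by norm_num) (by norm_num) (by simp)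
    rw [div_lt_one (by norm_num)]
    linarith

theorem exists_compatible_of_denseRange {X : ℕ → Type*} [∀ n, MetricSpace (X n)]
    [∀ n, CompleteSpace (X n)] (Φ : ∀ n, X (n + 1) → X n) (hΦ : ∀ n, LipschitzWith 1 (Φ n))
    (hd : ∀ n, DenseRange (Φ n)) (x₀ : X 0) : ∃ w : ∀ n, X n, ∀ n, Φ n (w (n + 1)) = w n := by
  have h : ∀ n (x : X n), ∃ y, dist (Φ n y) x ≤ (1 / 4 : ℝ) ^ (n + 1) := fun n x ↦ by
    obtain ⟨y, hy⟩ := (hd n).exists_dist_lt x (ε := (1 / 4 : ℝ) ^ (n + 1)) (by positivity)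
    exact ⟨y, by rw [dist_comm]; exact hy.le⟩
  choose g hg using h
  obtain ⟨w, hw, -⟩ := exists_compatible_near Φ hΦ
    (fun n ↦ Nat.rec (motive := fun n ↦ X n) x₀ (fun n z ↦ g n z) n) fun n ↦ hg n _
  exact ⟨w, hw⟩

namespace AnnulusRing

variable {R : Type u} [CommRing R] (D : AnnulusRing R) {s : ℝ}

theorem lipschitz_res {a a' : D.Radius} (h : a' ≤ a) : LipschitzWith 1 (D.res h) :=
  LipschitzWith.mk_one fun x y ↦ by
    rw [dist_eq_norm, dist_eq_norm, ← _root_.map_sub]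
    exact D.norm_res_le h _

theorem res_res {a a' a'' : D.Radius} (h : a' ≤ a) (h' : a'' ≤ a') (x : D.T a'') :
    D.res h (D.res h' x) = D.res (h'.trans h) x :=
  (D.denseRange_toT a'').induction_on (p := fun x ↦ D.res h (D.res h' x) = D.res (h'.trans h) x) x
    (isClosed_eq ((D.continuous_res h).comp (D.continuous_res h')) (D.continuous_res _))
    fun x ↦ by rw [D.res_toT, D.res_toT, D.res_toT]

theorem res_refl {a : D.Radius} (x : D.T a) : D.res le_rfl x = x :=
  (D.denseRange_toT a).induction_on (p := fun x ↦ D.res le_rfl x = x) x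
    (isClosed_eq (D.continuous_res _) continuous_id) fun x ↦ D.res_toT _ x

theorem toT_injective (a : D.Radius) : Function.Injective (D.toT a) := by
  rw [injective_iff_map_eq_zero]
  intro x hx
  refine D.eq_zero a a.2.1 a.2.2 x ?_
  rw [← D.M_toT le_rfl a.2.2, hx, D.M_zero le_rfl a.2.2]

theorem mul_left_cancel_of_M {a : D.Radius} {x y z : D.T a} (h1 : D.M a a x ≠ 0)
    (h2 : D.M a D.r x ≠ 0) (h : x * y = x * z) : y = z := by
  rw [← sub_eq_zero]
  have h3 : x * (y - z) = 0 := by rw [mul_sub, h, sub_self]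
  refine D.eq_zero_of_M ?_ ?_
  · have := D.M_mul le_rfl a.2.2 x (y - z)
    rw [h3, D.M_zero le_rfl a.2.2] at this
    exact (mul_eq_zero.1 this.symm).resolve_left h1
  · have := D.M_mul a.2.2 le_rfl x (y - z)
    rw [h3, D.M_zero a.2.2 le_rfl] at this
    exact (mul_eq_zero.1 this.symm).resolve_left h2

variable {a : ℕ → D.Radius} (ha : ∀ n, a (n + 1) ≤ a n)

/-- Compatible families come from elements of `R`. -/
theorem exists_of_compatible (hlim : ∀ s > 0, ∃ n, (a n : ℝ) ≤ s)
    (E : ∀ n, D.T (a n)) (hE : ∀ n, D.res (ha n) (E (n + 1)) = E n) :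
    ∃ x : R, ∀ n, D.toT (a n) x = E n := by
  have hanti : Antitone a := antitone_nat_of_succ_le ha
  have hE' : ∀ k m (h : k ≤ m), D.res (hanti h) (E m) = E k := by
    intro k m h
    induction m, h using Nat.le_induction with
    | base => exact D.res_refl _
    | succ m h ih =>
      rw [← ih, ← hE m, D.res_res]
  have happ : ∀ n, ∃ x : R, ‖D.toT (a n) x - E n‖ ≤ (1 / 2 : ℝ) ^ n := fun n ↦ by
    obtain ⟨x, hx⟩ := (D.denseRange_toT (a n)).exists_dist_lt (E n) (ε := (1 / 2 : ℝ) ^ n)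
      (by positivity)
    refine ⟨x, ?_⟩
    rw [← dist_eq_norm, dist_comm]
    exact hx.le
  choose x hx using happ
  have key : ∀ k m, k ≤ m → ∀ s : ℝ, a k ≤ s → s ≤ D.r →
      D.M (a k) s (D.toT (a k) (x m) - E k) ≤ (1 / 2) ^ m := by
    intro k m h s h1 h2
    rw [← hE' k m h, ← D.res_toT (hanti h), ← _root_.map_sub, D.M_res _ h1 h2]
    exact (D.M_le_norm_of (le_trans (Subtype.coe_le_coe.2 (hanti h)) h1) h2 _).trans (hx m)
  have hhalf : Tendsto (fun n : ℕ ↦ (1 / 2 : ℝ) ^ n) atTop (𝓝 0) :=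
    tendsto_pow_atTop_nhds_zero_of_lt_one (by norm_num) (by norm_num)
  obtain ⟨y, hy⟩ := D.complete x (by
    intro s hs hsr ε hε
    obtain ⟨k, hk⟩ := hlim s hs
    obtain ⟨M, hM⟩ := exists_pow_lt_of_lt_one hε (show (1 / 2 : ℝ) < 1 by norm_num)
    have hb : ∀ m ≥ max k M, D.M (a k) s (D.toT (a k) (x m) - E k) ≤ ε := fun m hm ↦
      (key k m ((le_max_left _ _).trans hm) s hk hsr).trans
        ((pow_le_pow_of_le_one (by norm_num) (by norm_num)
          ((le_max_right _ _).trans hm)).trans hM.le)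
    refine ⟨max k M, fun m hm n hn ↦ ?_⟩
    rw [← D.M_toT hk hsr, _root_.map_sub,
      ← sub_sub_sub_cancel_right _ _ (E k)]
    exact (D.M_sub_le hk hsr _ _).trans (max_le (hb m hm) (hb n hn)))
  refine ⟨y, fun k ↦ sub_eq_zero.1 ?_⟩
  have hz : ∀ s : ℝ, a k ≤ s → s ≤ D.r → D.M (a k) s (D.toT (a k) y - E k) = 0 := by
    intro s h1 h2
    refine le_antisymm ?_ (D.M_nonneg h1 h2 _)
    have h3 := (hy s ((a k).2.1.trans_le h1) h2).max hhalf
    rw [max_self] at h3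
    refine ge_of_tendsto h3 ((eventually_ge_atTop k).mono fun m hm ↦ ?_)
    have h4 : D.toT (a k) y - E k = (D.toT (a k) (x m) - E k) - D.toT (a k) (x m - y) := by
      rw [_root_.map_sub]
      ring
    rw [h4]
    refine (D.M_sub_le h1 h2 _ _).trans ?_
    rw [D.M_toT h1 h2, max_comm]
    exact max_le_max le_rfl (key k m hm s h1 h2)
  exact D.eq_zero_of_M (hz _ le_rfl (a k).2.2) (hz _ (a k).2.2 le_rfl)

theorem exists_compatible_unit (v : ∀ n, D.T (a n)) (hv : ∀ n, ‖v n - 1‖ ≤ (1 / 4) ^ (n + 1)) :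
    ∃ w : ∀ n, D.T (a n), (∀ n, IsUnit (w n)) ∧ ∀ n, v n * D.res (ha n) (w (n + 1)) = w n := by
  have hv1 : ∀ n, ‖v n‖ = 1 := fun n ↦ D.norm_eq_one ((hv n).trans_lt
    (pow_lt_one₀ (by norm_num) (by norm_num) (by simp)))
  obtain ⟨w, hw, hd⟩ := exists_compatible_near (X := fun n ↦ D.T (a n))
    (fun n y ↦ v n * D.res (ha n) y) (fun n ↦ LipschitzWith.mk_one fun x y ↦ by
      rw [dist_eq_norm, dist_eq_norm, ← mul_sub, ← _root_.map_sub]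
      refine (norm_mul_le _ _).trans ?_
      rw [hv1, one_mul]
      exact D.norm_res_le _ _) (fun n ↦ 1) (fun n ↦ by
      rw [_root_.map_one, mul_one, dist_eq_norm]
      exact hv n)
  refine ⟨w, fun n ↦ D.isUnit_of_norm_sub_one_lt ?_, hw⟩
  rw [← dist_eq_norm]
  exact hd n

/-- If `p` and `q` generate the unit ideal on all annuli then they do so in `R`. -/
theorem exists_bezout_of_local (ha : ∀ n, a (n + 1) ≤ a n) (hlim : ∀ s > 0, ∃ n, (a n : ℝ) ≤ s) (p q : R)
    (h : ∀ n, ∃ α β : D.T (a n), α * D.toT (a n) p + β * D.toT (a n) q = 1) :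
    ∃ α β : R, α * p + β * q = 1 := by
  let X : ℕ → Type u := fun n ↦
    {z : D.T (a n) × D.T (a n) // z.1 * D.toT (a n) p + z.2 * D.toT (a n) q = 1}
  have hcl : ∀ n, IsClosed {z : D.T (a n) × D.T (a n) |
      z.1 * D.toT (a n) p + z.2 * D.toT (a n) q = 1} := fun n ↦
    isClosed_eq ((continuous_fst.mul continuous_const).add (continuous_snd.mul continuous_const))
      continuous_const
  let _ : ∀ n, CompleteSpace (X n) := fun n ↦ (hcl n).completeSpace_coe
  let Φ : ∀ n, X (n + 1) → X n := fun n z ↦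
    ⟨(D.res (ha n) z.1.1, D.res (ha n) z.1.2), by
      have := congrArg (D.res (ha n)) z.2
      rwa [_root_.map_add, _root_.map_mul, _root_.map_mul, D.res_toT, D.res_toT,
        _root_.map_one] at this⟩
  obtain ⟨α₀, β₀, h₀⟩ := h 0
  obtain ⟨w, hw⟩ := exists_compatible_of_denseRange Φ (fun n ↦ LipschitzWith.mk_one fun x y ↦
      max_le_max (((D.lipschitz_res (ha n)).dist_le_mul _ _).trans_eq (one_mul _))
        (((D.lipschitz_res (ha n)).dist_le_mul _ _).trans_eq (one_mul _))) (fun n ↦ by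
      rw [Metric.denseRange_iff]
      rintro ⟨⟨z₁, z₂⟩, hz⟩ ε hε
      dsimp only at hz
      obtain ⟨α, β, hαβ⟩ := h (n + 1)
      have hαβ' := congrArg (D.res (ha n)) hαβ
      rw [_root_.map_add, _root_.map_mul, _root_.map_mul, D.res_toT, D.res_toT,
        _root_.map_one] at hαβ'
      set c := (z₁ - D.res (ha n) α) * D.res (ha n) β - (z₂ - D.res (ha n) β) * D.res (ha n) α
        with hc
      set P := D.toT (a n) p with hP
      set Q := D.toT (a n) q with hQ
      have hK : 0 < ‖P‖ + ‖Q‖ + 1 := by positivity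
      obtain ⟨c', hc'⟩ := (D.denseRange_res (ha n)).exists_dist_lt c (div_pos hε hK)
      refine ⟨⟨(α + c' * D.toT (a (n + 1)) q, β - c' * D.toT (a (n + 1)) p), ?_⟩, ?_⟩
      · dsimp only
        linear_combination hαβ
      have hsmall : ∀ b : D.T (a n), ‖b‖ ≤ ‖P‖ + ‖Q‖ → ‖(c - D.res (ha n) c') * b‖ < ε := by
        intro b hb
        refine (norm_mul_le _ _).trans_lt ?_
        rw [← dist_eq_norm]
        calc _ ≤ ε / (‖P‖ + ‖Q‖ + 1) * ‖b‖ := mul_le_mul_of_nonneg_right hc'.le (norm_nonneg _)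
          _ < ε / (‖P‖ + ‖Q‖ + 1) * (‖P‖ + ‖Q‖ + 1) :=
            mul_lt_mul_of_pos_left (by linarith) (div_pos hε hK)
          _ = ε := div_mul_cancel₀ _ hK.ne'
      refine max_lt ?_ ?_
      · change dist z₁ (D.res (ha n) (α + c' * D.toT (a (n + 1)) q)) < ε
        have h1 : z₁ - D.res (ha n) (α + c' * D.toT (a (n + 1)) q) =
            (c - D.res (ha n) c') * Q := by
          rw [_root_.map_add, _root_.map_mul, D.res_toT, ← hQ]
          linear_combination (-z₁) * hαβ' + D.res (ha n) α * hz
        rw [dist_eq_norm, h1]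
        exact hsmall Q (le_add_of_nonneg_left (norm_nonneg _))
      · change dist z₂ (D.res (ha n) (β - c' * D.toT (a (n + 1)) p)) < ε
        have h1 : D.res (ha n) (β - c' * D.toT (a (n + 1)) p) - z₂ =
            (c - D.res (ha n) c') * P := by
          rw [_root_.map_sub, _root_.map_mul, D.res_toT, ← hP]
          linear_combination z₂ * hαβ' - D.res (ha n) β * hz
        rw [dist_comm, dist_eq_norm, h1]
        exact hsmall P (le_add_of_nonneg_right (norm_nonneg _))) ⟨(α₀, β₀), h₀⟩
  obtain ⟨α, hα⟩ := D.exists_of_compatible ha hlim (fun n ↦ (w n).1.1)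
    fun n ↦ congrArg (fun z : X n ↦ z.1.1) (hw n)
  obtain ⟨β, hβ⟩ := D.exists_of_compatible ha hlim (fun n ↦ (w n).1.2)
    fun n ↦ congrArg (fun z : X n ↦ z.1.2) (hw n)
  refine ⟨α, β, D.toT_injective (a 0) ?_⟩
  rw [_root_.map_add, _root_.map_mul, _root_.map_mul, hα, hβ, _root_.map_one]
  exact (w 0).2

/-- There is a sequence of irrational radii that decreases quickly. -/
theorem exists_radii (hr : 0 < D.r) : ∃ a : ℕ → D.Radius, (∀ n, Irrational (a n)) ∧
    (∀ n, a (n + 1) ≤ a n) ∧ (∀ s > 0, ∃ n, (a n : ℝ) ≤ s) ∧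
    ∀ n, Real.exp (-(D.κ * ((a n : ℝ) / a (n + 1) - 1))) ≤ (1 / 4) ^ (n + 1) := by
  have hκ : (0 : ℝ) < D.κ := by exact_mod_cast D.κ_pos
  obtain ⟨a, ha⟩ := exists_seq_of_step
    (P := fun n (a : D.Radius) ↦ Irrational a ∧ (a : ℝ) ≤ D.r * (1 / 2) ^ n)
    (Q := fun n a b ↦ b ≤ a ∧ Real.exp (-(D.κ * ((a : ℝ) / b - 1))) ≤ (1 / 4) ^ (n + 1))
    (by
      obtain ⟨x, hx, h0, h1⟩ := exists_irrational_btwn hr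
      exact ⟨⟨x, h0, h1.le⟩, hx, by simpa using h1.le⟩)
    (by
      rintro n a ⟨-, hle⟩
      have ha := a.2.1
      set L := -Real.log ((1 / 4) ^ (n + 1)) with hL
      have hL0 : 0 ≤ L := by
        rw [hL, Left.nonneg_neg_iff]
        exact Real.log_nonpos (by positivity) (pow_le_one₀ (by norm_num) (by norm_num))
      have hq : 0 < 1 + L / D.κ := by positivity
      obtain ⟨x, hx, h0, h1⟩ := exists_irrational_btwn
        (lt_min (half_pos ha) (div_pos ha hq) : (0 : ℝ) < min ((a : ℝ) / 2) (a / (1 + L / D.κ)))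
      have h2 := h1.trans_le (min_le_left _ _)
      have h3 := h1.trans_le (min_le_right _ _)
      have hxa : x ≤ a := by linarith
      refine ⟨⟨x, h0, hxa.trans a.2.2⟩, ⟨hx, ?_⟩, hxa, ?_⟩
      · refine h2.le.trans ?_
        rw [pow_succ]
        linarith
      · dsimp only
        rw [← Real.exp_log (show (0 : ℝ) < (1 / 4) ^ (n + 1) by positivity), Real.exp_le_exp,
          neg_le, ← hL]
        rw [lt_div_iff₀ hq] at h3
        have h4 : 1 + L / D.κ ≤ a / x := by
          rw [le_div_iff₀ h0]
          linarith
        calc L = D.κ * (L / D.κ) := by field_simp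
          _ ≤ D.κ * (a / x - 1) := mul_le_mul_of_nonneg_left (by linarith) hκ.le)
  refine ⟨a, fun n ↦ (ha n).1.1, fun n ↦ (ha n).2.1, fun s hs ↦ ?_, fun n ↦ (ha n).2.2⟩
  obtain ⟨n, hn⟩ := exists_pow_lt_of_lt_one (div_pos hs hr) (show (1 / 2 : ℝ) < 1 by norm_num)
  refine ⟨n, (ha n).1.2.trans ?_⟩
  rw [lt_div_iff₀ hr] at hn
  linarith

theorem span_pair_isPrincipal_of_ne_zero (hr : 0 < D.r) {f g : R} (hf : f ≠ 0) (hg : g ≠ 0) :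
    (Ideal.span {f, g}).IsPrincipal := by
  obtain ⟨a, hirr, ha, hlim, hκ⟩ := D.exists_radii hr
  have hN : ∀ x : R, x ≠ 0 → ∀ n (s : ℝ), a n ≤ s → s ≤ D.r → D.M (a n) s (D.toT (a n) x) ≠ 0 :=
    fun x hx n s h1 h2 h ↦ hx (D.eq_zero s ((a n).2.1.trans_le h1) h2 x
      (by rwa [D.M_toT h1 h2] at h))
  choose d p q α β hp hq hd using fun n ↦ D.exists_generator (hirr n) (hN f hf n _ le_rfl (a n).2.2)
    (hN g hg n _ le_rfl (a n).2.2)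
  have hreg : ∀ n (x y z : D.T (a n)), (∃ t, D.toT (a n) f = t * x) → x * y = x * z → y = z := by
    rintro n x y z ⟨t, ht⟩ h
    have h1 := hN f hf n _ le_rfl (a n).2.2
    have h2 := hN f hf n _ (a n).2.2 le_rfl
    rw [ht, D.M_mul le_rfl (a n).2.2] at h1
    rw [ht, D.M_mul (a n).2.2 le_rfl] at h2
    exact D.mul_left_cancel_of_M (right_ne_zero_of_mul h1) (right_ne_zero_of_mul h2) h
  -- the generators on different annuli differ by units
  have hunit : ∀ n, ∃ u v : D.T (a n), u * v = 1 ∧ D.res (ha n) (d (n + 1)) = u * d n := by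
    intro n
    have h1 := congrArg (D.res (ha n)) (hp (n + 1))
    have h2 := congrArg (D.res (ha n)) (hq (n + 1))
    have h3 := congrArg (D.res (ha n)) (hd (n + 1))
    simp only [_root_.map_add, _root_.map_mul, D.res_toT] at h1 h2 h3
    refine ⟨D.res (ha n) (α (n + 1)) * p n + D.res (ha n) (β (n + 1)) * q n,
      α n * D.res (ha n) (p (n + 1)) + β n * D.res (ha n) (q (n + 1)), ?_, ?_⟩
    · refine hreg n (d n) _ _ ⟨p n, hp n⟩ ?_
      linear_combination
        (-(α n * D.res (ha n) (p (n + 1)) + β n * D.res (ha n) (q (n + 1))))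
          * D.res (ha n) (α (n + 1)) * hp n
        - (α n * D.res (ha n) (p (n + 1)) + β n * D.res (ha n) (q (n + 1)))
          * D.res (ha n) (β (n + 1)) * hq n
        - (α n * D.res (ha n) (p (n + 1)) + β n * D.res (ha n) (q (n + 1))) * h3
        - α n * h1 - β n * h2 - hd n
    · linear_combination h3 + D.res (ha n) (α (n + 1)) * hp n + D.res (ha n) (β (n + 1)) * hq n
  choose u v huv hu using hunit
  have hε1 : ∀ n, ((1 : ℝ) / 4) ^ (n + 1) < 1 := fun n ↦
    pow_lt_one₀ (by norm_num) (by norm_num) (by simp)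
  choose U hU using fun n ↦ D.exists_global_unit (hirr (n + 1)) (ha n)
    (show (0 : ℝ) < (1 / 4) ^ (n + 1) by positivity) (hε1 n) (hκ n) (huv (n + 1))
  obtain ⟨w, hwu, hw⟩ := D.exists_compatible_unit ha _ hU
  -- the corrected generators
  let W : ℕ → Rˣ := fun n ↦ Nat.rec 1 (fun n x ↦ x * (U n)⁻¹) n
  have hW : ∀ n, W (n + 1) = W n * (U n)⁻¹ := fun n ↦ rfl
  let E : ∀ n, D.T (a n) := fun n ↦
    w n * D.toT (a n) (W n).val * D.res (ha n) (d (n + 1))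
  have hE : ∀ n, D.res (ha n) (E (n + 1)) = E n := by
    intro n
    have h1 := congrArg (D.res (ha n)) (hu (n + 1))
    rw [_root_.map_mul] at h1
    simp only [E, _root_.map_mul, D.res_toT, hW, Units.val_mul]
    rw [h1]
    linear_combination D.toT (a n) (W n).val * D.res (ha n) (d (n + 1)) * hw n
  obtain ⟨e, he⟩ := D.exists_of_compatible ha hlim E hE
  have hEu : ∀ n, ∃ b b' : D.T (a n), b * b' = 1 ∧ E n = b * d n := by
    intro n
    obtain ⟨w', hw'⟩ := (hwu n).exists_right_inv
    have h1 : D.toT (a n) (W n).val * D.toT (a n) (W n)⁻¹.val = 1 := by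
      rw [← _root_.map_mul, Units.mul_inv, _root_.map_one]
    refine ⟨w n * D.toT (a n) (W n).val * u n, w' * D.toT (a n) (W n)⁻¹.val * v n, ?_, ?_⟩
    · linear_combination (D.toT (a n) (W n).val * D.toT (a n) (W n)⁻¹.val * u n * v n) * hw'
        + (u n * v n) * h1 + huv n
    · simp only [E]
      rw [hu n]
      ring
  choose b b' hbb hEb using hEu
  have hp' : ∀ n, D.toT (a n) f = E n * (b' n * p n) := fun n ↦ by
    rw [hEb n]
    linear_combination hp n - d n * p n * hbb n
  have hq' : ∀ n, D.toT (a n) g = E n * (b' n * q n) := fun n ↦ by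
    rw [hEb n]
    linear_combination hq n - d n * q n * hbb n
  have hquot : ∀ (x : R) (y : ∀ n, D.T (a n)), (∀ n, D.toT (a n) x = E n * y n) →
      ∃ z : R, (∀ n, D.toT (a n) z = y n) ∧ x = e * z := by
    intro x y hxy
    obtain ⟨z, hz⟩ := D.exists_of_compatible ha hlim y (fun n ↦ by
      refine hreg n (E n) _ _ ⟨b' n * p n, (hp' n).trans (mul_comm _ _)⟩ ?_
      have h1 := congrArg (D.res (ha n)) (hxy (n + 1))
      rw [D.res_toT, _root_.map_mul, hE] at h1
      rw [← h1, hxy])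
    refine ⟨z, hz, D.toT_injective (a 0) ?_⟩
    rw [hxy, _root_.map_mul, he, hz]
  obtain ⟨P, hP, hfP⟩ := hquot f _ hp'
  obtain ⟨Q, hQ, hgQ⟩ := hquot g _ hq'
  obtain ⟨A, B, hAB⟩ := D.exists_bezout_of_local ha hlim P Q (fun n ↦ by
    refine ⟨α n * b n, β n * b n, hreg n (d n) _ _ ⟨p n, hp n⟩ ?_⟩
    rw [hP, hQ]
    linear_combination (d n * α n * p n + d n * β n * q n) * hbb n - α n * hp n - β n * hq n - hd n)
  refine ⟨e, ?_⟩
  rw [Ideal.submodule_span_eq]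
  refine le_antisymm ?_ ?_
  · rw [Ideal.span_le, Set.insert_subset_iff, Set.singleton_subset_iff]
    exact ⟨Ideal.mem_span_singleton'.2 ⟨P, by rw [hfP, mul_comm]⟩,
      Ideal.mem_span_singleton'.2 ⟨Q, by rw [hgQ, mul_comm]⟩⟩
  · rw [Ideal.span_singleton_le_iff_mem, Ideal.mem_span_pair]
    exact ⟨A, B, by rw [hfP, hgQ]; linear_combination e * hAB⟩

theorem isBezout (D : AnnulusRing R) (hr : 0 < D.r) : IsBezout R := by
  rw [IsBezout.iff_span_pair_isPrincipal]
  intro f g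
  rcases eq_or_ne f 0 with rfl | hf
  · exact ⟨g, by rw [Ideal.span_insert_zero]⟩
  rcases eq_or_ne g 0 with rfl | hg
  · exact ⟨f, by rw [Set.pair_comm, Ideal.span_insert_zero]⟩
  exact D.span_pair_isPrincipal_of_ne_zero hr hf hg

end AnnulusRing

section ResidueGenerators

variable {k : Type u} [Field k] (K : IntermediateField (LaurentSeries k) (LaurentAlg k))

theorem lnorm_C_le (a : k) :
    lnorm (algebraMap (LaurentSeries k) (LaurentAlg k) (HahnSeries.C a)) ≤ 1 := by
  by_cases h : a = 0
  · rw [h, map_zero, map_zero, lnorm_zero]; exact zero_le_one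
  · exact (lnorm_const h).le

theorem exists_lnorm_sub_C_lt {f : LaurentSeries k}
    (hf : lnorm (algebraMap (LaurentSeries k) (LaurentAlg k) f) ≤ 1) :
    lnorm (algebraMap (LaurentSeries k) (LaurentAlg k) (f - HahnSeries.C (f.coeff 0))) < 1 := by
  set g := f - HahnSeries.C (f.coeff 0) with hg
  have hneg : ∀ i < 0, f.coeff i = 0 := by
    intro i hi
    by_cases h0 : f = 0
    · rw [h0, HahnSeries.coeff_zero]
    · rw [lnorm_algebraMap h0, Real.exp_le_one_iff, neg_nonpos] at hf
      exact HahnSeries.coeff_eq_zero_of_lt_order (hi.trans_le (by exact_mod_cast hf))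
  by_cases h0 : g = 0
  · rw [h0, map_zero, lnorm_zero]; exact zero_lt_one
  · rw [lnorm_algebraMap h0, Real.exp_lt_one_iff, neg_neg_iff_pos]
    by_contra h
    have h1 : g.order ≤ 0 := by exact_mod_cast not_lt.1 h
    have h2 : g.coeff g.order ≠ 0 := HahnSeries.coeff_order_eq_zero.not.2 h0
    rcases h1.lt_or_eq with h3 | h3
    · apply h2
      have h4 : ∀ i < 0, g.coeff i = 0 := fun i hi ↦ by
        rw [hg, HahnSeries.coeff_sub, hneg i hi, HahnSeries.C_apply,
          HahnSeries.coeff_single_of_ne hi.ne, sub_zero]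
      exact h4 _ h3
    · apply h2
      rw [h3, hg, HahnSeries.coeff_sub, HahnSeries.C_apply, HahnSeries.coeff_single_same, sub_self]

theorem smul_eq_algebraMap_C_mul (a : k) (x : LaurentAlg k) :
    a • x = algebraMap (LaurentSeries k) (LaurentAlg k) (HahnSeries.C a) * x := by
  rw [Algebra.smul_def, IsScalarTower.algebraMap_apply k (LaurentSeries k) (LaurentAlg k),
    HahnSeries.algebraMap_apply', PowerSeries.algebraMap_apply, Algebra.algebraMap_self_apply,
    HahnSeries.ofPowerSeries_C]

/-- The valuation ring of `K`, as a vector space over the constants. -/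
def integersSubmodule : Submodule k (LaurentAlg k) where
  carrier := {x | x ∈ K ∧ lnorm x ≤ 1}
  add_mem' := fun hx hy ↦ ⟨K.add_mem hx.1 hy.1, (lnorm_add_le _ _).trans (max_le hx.2 hy.2)⟩
  zero_mem' := ⟨K.zero_mem, by rw [lnorm_zero]; exact zero_le_one⟩
  smul_mem' := fun a x hx ↦ by
    rw [smul_eq_algebraMap_C_mul]
    refine ⟨K.mul_mem (K.algebraMap_mem _) hx.1, ?_⟩
    rw [lnorm_mul]
    exact mul_le_one₀ (lnorm_C_le a) (lnorm_nonneg _) hx.2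

/-- The maximal ideal of the valuation ring of `K`, as a vector space over the constants. -/
def maximalSubmodule : Submodule k (integersSubmodule K) where
  carrier := {x | lnorm (x : LaurentAlg k) < 1}
  add_mem' := fun hx hy ↦ (lnorm_add_le _ _).trans_lt (max_lt hx hy)
  zero_mem' := by
    change lnorm (0 : LaurentAlg k) < 1
    rw [lnorm_zero]; exact zero_lt_one
  smul_mem' := fun a x hx ↦ by
    change lnorm (a • (x : LaurentAlg k)) < 1
    rw [smul_eq_algebraMap_C_mul, lnorm_mul]
    exact mul_lt_one_of_nonneg_of_lt_one_right (lnorm_C_le a) (lnorm_nonneg _) hx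

variable [FiniteDimensional (LaurentSeries k) K]

theorem card_le_of_linearIndependent_residues (s : Finset (integersSubmodule K ⧸ maximalSubmodule K))
    (hs : LinearIndependent k (fun i : s ↦ (i : integersSubmodule K ⧸ maximalSubmodule K))) :
    s.card ≤ Module.finrank (LaurentSeries k) K := by
  choose e he using fun i : s ↦ (maximalSubmodule K).mkQ_surjective i
  have hli : LinearIndependent (LaurentSeries k) (fun i : s ↦ (⟨e i, (e i).2.1⟩ : K)) := by
    rw [Fintype.linearIndependent_iff]
    intro f hf
    by_contra! hne
    obtain ⟨j, hj⟩ := hne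
    have hf' : ∑ i, algebraMap (LaurentSeries k) (LaurentAlg k) (f i) * e i = 0 := by
      have := congrArg (fun x : K ↦ (x : LaurentAlg k)) hf
      simp only [AddSubmonoidClass.coe_finsetSum, IntermediateField.coe_smul, ZeroMemClass.coe_zero] at this
      simpa only [Algebra.smul_def] using this
    obtain ⟨i₀, -, hi₀⟩ := Finset.exists_max_image Finset.univ
      (fun i ↦ lnorm (algebraMap (LaurentSeries k) (LaurentAlg k) (f i))) ⟨j, Finset.mem_univ j⟩
    have hfi : f i₀ ≠ 0 := by
      intro h0
      have h1 := hi₀ j (Finset.mem_univ j)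
      rw [h0, map_zero, lnorm_zero] at h1
      exact absurd h1 (not_le.2 (lnorm_pos ((map_ne_zero _).2 hj)))
    have hpos := lnorm_pos ((map_ne_zero (algebraMap (LaurentSeries k) (LaurentAlg k))).2 hfi)
    have hg : ∀ i, lnorm (algebraMap (LaurentSeries k) (LaurentAlg k) (f i / f i₀)) ≤ 1 := by
      intro i
      rw [map_div₀, lnorm_div, div_le_one hpos]
      exact hi₀ i (Finset.mem_univ i)
    have hsum : ∑ i, algebraMap (LaurentSeries k) (LaurentAlg k) (f i / f i₀) * e i = 0 := by
      have := congrArg (fun x ↦ (algebraMap (LaurentSeries k) (LaurentAlg k) (f i₀))⁻¹ * x) hf'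
      simp only [mul_zero, Finset.mul_sum] at this
      rw [← this]
      refine Finset.sum_congr rfl fun i _ ↦ ?_
      rw [map_div₀, div_eq_inv_mul, mul_assoc]
    have hq : ∑ i, ((f i / f i₀).coeff 0) • (i : integersSubmodule K ⧸ maximalSubmodule K) = 0 := by
      have h1 : ∑ i, ((f i / f i₀).coeff 0) • e i ∈ maximalSubmodule K := by
        change lnorm ((∑ i, ((f i / f i₀).coeff 0) • e i : integersSubmodule K) : LaurentAlg k) < 1
        have h2 : ((∑ i, ((f i / f i₀).coeff 0) • e i : integersSubmodule K) : LaurentAlg k) =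
            - ∑ i, algebraMap (LaurentSeries k) (LaurentAlg k)
              (f i / f i₀ - HahnSeries.C ((f i / f i₀).coeff 0)) * e i := by
          simp only [map_sub, sub_mul, Finset.sum_sub_distrib, hsum, zero_sub, neg_neg,
            AddSubmonoidClass.coe_finsetSum, Submodule.coe_smul, smul_eq_algebraMap_C_mul]
        rw [h2, lnorm_neg]
        have h3 : ∀ t : Finset s, lnorm (∑ i ∈ t, algebraMap (LaurentSeries k) (LaurentAlg k)
            (f i / f i₀ - HahnSeries.C ((f i / f i₀).coeff 0)) * (e i : LaurentAlg k)) < 1 := by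
          intro t
          induction t using Finset.cons_induction with
          | empty => rw [Finset.sum_empty, lnorm_zero]; exact zero_lt_one
          | cons i t hi ih =>
            rw [Finset.sum_cons]
            refine (lnorm_add_le _ _).trans_lt (max_lt ?_ ih)
            rw [lnorm_mul]
            exact mul_lt_one_of_nonneg_of_lt_one_left (lnorm_nonneg _)
              (exists_lnorm_sub_C_lt (hg i)) (e i).2.2
        exact h3 _
      have h2 := (Submodule.Quotient.mk_eq_zero _).2 h1
      rw [← Submodule.mkQ_apply, map_sum] at h2
      simp only [map_smul, he] at h2
      exact h2
    have h := Fintype.linearIndependent_iff.1 hs _ hq i₀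
    rw [div_self hfi, HahnSeries.coeff_one, if_pos rfl] at h
    exact one_ne_zero h
  have := hli.fintype_card_le_finrank
  rwa [Fintype.card_coe] at this

/-- The residue field of a finite extension of `k((t))` is finite over `k`. -/
theorem exists_residue_generators : ∃ (n : ℕ) (e : Fin n → LaurentAlg k),
    (∀ i, e i ∈ K ∧ lnorm (e i) ≤ 1) ∧ ∀ a ∈ K, lnorm a ≤ 1 → ∃ c : Fin n → k,
      lnorm (a - ∑ i, algebraMap (LaurentSeries k) (LaurentAlg k) (HahnSeries.C (c i)) * e i) < 1 := by
  have hfin : Module.Finite k (integersSubmodule K ⧸ maximalSubmodule K) :=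
    Module.rank_lt_aleph0_iff.1 ((rank_le (card_le_of_linearIndependent_residues K)).trans_lt
      Cardinal.natCast_lt_aleph0)
  obtain ⟨n, s, hs⟩ := Module.Finite.exists_fin (R := k)
    (M := integersSubmodule K ⧸ maximalSubmodule K)
  choose e he using fun i ↦ (maximalSubmodule K).mkQ_surjective (s i)
  refine ⟨n, fun i ↦ e i, fun i ↦ (e i).2, fun a ha ha1 ↦ ?_⟩
  have hmem : (maximalSubmodule K).mkQ ⟨a, ha, ha1⟩ ∈ Submodule.span k (Set.range s) := by
    rw [hs]; trivial
  obtain ⟨c, hc⟩ := (Submodule.mem_span_range_iff_exists_fun k).1 hmem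
  refine ⟨c, ?_⟩
  have h1 : (maximalSubmodule K).mkQ (⟨a, ha, ha1⟩ - ∑ i, c i • e i) = 0 := by
    rw [map_sub, map_sum, ← hc]
    simp only [map_smul, he, sub_self]
  have h2 : lnorm (((⟨a, ha, ha1⟩ - ∑ i, c i • e i : integersSubmodule K)) : LaurentAlg k) < 1 :=
    (Submodule.Quotient.mk_eq_zero _).1 h1
  simpa only [AddSubgroupClass.coe_sub, AddSubmonoidClass.coe_finsetSum, Submodule.coe_smul,
    smul_eq_algebraMap_C_mul] using h2

theorem exists_lnorm_eq_exp_div {x : LaurentAlg k} (hx : x ∈ K) (h0 : x ≠ 0) :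
    ∃ m : ℤ, lnorm x = Real.exp (-(m / (Module.finrank (LaurentSeries k) K : ℝ))) := by
  have hd := minpoly.degree_dvd (K := LaurentSeries k) (x := (⟨x, hx⟩ : K))
    (Algebra.IsIntegral.isIntegral _)
  rw [IntermediateField.minpoly_eq] at hd
  obtain ⟨c, hc⟩ := hd
  have hpos : 0 < Module.finrank (LaurentSeries k) K := Module.finrank_pos
  have h1 := laurentVal_eq h0
  rw [laurentVal, if_neg h0, EReal.coe_eq_coe_iff] at h1
  have h2 : lnorm x = Real.exp (-(-Real.log (lnorm x))) := by
    rw [neg_neg, Real.exp_log (lnorm_pos h0)]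
  refine ⟨((minpoly (LaurentSeries k) x).coeff 0).order * c, ?_⟩
  rw [h2, ← h1, hc]
  have hn : ((minpoly (LaurentSeries k) x).natDegree : ℝ) ≠ 0 := by
    intro h
    rw [Nat.cast_eq_zero] at h
    change _ = (minpoly (LaurentSeries k) x).natDegree * c at hc
    rw [h, zero_mul] at hc
    omega
  have hc0 : (c : ℝ) ≠ 0 := by
    intro h
    rw [Nat.cast_eq_zero] at h
    rw [h, mul_zero] at hc
    omega
  push_cast
  rw [mul_div_mul_right _ _ hc0]

/-- A uniformizer of a finite extension of `k((t))`. -/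
theorem exists_lnorm_generator : ∃ x ∈ K, x ≠ 0 ∧ lnorm x < 1 ∧
    ∀ a ∈ K, a ≠ 0 → ∃ j : ℤ, lnorm a = lnorm x ^ j := by
  classical
  set d := Module.finrank (LaurentSeries k) K with hd
  have hpos : 0 < d := Module.finrank_pos
  have hd0 : (0 : ℝ) < d := Nat.cast_pos.2 hpos
  have hex : ∃ m : ℕ, 0 < m ∧ ∃ x ∈ K, x ≠ 0 ∧ lnorm x = Real.exp (-(m / (d : ℝ))) := by
    refine ⟨d, hpos, algebraMap (LaurentSeries k) (LaurentAlg k) (HahnSeries.single 1 1),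
      K.algebraMap_mem _, (map_ne_zero _).2 (HahnSeries.single_ne_zero one_ne_zero), ?_⟩
    rw [lnorm_algebraMap (HahnSeries.single_ne_zero one_ne_zero),
      HahnSeries.order_single one_ne_zero, div_self hd0.ne', Int.cast_one]
  obtain ⟨hm0, x, hx, hx0, hxn⟩ := Nat.find_spec hex
  set m := Nat.find hex with hm
  have hmR : (0 : ℝ) < m := Nat.cast_pos.2 hm0
  refine ⟨x, hx, hx0, ?_, fun a ha ha0 ↦ ?_⟩
  · rw [hxn, Real.exp_lt_one_iff, neg_neg_iff_pos]
    positivity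
  · obtain ⟨n, hn⟩ := exists_lnorm_eq_exp_div K ha ha0
    refine ⟨n / m, ?_⟩
    have hmz : (0 : ℤ) < m := by exact_mod_cast hm0
    have hz := Int.mul_ediv_add_emod n m
    have key : lnorm (a * (x ^ (n / m : ℤ))⁻¹) = Real.exp (-((n % m : ℤ) / (d : ℝ))) := by
      rw [lnorm_mul, lnorm_inv, lnorm_zpow, hn, hxn, ← Real.rpow_intCast, ← Real.exp_mul, ← Real.exp_neg,
        ← Real.exp_add]
      congr 1
      have hz' : ((m : ℝ)) * ((n / m : ℤ) : ℝ) + ((n % m : ℤ) : ℝ) = (n : ℝ) := by exact_mod_cast hz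
      rw [← hz']
      ring
    have h0 : n % m = 0 := by
      by_contra hne
      have h1 := Int.emod_nonneg n hmz.ne'
      have h2 := Int.emod_lt_of_pos n hmz
      obtain ⟨l, hl⟩ := Int.eq_ofNat_of_zero_le h1
      refine Nat.find_min hex (m := l) (by omega) ⟨by omega, a * (x ^ (n / m : ℤ))⁻¹,
        K.mul_mem ha (K.inv_mem (zpow_mem hx _)),
        mul_ne_zero ha0 (inv_ne_zero (zpow_ne_zero _ hx0)), ?_⟩
      rw [key, hl]
      simp
    rw [h0, Int.cast_zero, zero_div, neg_zero, Real.exp_zero, lnorm_mul, lnorm_inv, lnorm_zpow] at key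
    exact eq_of_mul_inv_eq_one key

end ResidueGenerators

/-! ## Rings with a regular element generating the kernel of a residue map -/

/-- `ϖ` is regular and generates the kernel of `ρ`. -/
structure IsResidueUniformizer {S F : Type*} [CommRing S] [CommRing F] (ρ : S →+* F) (ϖ : S) :
    Prop where
  dvd_iff : ∀ x, ρ x = 0 ↔ ϖ ∣ x
  regular : ∀ x, ϖ * x = 0 → x = 0

namespace AdicCompletion

variable {S : Type*} [CommRing S] {a : S}

theorem evalₐ_eq_zero_of_le {I : Ideal S} {m n : ℕ} (h : m ≤ n) {x : AdicCompletion I S}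
    (hx : evalₐ I n x = 0) : evalₐ I m x = 0 := by
  obtain ⟨f, rfl⟩ := mk_surjective I S x
  rw [evalₐ_mk] at hx ⊢
  rw [Ideal.Quotient.eq_zero_iff_mem] at hx ⊢
  have h1 := AdicCompletion.Ideal.mk_eq_mk (I := I) h f
  rw [← Ideal.Quotient.eq_zero_iff_mem, ← h1, Ideal.Quotient.eq_zero_iff_mem]
  exact Ideal.pow_le_pow_right h hx

theorem evalₐ_algebraMap (I : Ideal S) (n : ℕ) (x : S) :
    evalₐ I n (algebraMap S (AdicCompletion I S) x) = Ideal.Quotient.mk (I ^ n) x :=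
  evalₐ_of I n x

/-- The kernel of reduction modulo `a` in the `a`-adic completion is generated by `a`. -/
theorem dvd_of_evalOneₐ_eq_zero {x : AdicCompletion (Ideal.span {a}) S}
    (hx : evalOneₐ (Ideal.span {a}) x = 0) : algebraMap S _ a ∣ x := by
  have h := ker_evalOneₐ_eq_map (Ideal.span {a}) ⟨{a}, by simp⟩
  have h1 : x ∈ RingHom.ker (evalOneₐ (Ideal.span {a})).toRingHom := hx
  rw [h, Ideal.map_span, Set.image_singleton, Ideal.mem_span_singleton] at h1
  exact h1

/-- A regular element stays regular in the completion along itself. -/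
theorem eq_zero_of_algebraMap_mul (ha : ∀ x : S, a * x = 0 → x = 0)
    {x : AdicCompletion (Ideal.span {a}) S} (hx : algebraMap S _ a * x = 0) : x = 0 := by
  apply ext_evalₐ
  intro n
  rw [_root_.map_zero]
  obtain ⟨y, hy⟩ := Ideal.Quotient.mk_surjective (evalₐ (Ideal.span {a}) (n + 1) x)
  have h1 : evalₐ (Ideal.span {a}) (n + 1) (algebraMap S _ a * x) = 0 := by rw [hx, _root_.map_zero]
  rw [map_mul, evalₐ_algebraMap, ← hy, ← map_mul, Ideal.Quotient.eq_zero_iff_mem,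
    Ideal.span_singleton_pow, Ideal.mem_span_singleton] at h1
  obtain ⟨z, hz⟩ := h1
  have h2 : y = a ^ n * z := by
    have := ha (y - a ^ n * z) (by rw [mul_sub, hz]; ring)
    exact sub_eq_zero.1 this
  obtain ⟨f, rfl⟩ := mk_surjective (Ideal.span {a}) S x
  rw [evalₐ_mk] at hy ⊢
  have h3 := AdicCompletion.Ideal.mk_eq_mk (I := Ideal.span {a}) n.le_succ f
  rw [← h3]
  rw [Ideal.Quotient.eq] at hy
  rw [Ideal.Quotient.eq_zero_iff_mem]
  have h4 : y - f.val (n + 1) ∈ Ideal.span {a} ^ n := Ideal.pow_le_pow_right n.le_succ hy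
  have h5 : y ∈ Ideal.span {a} ^ n := by
    rw [Ideal.span_singleton_pow, Ideal.mem_span_singleton]; exact ⟨z, h2⟩
  simpa using sub_mem h5 h4

end AdicCompletion

/-! ## The ring `Γ^{k((t))}` -/

section Laurent

variable {O : Type u} [CommRing O]

theorem HahnSeries.exists_C_mul_of_dvd_coeff {ϖ : O} (f : LaurentSeries O)
    (h : ∀ i, ϖ ∣ f.coeff i) : ∃ g : LaurentSeries O, f = HahnSeries.C ϖ * g := by
  classical
  choose g hg using h
  have hs : (Function.support fun i ↦ if f.coeff i = 0 then 0 else g i).IsPWO :=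
    f.isPWO_support.mono fun i hi hfi ↦ hi (by simp [hfi])
  refine ⟨⟨_, hs⟩, ?_⟩
  ext i
  rw [HahnSeries.C_mul_eq_smul, HahnSeries.coeff_smul]
  by_cases hi : f.coeff i = 0
  · simp [hi]
  · simp [hi, ← hg i]

theorem HahnSeries.C_mul_eq_zero_of_isDomain [IsDomain O] {ϖ : O} (h : ϖ ≠ 0)
    (f : LaurentSeries O) (hf : HahnSeries.C ϖ * f = 0) : f = 0 := by
  ext i
  have := congrArg (fun g ↦ HahnSeries.coeff g i) hf
  simp only [HahnSeries.C_mul_eq_smul, HahnSeries.coeff_smul, HahnSeries.coeff_zero,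
    smul_eq_mul] at this
  simpa [h] using this

variable [IsDomain O] [IsDiscreteValuationRing O] {ϖ : O} [hϖ : Fact (Irreducible ϖ)]

theorem residue_eq_zero_iff_dvd (a : O) : IsLocalRing.residue O a = 0 ↔ ϖ ∣ a := by
  rw [IsLocalRing.residue_eq_zero_iff, hϖ.out.maximalIdeal_eq, Ideal.mem_span_singleton]

theorem laurentReduction_eq_zero_iff (f : LaurentSeries O) :
    laurentReduction O f = 0 ↔ HahnSeries.C ϖ ∣ f := by
  constructor
  · intro h
    obtain ⟨g, hg⟩ := HahnSeries.exists_C_mul_of_dvd_coeff (ϖ := ϖ) f fun i ↦ by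
      rw [← residue_eq_zero_iff_dvd]
      exact congrArg (fun g ↦ HahnSeries.coeff g i) h
    exact ⟨g, hg⟩
  · rintro ⟨g, rfl⟩
    have h1 : laurentReduction O (HahnSeries.C ϖ)
        = HahnSeries.C (IsLocalRing.residue O ϖ) := HahnSeries.map_C ϖ _
    rw [map_mul, h1, (residue_eq_zero_iff_dvd ϖ).2 dvd_rfl, map_zero, zero_mul]

namespace GammaLaurent

theorem residue_of (f : LaurentSeries O) : residue ϖ (of ϖ f) = laurentReduction O f := rfl

theorem residue_const (a : O) :
    residue ϖ (const ϖ a) = HahnSeries.C (IsLocalRing.residue O a) := by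
  rw [const, RingHom.comp_apply, residue_of]
  exact HahnSeries.map_C a _

theorem of_eq_zero_of_mul (x : GammaLaurent ϖ) (h : const ϖ ϖ * x = 0) : x = 0 :=
  AdicCompletion.eq_zero_of_algebraMap_mul
    (HahnSeries.C_mul_eq_zero_of_isDomain hϖ.out.ne_zero) h

theorem isResidueUniformizer : IsResidueUniformizer (residue ϖ) (const ϖ ϖ) where
  dvd_iff x := by
    constructor
    · intro hx
      obtain ⟨f, hf⟩ := Ideal.Quotient.mk_surjective (AdicCompletion.evalOneₐ (laurentIdeal ϖ) x)
      have h1 : laurentReduction O f = 0 := by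
        rw [← hx, residue, RingHom.comp_apply]
        change _ = Ideal.Quotient.lift _ _ _ (AdicCompletion.evalOneₐ (laurentIdeal ϖ) x)
        rw [← hf, Ideal.Quotient.lift_mk]
      have h2 : const ϖ ϖ ∣ x - of ϖ f := by
        apply AdicCompletion.dvd_of_evalOneₐ_eq_zero
        refine (map_sub (AdicCompletion.evalOneₐ (laurentIdeal ϖ)) _ _).trans ?_
        rw [← hf]
        exact sub_self _
      have h3 : const ϖ ϖ ∣ of ϖ f := by
        obtain ⟨g, hg⟩ := (laurentReduction_eq_zero_iff (ϖ := ϖ) f).1 h1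
        exact ⟨of ϖ g, by rw [hg, map_mul]; rfl⟩
      simpa using dvd_add h2 h3
    · rintro ⟨y, rfl⟩
      rw [map_mul, residue_const, (residue_eq_zero_iff_dvd ϖ).2 dvd_rfl, map_zero, zero_mul]
  regular := of_eq_zero_of_mul

end GammaLaurent

/-- The ramification index of `O`. -/
def ramIndex (p : ℕ) (ϖ : O) : ℕ := multiplicity ϖ ((p : ℕ) : O)

variable {p : ℕ} [Fact p.Prime] [CharP (IsLocalRing.ResidueField O) p] [CharZero O]

theorem exists_natCast_eq_unit_mul_pow :
    ∃ v : Oˣ, ((p : ℕ) : O) = v * ϖ ^ ramIndex p ϖ := by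
  have hp : ((p : ℕ) : O) ≠ 0 := Nat.cast_ne_zero.2 (Fact.out : p.Prime).ne_zero
  obtain ⟨n, v, hv⟩ := IsDiscreteValuationRing.eq_unit_mul_pow_irreducible hp hϖ.out
  have hn : ramIndex p ϖ = n := by
    apply multiplicity_eq_of_dvd_of_not_dvd
    · exact ⟨v, by rw [hv, mul_comm]⟩
    · intro h
      rw [hv, mul_comm, Units.dvd_mul_right] at h
      exact absurd ((pow_dvd_pow_iff hϖ.out.ne_zero hϖ.out.not_isUnit).1 h) (by omega)
  exact ⟨v, by rw [hn, hv]⟩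

theorem ramIndex_pos : 0 < ramIndex p ϖ := by
  rcases Nat.eq_zero_or_pos (ramIndex p ϖ) with h | h
  · obtain ⟨v, hv⟩ := exists_natCast_eq_unit_mul_pow (p := p) (ϖ := ϖ)
    rw [h, pow_zero, mul_one] at hv
    have h1 : IsLocalRing.residue O ((p : ℕ) : O) = 0 := by
      rw [map_natCast, CharP.cast_eq_zero]
    rw [IsLocalRing.residue_eq_zero_iff, hv] at h1
    exact absurd v.isUnit h1
  · exact h

namespace FrobeniusLift

variable (σ : FrobeniusLift p ϖ)

theorem residue_base (a : O) :
    IsLocalRing.residue O (σ.base a) = IsLocalRing.residue O a ^ p := by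
  have h := σ.residue_hom (GammaLaurent.const ϖ a)
  rw [σ.hom_const, GammaLaurent.residue_const, GammaLaurent.residue_const, ← map_pow] at h
  exact HahnSeries.C_injective h

theorem exists_base_unif : ∃ v : Oˣ, σ.base ϖ = v * ϖ := by
  obtain ⟨v, hv⟩ := exists_natCast_eq_unit_mul_pow (p := p) (ϖ := ϖ)
  have h0 : σ.base ϖ ≠ 0 := by
    intro h
    have := congrArg σ.base hv
    rw [map_natCast, map_mul, map_pow, h, zero_pow ramIndex_pos.ne', mul_zero] at this
    exact (Fact.out : p.Prime).ne_zero (Nat.cast_eq_zero.1 this)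
  obtain ⟨n, w, hw⟩ := IsDiscreteValuationRing.eq_unit_mul_pow_irreducible h0 hϖ.out
  have h1 : ((p : ℕ) : O) = ↑(Units.map σ.base.toMonoidHom v * w ^ ramIndex p ϖ) *
      ϖ ^ (n * ramIndex p ϖ) := by
    have := congrArg σ.base hv
    rw [map_natCast, map_mul, map_pow, hw] at this
    rw [this]
    push_cast
    rw [mul_pow, pow_mul, mul_assoc]
    rfl
  have h2 : ramIndex p ϖ = n * ramIndex p ϖ := by
    have h3 : Associated (ϖ ^ ramIndex p ϖ) (ϖ ^ (n * ramIndex p ϖ)) := by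
      have e1 : Associated ((p : ℕ) : O) (ϖ ^ ramIndex p ϖ) :=
by
        rw [hv]
        exact associated_unit_mul_left _ _ (Units.isUnit _)
      have e2 : Associated ((p : ℕ) : O) (ϖ ^ (n * ramIndex p ϖ)) := by
        rw [h1]
        exact associated_unit_mul_left _ _ (Units.isUnit _)
      exact e1.symm.trans e2
    apply le_antisymm
    · exact (pow_dvd_pow_iff hϖ.out.ne_zero hϖ.out.not_isUnit).1 h3.dvd
    · exact (pow_dvd_pow_iff hϖ.out.ne_zero hϖ.out.not_isUnit).1 h3.symm.dvd
  have h3 : n = 1 := by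
    have := ramIndex_pos (p := p) (ϖ := ϖ)
    nlinarith
  exact ⟨w, by rw [hw, h3, pow_one]⟩

theorem exists_base_pow_unif (i : ℕ) : ∃ v : Oˣ, (σ.base ^ i) ϖ = v * ϖ := by
  induction i with
  | zero => exact ⟨1, by simp⟩
  | succ i ih =>
    obtain ⟨v, hv⟩ := ih
    obtain ⟨w, hw⟩ := σ.exists_base_unif
    refine ⟨Units.map σ.base.toMonoidHom v * w, ?_⟩
    rw [pow_succ', RingHom.mul_def, RingHom.comp_apply, hv, map_mul, hw]
    push_cast
    rw [mul_assoc]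
    rfl

theorem hom_pow_const (i : ℕ) (a : O) :
    (σ.hom ^ i) (GammaLaurent.const ϖ a) = GammaLaurent.const ϖ ((σ.base ^ i) a) := by
  induction i with
  | zero => simp
  | succ i ih =>
    rw [pow_succ', RingHom.mul_def, RingHom.comp_apply, ih, σ.hom_const, pow_succ',
      RingHom.mul_def, RingHom.comp_apply]

/-! ## The direct limit -/

theorem toColim_hom (i : ℕ) (x : GammaLaurent ϖ) : σ.toColim (i + 1) (σ.hom x) = σ.toColim i x := by
  have := Ring.DirectLimit.of_f (G := fun _ : ℕ ↦ GammaLaurent ϖ)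
    (f := fun i j h ↦ σ.trans i j h) (i := i) (j := i + 1) (Nat.le_succ i) x
  simp only [trans, Nat.add_sub_cancel_left, pow_one] at this
  exact this

theorem toColim_hom_pow (i j : ℕ) (x : GammaLaurent ϖ) :
    σ.toColim (i + j) ((σ.hom ^ j) x) = σ.toColim i x := by
  induction j with
  | zero => simp
  | succ j ih =>
    rw [pow_succ', RingHom.mul_def, RingHom.comp_apply, ← add_assoc, toColim_hom, ih]

theorem exists_toColim (z : σ.GammaColim) : ∃ i x, σ.toColim i x = z :=
  Ring.DirectLimit.exists_of (G := fun _ : ℕ ↦ GammaLaurent ϖ) (f := fun i j h ↦ σ.trans i j h) z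

instance : DirectedSystem (fun _ : ℕ ↦ GammaLaurent ϖ) (fun i j h ↦ σ.trans i j h) where
  map_self i x := by simp [trans]
  map_map i j l hij hjl x := by
    simp only [trans]
    rw [← RingHom.comp_apply, ← RingHom.mul_def, ← pow_add]
    congr 3
    omega

theorem exists_hom_pow_eq_zero {i : ℕ} {x : GammaLaurent ϖ} (h : σ.toColim i x = 0) :
    ∃ j, (σ.hom ^ j) x = 0 := by
  obtain ⟨j, hij, hj⟩ := Ring.DirectLimit.of.zero_exact (G := fun _ : ℕ ↦ GammaLaurent ϖ)
    (f' := fun i j h ↦ σ.trans i j h) h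
  exact ⟨j - i, hj⟩

theorem residueColim_toColim (i : ℕ) (x : GammaLaurent ϖ) :
    σ.residueColim (σ.toColim i x) = residueLevel (p := p) ϖ i x :=
  Ring.DirectLimit.lift_of _ _ _ _ _

/-- The uniformizer of the direct limit. -/
def unifColim : σ.GammaColim := σ.toColim 0 (GammaLaurent.const ϖ ϖ)

theorem exists_unit_toColim_unif (i : ℕ) : ∃ v : Oˣ,
    σ.unifColim = σ.toColim i (GammaLaurent.const ϖ v) * σ.toColim i (GammaLaurent.const ϖ ϖ) := by
  obtain ⟨v, hv⟩ := σ.exists_base_pow_unif i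
  refine ⟨v, ?_⟩
  have := σ.toColim_hom_pow 0 i (GammaLaurent.const ϖ ϖ)
  rw [zero_add, hom_pow_const, hv, map_mul, map_mul] at this
  exact this.symm

theorem residueLevel_eq_zero_iff (i : ℕ) (x : GammaLaurent ϖ) :
    residueLevel (p := p) ϖ i x = 0 ↔ GammaLaurent.const ϖ ϖ ∣ x := by
  rw [← GammaLaurent.isResidueUniformizer.dvd_iff]
  simp [residueLevel]

theorem isResidueUniformizer_colim : IsResidueUniformizer σ.residueColim σ.unifColim where
  dvd_iff z := by
    obtain ⟨i, x, rfl⟩ := σ.exists_toColim z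
    obtain ⟨v, hv⟩ := σ.exists_unit_toColim_unif i
    have hu : IsUnit (σ.toColim i (GammaLaurent.const ϖ v)) :=
      (v.isUnit.map (GammaLaurent.const ϖ)).map (σ.toColim i)
    rw [residueColim_toColim, residueLevel_eq_zero_iff, hv, hu.mul_left_dvd]
    constructor
    · rintro ⟨y, rfl⟩
      exact ⟨_, map_mul _ _ _⟩
    · rintro ⟨y, hy⟩
      have : σ.residueColim (σ.toColim i x) = 0 := by
        rw [hy, map_mul, residueColim_toColim, (residueLevel_eq_zero_iff i _).2 dvd_rfl, zero_mul]
      rwa [residueColim_toColim, residueLevel_eq_zero_iff] at this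
  regular z hz := by
    obtain ⟨i, x, rfl⟩ := σ.exists_toColim z
    obtain ⟨v, hv⟩ := σ.exists_unit_toColim_unif i
    have hu : IsUnit (σ.toColim i (GammaLaurent.const ϖ v)) :=
      (v.isUnit.map (GammaLaurent.const ϖ)).map (σ.toColim i)
    rw [hv, mul_assoc, hu.mul_right_eq_zero, ← map_mul] at hz
    obtain ⟨j, hj⟩ := σ.exists_hom_pow_eq_zero hz
    obtain ⟨w, hw⟩ := σ.exists_base_pow_unif j
    rw [map_mul, hom_pow_const, hw, map_mul, mul_assoc,
      (w.isUnit.map (GammaLaurent.const ϖ)).mul_right_eq_zero] at hj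
    rw [← σ.toColim_hom_pow i j, GammaLaurent.of_eq_zero_of_mul _ hj, map_zero]

theorem exists_unit_natCast_colim : ∃ v : σ.GammaColimˣ,
    ((p : ℕ) : σ.GammaColim) = v * σ.unifColim ^ ramIndex p ϖ := by
  obtain ⟨v, hv⟩ := exists_natCast_eq_unit_mul_pow (p := p) (ϖ := ϖ)
  refine ⟨Units.map ((σ.toColim 0).comp (GammaLaurent.const ϖ)).toMonoidHom v, ?_⟩
  have := congrArg ((σ.toColim 0).comp (GammaLaurent.const ϖ)) hv
  rw [map_natCast, map_mul, map_pow] at this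
  exact this

/-! ## The ring `Γ^perf` -/

theorem residueColim_eq_zero_of_mem (a : σ.GammaColim)
    (ha : a ∈ Ideal.span {(p : σ.GammaColim)}) : σ.residueColim a = 0 := by
  obtain ⟨b, rfl⟩ := Ideal.mem_span_singleton.1 ha
  rw [map_mul, map_natCast, cast_residueAlg, zero_mul]

/-- The uniformizer of `Γ^perf`. -/
def unifPerf : σ.GammaPerf := σ.colimToPerf σ.unifColim

theorem exists_unit_natCast_perf : ∃ v : σ.GammaPerfˣ,
    ((p : ℕ) : σ.GammaPerf) = v * σ.unifPerf ^ ramIndex p ϖ := by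
  obtain ⟨v, hv⟩ := σ.exists_unit_natCast_colim
  refine ⟨Units.map σ.colimToPerf.toMonoidHom v, ?_⟩
  have := congrArg σ.colimToPerf hv
  rw [map_natCast, map_mul, map_pow] at this
  exact this

theorem residuePerf_colimToPerf (x : σ.GammaColim) :
    σ.residuePerf (σ.colimToPerf x) = σ.residueColim x := rfl

theorem IsResidueUniformizer.pow_regular {S F : Type*} [CommRing S] [CommRing F] {ρ : S →+* F}
    {a : S} (h : IsResidueUniformizer ρ a) (n : ℕ) (x : S) (hx : a ^ n * x = 0) : x = 0 := by
  induction n with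
  | zero => simpa using hx
  | succ n ih => exact ih (h.regular _ (by rw [← hx]; ring))

theorem isResidueUniformizer_perf : IsResidueUniformizer σ.residuePerf σ.unifPerf where
  dvd_iff x := by
    constructor
    · intro hx
      obtain ⟨c, hc⟩ := Ideal.Quotient.mk_surjective
        (AdicCompletion.evalOneₐ (Ideal.span {(p : σ.GammaColim)}) x)
      have h1 : σ.residueColim c = 0 := by
        rw [← hx]
        change _ = Ideal.Quotient.lift (Ideal.span {(p : σ.GammaColim)}) σ.residueColim
          σ.residueColim_eq_zero_of_mem (AdicCompletion.evalOneₐ (Ideal.span {(p : σ.GammaColim)}) x)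
        rw [← hc, Ideal.Quotient.lift_mk]
      have h2 : σ.colimToPerf (p : σ.GammaColim) ∣ x - σ.colimToPerf c := by
        apply AdicCompletion.dvd_of_evalOneₐ_eq_zero
        refine (map_sub (AdicCompletion.evalOneₐ (Ideal.span {(p : σ.GammaColim)})) _ _).trans ?_
        rw [← hc]
        exact sub_self _
      have h3 : σ.unifPerf ∣ σ.colimToPerf c :=
        map_dvd σ.colimToPerf ((σ.isResidueUniformizer_colim.dvd_iff c).1 h1)
      have h4 : σ.unifPerf ∣ ((p : ℕ) : σ.GammaPerf) := by
        obtain ⟨v, hv⟩ := σ.exists_unit_natCast_perf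
        rw [hv]
        exact (dvd_pow_self _ ramIndex_pos.ne').mul_left _
      rw [map_natCast] at h2
      simpa using dvd_add (h4.trans h2) h3
    · rintro ⟨y, rfl⟩
      rw [map_mul, unifPerf, residuePerf_colimToPerf,
        (σ.isResidueUniformizer_colim.dvd_iff _).2 dvd_rfl, zero_mul]
  regular x hx := by
    have h : ((p : ℕ) : σ.GammaPerf) * x = 0 := by
      obtain ⟨v, hv⟩ := σ.exists_unit_natCast_perf
      obtain ⟨n, hn⟩ := Nat.exists_eq_succ_of_ne_zero (ramIndex_pos (p := p) (ϖ := ϖ)).ne'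
      rw [hv, hn, pow_succ]
      linear_combination (v * σ.unifPerf ^ n) * hx
    rw [← map_natCast σ.colimToPerf] at h
    refine AdicCompletion.eq_zero_of_algebraMap_mul (fun y hy ↦ ?_) h
    obtain ⟨v, hv⟩ := σ.exists_unit_natCast_colim
    rw [hv, mul_assoc, v.mul_right_eq_zero] at hy
    exact IsResidueUniformizer.pow_regular σ.isResidueUniformizer_colim _ _ hy

end FrobeniusLift
end Laurent

namespace IsResidueUniformizer

variable {S F : Type*} [CommRing S] [CommRing F] {ρ : S →+* F} {a : S}

theorem dvd_sub_iff (h : IsResidueUniformizer ρ a) (x y : S) : ρ x = ρ y ↔ a ∣ x - y := by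
  rw [← h.dvd_iff, map_sub, sub_eq_zero]

theorem mul_left_cancel_pow (h : IsResidueUniformizer ρ a) (n : ℕ) {x y : S}
    (hx : a ^ n * x = a ^ n * y) : x = y := by
  rw [← sub_eq_zero, ← mul_sub] at hx
  exact sub_eq_zero.1 (FrobeniusLift.IsResidueUniformizer.pow_regular h n _ hx)

end IsResidueUniformizer

section Coefficients

variable {p : ℕ} [Fact p.Prime] {O : Type u} [CommRing O] [IsDomain O] [IsDiscreteValuationRing O]
  [CharZero O] [CharP (IsLocalRing.ResidueField O) p] {ϖ : O} [hϖ : Fact (Irreducible ϖ)]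

namespace FrobeniusLift

variable (σ : FrobeniusLift p ϖ)

theorem residueModP_mk (x : σ.GammaPerf) :
    σ.residueModP (Ideal.Quotient.mk _ x) = σ.residuePerf x := rfl

theorem unifPerf_pow_dvd_natCast {n : ℕ} (h : n ≤ ramIndex p ϖ) :
    σ.unifPerf ^ n ∣ (p : σ.GammaPerf) := by
  obtain ⟨v, hv⟩ := σ.exists_unit_natCast_perf
  rw [hv]
  exact (pow_dvd_pow _ h).mul_left _

theorem natCast_dvd_unifPerf_pow : (p : σ.GammaPerf) ∣ σ.unifPerf ^ ramIndex p ϖ := by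
  obtain ⟨v, hv⟩ := σ.exists_unit_natCast_perf
  rw [hv]
  exact v.isUnit.mul_left_dvd.2 dvd_rfl

/-- The kernel of `Γ^perf / p → k((t))^alg` is killed by a power of Frobenius. -/
theorem pow_eq_zero_of_residueModP_eq_zero {c : ModP σ.GammaPerf p} (h : σ.residueModP c = 0) :
    c ^ p ^ ramIndex p ϖ = 0 := by
  obtain ⟨x, rfl⟩ := Ideal.Quotient.mk_surjective c
  obtain ⟨y, rfl⟩ := (σ.isResidueUniformizer_perf.dvd_iff x).1 h
  have h1 : ramIndex p ϖ ≤ p ^ ramIndex p ϖ :=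
    (Nat.lt_pow_self (Fact.out : p.Prime).one_lt).le
  rw [← map_pow, Ideal.Quotient.eq_zero_iff_mem, Ideal.mem_span_singleton, mul_pow]
  exact (σ.natCast_dvd_unifPerf_pow.trans (pow_dvd_pow _ h1)).mul_right _

/-- The residue map of the tilt. -/
def residueTilt : PreTilt σ.GammaPerf p →+* LaurentAlg (IsLocalRing.ResidueField O) :=
  σ.residueModP.comp (PreTilt.coeff (p := p) 0)

theorem coeff_pow_pow (x : PreTilt σ.GammaPerf p) (n k : ℕ) :
    PreTilt.coeff (n + k) x ^ p ^ k = PreTilt.coeff n x := by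
  induction k with
  | zero => simp
  | succ k ih =>
    rw [pow_succ', pow_mul, ← add_assoc, PreTilt.coeff_pow_p, ih]

theorem residueTilt_injective : Function.Injective σ.residueTilt := by
  rw [injective_iff_map_eq_zero]
  intro x hx
  refine Perfection.ext fun n ↦ ?_
  have h1 : ∀ n, σ.residueModP (PreTilt.coeff n x) = 0 := by
    intro n
    have h2 : σ.residueModP (PreTilt.coeff (0 + n) x ^ p ^ n) = 0 := by
      rw [σ.coeff_pow_pow]
      exact hx
    rw [zero_add, map_pow] at h2
    exact pow_eq_zero_iff (pow_ne_zero _ (Fact.out : p.Prime).ne_zero) |>.1 h2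
  change PreTilt.coeff n x = 0
  rw [← σ.coeff_pow_pow x n (ramIndex p ϖ), σ.pow_eq_zero_of_residueModP_eq_zero (h1 _)]

theorem exists_residuePerf_pow (y : σ.GammaPerf) :
    ∃ z : σ.GammaPerf, σ.residuePerf z ^ p = σ.residuePerf y := by
  obtain ⟨c, hc⟩ := Ideal.Quotient.mk_surjective
    (AdicCompletion.evalOneₐ (Ideal.span {(p : σ.GammaColim)}) y)
  obtain ⟨i, x, rfl⟩ := σ.exists_toColim c
  refine ⟨σ.colimToPerf (σ.toColim (i + 1) x), ?_⟩
  rw [← map_pow, ← map_pow, ← map_pow, residuePerf_colimToPerf]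
  have h2 : σ.residuePerf y = σ.residueColim (σ.toColim i x) := by
    change Ideal.Quotient.lift (Ideal.span {(p : σ.GammaColim)}) σ.residueColim
          σ.residueColim_eq_zero_of_mem (AdicCompletion.evalOneₐ (Ideal.span {(p : σ.GammaColim)}) y)
          = _
    rw [← hc, Ideal.Quotient.lift_mk]
  rw [h2, ← σ.toColim_hom i x, residueColim_toColim, residueColim_toColim]
  simp only [residueLevel, RingHom.comp_apply]
  rw [σ.residue_hom, map_pow]

theorem exists_residueTilt_eq (y : σ.GammaPerf) :
    ∃ x, σ.residueTilt x = σ.residuePerf y := by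
  choose r hr using σ.exists_residuePerf_pow
  set z : ℕ → σ.GammaPerf := fun n ↦ r^[n] y with hz
  have hz1 : ∀ n, σ.residuePerf (z (n + 1)) ^ p = σ.residuePerf (z n) := by
    intro n
    simp only [hz, Function.iterate_succ_apply']
    exact hr _
  have hz2 : ∀ n, σ.residuePerf (z n) ^ p ^ n = σ.residuePerf y := by
    intro n
    induction n with
    | zero => simp [hz]
    | succ n ih => rw [pow_succ', pow_mul, hz1, ih]
  let k := ramIndex p ϖ
  refine ⟨⟨fun n ↦ (Ideal.Quotient.mk _ (z (n + k)) : ModP σ.GammaPerf p) ^ p ^ k, ?_⟩, ?_⟩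
  · intro n
    change ((Ideal.Quotient.mk _ (z (n + 1 + k)) : ModP σ.GammaPerf p) ^ p ^ k) ^ p =
      (Ideal.Quotient.mk _ (z (n + k)) : ModP σ.GammaPerf p) ^ p ^ k
    rw [← pow_mul, mul_comm, pow_mul, ← sub_eq_zero, ← sub_pow_char_pow (p := p)]
    apply σ.pow_eq_zero_of_residueModP_eq_zero
    rw [map_sub, map_pow, residueModP_mk, residueModP_mk, add_right_comm, hz1, sub_self]
  · change σ.residueModP ((Ideal.Quotient.mk _ (z (0 + k)) : ModP σ.GammaPerf p) ^ p ^ k) = _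
    rw [map_pow, residueModP_mk, zero_add, hz2]

theorem algebraMap_perf (w : σ.WittPerf) :
    algebraMap σ.WittPerf σ.GammaPerf w = WittVector.fontaineTheta σ.GammaPerf p w := rfl

theorem residuePerf_algebraMap (w : σ.WittPerf) :
    σ.residuePerf (algebraMap σ.WittPerf σ.GammaPerf w) = σ.residueTilt (w.coeff 0) := by
  rw [algebraMap_perf, residue_compatible, WittVector.constantCoeff_apply, WittVector.map_coeff]
  rfl

theorem natCast_dvd_of_unifPerf_dvd {w : σ.WittPerf}
    (h : σ.unifPerf ∣ algebraMap σ.WittPerf σ.GammaPerf w) : (p : σ.WittPerf) ∣ w := by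
  rw [← σ.isResidueUniformizer_perf.dvd_iff, residuePerf_algebraMap,
    map_eq_zero_iff _ σ.residueTilt_injective, ← WittVector.mem_span_p_iff_coeff_zero_eq_zero,
    Ideal.mem_span_singleton] at h
  exact h

theorem exists_unifPerf_dvd_sub (y : σ.GammaPerf) :
    ∃ w : σ.WittPerf, σ.unifPerf ∣ y - algebraMap σ.WittPerf σ.GammaPerf w := by
  obtain ⟨x, hx⟩ := σ.exists_residueTilt_eq y
  refine ⟨WittVector.teichmuller p x, ?_⟩
  rw [← σ.isResidueUniformizer_perf.dvd_iff, map_sub, residuePerf_algebraMap,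
    WittVector.teichmuller_coeff_zero, hx, sub_self]

theorem exists_unifPerf_pow_dvd_sub_sum (n : ℕ) (y : σ.GammaPerf) :
    ∃ c : ℕ → σ.WittPerf, σ.unifPerf ^ n ∣ y - ∑ i ∈ Finset.range n, c i • σ.unifPerf ^ i := by
  induction n generalizing y with
  | zero => exact ⟨0, by simp⟩
  | succ n ih =>
    obtain ⟨w, z, hz⟩ := σ.exists_unifPerf_dvd_sub y
    obtain ⟨c, d, hd⟩ := ih z
    refine ⟨fun i ↦ Nat.casesOn i w c, d, ?_⟩
    rw [Finset.sum_range_succ']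
    simp only [pow_zero, pow_succ, Algebra.smul_def, mul_one]
    have h3 : ∑ i ∈ Finset.range n, algebraMap σ.WittPerf σ.GammaPerf (c i) *
        (σ.unifPerf ^ i * σ.unifPerf) = (∑ i ∈ Finset.range n, c i • σ.unifPerf ^ i) *
          σ.unifPerf := by
      rw [Finset.sum_mul]
      exact Finset.sum_congr rfl fun i _ ↦ by rw [Algebra.smul_def, mul_assoc]
    rw [h3]
    linear_combination hz + σ.unifPerf * hd

theorem natCast_smul_eq (c : σ.WittPerf) (x : σ.GammaPerf) :
    ((p : σ.WittPerf) * c) • x = (p : σ.GammaPerf) * (c • x) := by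
  rw [Algebra.smul_def, Algebra.smul_def, map_mul, map_natCast, mul_assoc]

theorem dvd_of_sum_smul_eq_zero {c : Fin (ramIndex p ϖ) → σ.WittPerf}
    (h : ∑ i, c i • σ.unifPerf ^ (i : ℕ) = 0) (i : Fin (ramIndex p ϖ)) :
    (p : σ.WittPerf) ∣ c i := by
  classical
  obtain ⟨j, hj⟩ := i
  induction j using Nat.strong_induction_on with
  | _ j ih =>
    apply σ.natCast_dvd_of_unifPerf_dvd
    rw [← Finset.add_sum_erase _ _ (Finset.mem_univ (⟨j, hj⟩ : Fin (ramIndex p ϖ)))] at h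
    have h1 : σ.unifPerf ^ (j + 1) ∣ ∑ i ∈ Finset.univ.erase (⟨j, hj⟩ : Fin (ramIndex p ϖ)),
        c i • σ.unifPerf ^ (i : ℕ) := by
      refine Finset.dvd_sum fun i hi ↦ ?_
      rcases lt_trichotomy (i : ℕ) j with hij | hij | hij
      · obtain ⟨d, hd⟩ := ih i hij i.2
        have : c i = p * d := hd
        rw [this, natCast_smul_eq]
        exact (σ.unifPerf_pow_dvd_natCast hj).mul_right _
      · exact absurd (Fin.ext hij) (Finset.ne_of_mem_erase hi)
      · rw [Algebra.smul_def]
        exact (pow_dvd_pow _ hij).mul_left _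
    rw [eq_neg_of_add_eq_zero_right h, dvd_neg] at h1
    obtain ⟨d, hd⟩ := h1
    refine ⟨d, ?_⟩
    apply σ.isResidueUniformizer_perf.mul_left_cancel_pow j
    rw [Algebra.smul_def, pow_succ] at hd
    linear_combination hd

theorem linearIndependent_unifPerf_pow : LinearIndependent σ.WittPerf
    (fun i : Fin (ramIndex p ϖ) ↦ σ.unifPerf ^ (i : ℕ)) := by
  rw [Fintype.linearIndependent_iff]
  have key : ∀ (n : ℕ) (c : Fin (ramIndex p ϖ) → σ.WittPerf),
      ∑ i, c i • σ.unifPerf ^ (i : ℕ) = 0 → ∀ i, (p : σ.WittPerf) ^ n ∣ c i := by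
    intro n
    induction n with
    | zero => intro c _ i; simp
    | succ n ih =>
      intro c hc i
      choose d hd using σ.dvd_of_sum_smul_eq_zero hc
      have h1 : ∑ i, d i • σ.unifPerf ^ (i : ℕ) = 0 := by
        simp_rw [hd, natCast_smul_eq] at hc
        rw [← Finset.mul_sum] at hc
        obtain ⟨v, hv⟩ := σ.exists_unit_natCast_perf
        rw [hv, mul_assoc, v.mul_right_eq_zero] at hc
        exact FrobeniusLift.IsResidueUniformizer.pow_regular σ.isResidueUniformizer_perf _ _ hc
      obtain ⟨f, hf⟩ := ih d h1 i
      exact ⟨f, by rw [hd, hf]; ring⟩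
  intro c hc i
  apply IsHausdorff.haus (I := Ideal.span {(p : σ.WittPerf)}) inferInstance
  intro n
  rw [SModEq.zero, smul_eq_mul, Ideal.mul_top, Ideal.span_singleton_pow, Ideal.mem_span_singleton]
  exact key n c hc i

theorem span_unifPerf_pow : ⊤ ≤ Submodule.span σ.WittPerf
    (Set.range (fun i : Fin (ramIndex p ϖ) ↦ σ.unifPerf ^ (i : ℕ))) := by
  intro y _
  have step : ∀ y : σ.GammaPerf, ∃ (c : Fin (ramIndex p ϖ) → σ.WittPerf) (z : σ.GammaPerf),
      y = ∑ i, c i • σ.unifPerf ^ (i : ℕ) + p * z := by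
    intro y
    obtain ⟨c, d, hd⟩ := σ.exists_unifPerf_pow_dvd_sub_sum (ramIndex p ϖ) y
    obtain ⟨f, hf⟩ := σ.natCast_dvd_unifPerf_pow
    refine ⟨fun i ↦ c i, f * d, ?_⟩
    rw [Fin.sum_univ_eq_sum_range (fun i ↦ c i • σ.unifPerf ^ i)]
    rw [hf] at hd
    linear_combination hd
  choose c r hr using step
  let z : ℕ → σ.GammaPerf := fun n ↦ r^[n] y
  let s : ℕ → Fin (ramIndex p ϖ) → σ.WittPerf :=
    fun n i ↦ ∑ m ∈ Finset.range n, (p : σ.WittPerf) ^ m * c (z m) i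
  have hs : ∀ n, y = ∑ i, s n i • σ.unifPerf ^ (i : ℕ) + p ^ n * z n := by
    intro n
    induction n with
    | zero => simp [s, z]
    | succ n ih =>
      have h1 := hr (z n)
      have h2 : r (z n) = z (n + 1) := by simp only [z, Function.iterate_succ_apply']
      rw [h2] at h1
      have h3 : ∑ i, s (n + 1) i • σ.unifPerf ^ (i : ℕ) = ∑ i, s n i • σ.unifPerf ^ (i : ℕ) +
          (p : σ.GammaPerf) ^ n * ∑ i, c (z n) i • σ.unifPerf ^ (i : ℕ) := by
        rw [Finset.mul_sum, ← Finset.sum_add_distrib]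
        refine Finset.sum_congr rfl fun i _ ↦ ?_
        simp only [s, Finset.sum_range_succ, add_smul]
        rw [Algebra.smul_def (_ * _), map_mul, map_pow, map_natCast, Algebra.smul_def (c (z n) i),
          mul_assoc]
      rw [h3]
      linear_combination ih + (p : σ.GammaPerf) ^ n * h1
  have hL : ∀ i, ∃ L : σ.WittPerf, ∀ n, (p : σ.WittPerf) ^ n ∣ s n i - L := by
    intro i
    obtain ⟨L, hL⟩ := IsPrecomplete.prec (I := Ideal.span {(p : σ.WittPerf)}) (M := σ.WittPerf)
      inferInstance (f := fun n ↦ s n i) (by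
        intro m n hmn
        rw [SModEq.sub_mem, smul_eq_mul, Ideal.mul_top, Ideal.span_singleton_pow,
          Ideal.mem_span_singleton, ← neg_sub, dvd_neg]
        simp only [s]
        rw [← Finset.sum_range_add_sum_Ico _ hmn, add_sub_cancel_left]
        exact Finset.dvd_sum fun j hj ↦ (pow_dvd_pow _ (Finset.mem_Ico.1 hj).1).mul_right _)
    refine ⟨L, fun n ↦ ?_⟩
    have := hL n
    rwa [SModEq.sub_mem, smul_eq_mul, Ideal.mul_top, Ideal.span_singleton_pow,
      Ideal.mem_span_singleton] at this
  choose L hL using hL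
  have : y = ∑ i, L i • σ.unifPerf ^ (i : ℕ) := by
    rw [← sub_eq_zero]
    apply IsHausdorff.haus (I := Ideal.span {(p : σ.GammaPerf)}) inferInstance
    intro n
    rw [SModEq.zero, smul_eq_mul, Ideal.mul_top, Ideal.span_singleton_pow,
      Ideal.mem_span_singleton]
    nth_rw 1 [hs n]
    rw [add_sub_right_comm, ← Finset.sum_sub_distrib]
    refine dvd_add (Finset.dvd_sum fun i _ ↦ ?_) (dvd_mul_right _ _)
    obtain ⟨d, hd⟩ := hL i n
    rw [← sub_smul, hd, Algebra.smul_def, map_mul, map_pow, map_natCast, mul_assoc]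
    exact dvd_mul_right _ _
  rw [this]
  exact Submodule.sum_mem _ fun i _ ↦
    Submodule.smul_mem _ _ (Submodule.subset_span (Set.mem_range_self i))

/-- `Γ^perf` is free over `W(k((t))^perf)`. -/
def perfBasis : Module.Basis (Fin (ramIndex p ϖ)) σ.WittPerf σ.GammaPerf :=
  Module.Basis.mk σ.linearIndependent_unifPerf_pow σ.span_unifPerf_pow

instance : Algebra (WittVector p (LaurentAlg (IsLocalRing.ResidueField O))) σ.GammaAlg :=
  inferInstanceAs (Algebra (WittVector p (LaurentAlg (IsLocalRing.ResidueField O)))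
    (WittVector p (LaurentAlg (IsLocalRing.ResidueField O)) ⊗[σ.WittPerf] σ.GammaPerf))

/-- `Γ^alg` is free over `W(k((t))^alg)`. -/
def algBasis : Module.Basis (Fin (ramIndex p ϖ))
    (WittVector p (LaurentAlg (IsLocalRing.ResidueField O))) σ.GammaAlg :=
  Algebra.TensorProduct.basis (WittVector p (LaurentAlg (IsLocalRing.ResidueField O))) σ.perfBasis

/-! ## `Γ^alg` is a complete discrete valuation ring -/

theorem unif_eq : σ.unif = σ.perfToAlg σ.unifPerf := rfl

theorem residueAlg_wittToAlg (w : WittVector p (LaurentAlg (IsLocalRing.ResidueField O))) :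
    σ.residueAlg (σ.wittToAlg w) = w.coeff 0 := by
  let := σ.algebraResidue
  refine (Algebra.TensorProduct.productMap_left_apply
    (A := WittVector p (LaurentAlg (IsLocalRing.ResidueField O))) (B := σ.GammaPerf)
    (R := σ.WittPerf) (S := LaurentAlg (IsLocalRing.ResidueField O)) _ _ w).trans ?_
  rfl

theorem residueAlg_perfToAlg (x : σ.GammaPerf) :
    σ.residueAlg (σ.perfToAlg x) = σ.residuePerf x := by
  let := σ.algebraResidue
  refine (Algebra.TensorProduct.productMap_right_apply
    (A := WittVector p (LaurentAlg (IsLocalRing.ResidueField O))) (B := σ.GammaPerf)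
    (R := σ.WittPerf) (S := LaurentAlg (IsLocalRing.ResidueField O)) _ _ x).trans ?_
  rfl

theorem residueAlg_teich (a : LaurentAlg (IsLocalRing.ResidueField O)) :
    σ.residueAlg (σ.teich a) = a := by
  rw [teich, residueAlg_wittToAlg, WittVector.teichmuller_coeff_zero]

theorem perfToAlg_algebraMap (w : σ.WittPerf) :
    σ.perfToAlg (algebraMap σ.WittPerf σ.GammaPerf w) = σ.wittToAlg (algebraMap σ.WittPerf _ w) := by
  have h1 := Algebra.TensorProduct.algebraMap_apply
    (A := WittVector p (LaurentAlg (IsLocalRing.ResidueField O))) (B := σ.GammaPerf)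
    (R := σ.WittPerf) (S := σ.WittPerf) w
  have h2 := Algebra.TensorProduct.algebraMap_apply'
    (A := WittVector p (LaurentAlg (IsLocalRing.ResidueField O))) (B := σ.GammaPerf)
    (R := σ.WittPerf) w
  exact h2.symm.trans h1

theorem exists_unit_natCast_alg : ∃ v : σ.GammaAlgˣ,
    ((p : ℕ) : σ.GammaAlg) = v * σ.unif ^ ramIndex p ϖ := by
  obtain ⟨v, hv⟩ := σ.exists_unit_natCast_perf
  refine ⟨Units.map σ.perfToAlg.toMonoidHom v, ?_⟩
  have := congrArg σ.perfToAlg hv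
  rw [map_natCast, map_mul, map_pow] at this
  exact this

theorem exists_natCast_alg_unit : ∃ v : σ.GammaAlgˣ,
    σ.unif ^ ramIndex p ϖ = v * ((p : ℕ) : σ.GammaAlg) := by
  obtain ⟨v, hv⟩ := σ.exists_unit_natCast_alg
  exact ⟨v⁻¹, by rw [hv, Units.inv_mul_cancel_left]⟩

theorem unif_dvd_natCast : σ.unif ∣ ((p : ℕ) : σ.GammaAlg) := by
  obtain ⟨v, hv⟩ := σ.exists_unit_natCast_alg
  rw [hv]
  exact (dvd_pow_self _ ramIndex_pos.ne').mul_left _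

theorem exists_unif_dvd_sub_wittToAlg (x : σ.GammaAlg) :
    ∃ w, σ.unif ∣ x - σ.wittToAlg w := by
  induction x using TensorProduct.induction_on with
  | zero => exact ⟨0, by rw [map_zero]; exact ⟨0, by rw [mul_zero]; exact sub_self _⟩⟩
  | tmul w y =>
    obtain ⟨c, z, hz⟩ := σ.exists_unifPerf_dvd_sub y
    refine ⟨w * algebraMap _ _ c, σ.wittToAlg w * σ.perfToAlg z, ?_⟩
    have h1 : (w ⊗ₜ[σ.WittPerf] y : WittVector p (LaurentAlg (IsLocalRing.ResidueField O))
        ⊗[σ.WittPerf] σ.GammaPerf) = (σ.wittToAlg w * σ.perfToAlg y : σ.GammaAlg) := by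
      refine Eq.trans ?_ (Algebra.TensorProduct.tmul_mul_tmul w (1 :
        WittVector p (LaurentAlg (IsLocalRing.ResidueField O))) (1 : σ.GammaPerf) y).symm
      rw [mul_one, one_mul]
    refine (congrArg (fun x : σ.GammaAlg ↦ x - σ.wittToAlg (w * algebraMap _ _ c)) h1).trans ?_
    have h2 := congrArg σ.perfToAlg hz
    rw [map_sub, map_mul, perfToAlg_algebraMap, ← unif_eq] at h2
    rw [map_mul]
    linear_combination σ.wittToAlg w * h2
  | add x y hx hy =>
    obtain ⟨w, hw⟩ := hx
    obtain ⟨v, hv⟩ := hy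
    refine ⟨w + v, ?_⟩
    rw [map_add]
    exact (dvd_add hw hv).trans (dvd_of_eq (sub_add_sub_comm (α := σ.GammaAlg) x _ y _))

theorem algBasis_repr_mul_natCast (n : ℕ) (x : σ.GammaAlg) (i : Fin (ramIndex p ϖ)) :
    σ.algBasis.repr (((p : ℕ) : σ.GammaAlg) ^ n * x) i = (p : WittVector p _) ^ n *
      σ.algBasis.repr x i := by
  have h : ((p : ℕ) : σ.GammaAlg) ^ n * x =
      ((p : WittVector p (LaurentAlg (IsLocalRing.ResidueField O))) ^ n) • x := by
    rw [Algebra.smul_def, map_pow, map_natCast]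
  rw [h, map_smul, Finsupp.smul_apply, smul_eq_mul]

theorem natCast_pow_dvd_alg_iff (n : ℕ) (x : σ.GammaAlg) :
    ((p : ℕ) : σ.GammaAlg) ^ n ∣ x ↔ ∀ i, (p : WittVector p _) ^ n ∣ σ.algBasis.repr x i := by
  constructor
  · rintro ⟨y, rfl⟩ i
    rw [algBasis_repr_mul_natCast]
    exact dvd_mul_right _ _
  · intro h
    choose c hc using h
    refine ⟨∑ i, c i • σ.algBasis i, ?_⟩
    apply σ.algBasis.repr.injective
    ext1 i
    rw [algBasis_repr_mul_natCast, hc, Module.Basis.repr_sum_self]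

theorem natCast_mul_alg_eq_zero {x : σ.GammaAlg} (h : ((p : ℕ) : σ.GammaAlg) * x = 0) : x = 0 := by
  apply σ.algBasis.repr.injective
  ext1 i
  have := σ.algBasis_repr_mul_natCast 1 x i
  rw [pow_one, h, pow_one, map_zero, Finsupp.zero_apply] at this
  rw [map_zero, Finsupp.zero_apply]
  exact WittVector.eq_zero_of_p_mul_eq_zero _ (by rw [mul_comm]; exact this.symm)

theorem isResidueUniformizer_alg : IsResidueUniformizer σ.residueAlg σ.unif where
  dvd_iff x := by
    constructor
    · intro hx
      obtain ⟨w, hw⟩ := σ.exists_unif_dvd_sub_wittToAlg x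
      have h0 : σ.residueAlg σ.unif = 0 := by
        rw [unif_eq, residueAlg_perfToAlg, (σ.isResidueUniformizer_perf.dvd_iff _).2 dvd_rfl]
      have h1 : σ.residueAlg (σ.wittToAlg w) = 0 := by
        obtain ⟨y, hy⟩ := hw
        have := congrArg σ.residueAlg hy
        rw [map_sub, hx, map_mul, h0, zero_mul, zero_sub, neg_eq_zero] at this
        exact this
      rw [residueAlg_wittToAlg, ← WittVector.mem_span_p_iff_coeff_zero_eq_zero,
        Ideal.mem_span_singleton] at h1
      have h2 := map_dvd σ.wittToAlg h1
      rw [map_natCast] at h2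
      simpa using dvd_add hw (σ.unif_dvd_natCast.trans h2)
    · rintro ⟨y, rfl⟩
      rw [map_mul, unif_eq, residueAlg_perfToAlg,
        (σ.isResidueUniformizer_perf.dvd_iff _).2 dvd_rfl, zero_mul]
  regular x hx := by
    apply σ.natCast_mul_alg_eq_zero
    obtain ⟨v, hv⟩ := σ.exists_unit_natCast_alg
    obtain ⟨n, hn⟩ := Nat.exists_eq_succ_of_ne_zero (ramIndex_pos (p := p) (ϖ := ϖ)).ne'
    rw [hv, hn, pow_succ]
    linear_combination (v * σ.unif ^ n) * hx

theorem unif_pow_ramIndex_mul_dvd_iff (n : ℕ) (x : σ.GammaAlg) :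
    σ.unif ^ (ramIndex p ϖ * n) ∣ x ↔ ((p : ℕ) : σ.GammaAlg) ^ n ∣ x := by
  obtain ⟨v, hv⟩ := σ.exists_natCast_alg_unit
  rw [pow_mul, hv, mul_pow, (v.isUnit.pow n).mul_left_dvd]

theorem eq_zero_of_forall_unif_pow_dvd {x : σ.GammaAlg} (h : ∀ n, σ.unif ^ n ∣ x) : x = 0 := by
  apply σ.algBasis.repr.injective
  ext1 i
  rw [map_zero, Finsupp.zero_apply]
  apply IsHausdorff.haus (I := Ideal.span {(p : WittVector p
    (LaurentAlg (IsLocalRing.ResidueField O)))}) inferInstance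
  intro n
  rw [SModEq.zero, smul_eq_mul, Ideal.mul_top, Ideal.span_singleton_pow, Ideal.mem_span_singleton]
  exact (σ.natCast_pow_dvd_alg_iff n x).1 ((σ.unif_pow_ramIndex_mul_dvd_iff n x).1 (h _)) i

theorem exists_limit_alg (f : ℕ → σ.GammaAlg) (hf : ∀ n, σ.unif ^ n ∣ f (n + 1) - f n) :
    ∃ L, ∀ n, σ.unif ^ n ∣ f n - L := by
  have hf' : ∀ m n, m ≤ n → σ.unif ^ m ∣ f n - f m := by
    intro m n hmn
    induction n, hmn using Nat.le_induction with
    | base => simp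
    | succ n hmn ih =>
      have := dvd_add ((pow_dvd_pow _ hmn).trans (hf n)) ih
      simpa using this
  let e := ramIndex p ϖ
  have he : 0 < e := ramIndex_pos
  have h1 : ∀ i, ∃ L : WittVector p (LaurentAlg (IsLocalRing.ResidueField O)),
      ∀ n, (p : WittVector p _) ^ n ∣ σ.algBasis.repr (f (e * n)) i - L := by
    intro i
    obtain ⟨L, hL⟩ := IsPrecomplete.prec (I := Ideal.span {(p : WittVector p
      (LaurentAlg (IsLocalRing.ResidueField O)))}) (M := WittVector p
      (LaurentAlg (IsLocalRing.ResidueField O)))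
      inferInstance (f := fun n ↦ σ.algBasis.repr (f (e * n)) i) (by
        intro m n hmn
        rw [SModEq.sub_mem, smul_eq_mul, Ideal.mul_top, Ideal.span_singleton_pow,
          Ideal.mem_span_singleton, ← neg_sub, dvd_neg]
        have h2 := hf' (e * m) (e * n) (Nat.mul_le_mul_left e hmn)
        rw [unif_pow_ramIndex_mul_dvd_iff, natCast_pow_dvd_alg_iff] at h2
        have h3 := h2 i
        rwa [map_sub, Finsupp.sub_apply] at h3)
    refine ⟨L, fun n ↦ ?_⟩
    have := hL n
    rwa [SModEq.sub_mem, smul_eq_mul, Ideal.mul_top, Ideal.span_singleton_pow,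
      Ideal.mem_span_singleton] at this
  choose L hL using h1
  refine ⟨∑ i, L i • σ.algBasis i, fun n ↦ ?_⟩
  have h2 : σ.unif ^ (e * n) ∣ f (e * n) - ∑ i, L i • σ.algBasis i := by
    rw [unif_pow_ramIndex_mul_dvd_iff, natCast_pow_dvd_alg_iff]
    intro i
    rw [map_sub, Finsupp.sub_apply, Module.Basis.repr_sum_self]
    exact hL i n
  have h3 : n ≤ e * n := Nat.le_mul_of_pos_left n he
  have := dvd_sub ((pow_dvd_pow _ h3).trans h2) (hf' n _ h3)
  simpa using this

@[simp] theorem teich_mul (a b : ResAlg O) : σ.teich (a * b) = σ.teich a * σ.teich b := by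
  simp [teich]

@[simp] theorem teich_one : σ.teich (1 : ResAlg O) = 1 := by simp [teich]

@[simp] theorem teich_zero : σ.teich (0 : ResAlg O) = 0 := by simp [teich]

theorem teich_pow (a : ResAlg O) (n : ℕ) : σ.teich (a ^ n) = σ.teich a ^ n := by simp [teich]

theorem unif_dvd_sub_teich (x : σ.GammaAlg) : σ.unif ∣ x - σ.teich (σ.residueAlg x) := by
  rw [← σ.isResidueUniformizer_alg.dvd_sub_iff, residueAlg_teich]

/-- `(x - [x̄]) / ϖ`. -/
def shift (x : σ.GammaAlg) : σ.GammaAlg := (σ.unif_dvd_sub_teich x).choose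

theorem eq_teich_add_shift (x : σ.GammaAlg) :
    x = σ.teich (σ.residueAlg x) + σ.unif * σ.shift x :=
  (sub_eq_iff_eq_add'.1 (σ.unif_dvd_sub_teich x).choose_spec)

/-- The coefficients of the Teichmüller expansion of an element of `Γ^alg`. -/
def coefA (x : σ.GammaAlg) (i : ℕ) : ResAlg O := σ.residueAlg (σ.shift^[i] x)

@[simp] theorem coefA_zero (x : σ.GammaAlg) : σ.coefA x 0 = σ.residueAlg x := rfl

@[simp] theorem coefA_shift (x : σ.GammaAlg) (i : ℕ) :
    σ.coefA (σ.shift x) i = σ.coefA x (i + 1) := rfl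

theorem unif_pow_dvd_mul {n : ℕ} {x : σ.GammaAlg} :
    σ.unif ^ (n + 1) ∣ σ.unif * x ↔ σ.unif ^ n ∣ x := by
  constructor
  · rintro ⟨y, hy⟩
    refine ⟨y, σ.isResidueUniformizer_alg.mul_left_cancel_pow 1 ?_⟩
    rw [pow_one, hy]
    ring
  · rintro ⟨y, rfl⟩
    exact ⟨y, by ring⟩

theorem sum_teich_succ (n : ℕ) (c : ℕ → ResAlg O) :
    ∑ i ∈ Finset.range (n + 1), σ.unif ^ i * σ.teich (c i) =
      σ.teich (c 0) + σ.unif * ∑ i ∈ Finset.range n, σ.unif ^ i * σ.teich (c (i + 1)) := by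
  rw [Finset.sum_range_succ', Finset.mul_sum, add_comm]
  simp only [pow_zero, one_mul, pow_succ]
  congr 1
  exact Finset.sum_congr rfl fun i _ ↦ by ring

theorem dvd_sub_sum_coefA (n : ℕ) (x : σ.GammaAlg) :
    σ.unif ^ n ∣ x - ∑ i ∈ Finset.range n, σ.unif ^ i * σ.teich (σ.coefA x i) := by
  induction n generalizing x with
  | zero => simp
  | succ n ih =>
    have h : x - ∑ i ∈ Finset.range (n + 1), σ.unif ^ i * σ.teich (σ.coefA x i) =
        σ.unif * (σ.shift x - ∑ i ∈ Finset.range n, σ.unif ^ i * σ.teich (σ.coefA (σ.shift x) i)) := by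
      rw [sum_teich_succ]
      simp only [coefA_zero, coefA_shift]
      linear_combination σ.eq_teich_add_shift x
    rw [h, unif_pow_dvd_mul]
    exact ih _

theorem coefA_eq_of_dvd {n : ℕ} {x : σ.GammaAlg} {c : ℕ → ResAlg O}
    (h : σ.unif ^ n ∣ x - ∑ i ∈ Finset.range n, σ.unif ^ i * σ.teich (c i)) :
    ∀ i < n, σ.coefA x i = c i := by
  induction n generalizing x c with
  | zero => simp
  | succ n ih =>
    rw [sum_teich_succ] at h
    have h0 : σ.residueAlg x = c 0 := by
      have h1 := (dvd_pow_self _ n.succ_ne_zero).trans h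
      rw [← σ.isResidueUniformizer_alg.dvd_sub_iff, map_add, map_mul,
        (σ.isResidueUniformizer_alg.dvd_iff σ.unif).2 dvd_rfl, zero_mul, add_zero,
        residueAlg_teich] at h1
      exact h1
    have h2 : x - (σ.teich (c 0) + σ.unif * ∑ i ∈ Finset.range n, σ.unif ^ i * σ.teich (c (i + 1)))
        = σ.unif * (σ.shift x - ∑ i ∈ Finset.range n, σ.unif ^ i * σ.teich (c (i + 1))) := by
      conv_lhs => rw [σ.eq_teich_add_shift x, h0]
      ring
    rw [h2, unif_pow_dvd_mul] at h
    intro i hi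
    cases i with
    | zero => exact h0
    | succ i => exact ih h i (by omega)

theorem coefA_congr {n : ℕ} {x y : σ.GammaAlg} (h : σ.unif ^ n ∣ x - y) {i : ℕ} (hi : i < n) :
    σ.coefA x i = σ.coefA y i := by
  refine σ.coefA_eq_of_dvd (n := n) ?_ i hi
  have := dvd_add h (σ.dvd_sub_sum_coefA n y)
  rwa [sub_add_sub_cancel] at this

theorem coefA_dvd {n : ℕ} {x y : σ.GammaAlg} (h : ∀ i < n, σ.coefA x i = σ.coefA y i) :
    σ.unif ^ n ∣ x - y := by
  have := dvd_sub (σ.dvd_sub_sum_coefA n x) (σ.dvd_sub_sum_coefA n y)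
  rwa [Finset.sum_congr rfl fun i hi ↦ by rw [h i (Finset.mem_range.1 hi)],
    sub_sub_sub_cancel_right] at this

theorem coefA_injective : Function.Injective σ.coefA := fun x y h ↦
  sub_eq_zero.1 (σ.eq_zero_of_forall_unif_pow_dvd fun n ↦ σ.coefA_dvd fun i _ ↦ by rw [h])

@[simp] theorem coefA_zero_left (i : ℕ) : σ.coefA 0 i = 0 :=
  σ.coefA_eq_of_dvd (n := i + 1) (c := 0) (by simp) i i.lt_succ_self

theorem shift_unif_mul (x : σ.GammaAlg) : σ.shift (σ.unif * x) = x := by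
  have h := σ.eq_teich_add_shift (σ.unif * x)
  rw [map_mul, (σ.isResidueUniformizer_alg.dvd_iff σ.unif).2 dvd_rfl, zero_mul, teich_zero,
    zero_add] at h
  exact (σ.isResidueUniformizer_alg.mul_left_cancel_pow 1 (by simpa using h)).symm

theorem coefA_unif_mul_succ (x : σ.GammaAlg) (i : ℕ) :
    σ.coefA (σ.unif * x) (i + 1) = σ.coefA x i := by
  rw [← coefA_shift, shift_unif_mul]

theorem coefA_unif_mul_zero (x : σ.GammaAlg) : σ.coefA (σ.unif * x) 0 = 0 :=
  (σ.isResidueUniformizer_alg.dvd_iff _).2 (dvd_mul_right _ _)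

theorem coefA_teich_add_unif_mul (a : ResAlg O) (x : σ.GammaAlg) :
    (σ.coefA (σ.teich a + σ.unif * x) 0 = a) ∧
      ∀ i, σ.coefA (σ.teich a + σ.unif * x) (i + 1) = σ.coefA x i := by
  have h0 : σ.residueAlg (σ.teich a + σ.unif * x) = a := by
    rw [map_add, map_mul, (σ.isResidueUniformizer_alg.dvd_iff σ.unif).2 dvd_rfl, zero_mul,
      add_zero, residueAlg_teich]
  refine ⟨h0, fun i ↦ ?_⟩
  rw [← coefA_shift]
  congr 1
  have h := σ.eq_teich_add_shift (σ.teich a + σ.unif * x)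
  rw [h0] at h
  exact (σ.isResidueUniformizer_alg.mul_left_cancel_pow 1 (by simpa using h)).symm

/-! ### Constants have coefficients of norm at most one -/

theorem emb_hom_pow (i j : ℕ) (x : GammaLaurent ϖ) :
    σ.emb (i + j) ((σ.hom ^ j) x) = σ.emb i x := by
  simp only [emb, RingHom.comp_apply, toColim_hom_pow]

theorem emb_const (i j : ℕ) (a : O) :
    σ.emb i (GammaLaurent.const ϖ a) = σ.emb (i + j) (GammaLaurent.const ϖ ((σ.base ^ j) a)) := by
  rw [← hom_pow_const, emb_hom_pow]

theorem exists_unit_emb_unif (i : ℕ) :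
    ∃ v : O, σ.emb i (GammaLaurent.const ϖ ϖ) = σ.emb i (GammaLaurent.const ϖ v) * σ.unif := by
  obtain ⟨v, hv⟩ := σ.exists_base_pow_unif i
  refine ⟨(v⁻¹ : Oˣ), ?_⟩
  rw [unif, σ.emb_const 0 i, zero_add, hv, ← map_mul, ← map_mul, ← mul_assoc, Units.inv_mul, one_mul]

theorem residueAlg_emb (i : ℕ) (x : GammaLaurent ϖ) :
    σ.residueAlg (σ.emb i x) = residueLevel (p := p) ϖ i x := by
  rw [emb, RingHom.comp_apply, RingHom.comp_apply, residueAlg_perfToAlg, residuePerf_colimToPerf,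
    residueColim_toColim]

theorem residueLevel_pow (i : ℕ) (x : GammaLaurent ϖ) :
    residueLevel (p := p) ϖ i x ^ p ^ i =
      algebraMap (LaurentSeries _) (ResAlg O) (GammaLaurent.residue ϖ x) := by
  simp only [residueLevel, RingHom.comp_apply]
  rw [← iterateFrobeniusEquiv_def (R := ResAlg O) p i]
  exact RingEquiv.apply_symm_apply _ _

theorem pow_dvd_pow_sub_pow {S : Type*} [CommRing S] {q : ℕ}
    {x y c : S} (hp : c ∣ (q : S)) (h : c ∣ x - y) (m : ℕ) :
    c ^ (m + 1) ∣ x ^ q ^ m - y ^ q ^ m := by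
  induction m with
  | zero => simpa using h
  | succ m ih =>
    rw [pow_succ q m, pow_mul, pow_mul, ← geom_sum₂_mul, pow_succ']
    refine mul_dvd_mul ?_ ih
    have h2 : c ∣ x ^ q ^ m - y ^ q ^ m := (dvd_pow_self c m.succ_ne_zero).trans ih
    let f : S →+* S ⧸ Ideal.span {c} := Ideal.Quotient.mk (Ideal.span {c})
    have hf : ∀ r : S, c ∣ r ↔ f r = 0 := fun r ↦ by
      rw [Ideal.Quotient.eq_zero_iff_mem, Ideal.mem_span_singleton]
    rw [hf, map_sub, sub_eq_zero] at h2
    rw [hf, RingHom.map_geom_sum₂, h2, geom_sum₂_self, mul_eq_zero_of_left]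
    rw [← map_natCast f, ← hf]
    exact hp

theorem exists_emb_const_step (i m : ℕ) (a : O) : ∃ j b,
    σ.unif ^ (m + 1) ∣ σ.emb i (GammaLaurent.const ϖ a) -
      (σ.teich (σ.residueAlg (σ.emb i (GammaLaurent.const ϖ a))) +
        σ.unif * σ.emb j (GammaLaurent.const ϖ b)) := by
  obtain ⟨c, hc⟩ : ϖ ∣ (σ.base ^ m) a - a ^ p ^ m := by
    rw [← residue_eq_zero_iff_dvd, map_sub, sub_eq_zero, map_pow]
    induction m with
    | zero => simp
    | succ m ih => rw [pow_succ', RingHom.mul_def, RingHom.comp_apply, residue_base, ih, pow_succ,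
        pow_mul]
  obtain ⟨v, hv⟩ := σ.exists_unit_emb_unif (i + m)
  refine ⟨i + m, v * c, ?_⟩
  have h1 : σ.emb i (GammaLaurent.const ϖ a) = σ.emb (i + m) (GammaLaurent.const ϖ a) ^ p ^ m +
      σ.unif * σ.emb (i + m) (GammaLaurent.const ϖ (v * c)) := by
    rw [σ.emb_const i m a, eq_add_of_sub_eq hc, map_add, map_add, map_mul, map_mul, hv, map_mul,
      map_mul, map_pow, map_pow]
    ring
  have h2 : σ.residueAlg (σ.emb i (GammaLaurent.const ϖ a)) =
      σ.residueAlg (σ.emb (i + m) (GammaLaurent.const ϖ a)) ^ p ^ m := by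
    rw [h1, map_add, map_mul, (σ.isResidueUniformizer_alg.dvd_iff σ.unif).2 dvd_rfl, zero_mul,
      add_zero, map_pow]
  rw [h2, teich_pow]
  conv_rhs => rw [h1]
  rw [add_sub_add_right_eq_sub]
  exact pow_dvd_pow_sub_pow σ.unif_dvd_natCast (σ.unif_dvd_sub_teich _) m

theorem lnorm_residueLevel_const_le (i : ℕ) (a : O) :
    lnorm (residueLevel (p := p) ϖ i (GammaLaurent.const ϖ a)) ≤ 1 := by
  have h := congrArg lnorm (residueLevel_pow (p := p) i (GammaLaurent.const ϖ a))
  rw [lnorm_pow, GammaLaurent.residue_const] at h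
  by_contra! h1
  have h2 := one_lt_pow₀ h1 (pow_pos (Fact.out : p.Prime).pos i).ne'
  rw [h] at h2
  by_cases h3 : IsLocalRing.residue O a = 0
  · rw [h3, map_zero, map_zero, lnorm_zero] at h2
    linarith
  · rw [lnorm_const h3] at h2
    exact lt_irrefl _ h2

theorem lnorm_coefA_emb_const_le (n i : ℕ) (a : O) :
    lnorm (σ.coefA (σ.emb i (GammaLaurent.const ϖ a)) n) ≤ 1 := by
  induction n generalizing i a with
  | zero => rw [coefA_zero, residueAlg_emb]; exact lnorm_residueLevel_const_le i a
  | succ n ih =>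
    obtain ⟨j, b, h⟩ := σ.exists_emb_const_step i (n + 1) a
    rw [σ.coefA_congr h (by omega), (σ.coefA_teich_add_unif_mul _ _).2]
    exact ih j b

/-! ### Sums of Teichmüller lifts -/

/-- The Witt vectors over the valuation ring of `k((t))^alg`. -/
def integers (O : Type u) [CommRing O] [IsLocalRing O] : Subring (ResAlg O) where
  carrier := {x | lnorm x ≤ 1}
  mul_mem' {x y} hx hy := by
    change lnorm (x * y) ≤ 1
    rw [lnorm_mul]
    exact mul_le_one₀ hx (lnorm_nonneg y) hy
  one_mem' := lnorm_one.le
  add_mem' hx hy := (lnorm_add_le _ _).trans (max_le hx hy)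
  zero_mem' := by simp
  neg_mem' {x} hx := by
    change lnorm (-x) ≤ 1
    rwa [lnorm_neg]

theorem lnorm_frobeniusEquiv_symm_le {x : ResAlg O} (hx : lnorm x ≤ 1) (n : ℕ) :
    lnorm (((_root_.frobeniusEquiv (ResAlg O) p).symm ^ n) x) ≤ 1 := by
  induction n with
  | zero => simpa
  | succ n ih =>
    rw [pow_succ', RingAut.mul_apply]
    set y := ((_root_.frobeniusEquiv (ResAlg O) p).symm ^ n) x
    have h : ((_root_.frobeniusEquiv (ResAlg O) p).symm y) ^ p = y := frobeniusEquiv_symm_pow_p _ _ _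
    have h1 := congrArg lnorm h
    rw [lnorm_pow] at h1
    by_contra! h2
    have h3 := one_lt_pow₀ h2 (Fact.out : p.Prime).ne_zero
    rw [h1] at h3
    exact absurd ih h3.not_ge

theorem exists_witt_sum (s : Multiset (ResAlg O)) (hs : ∀ a ∈ s, lnorm a ≤ 1) (N : ℕ) :
    ∃ e : ℕ → ResAlg O, (∀ n, lnorm (e n) ≤ 1) ∧
      (p : WittVector p (ResAlg O)) ^ (N + 1) ∣ (s.map (WittVector.teichmuller p)).sum -
        (WittVector.teichmuller p s.sum +
          ∑ n ∈ Finset.range N, p ^ (n + 1) * WittVector.teichmuller p (e n)) := by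
  have h1 : (s.map (WittVector.teichmuller p)).sum ∈
      (WittVector.map (p := p) (integers O).subtype).range := by
    refine Subring.multiset_sum_mem _ _ fun x hx ↦ ?_
    obtain ⟨a, ha, rfl⟩ := Multiset.mem_map.1 hx
    exact ⟨WittVector.teichmuller p ⟨a, hs a ha⟩, by rw [WittVector.map_teichmuller]; rfl⟩
  set w := (s.map (WittVector.teichmuller p)).sum with hw
  have h0 : w.coeff 0 = s.sum := by
    have : WittVector.constantCoeff w = s.sum := by
      rw [hw, map_multiset_sum, Multiset.map_map]
      simp [Function.comp_def, WittVector.constantCoeff_apply, WittVector.teichmuller_coeff_zero]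
    exact this
  have h2 : ∀ n, lnorm (w.coeff n) ≤ 1 := by
    obtain ⟨z, hz⟩ := h1
    intro n
    rw [← hz, WittVector.map_coeff]
    exact (z.coeff n).2
  refine ⟨fun n ↦ ((_root_.frobeniusEquiv (ResAlg O) p).symm ^ (n + 1)) (w.coeff (n + 1)),
    fun n ↦ lnorm_frobeniusEquiv_symm_le (h2 _) _, ?_⟩
  have h3 := WittVector.dvd_sub_sum_teichmuller_iterateFrobeniusEquiv_coeff w N
  rw [← Nat.range_succ_eq_Iic, Finset.sum_range_succ'] at h3
  simp only [pow_zero, mul_one, RingAut.one_apply, h0] at h3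
  rw [add_comm (∑ x ∈ _, _), Finset.sum_congr rfl fun _ _ ↦ mul_comm _ _] at h3
  exact h3

/-- The finite sums `∑ ϖ^i [a]` with `|a| ≤ φ i`. -/
def finSums (φ : ℕ → ℝ) : AddSubmonoid σ.GammaAlg :=
  AddSubmonoid.closure {x | ∃ (i : ℕ) (a : ResAlg O), lnorm a ≤ φ i ∧ x = σ.unif ^ i * σ.teich a}

theorem mem_finSums {φ : ℕ → ℝ} {i : ℕ} {a : ResAlg O} (h : lnorm a ≤ φ i) :
    σ.unif ^ i * σ.teich a ∈ σ.finSums φ := AddSubmonoid.subset_closure ⟨i, a, h, rfl⟩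

theorem teich_mem_finSums {φ : ℕ → ℝ} {a : ResAlg O} (h : lnorm a ≤ φ 0) :
    σ.teich a ∈ σ.finSums φ := by simpa using σ.mem_finSums h

theorem finSums_mono {φ ψ : ℕ → ℝ} (h : ∀ i, φ i ≤ ψ i) : σ.finSums φ ≤ σ.finSums ψ := by
  refine AddSubmonoid.closure_mono ?_
  rintro _ ⟨i, a, ha, rfl⟩
  exact ⟨i, a, ha.trans (h i), rfl⟩

theorem finSums_mul {φ ψ χ : ℕ → ℝ} (h : ∀ i j, φ i * ψ j ≤ χ (i + j))
    {x y : σ.GammaAlg} (hx : x ∈ σ.finSums φ) (hy : y ∈ σ.finSums ψ) : x * y ∈ σ.finSums χ := by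
  induction hx using AddSubmonoid.closure_induction with
  | zero => rw [zero_mul]; exact zero_mem _
  | add x z _ _ h1 h2 => rw [add_mul]; exact add_mem h1 h2
  | mem x hx =>
  obtain ⟨i, a, ha, rfl⟩ := hx
  induction hy using AddSubmonoid.closure_induction with
  | zero => rw [mul_zero]; exact zero_mem _
  | add x z _ _ h1 h2 => rw [mul_add]; exact add_mem h1 h2
  | mem y hy =>
    obtain ⟨j, b, hb, rfl⟩ := hy
    have : σ.unif ^ i * σ.teich a * (σ.unif ^ j * σ.teich b) =
        σ.unif ^ (i + j) * σ.teich (a * b) := by rw [teich_mul]; ring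
    rw [this]
    refine σ.mem_finSums ((lnorm_mul a b).trans_le ((mul_le_mul ha hb (lnorm_nonneg _)
      ((lnorm_nonneg a).trans ha)).trans (h i j)))

theorem finSums_split {φ : ℕ → ℝ} {x : σ.GammaAlg} (hx : x ∈ σ.finSums φ) :
    ∃ s : Multiset (ResAlg O), (∀ a ∈ s, lnorm a ≤ φ 0) ∧
      ∃ y ∈ σ.finSums (fun i ↦ φ (i + 1)), x = (s.map σ.teich).sum + σ.unif * y := by
  induction hx using AddSubmonoid.closure_induction with
  | mem x hx =>
    obtain ⟨i, a, ha, rfl⟩ := hx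
    cases i with
    | zero => exact ⟨{a}, by simpa using ha, 0, zero_mem _, by simp⟩
    | succ i =>
      exact ⟨0, by simp, _, σ.mem_finSums (φ := fun i ↦ φ (i + 1)) ha, by
        rw [Multiset.map_zero, Multiset.sum_zero]; ring⟩
  | zero => exact ⟨0, by simp, 0, zero_mem _, by simp⟩
  | add x y _ _ h1 h2 =>
    obtain ⟨s, hs, z, hz, rfl⟩ := h1
    obtain ⟨t, ht, w, hw, rfl⟩ := h2
    refine ⟨s + t, fun a ha ↦ (Multiset.mem_add.1 ha).elim (hs a) (ht a), z + w, add_mem hz hw, ?_⟩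
    rw [Multiset.map_add, Multiset.sum_add]
    ring

theorem exists_finSums_natCast (N : ℕ) :
    ∃ q ∈ σ.finSums (fun _ ↦ 1), σ.unif ^ N ∣ ((p : ℕ) : σ.GammaAlg) - σ.unif * q := by
  obtain ⟨v, hv⟩ := exists_natCast_eq_unit_mul_pow (p := p) (ϖ := ϖ)
  set b := σ.emb 0 (GammaLaurent.const ϖ (v : O)) with hb
  have h1 : ((p : ℕ) : σ.GammaAlg) = b * σ.unif ^ ramIndex p ϖ := by
    rw [hb, unif, ← map_pow, ← map_pow, ← map_mul, ← map_mul, ← hv, map_natCast, map_natCast]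
  obtain ⟨e, he⟩ : ∃ e, ramIndex p ϖ = e + 1 := ⟨_, (Nat.succ_pred_eq_of_pos ramIndex_pos).symm⟩
  refine ⟨∑ i ∈ Finset.range N, σ.unif ^ (e + i) * σ.teich (σ.coefA b i),
    sum_mem fun i _ ↦ σ.mem_finSums (σ.lnorm_coefA_emb_const_le _ _ _), ?_⟩
  have h2 := (σ.dvd_sub_sum_coefA N b).mul_left (σ.unif ^ (e + 1))
  rw [h1, he]
  refine h2.trans (dvd_of_eq ?_)
  rw [mul_sub, Finset.mul_sum, Finset.mul_sum]
  congr 1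
  · ring
  · exact Finset.sum_congr rfl fun i _ ↦ by ring

theorem finSums_one_pow {q : σ.GammaAlg} (hq : q ∈ σ.finSums (fun _ ↦ 1)) (n : ℕ) :
    q ^ n ∈ σ.finSums (fun _ ↦ 1) := by
  induction n with
  | zero => simpa using σ.teich_mem_finSums (φ := fun _ ↦ 1) lnorm_one.le
  | succ n ih => rw [pow_succ]; exact σ.finSums_mul (by simp) ih hq

theorem exists_teich_sum (s : Multiset (ResAlg O)) {C : ℝ} (hC : 0 ≤ C)
    (hs : ∀ a ∈ s, lnorm a ≤ C) (N : ℕ) :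
    ∃ a, lnorm a ≤ C ∧ ∃ z ∈ σ.finSums (fun _ ↦ C),
      σ.unif ^ (N + 1) ∣ (s.map σ.teich).sum - (σ.teich a + σ.unif * z) := by
  obtain ⟨c, hc, hcs⟩ : ∃ c : ResAlg O, lnorm c ≤ C ∧ ∀ a ∈ s, lnorm a ≤ lnorm c := by
    clear N
    induction s using Multiset.induction_on with
    | empty => exact ⟨0, by simpa, by simp⟩
    | cons b s ih =>
      obtain ⟨c, hc, hcs⟩ := ih fun a ha ↦ hs a (Multiset.mem_cons_of_mem ha)
      rcases le_total (lnorm b) (lnorm c) with h | h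
      · exact ⟨c, hc, fun a ha ↦ (Multiset.mem_cons.1 ha).elim (fun e ↦ e ▸ h) (hcs a)⟩
      · exact ⟨b, hs b (Multiset.mem_cons_self _ _),
          fun a ha ↦ (Multiset.mem_cons.1 ha).elim (fun e ↦ e ▸ le_rfl) fun h2 ↦ (hcs a h2).trans h⟩
  have hmul : ∀ a ∈ s, a = c * (c⁻¹ * a) := fun a ha ↦ by
    by_cases h : c = 0
    · have := hcs a ha
      rw [h, lnorm_zero] at this
      rw [lnorm_eq_zero.1 (le_antisymm this (lnorm_nonneg a)), mul_zero, mul_zero]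
    · rw [mul_inv_cancel_left₀ h]
  have hle : ∀ a ∈ s.map (c⁻¹ * ·), lnorm a ≤ 1 := by
    intro a ha
    obtain ⟨b, hb, rfl⟩ := Multiset.mem_map.1 ha
    rw [lnorm_mul, lnorm_inv]
    exact inv_mul_le_one_of_le₀ (hcs b hb) (lnorm_nonneg _)
  obtain ⟨e, he, hd⟩ := exists_witt_sum (p := p) _ hle N
  obtain ⟨q, hq, hqd⟩ := σ.exists_finSums_natCast (N + 1)
  refine ⟨c * (s.map (c⁻¹ * ·)).sum, ?_,
    ∑ n ∈ Finset.range N, σ.unif ^ n * q ^ (n + 1) * σ.teich (c * e n), ?_, ?_⟩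
  · rw [lnorm_mul]
    refine (mul_le_of_le_one_right (lnorm_nonneg c) ?_).trans hc
    exact Subring.multiset_sum_mem (integers O) _ hle
  · refine sum_mem fun n _ ↦ σ.finSums_mul (φ := fun _ ↦ 1) (ψ := fun _ ↦ C) (by simp)
      (σ.finSums_mul (φ := fun _ ↦ 1) (ψ := fun _ ↦ 1) (by simp) ?_ (σ.finSums_one_pow hq _))
      (σ.teich_mem_finSums ?_)
    · simpa using σ.mem_finSums (φ := fun _ ↦ 1) (i := n) (a := 1) lnorm_one.le
    · rw [lnorm_mul]
      exact (mul_le_of_le_one_right (lnorm_nonneg c) (he n)).trans hc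
  · have h1 := map_dvd σ.wittToAlg hd
    rw [map_pow, map_natCast, map_sub, map_add, map_multiset_sum, Multiset.map_map, map_sum,
      Multiset.map_map] at h1
    have h2 : σ.unif ^ (N + 1) ∣ ((p : ℕ) : σ.GammaAlg) ^ (N + 1) :=
      pow_dvd_pow_of_dvd σ.unif_dvd_natCast _
    have h3 := (h2.trans h1).mul_left (σ.teich c)
    have h4 : (s.map σ.teich).sum = σ.teich c * (s.map ((σ.wittToAlg ∘
        (WittVector.teichmuller p)) ∘ (c⁻¹ * ·))).sum := by
      rw [← Multiset.sum_map_mul_left]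
      congr 1
      refine Multiset.map_congr rfl fun a ha ↦ ?_
      conv_lhs => rw [hmul a ha, teich_mul]
      rfl
    have h5 : σ.unif ^ (N + 1) ∣ ∑ n ∈ Finset.range N, (((p : ℕ) : σ.GammaAlg) ^ (n + 1) -
        (σ.unif * q) ^ (n + 1)) * σ.teich (c * e n) :=
      Finset.dvd_sum fun n _ ↦ (hqd.trans (sub_dvd_pow_sub_pow _ _ _)).mul_right _
    have h6 := dvd_add h3 h5
    refine h6.trans (dvd_of_eq ?_)
    rw [h4, teich_mul]
    have h7 : ∀ x, σ.wittToAlg (WittVector.teichmuller p x) = σ.teich x := fun _ ↦ rfl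
    simp only [map_mul, map_pow, map_natCast, h7, teich_mul, sub_mul, Finset.sum_sub_distrib,
      Finset.mul_sum, mul_sub, mul_add]
    rw [Finset.sum_congr rfl fun (n : ℕ) _ ↦ show σ.teich c * ((p : σ.GammaAlg) ^ (n + 1) *
      σ.teich (e n)) = (p : σ.GammaAlg) ^ (n + 1) * (σ.teich c * σ.teich (e n)) by ring,
      Finset.sum_congr rfl fun (n : ℕ) _ ↦ show σ.unif * (σ.unif ^ n * q ^ (n + 1) *
      (σ.teich c * σ.teich (e n))) = (σ.unif * q) ^ (n + 1) * (σ.teich c * σ.teich (e n)) by ring]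
    ring

theorem finSums_step {φ : ℕ → ℝ} (hφ : Monotone φ) (h0 : 0 ≤ φ 0) {x : σ.GammaAlg}
    (hx : x ∈ σ.finSums φ) (N : ℕ) : ∃ a, lnorm a ≤ φ 0 ∧
      ∃ y ∈ σ.finSums (fun i ↦ φ (i + 1)), σ.unif ^ (N + 1) ∣ x - (σ.teich a + σ.unif * y) := by
  obtain ⟨s, hs, y, hy, rfl⟩ := σ.finSums_split hx
  obtain ⟨a, ha, z, hz, hd⟩ := σ.exists_teich_sum s h0 hs N
  refine ⟨a, ha, z + y, add_mem (σ.finSums_mono (fun i ↦ hφ (Nat.zero_le _)) hz) hy, ?_⟩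
  refine hd.trans (dvd_of_eq ?_)
  ring

theorem lnorm_coefA_le_of_finSums {φ : ℕ → ℝ} (hφ : Monotone φ) (h0 : 0 ≤ φ 0) {x : σ.GammaAlg}
    (hx : x ∈ σ.finSums φ) (n : ℕ) : lnorm (σ.coefA x n) ≤ φ n := by
  induction n generalizing φ x with
  | zero =>
    obtain ⟨a, ha, y, hy, hd⟩ := σ.finSums_step hφ h0 hx 0
    rwa [σ.coefA_congr hd zero_lt_one, (σ.coefA_teich_add_unif_mul _ _).1]
  | succ n ih =>
    obtain ⟨a, ha, y, hy, hd⟩ := σ.finSums_step hφ h0 hx (n + 1)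
    rw [σ.coefA_congr hd (by omega), (σ.coefA_teich_add_unif_mul _ _).2]
    exact ih (φ := fun i ↦ φ (i + 1)) (fun _ _ h ↦ hφ (by omega)) (h0.trans (hφ (Nat.zero_le _))) hy

theorem lnorm_coefA_le_of_approx {φ : ℕ → ℝ} (hφ : Monotone φ) (h0 : 0 ≤ φ 0) {x : σ.GammaAlg}
    (hx : ∀ N, ∃ y ∈ σ.finSums φ, σ.unif ^ N ∣ x - y) (n : ℕ) : lnorm (σ.coefA x n) ≤ φ n := by
  obtain ⟨y, hy, hd⟩ := hx (n + 1)
  rw [σ.coefA_congr hd (by omega)]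
  exact σ.lnorm_coefA_le_of_finSums hφ h0 hy n

theorem exists_finSums_approx {φ : ℕ → ℝ} {x : σ.GammaAlg} (hx : ∀ i, lnorm (σ.coefA x i) ≤ φ i)
    (N : ℕ) : ∃ y ∈ σ.finSums φ, σ.unif ^ N ∣ x - y :=
  ⟨_, sum_mem fun i _ ↦ σ.mem_finSums (hx i), σ.dvd_sub_sum_coefA N x⟩

theorem lnorm_coefA_add_le {φ : ℕ → ℝ} (hφ : Monotone φ) (h0 : 0 ≤ φ 0) {x y : σ.GammaAlg}
    (hx : ∀ i, lnorm (σ.coefA x i) ≤ φ i) (hy : ∀ i, lnorm (σ.coefA y i) ≤ φ i) (n : ℕ) :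
    lnorm (σ.coefA (x + y) n) ≤ φ n := by
  refine σ.lnorm_coefA_le_of_approx hφ h0 (fun N ↦ ?_) n
  obtain ⟨x', hx', hdx⟩ := σ.exists_finSums_approx hx N
  obtain ⟨y', hy', hdy⟩ := σ.exists_finSums_approx hy N
  exact ⟨x' + y', add_mem hx' hy', by rw [add_sub_add_comm]; exact dvd_add hdx hdy⟩

theorem lnorm_coefA_mul_le {φ ψ χ : ℕ → ℝ} (hχ : Monotone χ) (h0 : 0 ≤ χ 0)
    (h : ∀ i j, φ i * ψ j ≤ χ (i + j)) {x y : σ.GammaAlg}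
    (hx : ∀ i, lnorm (σ.coefA x i) ≤ φ i) (hy : ∀ i, lnorm (σ.coefA y i) ≤ ψ i) (n : ℕ) :
    lnorm (σ.coefA (x * y) n) ≤ χ n := by
  refine σ.lnorm_coefA_le_of_approx hχ h0 (fun N ↦ ?_) n
  obtain ⟨x', hx', hdx⟩ := σ.exists_finSums_approx hx N
  obtain ⟨y', hy', hdy⟩ := σ.exists_finSums_approx hy N
  refine ⟨x' * y', σ.finSums_mul h hx' hy', ?_⟩
  have := dvd_add (hdx.mul_right y) (hdy.mul_left x')
  refine this.trans (dvd_of_eq ?_)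
  ring

theorem lnorm_coefA_neg_le {φ : ℕ → ℝ} (hφ : Monotone φ) (h0 : 0 ≤ φ 0) {x : σ.GammaAlg}
    (hx : ∀ i, lnorm (σ.coefA x i) ≤ φ i) (n : ℕ) : lnorm (σ.coefA (-x) n) ≤ φ n := by
  refine σ.lnorm_coefA_le_of_approx hφ h0 (fun N ↦ ?_) n
  obtain ⟨x', hx', hdx⟩ := σ.exists_finSums_approx hx N
  refine ⟨(p ^ N - 1) • x', nsmul_mem hx' _, ?_⟩
  have h1 : (1 : ℕ) ≤ p ^ N := Nat.one_le_pow _ _ (Fact.out : p.Prime).pos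
  have h2 : σ.unif ^ N ∣ ((p : ℕ) : σ.GammaAlg) ^ N := pow_dvd_pow_of_dvd σ.unif_dvd_natCast _
  rw [nsmul_eq_mul, Nat.cast_sub h1]
  push_cast
  have := dvd_sub (dvd_neg.2 hdx) (h2.mul_right x')
  refine this.trans (dvd_of_eq ?_)
  ring

theorem vUnif_eq : vUnif p ϖ = 1 / (ramIndex p ϖ : ℝ) := rfl

theorem vUnif_pos : 0 < vUnif p ϖ := by
  rw [vUnif_eq]
  have : 0 < ramIndex p ϖ := ramIndex_pos
  positivity

/-- The norm of `ϖ`, i.e. `exp (-v_p(ϖ))`. -/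
def thet (p : ℕ) (ϖ : O) : ℝ := Real.exp (-vUnif p ϖ)

theorem thet_pos : 0 < thet p ϖ := Real.exp_pos _

theorem thet_lt_one : thet p ϖ < 1 := by
  rw [thet, Real.exp_lt_one_iff]
  exact neg_lt_zero.2 vUnif_pos

theorem thet_pow_pos (i : ℕ) : 0 < thet p ϖ ^ i := pow_pos thet_pos i

/-- The `i`-th term of the Gauss norm `|x|_s`. -/
def gterm (s : ℝ) (x : σ.GammaAlg) (i : ℕ) : ℝ := thet p ϖ ^ i * lnorm (σ.coefA x i) ^ s

/-- The Gauss norm `|x|_s` on `Γ^alg`. -/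
def gnorm (s : ℝ) (x : σ.GammaAlg) : ℝ := ⨆ i, σ.gterm s x i

/-- The elements whose Gauss terms at `s` tend to zero. -/
def IsGauss (s : ℝ) (x : σ.GammaAlg) : Prop := Tendsto (σ.gterm s x) atTop (𝓝 0)

theorem gterm_nonneg (s : ℝ) (x : σ.GammaAlg) (i : ℕ) : 0 ≤ σ.gterm s x i :=
  mul_nonneg (thet_pow_pos i).le (Real.rpow_nonneg (lnorm_nonneg _) _)

variable {σ}

theorem gnorm_nonneg {s : ℝ} {x : σ.GammaAlg} : 0 ≤ σ.gnorm s x :=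
  Real.iSup_nonneg fun i ↦ σ.gterm_nonneg s x i

theorem gnorm_le {s C : ℝ} {x : σ.GammaAlg} (h : ∀ i, σ.gterm s x i ≤ C) : σ.gnorm s x ≤ C :=
  ciSup_le h

theorem IsGauss.le_gnorm {s : ℝ} {x : σ.GammaAlg} (h : σ.IsGauss s x) (i : ℕ) :
    σ.gterm s x i ≤ σ.gnorm s x := le_ciSup h.bddAbove_range i

theorem IsGauss.gnorm_le_iff {s C : ℝ} {x : σ.GammaAlg} (h : σ.IsGauss s x) :
    σ.gnorm s x ≤ C ↔ ∀ i, σ.gterm s x i ≤ C := ⟨fun h1 i ↦ (h.le_gnorm i).trans h1, gnorm_le⟩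

theorem IsGauss.exists_eq {s : ℝ} {x : σ.GammaAlg} (h : σ.IsGauss s x) :
    ∃ i, σ.gterm s x i = σ.gnorm s x := by
  obtain ⟨i, hi⟩ := exists_forall_le_of_tendsto_zero (σ.gterm_nonneg s x) h
  exact ⟨i, le_antisymm (h.le_gnorm i) (gnorm_le hi)⟩

theorem gterm_eq_zero {s : ℝ} (hs : 0 < s) {x : σ.GammaAlg} {i : ℕ} :
    σ.gterm s x i = 0 ↔ σ.coefA x i = 0 := by
  rw [gterm, mul_eq_zero, Real.rpow_eq_zero (lnorm_nonneg _) hs.ne', lnorm_eq_zero]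
  exact or_iff_right (thet_pow_pos i).ne'

theorem gnorm_zero {s : ℝ} (hs : 0 < s) : σ.gnorm s 0 = 0 := by
  refine le_antisymm (gnorm_le fun i ↦ ?_) gnorm_nonneg
  rw [(gterm_eq_zero hs).2 (σ.coefA_zero_left i)]

theorem IsGauss.gnorm_eq_zero {s : ℝ} (hs : 0 < s) {x : σ.GammaAlg} (h : σ.IsGauss s x) :
    σ.gnorm s x = 0 ↔ x = 0 := by
  constructor
  · intro h0
    refine σ.coefA_injective (funext fun i ↦ ?_)
    rw [coefA_zero_left, ← gterm_eq_zero hs]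
    exact le_antisymm (h0 ▸ h.le_gnorm i) (σ.gterm_nonneg s x i)
  · rintro rfl
    exact gnorm_zero hs

theorem gterm_le_iff {s : ℝ} (hs : 0 < s) {x : σ.GammaAlg} {i : ℕ} {C : ℝ} (hC : 0 ≤ C) :
    σ.gterm s x i ≤ C ↔ lnorm (σ.coefA x i) ≤ (C / thet p ϖ ^ i) ^ s⁻¹ := by
  rw [gterm, ← le_div_iff₀' (thet_pow_pos i), Real.le_rpow_inv_iff_of_pos (lnorm_nonneg _)
    (div_nonneg hC (thet_pow_pos i).le) hs]

theorem monotone_bound {s : ℝ} (hs : 0 < s) {C : ℝ} (hC : 0 ≤ C) :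
    Monotone fun i : ℕ ↦ (C / thet p ϖ ^ i) ^ s⁻¹ := fun i j hij ↦
  Real.rpow_le_rpow (div_nonneg hC (thet_pow_pos i).le)
    (div_le_div_of_nonneg_left hC (thet_pow_pos j)
      (pow_le_pow_of_le_one thet_pos.le thet_lt_one.le hij)) (inv_nonneg.2 hs.le)

theorem gterm_add_le {s : ℝ} (hs : 0 < s) {x y : σ.GammaAlg} {C : ℝ}
    (hx : ∀ i, σ.gterm s x i ≤ C) (hy : ∀ i, σ.gterm s y i ≤ C) (i : ℕ) :
    σ.gterm s (x + y) i ≤ C := by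
  have hC : 0 ≤ C := (σ.gterm_nonneg s x 0).trans (hx 0)
  rw [gterm_le_iff hs hC]
  exact σ.lnorm_coefA_add_le (monotone_bound (p := p) (ϖ := ϖ) hs hC) (by positivity)
    (fun i ↦ (gterm_le_iff hs hC).1 (hx i)) (fun i ↦ (gterm_le_iff hs hC).1 (hy i)) i

theorem gterm_neg_le {s : ℝ} (hs : 0 < s) {x : σ.GammaAlg} {C : ℝ}
    (hx : ∀ i, σ.gterm s x i ≤ C) (i : ℕ) : σ.gterm s (-x) i ≤ C := by
  have hC : 0 ≤ C := (σ.gterm_nonneg s x 0).trans (hx 0)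
  rw [gterm_le_iff hs hC]
  exact σ.lnorm_coefA_neg_le (monotone_bound (p := p) (ϖ := ϖ) hs hC) (by positivity)
    (fun i ↦ (gterm_le_iff hs hC).1 (hx i)) i

theorem gterm_mul_le {s : ℝ} (hs : 0 < s) {x y : σ.GammaAlg} {C D : ℝ}
    (hx : ∀ i, σ.gterm s x i ≤ C) (hy : ∀ i, σ.gterm s y i ≤ D) (i : ℕ) :
    σ.gterm s (x * y) i ≤ C * D := by
  have hC : 0 ≤ C := (σ.gterm_nonneg s x 0).trans (hx 0)
  have hD : 0 ≤ D := (σ.gterm_nonneg s y 0).trans (hy 0)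
  rw [gterm_le_iff hs (mul_nonneg hC hD)]
  refine σ.lnorm_coefA_mul_le (monotone_bound (p := p) (ϖ := ϖ) hs (mul_nonneg hC hD)) (by positivity) (fun i j ↦ ?_)
    (fun i ↦ (gterm_le_iff hs hC).1 (hx i)) (fun i ↦ (gterm_le_iff hs hD).1 (hy i)) i
  rw [← Real.mul_rpow (div_nonneg hC (thet_pow_pos i).le) (div_nonneg hD (thet_pow_pos j).le),
    div_mul_div_comm, pow_add]

theorem lnorm_coefA_le_partialSups (x : σ.GammaAlg) (i : ℕ) :
    lnorm (σ.coefA x i) ≤ partialSups (fun j ↦ lnorm (σ.coefA x j)) i :=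
  le_partialSups (fun j ↦ lnorm (σ.coefA x j)) i

theorem partialSups_nonneg (x : σ.GammaAlg) (i : ℕ) :
    0 ≤ partialSups (fun j ↦ lnorm (σ.coefA x j)) i :=
  (lnorm_nonneg _).trans (lnorm_coefA_le_partialSups x i)

theorem IsGauss.tendsto_partialSups {s : ℝ} {x : σ.GammaAlg} (h : σ.IsGauss s x) :
    Tendsto (fun i ↦ thet p ϖ ^ i * partialSups (fun j ↦ lnorm (σ.coefA x j)) i ^ s)
      atTop (𝓝 0) := by
  refine tendsto_zero_of_le_max (thet_pos (p := p) (ϖ := ϖ)).le thet_lt_one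
    (fun i ↦ mul_nonneg (thet_pow_pos i).le (Real.rpow_nonneg (partialSups_nonneg x i) _))
    (fun i ↦ ?_) h
  rw [partialSups_add_one]
  rcases le_total (partialSups (fun j ↦ lnorm (σ.coefA x j)) i) (lnorm (σ.coefA x (i + 1)))
    with h1 | h1
  · rw [sup_eq_right.2 h1]
    exact le_max_right _ _
  · rw [sup_eq_left.2 h1, pow_succ', mul_assoc]
    exact le_max_left _ _

theorem isGauss_of_le {s : ℝ} (hs : 0 < s) {x : σ.GammaAlg} {φ : ℕ → ℝ}
    (h : ∀ i, lnorm (σ.coefA x i) ≤ φ i) (hφ : Tendsto (fun i ↦ thet p ϖ ^ i * φ i ^ s) atTop (𝓝 0)) :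
    σ.IsGauss s x :=
  squeeze_zero (σ.gterm_nonneg s x) (fun i ↦ mul_le_mul_of_nonneg_left
    (Real.rpow_le_rpow (lnorm_nonneg _) (h i) hs.le) (thet_pow_pos i).le) hφ

theorem IsGauss.add {s : ℝ} (hs : 0 < s) {x y : σ.GammaAlg} (hx : σ.IsGauss s x)
    (hy : σ.IsGauss s y) : σ.IsGauss s (x + y) := by
  set φ := partialSups (fun j ↦ lnorm (σ.coefA x j))
  set ψ := partialSups (fun j ↦ lnorm (σ.coefA y j))
  refine isGauss_of_le hs (φ := fun i ↦ max (φ i) (ψ i)) (fun i ↦ ?_) ?_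
  · exact σ.lnorm_coefA_add_le (fun i j hij ↦ max_le_max (φ.monotone hij) (ψ.monotone hij))
      (le_max_of_le_left (partialSups_nonneg x 0))
      (fun i ↦ le_max_of_le_left (lnorm_coefA_le_partialSups x i))
      (fun i ↦ le_max_of_le_right (lnorm_coefA_le_partialSups y i)) i
  · have := (hx.tendsto_partialSups).max (hy.tendsto_partialSups)
    rw [max_self] at this
    refine this.congr fun i ↦ ?_
    rw [← mul_max_of_nonneg _ _ (thet_pow_pos i).le,
      (Real.monotoneOn_rpow_Ici_of_exponent_nonneg hs.le).map_max (partialSups_nonneg x i)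
        (partialSups_nonneg y i)]

theorem IsGauss.neg {s : ℝ} (hs : 0 < s) {x : σ.GammaAlg} (hx : σ.IsGauss s x) :
    σ.IsGauss s (-x) :=
  isGauss_of_le hs (fun i ↦ σ.lnorm_coefA_neg_le (partialSups _).monotone
    (partialSups_nonneg x 0) (lnorm_coefA_le_partialSups x) i) (hx.tendsto_partialSups)

theorem IsGauss.mul {s : ℝ} (hs : 0 < s) {x y : σ.GammaAlg} (hx : σ.IsGauss s x)
    (hy : σ.IsGauss s y) : σ.IsGauss s (x * y) := by
  set φ := partialSups (fun j ↦ lnorm (σ.coefA x j)) with hφ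
  set ψ := partialSups (fun j ↦ lnorm (σ.coefA y j)) with hψ
  have hφ0 : ∀ i, 0 ≤ φ i := partialSups_nonneg x
  have hψ0 : ∀ i, 0 ≤ ψ i := partialSups_nonneg y
  let χ : ℕ → ℝ := fun n ↦ (Finset.HasAntidiagonal.antidiagonal n).sup' ⟨(0, n), by simp⟩
    fun ij ↦ φ ij.1 * ψ ij.2
  have hχ : ∀ i j, φ i * ψ j ≤ χ (i + j) := fun i j ↦
    Finset.le_sup' (fun ij : ℕ × ℕ ↦ φ ij.1 * ψ ij.2) (b := (i, j)) (by simp)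
  have hmono : Monotone χ := monotone_nat_of_le_succ fun n ↦ by
    refine Finset.sup'_le _ _ fun ij hij ↦ ?_
    refine (mul_le_mul_of_nonneg_right (φ.monotone (Nat.le_succ ij.1)) (hψ0 _)).trans ?_
    have := hχ (ij.1 + 1) ij.2
    rwa [show ij.1 + 1 + ij.2 = n + 1 by rw [Finset.HasAntidiagonal.mem_antidiagonal] at hij; omega] at this
  refine isGauss_of_le hs (σ.lnorm_coefA_mul_le hmono
    ((mul_nonneg (hφ0 0) (hψ0 0)).trans (hχ 0 0)) hχ (lnorm_coefA_le_partialSups x)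
    (lnorm_coefA_le_partialSups y)) ?_
  have h1 := hx.tendsto_partialSups
  have h2 := hy.tendsto_partialSups
  rw [← hφ] at h1
  rw [← hψ] at h2
  set a : ℕ → ℝ := fun i ↦ thet p ϖ ^ i * φ i ^ s
  set b : ℕ → ℝ := fun i ↦ thet p ϖ ^ i * ψ i ^ s
  have ha0 : ∀ i, 0 ≤ a i := fun i ↦ mul_nonneg (thet_pow_pos i).le (Real.rpow_nonneg (hφ0 i) _)
  have hb0 : ∀ i, 0 ≤ b i := fun i ↦ mul_nonneg (thet_pow_pos i).le (Real.rpow_nonneg (hψ0 i) _)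
  obtain ⟨A, hA⟩ := h1.bddAbove_range
  obtain ⟨B, hB⟩ := h2.bddAbove_range
  have hA' : ∀ i, a i ≤ A := fun i ↦ hA ⟨i, rfl⟩
  have hB' : ∀ i, b i ≤ B := fun i ↦ hB ⟨i, rfl⟩
  rw [Metric.tendsto_atTop]
  intro ε hε
  have hApos : 0 < |A| + |B| + 1 := by positivity
  obtain ⟨N1, hN1⟩ := (h1.eventually (gt_mem_nhds (div_pos hε hApos))).exists_forall_of_atTop
  obtain ⟨N2, hN2⟩ := (h2.eventually (gt_mem_nhds (div_pos hε hApos))).exists_forall_of_atTop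
  refine ⟨N1 + N2, fun n hn ↦ ?_⟩
  obtain ⟨ij, hij, he⟩ := Finset.exists_mem_eq_sup' (s := Finset.HasAntidiagonal.antidiagonal n) ⟨(0, n), by simp⟩
    (fun ij : ℕ × ℕ ↦ φ ij.1 * ψ ij.2)
  have he' : χ n = φ ij.1 * ψ ij.2 := he
  rw [Finset.HasAntidiagonal.mem_antidiagonal] at hij
  have h3 : thet p ϖ ^ n * χ n ^ s = a ij.1 * b ij.2 := by
    rw [he', Real.mul_rpow (hφ0 _) (hψ0 _), ← hij, pow_add]
    ring
  rw [h3, Real.dist_0_eq_abs, abs_of_nonneg (mul_nonneg (ha0 _) (hb0 _))]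
  have hC : ε / (|A| + |B| + 1) * (|A| + |B|) < ε := by
    rw [div_mul_eq_mul_div, div_lt_iff₀ hApos]
    nlinarith
  have hεC := (div_pos hε hApos).le
  rcases le_or_gt N1 ij.1 with h4 | h4
  · refine lt_of_le_of_lt (mul_le_mul (hN1 _ h4).le ((hB' _).trans (le_abs_self B)) (hb0 _)
      hεC) (lt_of_le_of_lt (mul_le_mul_of_nonneg_left ?_ hεC) hC)
    linarith [abs_nonneg A]
  · refine lt_of_le_of_lt (mul_le_mul ((hA' _).trans (le_abs_self A)) (hN2 _ (by omega)).le (hb0 _)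
      (abs_nonneg A)) (lt_of_le_of_lt ?_ hC)
    rw [mul_comm]
    exact mul_le_mul_of_nonneg_left (by linarith [abs_nonneg B]) hεC

theorem IsGauss.gnorm_add_le {s : ℝ} (hs : 0 < s) {x y : σ.GammaAlg} (hx : σ.IsGauss s x)
    (hy : σ.IsGauss s y) : σ.gnorm s (x + y) ≤ max (σ.gnorm s x) (σ.gnorm s y) :=
  gnorm_le (gterm_add_le hs (fun i ↦ (hx.le_gnorm i).trans (le_max_left _ _))
    (fun i ↦ (hy.le_gnorm i).trans (le_max_right _ _)))

theorem IsGauss.gnorm_neg {s : ℝ} (hs : 0 < s) {x : σ.GammaAlg} (hx : σ.IsGauss s x) :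
    σ.gnorm s (-x) = σ.gnorm s x := by
  refine le_antisymm (gnorm_le (gterm_neg_le hs hx.le_gnorm)) (gnorm_le ?_)
  have := gterm_neg_le hs (hx.neg hs).le_gnorm
  rwa [neg_neg] at this

theorem gterm_unif_mul_succ (s : ℝ) (x : σ.GammaAlg) (i : ℕ) :
    σ.gterm s (σ.unif * x) (i + 1) = thet p ϖ * σ.gterm s x i := by
  rw [gterm, gterm, coefA_unif_mul_succ, pow_succ']
  ring

theorem IsGauss.unif_mul {s : ℝ} {x : σ.GammaAlg} (hx : σ.IsGauss s x) :
    σ.IsGauss s (σ.unif * x) := by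
  rw [IsGauss, ← tendsto_add_atTop_iff_nat 1]
  simp only [gterm_unif_mul_succ]
  simpa using Tendsto.const_mul (thet p ϖ) hx

theorem IsGauss.gnorm_unif_mul {s : ℝ} (hs : 0 < s) {x : σ.GammaAlg} (hx : σ.IsGauss s x) :
    σ.gnorm s (σ.unif * x) = thet p ϖ * σ.gnorm s x := by
  refine le_antisymm (gnorm_le fun i ↦ ?_) ?_
  · cases i with
    | zero =>
      rw [(gterm_eq_zero hs).2 (σ.coefA_unif_mul_zero x)]
      exact mul_nonneg thet_pos.le gnorm_nonneg
    | succ i =>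
      rw [gterm_unif_mul_succ]
      exact mul_le_mul_of_nonneg_left (hx.le_gnorm i) thet_pos.le
  · obtain ⟨i, hi⟩ := hx.exists_eq
    rw [← hi, ← gterm_unif_mul_succ]
    exact hx.unif_mul.le_gnorm _

theorem IsGauss.unif_pow_mul {s : ℝ} (hs : 0 < s) {x : σ.GammaAlg} (hx : σ.IsGauss s x) (n : ℕ) :
    σ.IsGauss s (σ.unif ^ n * x) ∧ σ.gnorm s (σ.unif ^ n * x) = thet p ϖ ^ n * σ.gnorm s x := by
  induction n with
  | zero => simpa
  | succ n ih =>
    rw [pow_succ', mul_assoc, pow_succ', mul_assoc]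
    exact ⟨ih.1.unif_mul, by rw [ih.1.gnorm_unif_mul hs, ih.2]⟩

theorem coefA_teich_zero (a : ResAlg O) : σ.coefA (σ.teich a) 0 = a := σ.residueAlg_teich a

theorem coefA_teich_succ (a : ResAlg O) (i : ℕ) : σ.coefA (σ.teich a) (i + 1) = 0 := by
  have := (σ.coefA_teich_add_unif_mul a 0).2 i
  rwa [mul_zero, add_zero, coefA_zero_left] at this

theorem isGauss_teich {s : ℝ} (hs : 0 < s) (a : ResAlg O) : σ.IsGauss s (σ.teich a) := by
  rw [IsGauss, ← tendsto_add_atTop_iff_nat 1]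
  simp only [(gterm_eq_zero hs).2 (coefA_teich_succ a _)]
  exact tendsto_const_nhds

theorem gnorm_teich {s : ℝ} (hs : 0 < s) (a : ResAlg O) :
    σ.gnorm s (σ.teich a) = lnorm a ^ s := by
  have h0 : σ.gterm s (σ.teich a) 0 = lnorm a ^ s := by rw [gterm, coefA_teich_zero]; simp
  refine le_antisymm (gnorm_le fun i ↦ ?_) (h0 ▸ (isGauss_teich hs a).le_gnorm 0)
  cases i with
  | zero => exact h0.le
  | succ i =>
    rw [(gterm_eq_zero hs).2 (coefA_teich_succ a _)]
    exact Real.rpow_nonneg (lnorm_nonneg _) _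

theorem lnorm_residueAlg_le {s : ℝ} {x : σ.GammaAlg} (hx : σ.IsGauss s x) :
    lnorm (σ.residueAlg x) ^ s ≤ σ.gnorm s x := by
  have := hx.le_gnorm 0
  rwa [gterm, pow_zero, one_mul] at this

theorem coefA_iterate_shift (x : σ.GammaAlg) (n i : ℕ) :
    σ.coefA (σ.shift^[n] x) i = σ.coefA x (i + n) := by
  rw [coefA, ← Function.iterate_add_apply, coefA]

theorem eq_sum_add_iterate_shift (n : ℕ) (x : σ.GammaAlg) :
    x = ∑ i ∈ Finset.range n, σ.unif ^ i * σ.teich (σ.coefA x i) + σ.unif ^ n * σ.shift^[n] x := by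
  induction n with
  | zero => simp
  | succ n ih =>
    rw [Finset.sum_range_succ, Function.iterate_succ_apply']
    conv_lhs => rw [ih, σ.eq_teich_add_shift (σ.shift^[n] x)]
    rw [coefA]
    ring

theorem coefA_sum (n : ℕ) (c : ℕ → ResAlg O) (j : ℕ) :
    σ.coefA (∑ i ∈ Finset.range n, σ.unif ^ i * σ.teich (c i)) j = if j < n then c j else 0 := by
  induction n generalizing c j with
  | zero => simp
  | succ n ih =>
    rw [sum_teich_succ]
    cases j with
    | zero => rw [(σ.coefA_teich_add_unif_mul _ _).1]; simp
    | succ j => rw [(σ.coefA_teich_add_unif_mul _ _).2, ih]; simp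

theorem isGauss_of_coefA_eq_zero {s : ℝ} (hs : 0 < s) {x : σ.GammaAlg} {n : ℕ}
    (h : ∀ i ≥ n, σ.coefA x i = 0) : σ.IsGauss s x := by
  refine tendsto_const_nhds.congr' ?_
  filter_upwards [eventually_ge_atTop n] with i hi
  rw [(gterm_eq_zero hs).2 (h i hi)]

theorem isGauss_iterate_shift {s : ℝ} {x : σ.GammaAlg} (hx : σ.IsGauss s x) (n : ℕ) :
    σ.IsGauss s (σ.shift^[n] x) := by
  have h4 := (((tendsto_add_atTop_iff_nat n).2 hx).const_mul (thet p ϖ ^ n)⁻¹)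
  rw [mul_zero] at h4
  refine h4.congr fun i ↦ ?_
  rw [gterm, gterm, coefA_iterate_shift, pow_add]
  have := (thet_pow_pos (p := p) (ϖ := ϖ) n).ne'
  field_simp

/-- If the index `I` is the first one at which the norm is attained, then `x` is the sum of an
element of smaller norm and a multiple of `ϖ ^ I`. -/
theorem IsGauss.exists_split {s : ℝ} (hs : 0 < s) {x : σ.GammaAlg} (hx : σ.IsGauss s x)
    (h0 : x ≠ 0) : ∃ (I : ℕ) (y z : σ.GammaAlg), x = y + σ.unif ^ I * z ∧ σ.IsGauss s y ∧
      σ.IsGauss s z ∧ σ.gnorm s y < σ.gnorm s x ∧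
      σ.gnorm s x = thet p ϖ ^ I * lnorm (σ.residueAlg z) ^ s := by
  classical
  obtain ⟨I, hI, hmin⟩ : ∃ I, σ.gterm s x I = σ.gnorm s x ∧ ∀ i < I, σ.gterm s x i < σ.gnorm s x :=
    ⟨Nat.find hx.exists_eq, Nat.find_spec hx.exists_eq, fun i hi ↦
      (hx.le_gnorm i).lt_of_ne (Nat.find_min hx.exists_eq hi)⟩
  have hpos : 0 < σ.gnorm s x := gnorm_nonneg.lt_of_ne' (by rwa [ne_eq, hx.gnorm_eq_zero hs])
  have hyG : σ.IsGauss s (∑ i ∈ Finset.range I, σ.unif ^ i * σ.teich (σ.coefA x i)) :=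
    isGauss_of_coefA_eq_zero hs (n := I) fun i hi ↦ by rw [coefA_sum, if_neg hi.not_gt]
  refine ⟨I, _, _, eq_sum_add_iterate_shift I x, hyG, isGauss_iterate_shift hx I, ?_, hI.symm⟩
  obtain ⟨i, hi⟩ := hyG.exists_eq
  rw [← hi]
  by_cases h : i < I
  · rw [gterm, coefA_sum, if_pos h]
    exact hmin i h
  · rw [(gterm_eq_zero hs).2 (by rw [coefA_sum, if_neg h])]
    exact hpos

theorem IsGauss.gnorm_mul_le {s : ℝ} (hs : 0 < s) {x y : σ.GammaAlg} (hx : σ.IsGauss s x)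
    (hy : σ.IsGauss s y) : σ.gnorm s (x * y) ≤ σ.gnorm s x * σ.gnorm s y :=
  gnorm_le (gterm_mul_le hs hx.le_gnorm hy.le_gnorm)

theorem IsGauss.gnorm_mul {s : ℝ} (hs : 0 < s) {x y : σ.GammaAlg} (hx : σ.IsGauss s x)
    (hy : σ.IsGauss s y) : σ.gnorm s (x * y) = σ.gnorm s x * σ.gnorm s y := by
  refine le_antisymm (hx.gnorm_mul_le hs hy) ?_
  by_cases hx0 : x = 0
  · rw [hx0, zero_mul, gnorm_zero hs, zero_mul]
  by_cases hy0 : y = 0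
  · rw [hy0, mul_zero, gnorm_zero hs, mul_zero]
  have hxpos : 0 < σ.gnorm s x := gnorm_nonneg.lt_of_ne' (by rwa [ne_eq, hx.gnorm_eq_zero hs])
  have hypos : 0 < σ.gnorm s y := gnorm_nonneg.lt_of_ne' (by rwa [ne_eq, hy.gnorm_eq_zero hs])
  obtain ⟨I, x1, x2, hxe, hx1, hx2, hxlt, hxn⟩ := hx.exists_split hs hx0
  obtain ⟨J, y1, y2, hye, hy1, hy2, hylt, hyn⟩ := hy.exists_split hs hy0
  by_contra! hlt
  have h1 : σ.unif ^ (I + J) * (x2 * y2) = x * y + -(x1 * y + (x + -x1) * y1) := by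
    rw [hxe, hye]
    ring
  have hxx1 := hx.add hs (hx1.neg hs)
  have hg1 : σ.gnorm s (x + -x1) ≤ σ.gnorm s x := by
    refine (hx.gnorm_add_le hs (hx1.neg hs)).trans (max_le le_rfl ?_)
    rw [hx1.gnorm_neg hs]
    exact hxlt.le
  have hg2 : σ.gnorm s (x1 * y + (x + -x1) * y1) < σ.gnorm s x * σ.gnorm s y := by
    refine ((hx1.mul hs hy).gnorm_add_le hs (hxx1.mul hs hy1)).trans_lt (max_lt ?_ ?_)
    · exact (hx1.gnorm_mul_le hs hy).trans_lt (mul_lt_mul_of_pos_right hxlt hypos)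
    · exact (hxx1.gnorm_mul_le hs hy1).trans_lt (mul_lt_mul_of_le_of_lt_of_nonneg_of_pos hg1 hylt
        gnorm_nonneg hxpos)
  have hg3 := (hx1.mul hs hy).add hs (hxx1.mul hs hy1)
  have hg4 : σ.gnorm s (σ.unif ^ (I + J) * (x2 * y2)) < σ.gnorm s x * σ.gnorm s y := by
    rw [h1]
    refine ((hx.mul hs hy).gnorm_add_le hs (hg3.neg hs)).trans_lt (max_lt hlt ?_)
    rwa [hg3.gnorm_neg hs]
  rw [((hx2.mul hs hy2).unif_pow_mul hs (I + J)).2] at hg4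
  have hg5 := lnorm_residueAlg_le (hx2.mul hs hy2)
  rw [map_mul, lnorm_mul, Real.mul_rpow (lnorm_nonneg _) (lnorm_nonneg _)] at hg5
  have hg6 := mul_le_mul_of_nonneg_left hg5 (thet_pow_pos (p := p) (ϖ := ϖ) (I + J)).le
  refine absurd (hg6.trans_lt hg4) (not_lt.2 (le_of_eq ?_))
  rw [hxn, hyn, pow_add]
  ring

/-! ### Comparison of the norms for different parameters -/

theorem gterm_eq_rpow {s r : ℝ} (hr : 0 < r) (x : σ.GammaAlg) (i : ℕ) :
    σ.gterm s x i = (thet p ϖ ^ i) ^ (1 - s / r) * σ.gterm r x i ^ (s / r) := by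
  rw [gterm, gterm, Real.mul_rpow (thet_pow_pos i).le (Real.rpow_nonneg (lnorm_nonneg _) _),
    ← Real.rpow_mul (lnorm_nonneg _), ← mul_assoc, ← Real.rpow_add (thet_pow_pos i),
    mul_div_cancel₀ _ hr.ne', sub_add_cancel, Real.rpow_one]

theorem gterm_le_rpow {s r : ℝ} (hs : 0 < s) (hsr : s ≤ r) (x : σ.GammaAlg) (i : ℕ) :
    σ.gterm s x i ≤ σ.gterm r x i ^ (s / r) := by
  have hr := hs.trans_le hsr
  rw [gterm_eq_rpow hr]
  refine mul_le_of_le_one_left (Real.rpow_nonneg (σ.gterm_nonneg r x i) _) ?_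
  exact Real.rpow_le_one (thet_pow_pos i).le (pow_le_one₀ thet_pos.le thet_lt_one.le)
    (sub_nonneg.2 ((div_le_one hr).2 hsr))

theorem IsGauss.mono {s r : ℝ} (hs : 0 < s) (hsr : s ≤ r) {x : σ.GammaAlg} (hx : σ.IsGauss r x) :
    σ.IsGauss s x := by
  refine squeeze_zero (σ.gterm_nonneg s x) (gterm_le_rpow hs hsr x) ?_
  have := Tendsto.rpow_const (p := s / r) hx (Or.inr (div_pos hs (hs.trans_le hsr)).le)
  rwa [Real.zero_rpow (div_pos hs (hs.trans_le hsr)).ne'] at this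

theorem IsGauss.gnorm_le_rpow {s r : ℝ} (hs : 0 < s) (hsr : s ≤ r) {x : σ.GammaAlg}
    (hx : σ.IsGauss r x) : σ.gnorm s x ≤ σ.gnorm r x ^ (s / r) :=
  gnorm_le fun i ↦ (gterm_le_rpow hs hsr x i).trans (Real.rpow_le_rpow (σ.gterm_nonneg r x i)
    (hx.le_gnorm i) (div_pos hs (hs.trans_le hsr)).le)

/-- Log-convexity of the Gauss norms in the parameter. -/
theorem IsGauss.gnorm_le_rpow_mul_rpow {s t r a b : ℝ} (hs : 0 < s) (hr : 0 < r)
    {x : σ.GammaAlg} (hxs : σ.IsGauss s x) (hxr : σ.IsGauss r x) (ha : 0 ≤ a) (hb : 0 ≤ b)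
    (hab : a + b = 1) (ht : t = a * s + b * r) :
    σ.gnorm t x ≤ σ.gnorm s x ^ a * σ.gnorm r x ^ b := by
  refine gnorm_le fun i ↦ ?_
  have hpos : 0 ≤ lnorm (σ.coefA x i) := lnorm_nonneg _
  have h : σ.gterm t x i = σ.gterm s x i ^ a * σ.gterm r x i ^ b := by
    by_cases h0 : σ.coefA x i = 0
    · have ht0 : t ≠ 0 := by
        rw [ht]
        rcases ha.eq_or_lt with h | h
        · rw [← h] at hab ⊢
          rw [show b = 1 by linarith]
          simpa using hr.ne'
        · have := mul_pos h hs
          have := mul_nonneg hb hr.le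
          linarith
      simp only [gterm, h0, lnorm_zero, Real.zero_rpow ht0, Real.zero_rpow hs.ne',
        Real.zero_rpow hr.ne', mul_zero]
      rcases ha.eq_or_lt with h | h
      · rw [← h] at hab
        rw [show b = 1 by linarith]
        simp
      · rw [Real.zero_rpow h.ne', zero_mul]
    · have hl := lnorm_pos h0
      rw [gterm, gterm, gterm, Real.mul_rpow (thet_pow_pos i).le (Real.rpow_nonneg hpos _),
        Real.mul_rpow (thet_pow_pos i).le (Real.rpow_nonneg hpos _), ← Real.rpow_mul hpos,
        ← Real.rpow_mul hpos, mul_mul_mul_comm, ← Real.rpow_add (thet_pow_pos i), hab,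
        ← Real.rpow_add hl, ht, Real.rpow_one]
      congr 2
      ring
  rw [h]
  exact mul_le_mul (Real.rpow_le_rpow (σ.gterm_nonneg _ _ _) (hxs.le_gnorm i) ha)
    (Real.rpow_le_rpow (σ.gterm_nonneg _ _ _) (hxr.le_gnorm i) hb)
    (Real.rpow_nonneg (σ.gterm_nonneg _ _ _) _) (Real.rpow_nonneg gnorm_nonneg _)

variable (σ)

/-- The inclusion `Γ^alg → Γ^alg[1/p]`. -/
abbrev toP : σ.GammaAlg →+* σ.GammaAlgP := algebraMap σ.GammaAlg σ.GammaAlgP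

theorem toP_injective : Function.Injective σ.toP := by
  refine IsLocalization.injective (M := Submonoid.powers ((p : ℕ) : σ.GammaAlg)) _ ?_
  rintro _ ⟨n, rfl⟩
  refine pow_mem (mem_nonZeroDivisors_iff_right.2 fun x hx ↦ ?_) n
  exact σ.natCast_mul_alg_eq_zero (by rwa [mul_comm] at hx)

theorem isUnit_toP_natCast : IsUnit (σ.toP ((p : ℕ) : σ.GammaAlg)) :=
  IsLocalization.Away.algebraMap_isUnit _

theorem isUnit_toP_unif : IsUnit (σ.toP σ.unif) := by
  obtain ⟨v, hv⟩ := σ.exists_natCast_alg_unit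
  have h : IsUnit (σ.toP (σ.unif ^ ramIndex p ϖ)) := by
    rw [hv, map_mul]
    exact (v.isUnit.map σ.toP).mul σ.isUnit_toP_natCast
  rw [map_pow] at h
  exact (isUnit_pow_iff ramIndex_pos.ne').1 h

theorem exists_unif_pow_mul (x : σ.GammaAlgP) : ∃ (m : ℕ) (z : σ.GammaAlg),
    σ.toP (σ.unif ^ m) * x = σ.toP z := by
  obtain ⟨n, y, hy⟩ := IsLocalization.Away.surj ((p : ℕ) : σ.GammaAlg) x
  obtain ⟨v, hv⟩ := σ.exists_natCast_alg_unit
  refine ⟨ramIndex p ϖ * n, v ^ n * y, ?_⟩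
  rw [pow_mul, hv, mul_pow, map_mul, mul_assoc, map_mul, ← hy]
  rw [map_pow σ.toP (p : σ.GammaAlg), mul_comm (x : σ.GammaAlgP)]

variable {σ}

theorem coefA_unif_pow_mul (n : ℕ) (x : σ.GammaAlg) (i : ℕ) :
    σ.coefA (σ.unif ^ n * x) i = if i < n then 0 else σ.coefA x (i - n) := by
  induction n generalizing i with
  | zero => simp
  | succ n ih =>
    rw [pow_succ', mul_assoc]
    cases i with
    | zero => rw [coefA_unif_mul_zero]; simp
    | succ i =>
      rw [coefA_unif_mul_succ, ih]
      simp

/-- The coefficients `c i`, `i ∈ ℤ`, of `ϖ^(-m) z`. -/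
def coefShift (m : ℕ) (z : σ.GammaAlg) (i : ℤ) : ResAlg O :=
  if i < -(m : ℤ) then 0 else σ.coefA z (i + m).toNat

theorem coefShift_eq {m m' : ℕ} {z z' : σ.GammaAlg} (h : σ.unif ^ m' * z = σ.unif ^ m * z') :
    σ.coefShift m z = σ.coefShift m' z' := by
  have key : ∀ (m m' : ℕ) (z z' : σ.GammaAlg) (i : ℤ), -((m : ℤ) + m') ≤ i →
      σ.coefShift m z i = σ.coefA (σ.unif ^ m' * z) (i + m + m').toNat := by
    intro m m' z z' i hi
    rw [coefShift, coefA_unif_pow_mul]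
    by_cases h1 : i < -(m : ℤ)
    · rw [if_pos h1, if_pos (by omega)]
    · rw [if_neg h1, if_neg (by omega)]
      congr 1
      omega
  funext i
  by_cases hi : -((m : ℤ) + m') ≤ i
  · rw [key m m' z z' i hi, key m' m z' z i (by omega), h]
    congr 1
    omega
  · rw [coefShift, coefShift, if_pos (by omega), if_pos (by omega)]

theorem isTeichExpansion_coefShift {m : ℕ} {z : σ.GammaAlg} {x : σ.GammaAlgP}
    (h : σ.toP (σ.unif ^ m) * x = σ.toP z) : σ.IsTeichExpansion x (σ.coefShift m z) := by
  refine ⟨m, fun i hi ↦ if_pos hi, fun N ↦ ?_⟩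
  obtain ⟨y, hy⟩ := σ.dvd_sub_sum_coefA N z
  refine ⟨y, ?_⟩
  rw [h, ← map_sub, ← hy]
  congr 2
  refine Finset.sum_congr rfl fun i _ ↦ ?_
  rw [coefShift, if_neg (by omega)]
  simp

theorem IsTeichExpansion.exists_eq {x : σ.GammaAlgP} {c : ℤ → ResAlg O}
    (h : σ.IsTeichExpansion x c) :
    ∃ m z, σ.toP (σ.unif ^ m) * x = σ.toP z ∧ c = σ.coefShift m z := by
  obtain ⟨m, hm, h⟩ := h
  obtain ⟨z, hz⟩ := h 0
  simp only [Finset.range_zero, Finset.sum_empty, map_zero, sub_zero, pow_zero, one_mul] at hz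
  refine ⟨m, z, hz, funext fun i ↦ ?_⟩
  rw [coefShift]
  split_ifs with hi
  · exact hm i hi
  · rw [σ.coefA_eq_of_dvd (n := (i + m).toNat + 1) (c := fun i ↦ c ((i : ℤ) - m)) ?_ _
      (Nat.lt_succ_self _)]
    · congr 1
      omega
    · obtain ⟨y, hy⟩ := h ((i + m).toNat + 1)
      refine ⟨y, σ.toP_injective ?_⟩
      rw [← hy, hz, map_sub]

theorem teichCoeff_eq {m : ℕ} {z : σ.GammaAlg} {x : σ.GammaAlgP}
    (h : σ.toP (σ.unif ^ m) * x = σ.toP z) : σ.teichCoeff x = σ.coefShift m z := by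
  have h1 : σ.IsTeichExpansion x (σ.teichCoeff x) :=
    Classical.epsilon_spec (p := σ.IsTeichExpansion x) ⟨_, isTeichExpansion_coefShift h⟩
  obtain ⟨m', z', h2, h3⟩ := h1.exists_eq
  rw [h3]
  refine coefShift_eq (σ.toP_injective ?_)
  rw [map_mul, map_mul, ← h, ← h2]
  ring

/-! ### Comparison of `w` with the Gauss norm -/

theorem coe_le_coe_mul_add_iff {s C D : ℝ} (hs : 0 < s) (E : EReal) :
    (C : EReal) ≤ (s : EReal) * E + (D : EReal) ↔ (((C - D) / s : ℝ) : EReal) ≤ E := by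
  induction E with
  | bot => rw [EReal.coe_mul_bot_of_pos hs, EReal.bot_add]; simp
  | top => rw [EReal.coe_mul_top_of_pos hs, EReal.top_add_coe]; simp
  | coe E =>
    rw [← EReal.coe_mul, ← EReal.coe_add, EReal.coe_le_coe_iff, EReal.coe_le_coe_iff,
      div_le_iff₀ hs]
    constructor <;> intro h <;> linarith

theorem coe_le_laurentVal_iff {k : Type u} [Field k] (C : ℝ) (x : LaurentAlg k) :
    (C : EReal) ≤ laurentVal x ↔ lnorm x ≤ Real.exp (-C) := by
  by_cases hx : x = 0
  · rw [hx, laurentVal_zero, lnorm_zero]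
    simp [Real.exp_nonneg]
  · rw [laurentVal_eq hx, EReal.coe_le_coe_iff, le_neg, Real.log_le_iff_le_exp (lnorm_pos hx)]

theorem coe_le_lineVal_iff {s : ℝ} (hs : 0 < s) (C : ℝ) (l : ℤ) (x : σ.GammaAlgP) :
    (C : EReal) ≤ σ.lineVal s l x ↔
      ∀ i ≤ l, thet p ϖ ^ l * lnorm (σ.teichCoeff x i) ^ s ≤ Real.exp (-C) := by
  rw [lineVal, coe_le_coe_mul_add_iff hs, partialVal, le_iInf₂_iff]
  refine forall₂_congr fun i _ ↦ ?_
  rw [coe_le_laurentVal_iff, thet, ← Real.rpow_intCast, ← Real.exp_mul, ← le_div_iff₀' (Real.exp_pos _), ← Real.exp_sub,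
    ← Real.le_rpow_inv_iff_of_pos (lnorm_nonneg _) (Real.exp_pos _).le hs, ← Real.exp_mul]
  have : -((C - l * vUnif p ϖ) / s) = (-C - -vUnif p ϖ * l) * s⁻¹ := by
    field_simp
    ring
  rw [this]

theorem thet_zpow_anti {i l : ℤ} (h : i ≤ l) : thet p ϖ ^ l ≤ thet p ϖ ^ i :=
  zpow_le_zpow_right_of_le_one₀ thet_pos thet_lt_one.le h

theorem coe_le_w_iff {s : ℝ} (hs : 0 < s) (C : ℝ) (x : σ.GammaAlgP) :
    (C : EReal) ≤ σ.w s x ↔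
      ∀ i, thet p ϖ ^ i * lnorm (σ.teichCoeff x i) ^ s ≤ Real.exp (-C) := by
  rw [w, le_iInf_iff]
  simp only [coe_le_lineVal_iff hs]
  exact ⟨fun h i ↦ h i i le_rfl, fun h l i hi ↦ (mul_le_mul_of_nonneg_right (thet_zpow_anti hi)
    (Real.rpow_nonneg (lnorm_nonneg _) _)).trans (h i)⟩

theorem coefShift_zero (z : σ.GammaAlg) (i : ℕ) : σ.coefShift 0 z i = σ.coefA z i := by
  rw [coefShift, if_neg (by simp)]
  simp

theorem teichCoeff_toP (z : σ.GammaAlg) : σ.teichCoeff (σ.toP z) = σ.coefShift 0 z :=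
  teichCoeff_eq (by simp)

theorem tendsto_lineVal_iff {r : ℝ} (hr : 0 < r) (x : σ.GammaAlg) :
    Tendsto (fun l : ℕ ↦ σ.lineVal r l (σ.toP x)) atTop (𝓝 ⊤) ↔ σ.IsGauss r x := by
  constructor
  · intro h
    rw [EReal.tendsto_nhds_top_iff_real] at h
    rw [IsGauss, Metric.tendsto_atTop]
    intro ε hε
    obtain ⟨N, hN⟩ := (h (-Real.log (ε / 2))).exists_forall_of_atTop
    refine ⟨N, fun n hn ↦ ?_⟩
    have h1 := (coe_le_lineVal_iff hr _ _ _).1 (hN n hn).le n le_rfl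
    rw [neg_neg, Real.exp_log (half_pos hε), teichCoeff_toP, coefShift_zero, zpow_natCast] at h1
    rw [Real.dist_0_eq_abs, abs_of_nonneg (σ.gterm_nonneg _ _ _)]
    exact lt_of_le_of_lt h1 (half_lt_self hε)
  · intro h
    rw [EReal.tendsto_nhds_top_iff_real]
    intro C
    filter_upwards [(h.tendsto_partialSups).eventually
      (ge_mem_nhds (Real.exp_pos (-(C + 1))))] with l hl
    refine lt_of_lt_of_le (EReal.coe_lt_coe_iff.2 (lt_add_one C))
      ((coe_le_lineVal_iff hr _ _ _).2 fun i hi ↦ ?_)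
    rw [teichCoeff_toP]
    by_cases h0 : 0 ≤ i
    · lift i to ℕ using h0
      rw [coefShift_zero, zpow_natCast]
      refine le_trans (mul_le_mul_of_nonneg_left (Real.rpow_le_rpow (lnorm_nonneg _)
        (le_partialSups_of_le (fun j ↦ lnorm (σ.coefA x j)) (by exact_mod_cast hi)) hr.le)
        (thet_pow_pos _).le) hl
    · rw [coefShift, if_pos (by simpa using h0), lnorm_zero, Real.zero_rpow hr.ne', mul_zero]
      exact (Real.exp_pos _).le

variable (σ) in
/-- The subring of elements of `Γ^alg` whose Gauss terms at `s` tend to zero. -/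
def gaussSubring {s : ℝ} (hs : 0 < s) : Subring σ.GammaAlg where
  carrier := {x | σ.IsGauss s x}
  mul_mem' := fun hx hy ↦ IsGauss.mul hs hx hy
  one_mem' := by
    have := isGauss_teich (σ := σ) hs 1
    rwa [teich_one] at this
  add_mem' := fun hx hy ↦ IsGauss.add hs hx hy
  zero_mem' := by
    have := isGauss_teich (σ := σ) hs 0
    rwa [teich_zero] at this
  neg_mem' := fun hx ↦ IsGauss.neg hs hx

theorem mem_GammaAlgR {r : ℝ} (hr : 0 < r) {x : σ.GammaAlg} :
    x ∈ σ.GammaAlgR r ↔ σ.IsGauss r x := by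
  have : σ.GammaAlgR r = σ.gaussSubring hr := by
    have h : {x : σ.GammaAlg | Tendsto (fun l : ℕ ↦ σ.lineVal r l (σ.toP x)) atTop (𝓝 ⊤)} =
        (σ.gaussSubring hr : Set σ.GammaAlg) := Set.ext fun x ↦ tendsto_lineVal_iff hr x
    exact (congrArg Subring.closure h).trans (Subring.closure_eq (σ.gaussSubring hr))
  rw [this]
  rfl

/-! ### The Gauss norms on `Γ^alg[1/p]` -/

variable (σ) in
/-- The elements of `Γ^alg[1/p]` whose Gauss terms tend to zero. -/
def IsGaussP (s : ℝ) (x : σ.GammaAlgP) : Prop :=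
  ∃ (m : ℕ) (z : σ.GammaAlg), σ.IsGauss s z ∧ σ.toP (σ.unif ^ m) * x = σ.toP z

variable (σ) in
/-- The Gauss norm on `Γ^alg[1/p]`. -/
def pnorm (s : ℝ) (x : σ.GammaAlgP) : ℝ :=
  σ.gnorm s (σ.exists_unif_pow_mul x).choose_spec.choose /
    thet p ϖ ^ (σ.exists_unif_pow_mul x).choose

theorem isGauss_of_unif_pow_mul {s : ℝ} {n : ℕ} {x : σ.GammaAlg}
    (h : σ.IsGauss s (σ.unif ^ n * x)) : σ.IsGauss s x := by
  have h4 := (((tendsto_add_atTop_iff_nat n).2 h).const_mul (thet p ϖ ^ n)⁻¹)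
  rw [mul_zero] at h4
  refine h4.congr fun i ↦ ?_
  rw [gterm, gterm, coefA_unif_pow_mul, if_neg (by omega), pow_add, Nat.add_sub_cancel]
  have := (thet_pow_pos (p := p) (ϖ := ϖ) n).ne'
  field_simp

theorem gnorm_div_eq {s : ℝ} (hs : 0 < s) {m m' : ℕ} {z z' : σ.GammaAlg} {x : σ.GammaAlgP}
    (hz : σ.IsGauss s z) (h : σ.toP (σ.unif ^ m) * x = σ.toP z)
    (h' : σ.toP (σ.unif ^ m') * x = σ.toP z') :
    σ.IsGauss s z' ∧ σ.gnorm s z / thet p ϖ ^ m = σ.gnorm s z' / thet p ϖ ^ m' := by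
  have h1 : σ.unif ^ m' * z = σ.unif ^ m * z' := by
    apply σ.toP_injective
    rw [map_mul, map_mul, ← h, ← h']
    ring
  have h2 := hz.unif_pow_mul hs m'
  have hz' : σ.IsGauss s z' := isGauss_of_unif_pow_mul (h1 ▸ h2.1)
  refine ⟨hz', ?_⟩
  rw [h1, (hz'.unif_pow_mul hs m).2] at h2
  rw [div_eq_div_iff (thet_pow_pos _).ne' (thet_pow_pos _).ne', mul_comm, ← h2.2, mul_comm]

theorem pnorm_eq {s : ℝ} (hs : 0 < s) {m : ℕ} {z : σ.GammaAlg} {x : σ.GammaAlgP}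
    (hz : σ.IsGauss s z) (h : σ.toP (σ.unif ^ m) * x = σ.toP z) :
    σ.pnorm s x = σ.gnorm s z / thet p ϖ ^ m :=
  (gnorm_div_eq hs hz h (σ.exists_unif_pow_mul x).choose_spec.choose_spec).2.symm

theorem pnorm_nonneg (s : ℝ) (x : σ.GammaAlgP) : 0 ≤ σ.pnorm s x :=
  div_nonneg gnorm_nonneg (thet_pow_pos _).le

theorem pnorm_toP {s : ℝ} (hs : 0 < s) {z : σ.GammaAlg} (hz : σ.IsGauss s z) :
    σ.pnorm s (σ.toP z) = σ.gnorm s z := by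
  rw [pnorm_eq hs (m := 0) hz (by simp), pow_zero, div_one]

theorem exists_common {s : ℝ} (hs : 0 < s) {x y : σ.GammaAlgP} (hx : σ.IsGaussP s x)
    (hy : σ.IsGaussP s y) : ∃ (m : ℕ) (z t : σ.GammaAlg), σ.IsGauss s z ∧ σ.IsGauss s t ∧
      σ.toP (σ.unif ^ m) * x = σ.toP z ∧ σ.toP (σ.unif ^ m) * y = σ.toP t := by
  obtain ⟨m, z, hz, h⟩ := hx
  obtain ⟨n, t, ht, h'⟩ := hy
  refine ⟨m + n, σ.unif ^ n * z, σ.unif ^ m * t, (hz.unif_pow_mul hs n).1,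
    (ht.unif_pow_mul hs m).1, ?_, ?_⟩
  · rw [map_mul, ← h, pow_add, map_mul]; ring
  · rw [map_mul, ← h', pow_add, map_mul]; ring

theorem IsGaussP.add {s : ℝ} (hs : 0 < s) {x y : σ.GammaAlgP} (hx : σ.IsGaussP s x)
    (hy : σ.IsGaussP s y) : σ.IsGaussP s (x + y) ∧
      σ.pnorm s (x + y) ≤ max (σ.pnorm s x) (σ.pnorm s y) := by
  obtain ⟨m, z, t, hz, ht, h1, h2⟩ := exists_common hs hx hy
  have h3 : σ.toP (σ.unif ^ m) * (x + y) = σ.toP (z + t) := by rw [mul_add, h1, h2, map_add]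
  refine ⟨⟨m, z + t, hz.add hs ht, h3⟩, ?_⟩
  rw [pnorm_eq hs hz h1, pnorm_eq hs ht h2, pnorm_eq hs (hz.add hs ht) h3,
    max_div_div_right (thet_pow_pos m).le]
  exact div_le_div_of_nonneg_right (hz.gnorm_add_le hs ht) (thet_pow_pos m).le

theorem IsGaussP.mul {s : ℝ} (hs : 0 < s) {x y : σ.GammaAlgP} (hx : σ.IsGaussP s x)
    (hy : σ.IsGaussP s y) : σ.IsGaussP s (x * y) ∧
      σ.pnorm s (x * y) = σ.pnorm s x * σ.pnorm s y := by
  obtain ⟨m, z, t, hz, ht, h1, h2⟩ := exists_common hs hx hy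
  have h3 : σ.toP (σ.unif ^ (m + m)) * (x * y) = σ.toP (z * t) := by
    rw [map_mul, ← h1, ← h2, pow_add, map_mul]
    ring
  refine ⟨⟨_, z * t, hz.mul hs ht, h3⟩, ?_⟩
  rw [pnorm_eq hs hz h1, pnorm_eq hs ht h2, pnorm_eq hs (hz.mul hs ht) h3, hz.gnorm_mul hs ht,
    div_mul_div_comm, pow_add]

theorem IsGaussP.neg {s : ℝ} (hs : 0 < s) {x : σ.GammaAlgP} (hx : σ.IsGaussP s x) :
    σ.IsGaussP s (-x) ∧ σ.pnorm s (-x) = σ.pnorm s x := by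
  obtain ⟨m, z, hz, h⟩ := hx
  have h3 : σ.toP (σ.unif ^ m) * (-x) = σ.toP (-z) := by rw [mul_neg, h, map_neg]
  exact ⟨⟨m, -z, hz.neg hs, h3⟩, by rw [pnorm_eq hs hz h, pnorm_eq hs (hz.neg hs) h3,
    hz.gnorm_neg hs]⟩

theorem IsGaussP.sub {s : ℝ} (hs : 0 < s) {x y : σ.GammaAlgP} (hx : σ.IsGaussP s x)
    (hy : σ.IsGaussP s y) : σ.IsGaussP s (x - y) ∧
      σ.pnorm s (x - y) ≤ max (σ.pnorm s x) (σ.pnorm s y) := by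
  have := hx.add hs (hy.neg hs).1
  rwa [(hy.neg hs).2, ← sub_eq_add_neg] at this

theorem pnorm_zero {s : ℝ} (hs : 0 < s) : σ.pnorm s 0 = 0 := by
  have := pnorm_toP hs (σ.gaussSubring hs).zero_mem
  rwa [map_zero, gnorm_zero hs] at this

theorem IsGaussP.mono {s r : ℝ} (hs : 0 < s) (hsr : s ≤ r) {x : σ.GammaAlgP}
    (hx : σ.IsGaussP r x) : σ.IsGaussP s x := by
  obtain ⟨m, z, hz, h⟩ := hx
  exact ⟨m, z, hz.mono hs hsr, h⟩

theorem IsGaussP.coe_le_w_iff {s : ℝ} (hs : 0 < s) (C : ℝ) {x : σ.GammaAlgP}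
    (hx : σ.IsGaussP s x) : (C : EReal) ≤ σ.w s x ↔ σ.pnorm s x ≤ Real.exp (-C) := by
  obtain ⟨m, z, hz, h⟩ := hx
  rw [FrobeniusLift.coe_le_w_iff hs, teichCoeff_eq h, pnorm_eq hs hz h,
    div_le_iff₀ (thet_pow_pos m), hz.gnorm_le_iff]
  constructor
  · intro h1 i
    have h2 := h1 ((i : ℤ) - m)
    rw [coefShift, if_neg (by omega), zpow_sub₀ thet_pos.ne', zpow_natCast, zpow_natCast,
      div_mul_eq_mul_div, div_le_iff₀ (thet_pow_pos m), sub_add_cancel, Int.toNat_natCast] at h2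
    exact h2
  · intro h1 i
    rw [coefShift]
    split_ifs with hi
    · rw [lnorm_zero, Real.zero_rpow hs.ne', mul_zero]
      exact (Real.exp_pos _).le
    · have h2 := h1 (i + m).toNat
      rw [← div_le_iff₀ (thet_pow_pos m)] at h2
      refine le_trans (le_of_eq ?_) h2
      rw [gterm, mul_div_right_comm, ← zpow_natCast, Int.toNat_of_nonneg (by omega),
        zpow_add₀ thet_pos.ne', zpow_natCast, mul_div_cancel_right₀ _ (thet_pow_pos m).ne']

theorem tendsto_w_iff {ι : Type*} {l : Filter ι} {s : ℝ} (hs : 0 < s) {x : ι → σ.GammaAlgP}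
    (hx : ∀ i, σ.IsGaussP s (x i)) :
    Tendsto (fun i ↦ σ.w s (x i)) l (𝓝 ⊤) ↔ Tendsto (fun i ↦ σ.pnorm s (x i)) l (𝓝 0) := by
  rw [EReal.tendsto_nhds_top_iff_real, Metric.tendsto_nhds]
  constructor
  · intro h ε hε
    filter_upwards [h (-Real.log (ε / 2))] with i hi
    have h1 := ((hx i).coe_le_w_iff hs _).1 hi.le
    rw [neg_neg, Real.exp_log (half_pos hε)] at h1
    rw [Real.dist_0_eq_abs, abs_of_nonneg (pnorm_nonneg _ _)]
    exact h1.trans_lt (half_lt_self hε)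
  · intro h C
    filter_upwards [h _ (Real.exp_pos (-(C + 1)))] with i hi
    rw [Real.dist_0_eq_abs, abs_of_nonneg (pnorm_nonneg _ _)] at hi
    exact lt_of_lt_of_le (EReal.coe_lt_coe_iff.2 (lt_add_one C))
      (((hx i).coe_le_w_iff hs _).2 hi.le)

theorem IsGaussP.pnorm_le_rpow_mul_rpow {s t r a b : ℝ} (hs : 0 < s) (hst : s ≤ t) (htr : t ≤ r)
    {x : σ.GammaAlgP} (hx : σ.IsGaussP r x) (ha : 0 ≤ a) (hb : 0 ≤ b)
    (hab : a + b = 1) (ht : t = a * s + b * r) :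
    σ.pnorm t x ≤ σ.pnorm s x ^ a * σ.pnorm r x ^ b := by
  have ht0 := hs.trans_le hst
  obtain ⟨m, z, hz, h⟩ := hx
  rw [pnorm_eq hs (hz.mono hs (hst.trans htr)) h, pnorm_eq (ht0.trans_le htr) hz h,
    pnorm_eq ht0 (hz.mono ht0 htr) h, Real.div_rpow gnorm_nonneg (thet_pow_pos m).le,
    Real.div_rpow gnorm_nonneg (thet_pow_pos m).le, div_mul_div_comm,
    ← Real.rpow_add (thet_pow_pos m), hab, Real.rpow_one]
  exact div_le_div_of_nonneg_right ((hz.mono hs (hst.trans htr)).gnorm_le_rpow_mul_rpow hs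
    (ht0.trans_le htr) hz ha hb hab ht) (thet_pow_pos m).le

end FrobeniusLift

end Coefficients

section Levelwise

variable {O : Type u} [CommRing O] [IsDomain O] [IsDiscreteValuationRing O] {ϖ : O}
  [hϖ : Fact (Irreducible ϖ)]

namespace GammaLaurent

theorem evalₐ_eq_zero_iff (N : ℕ) (x : GammaLaurent ϖ) :
    AdicCompletion.evalₐ (laurentIdeal ϖ) N x = 0 ↔ const ϖ ϖ ^ N ∣ x := by
  constructor
  · intro h
    induction N generalizing x with
    | zero => exact ⟨x, by rw [pow_zero, one_mul]⟩
    | succ N ih =>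
      have h1 : AdicCompletion.evalₐ (laurentIdeal ϖ) 1 x = 0 :=
        AdicCompletion.evalₐ_eq_zero_of_le (by omega) h
      have h2 : AdicCompletion.evalOneₐ (laurentIdeal ϖ) x = 0 := by
        rw [← AdicCompletion.factorₐ_evalₐ_one, h1, map_zero]
      have hdvd : const ϖ ϖ ∣ x := AdicCompletion.dvd_of_evalOneₐ_eq_zero h2
      obtain ⟨y, rfl⟩ := hdvd
      have hconst : AdicCompletion.evalₐ (laurentIdeal ϖ) (N + 1) (const ϖ ϖ) =
          Ideal.Quotient.mk (laurentIdeal ϖ ^ (N + 1)) (HahnSeries.C ϖ) :=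
        AdicCompletion.evalₐ_algebraMap _ _ _
      have h3 : AdicCompletion.evalₐ (laurentIdeal ϖ) N y = 0 := by
        obtain ⟨g, hg⟩ := Ideal.Quotient.mk_surjective
          (AdicCompletion.evalₐ (laurentIdeal ϖ) (N + 1) y)
        have h4 : Ideal.Quotient.mk (laurentIdeal ϖ ^ (N + 1)) (HahnSeries.C ϖ * g) = 0 := by
          rw [map_mul, hg, ← hconst, ← map_mul, h]
        rw [Ideal.Quotient.eq_zero_iff_mem, laurentIdeal, Ideal.span_singleton_pow,
          Ideal.mem_span_singleton, pow_succ'] at h4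
        obtain ⟨e, he⟩ := h4
        have h5 : HahnSeries.C ϖ * (g - HahnSeries.C ϖ ^ N * e) = 0 := by
          linear_combination he
        have h6 := HahnSeries.C_mul_eq_zero_of_isDomain hϖ.out.ne_zero _ h5
        have h7 : AdicCompletion.evalₐ (laurentIdeal ϖ) (N + 1) (y - of ϖ g) = 0 := by
          rw [map_sub, ← hg, of, AdicCompletion.evalₐ_algebraMap, sub_self]
        have h8 := AdicCompletion.evalₐ_eq_zero_of_le N.le_succ h7
        rw [map_sub, sub_eq_zero] at h8
        rw [h8, of, AdicCompletion.evalₐ_algebraMap, Ideal.Quotient.eq_zero_iff_mem, laurentIdeal,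
          Ideal.span_singleton_pow, Ideal.mem_span_singleton]
        exact ⟨e, by linear_combination h6⟩
      obtain ⟨z, hz⟩ := ih y h3
      exact ⟨z, by rw [hz, ← mul_assoc, ← pow_succ']⟩
  · rintro ⟨y, rfl⟩
    rw [map_mul, ← map_pow, const, RingHom.comp_apply, of, AdicCompletion.evalₐ_algebraMap]
    have : Ideal.Quotient.mk (laurentIdeal ϖ ^ N) (HahnSeries.C (ϖ ^ N)) = 0 := by
      rw [Ideal.Quotient.eq_zero_iff_mem, laurentIdeal, Ideal.span_singleton_pow,
        Ideal.mem_span_singleton, map_pow]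
    rw [this, zero_mul]

theorem evalₐ_eq_mk_iff (N : ℕ) (x : GammaLaurent ϖ) (f : LaurentSeries O) :
    AdicCompletion.evalₐ (laurentIdeal ϖ) N x = Ideal.Quotient.mk (laurentIdeal ϖ ^ N) f ↔
      const ϖ ϖ ^ N ∣ x - of ϖ f := by
  rw [← evalₐ_eq_zero_iff, map_sub, sub_eq_zero, of, AdicCompletion.evalₐ_algebraMap]

theorem exists_of_dvd_sub (N : ℕ) (x : GammaLaurent ϖ) :
    ∃ f : LaurentSeries O, const ϖ ϖ ^ N ∣ x - of ϖ f := by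
  obtain ⟨f, hf⟩ := Ideal.Quotient.mk_surjective (AdicCompletion.evalₐ (laurentIdeal ϖ) N x)
  exact ⟨f, (evalₐ_eq_mk_iff N x f).1 hf.symm⟩

theorem dvd_coeff_of_dvd_of {N : ℕ} {f : LaurentSeries O} (h : const ϖ ϖ ^ N ∣ of ϖ f) (i : ℤ) :
    ϖ ^ N ∣ f.coeff i := by
  rw [← evalₐ_eq_zero_iff, of, AdicCompletion.evalₐ_algebraMap, Ideal.Quotient.eq_zero_iff_mem,
    laurentIdeal, Ideal.span_singleton_pow, Ideal.mem_span_singleton, ← map_pow] at h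
  obtain ⟨g, rfl⟩ := h
  rw [HahnSeries.C_mul_eq_smul, HahnSeries.coeff_smul]
  exact ⟨_, rfl⟩

theorem dvd_of_of_dvd_coeff {N : ℕ} {f : LaurentSeries O} (h : ∀ i, ϖ ^ N ∣ f.coeff i) :
    const ϖ ϖ ^ N ∣ of ϖ f := by
  obtain ⟨g, rfl⟩ := HahnSeries.exists_C_mul_of_dvd_coeff f h
  exact ⟨of ϖ g, by rw [map_mul, ← map_pow]; rfl⟩

theorem mem_levelNhd_iff {n : ℕ} {c : ℤ} {x : GammaLaurent ϖ} : x ∈ levelNhd ϖ n c ↔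
    ∃ f : LaurentSeries O, (∀ i ≤ c, f.coeff i = 0) ∧ const ϖ ϖ ^ (n + 1) ∣ x - of ϖ f := by
  classical
  constructor
  · intro h
    obtain ⟨f, hf⟩ := exists_of_dvd_sub (n + 1) x
    have hdvd : ∀ i ≤ c, ϖ ^ (n + 1) ∣ f.coeff i := by
      intro i hi
      obtain ⟨g, hg, hgi⟩ := h i hi
      rw [evalₐ_eq_mk_iff] at hg
      have h1 : const ϖ ϖ ^ (n + 1) ∣ of ϖ (f - g) := by
        rw [map_sub, ← sub_sub_sub_cancel_left _ _ x]
        exact dvd_sub hg hf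
      have h2 := dvd_coeff_of_dvd_of h1 i
      rw [HahnSeries.coeff_sub] at h2
      simpa using dvd_add h2 hgi
    have hs : (Function.support fun i ↦ if i ≤ c then 0 else f.coeff i).IsPWO :=
      f.isPWO_support.mono fun i hi hfi ↦ hi (by simp [hfi])
    refine ⟨⟨_, hs⟩, fun i hi ↦ if_pos hi, ?_⟩
    have h1 : const ϖ ϖ ^ (n + 1) ∣ of ϖ (f - ⟨_, hs⟩) := by
      refine dvd_of_of_dvd_coeff fun i ↦ ?_
      rw [HahnSeries.coeff_sub]
      change _ ∣ f.coeff i - if i ≤ c then 0 else f.coeff i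
      split_ifs with hi
      · rw [sub_zero]
        exact hdvd i hi
      · rw [sub_self]
        exact dvd_zero _
    rw [map_sub] at h1
    simpa using dvd_add hf h1
  · rintro ⟨f, hf, h⟩ i hi
    exact ⟨f, (evalₐ_eq_mk_iff _ _ _).2 h, by rw [hf i hi]; exact dvd_zero _⟩

theorem add_mem_levelNhd {n : ℕ} {c : ℤ} {x y : GammaLaurent ϖ} (hx : x ∈ levelNhd ϖ n c)
    (hy : y ∈ levelNhd ϖ n c) : x + y ∈ levelNhd ϖ n c := by
  rw [mem_levelNhd_iff] at *
  obtain ⟨f, hf, h⟩ := hx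
  obtain ⟨g, hg, h'⟩ := hy
  refine ⟨f + g, fun i hi ↦ by rw [HahnSeries.coeff_add, hf i hi, hg i hi, add_zero], ?_⟩
  rw [map_add, add_sub_add_comm]
  exact dvd_add h h'

theorem neg_mem_levelNhd {n : ℕ} {c : ℤ} {x : GammaLaurent ϖ} (hx : x ∈ levelNhd ϖ n c) :
    -x ∈ levelNhd ϖ n c := by
  rw [mem_levelNhd_iff] at *
  obtain ⟨f, hf, h⟩ := hx
  refine ⟨-f, fun i hi ↦ by rw [HahnSeries.coeff_neg, hf i hi, neg_zero], ?_⟩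
  rw [map_neg, ← neg_sub']
  exact h.neg_right

theorem zero_mem_levelNhd (n : ℕ) (c : ℤ) : (0 : GammaLaurent ϖ) ∈ levelNhd ϖ n c :=
  mem_levelNhd_iff.2 ⟨0, fun _ _ ↦ rfl, by simp⟩

theorem levelNhd_anti {n : ℕ} {c c' : ℤ} (h : c ≤ c') :
    levelNhd ϖ n c' ⊆ levelNhd ϖ n c := fun _ hx i hi ↦ hx i (hi.trans h)

theorem exists_mul_mem_levelNhd (x : GammaLaurent ϖ) (n : ℕ) (c : ℤ) :
    ∃ c', ∀ y ∈ levelNhd ϖ n c', x * y ∈ levelNhd ϖ n c := by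
  obtain ⟨f, hf⟩ := exists_of_dvd_sub (n + 1) x
  refine ⟨c - f.order, fun y hy ↦ ?_⟩
  rw [mem_levelNhd_iff] at *
  obtain ⟨g, hg, h⟩ := hy
  refine ⟨f * g, fun i hi ↦ ?_, ?_⟩
  · rw [HahnSeries.coeff_mul]
    refine Finset.sum_eq_zero fun ij hij ↦ ?_
    rw [Finset.mem_antidiagonal] at hij
    rcases lt_or_ge ij.1 f.order with h1 | h1
    · rw [HahnSeries.coeff_eq_zero_of_lt_order h1, zero_mul]
    · rw [hg ij.2 (by omega), mul_zero]
  · obtain ⟨a, ha⟩ := hf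
    obtain ⟨b, hb⟩ := h
    refine ⟨a * y + of ϖ f * b, ?_⟩
    rw [map_mul]
    linear_combination y * ha + of ϖ f * hb

/-- The levelwise closure of a subring. -/
def levelClosureSubring (S : Subring (GammaLaurent ϖ)) : Subring (GammaLaurent ϖ) where
  carrier := levelClosure (S : Set (GammaLaurent ϖ))
  mul_mem' {a b} ha hb n c := by
    obtain ⟨c₁, h₁⟩ := exists_mul_mem_levelNhd b n c
    obtain ⟨y, hy, hay⟩ := ha n c₁
    obtain ⟨c₂, h₂⟩ := exists_mul_mem_levelNhd y n c
    obtain ⟨z, hz, hbz⟩ := hb n c₂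
    refine ⟨y * z, S.mul_mem hy hz, ?_⟩
    have h : a * b - y * z = b * (a - y) + y * (b - z) := by ring
    rw [h]
    exact add_mem_levelNhd (h₁ _ hay) (h₂ _ hbz)
  one_mem' n c := ⟨1, S.one_mem, by rw [sub_self]; exact zero_mem_levelNhd n c⟩
  add_mem' {a b} ha hb n c := by
    obtain ⟨y, hy, hay⟩ := ha n c
    obtain ⟨z, hz, hbz⟩ := hb n c
    refine ⟨y + z, S.add_mem hy hz, ?_⟩
    rw [add_sub_add_comm]
    exact add_mem_levelNhd hay hbz
  zero_mem' n c := ⟨0, S.zero_mem, by rw [sub_self]; exact zero_mem_levelNhd n c⟩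
  neg_mem' {a} ha n c := by
    obtain ⟨y, hy, hay⟩ := ha n c
    refine ⟨-y, S.neg_mem hy, ?_⟩
    rw [← neg_sub']
    exact neg_mem_levelNhd hay

theorem levelClosure_subset {S : Subring (GammaLaurent ϖ)} {T : Set (GammaLaurent ϖ)}
    (h : (S : Set (GammaLaurent ϖ)) ⊆ levelClosure T) :
    levelClosure (S : Set (GammaLaurent ϖ)) ⊆ levelClosure T := by
  intro x hx n c
  obtain ⟨y, hy, hxy⟩ := hx n c
  obtain ⟨z, hz, hyz⟩ := h hy n c
  refine ⟨z, hz, ?_⟩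
  rw [← sub_add_sub_cancel]
  exact add_mem_levelNhd hxy hyz

theorem uPow_add (l l' : ℤ) : uPow ϖ (l + l') = uPow ϖ l * uPow ϖ l' := by
  rw [uPow, uPow, uPow, ← map_mul, HahnSeries.single_mul_single, one_mul]

theorem uPow_zero : uPow ϖ 0 = 1 := by
  rw [uPow]
  exact map_one (of ϖ)

theorem uPow_mem_levelNhd {l c : ℤ} (h : c < l) (n : ℕ) : uPow ϖ l ∈ levelNhd ϖ n c :=
  mem_levelNhd_iff.2 ⟨HahnSeries.single l 1, fun i hi ↦
    HahnSeries.coeff_single_of_ne (by omega), by rw [uPow, sub_self]; exact dvd_zero _⟩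

theorem residue_uPow (l : ℤ) : residue ϖ (uPow ϖ l) = HahnSeries.single l 1 := by
  rw [uPow, residue_of]
  exact (HahnSeries.map_single (IsLocalRing.residue O).toAddMonoidHom.toZeroHom).trans
    (congrArg _ (map_one (IsLocalRing.residue O)))

theorem residue_coeff_of_mem_levelNhd {n : ℕ} {c : ℤ} {x : GammaLaurent ϖ}
    (h : x ∈ levelNhd ϖ n c) {i : ℤ} (hi : i ≤ c) : (residue ϖ x).coeff i = 0 := by
  obtain ⟨f, hf, h⟩ := mem_levelNhd_iff.1 h
  have h1 : residue ϖ (x - of ϖ f) = 0 :=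
    (isResidueUniformizer.dvd_iff _).2 ((dvd_pow_self _ n.succ_ne_zero).trans h)
  rw [map_sub, sub_eq_zero] at h1
  rw [h1, residue_of]
  change IsLocalRing.residue O (f.coeff i) = 0
  rw [hf i hi, map_zero]

/-- Laurent polynomials are levelwise dense. -/
theorem exists_sum_sub_mem_levelNhd (x : GammaLaurent ϖ) (n : ℕ) (c : ℤ) :
    ∃ (F : Finset ℤ) (a : ℤ → O), x - ∑ l ∈ F, const ϖ (a l) * uPow ϖ l ∈ levelNhd ϖ n c := by
  obtain ⟨f, hf⟩ := exists_of_dvd_sub (n + 1) x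
  refine ⟨Finset.Icc f.order c, f.coeff, mem_levelNhd_iff.2
    ⟨f - ∑ l ∈ Finset.Icc f.order c, HahnSeries.single l (f.coeff l), fun i hi ↦ ?_, ?_⟩⟩
  · rw [HahnSeries.coeff_sub, HahnSeries.coeff_sum, sub_eq_zero]
    rcases lt_or_ge i f.order with h | h
    · rw [HahnSeries.coeff_eq_zero_of_lt_order h, Finset.sum_eq_zero]
      intro l hl
      exact HahnSeries.coeff_single_of_ne (by rw [Finset.mem_Icc] at hl; omega)
    · rw [Finset.sum_eq_single i]
      · rw [HahnSeries.coeff_single_same]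
      · intro l _ hl
        exact HahnSeries.coeff_single_of_ne hl.symm
      · intro hi'
        exact absurd (Finset.mem_Icc.2 ⟨h, hi⟩) hi'
  · have h1 : ∀ l : ℤ, const ϖ (f.coeff l) * uPow ϖ l = of ϖ (HahnSeries.single l (f.coeff l)) := by
      intro l
      rw [const, RingHom.comp_apply, uPow, ← map_mul]
      congr 1
      rw [HahnSeries.C_apply, HahnSeries.single_mul_single, zero_add, mul_one]
    simp only [h1]
    rw [map_sub, map_sum]
    simpa using hf

theorem mem_levelNhd_of_mul {n : ℕ} {c : ℤ} {x : GammaLaurent ϖ}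
    (h : const ϖ ϖ * x ∈ levelNhd ϖ (n + 1) c) : x ∈ levelNhd ϖ n c := by
  obtain ⟨f, hf, y, hy⟩ := mem_levelNhd_iff.1 h
  have h1 : ∀ i, ϖ ∣ f.coeff i := by
    intro i
    have h2 : const ϖ ϖ ^ 1 ∣ of ϖ f := ⟨x - const ϖ ϖ ^ (n + 1) * y, by
      linear_combination -hy⟩
    rw [← pow_one ϖ]
    exact dvd_coeff_of_dvd_of h2 i
  obtain ⟨g, rfl⟩ := HahnSeries.exists_C_mul_of_dvd_coeff f h1
  refine mem_levelNhd_iff.2 ⟨g, fun i hi ↦ ?_, y, ?_⟩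
  · have h3 := hf i hi
    rw [HahnSeries.C_mul_eq_smul, HahnSeries.coeff_smul, smul_eq_mul] at h3
    exact (mul_eq_zero.1 h3).resolve_left hϖ.out.ne_zero
  · refine sub_eq_zero.1 (of_eq_zero_of_mul _ ?_)
    rw [map_mul] at hy
    have h4 : of ϖ (HahnSeries.C ϖ) = const ϖ ϖ := rfl
    rw [h4] at hy
    linear_combination hy

end GammaLaurent

variable {p : ℕ} [Fact p.Prime] [CharP (IsLocalRing.ResidueField O) p] [CharZero O]

namespace FrobeniusLift

open GammaLaurent

variable (σ : FrobeniusLift p ϖ)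

theorem hom_pow_continuous (j n : ℕ) (c : ℤ) : ∃ (n' : ℕ) (c' : ℤ),
    ∀ x ∈ levelNhd ϖ n' c', (σ.hom ^ j) x ∈ levelNhd ϖ n c := by
  induction j generalizing n c with
  | zero => exact ⟨n, c, fun x hx ↦ by rwa [pow_zero]⟩
  | succ j ih =>
    obtain ⟨n', c', h⟩ := σ.levelwise_continuous n c
    obtain ⟨n'', c'', h'⟩ := ih n' c'
    refine ⟨n'', c'', fun x hx ↦ ?_⟩
    rw [pow_succ', RingHom.mul_def, RingHom.comp_apply]
    exact h _ (h' x hx)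

/-- The Laurent polynomials in `σ^j(u)`. -/
def polysIn (j : ℕ) : Subring (GammaLaurent ϖ) :=
  Subring.closure (Set.range (const ϖ) ∪ Set.range (fun l : ℤ ↦ (σ.hom ^ j) (uPow ϖ l)))

/-- `seriesIn j` as a subring. -/
def seriesSubring (j : ℕ) : Subring (GammaLaurent ϖ) := levelClosureSubring (σ.polysIn j)

theorem polysIn_le (j : ℕ) : σ.polysIn j ≤ σ.seriesSubring j := fun x hx n c ↦
  ⟨x, hx, by rw [sub_self]; exact zero_mem_levelNhd n c⟩

theorem const_mem_polysIn (j : ℕ) (a : O) : const ϖ a ∈ σ.polysIn j :=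
  Subring.subset_closure (Or.inl ⟨a, rfl⟩)

theorem hom_uPow_mem_polysIn (j : ℕ) (l : ℤ) : (σ.hom ^ j) (uPow ϖ l) ∈ σ.polysIn j :=
  Subring.subset_closure (Or.inr ⟨l, rfl⟩)

theorem hom_pow_mem_series (j : ℕ) (x : GammaLaurent ϖ) : (σ.hom ^ j) x ∈ σ.seriesSubring j := by
  intro n c
  obtain ⟨n', c', h⟩ := σ.hom_pow_continuous j n c
  obtain ⟨F, a, hF⟩ := exists_sum_sub_mem_levelNhd x n' c'
  refine ⟨_, ?_, by rw [← map_sub]; exact h _ hF⟩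
  rw [map_sum]
  refine sum_mem fun l _ ↦ ?_
  rw [map_mul, hom_pow_const]
  exact (σ.polysIn j).mul_mem (σ.const_mem_polysIn j _) (σ.hom_uPow_mem_polysIn j l)

theorem seriesSubring_anti {j j' : ℕ} (h : j ≤ j') : σ.seriesSubring j' ≤ σ.seriesSubring j := by
  refine levelClosure_subset ?_
  change σ.polysIn j' ≤ σ.seriesSubring j
  rw [polysIn, Subring.closure_le, Set.union_subset_iff]
  constructor
  · rintro _ ⟨a, rfl⟩
    exact σ.polysIn_le j (σ.const_mem_polysIn j a)
  · rintro _ ⟨l, rfl⟩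
    dsimp only
    obtain ⟨d, rfl⟩ := Nat.exists_eq_add_of_le h
    rw [pow_add, RingHom.mul_def, RingHom.comp_apply]
    exact σ.hom_pow_mem_series j _

theorem hom_mem_series {j : ℕ} {x : GammaLaurent ϖ} (hx : x ∈ σ.seriesSubring j) :
    σ.hom x ∈ σ.seriesSubring (j + 1) := by
  intro n c
  obtain ⟨n', c', h⟩ := σ.levelwise_continuous n c
  obtain ⟨y, hy, hxy⟩ := hx n' c'
  refine ⟨σ.hom y, ?_, by rw [← map_sub]; exact h _ hxy⟩
  have h1 : σ.polysIn j ≤ (σ.polysIn (j + 1)).comap σ.hom := by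
    rw [polysIn, Subring.closure_le, Set.union_subset_iff]
    constructor
    · rintro _ ⟨a, rfl⟩
      rw [SetLike.mem_coe, Subring.mem_comap, σ.hom_const]
      exact σ.const_mem_polysIn _ _
    · rintro _ ⟨l, rfl⟩
      rw [SetLike.mem_coe, Subring.mem_comap, ← RingHom.comp_apply, ← RingHom.mul_def, ← pow_succ']
      exact σ.hom_uPow_mem_polysIn _ l
  exact h1 hy

theorem hom_pow_mem_series_add {j : ℕ} {x : GammaLaurent ϖ} (hx : x ∈ σ.seriesSubring j) (d : ℕ) :
    (σ.hom ^ d) x ∈ σ.seriesSubring (j + d) := by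
  induction d with
  | zero => exact hx
  | succ d ih =>
    rw [pow_succ', RingHom.mul_def, RingHom.comp_apply]
    exact σ.hom_mem_series ih

theorem exists_finsupp_of_mem_polysIn {j : ℕ} {y : GammaLaurent ϖ} (hy : y ∈ σ.polysIn j) :
    ∃ a : ℤ →₀ O, y = a.sum fun l b ↦ const ϖ b * (σ.hom ^ j) (uPow ϖ l) := by
  have hadd : ∀ a b : ℤ →₀ O, ((a + b).sum fun l b ↦ const ϖ b * (σ.hom ^ j) (uPow ϖ l)) =
      (a.sum fun l b ↦ const ϖ b * (σ.hom ^ j) (uPow ϖ l)) +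
        b.sum fun l b ↦ const ϖ b * (σ.hom ^ j) (uPow ϖ l) := fun a b ↦
    Finsupp.sum_add_index' (fun l ↦ by rw [map_zero, zero_mul])
      (fun l x y ↦ by rw [map_add, add_mul])
  have hsingle : ∀ l b, ((Finsupp.single l b).sum fun l b ↦ const ϖ b * (σ.hom ^ j) (uPow ϖ l)) =
      const ϖ b * (σ.hom ^ j) (uPow ϖ l) := fun l b ↦
    Finsupp.sum_single_index (by rw [map_zero, zero_mul])
  have hmul : ∀ a b : ℤ →₀ O, ∃ c : ℤ →₀ O,
      (a.sum fun l b ↦ const ϖ b * (σ.hom ^ j) (uPow ϖ l)) *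
        (b.sum fun l b ↦ const ϖ b * (σ.hom ^ j) (uPow ϖ l)) =
          c.sum fun l b ↦ const ϖ b * (σ.hom ^ j) (uPow ϖ l) := by
    intro a b
    induction a using Finsupp.induction_linear with
    | zero => exact ⟨0, by rw [Finsupp.sum_zero_index, zero_mul]⟩
    | add a a' h h' =>
      obtain ⟨c, hc⟩ := h
      obtain ⟨c', hc'⟩ := h'
      exact ⟨c + c', by rw [hadd, hadd, add_mul, hc, hc']⟩
    | single l x =>
      induction b using Finsupp.induction_linear with
      | zero => exact ⟨0, by rw [Finsupp.sum_zero_index, mul_zero]⟩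
      | add b b' h h' =>
        obtain ⟨c, hc⟩ := h
        obtain ⟨c', hc'⟩ := h'
        exact ⟨c + c', by rw [hadd, hadd, mul_add, hc, hc']⟩
      | single l' x' =>
        refine ⟨Finsupp.single (l + l') (x * x'), ?_⟩
        rw [hsingle, hsingle, hsingle, uPow_add, map_mul, map_mul]
        ring
  induction hy using Subring.closure_induction with
  | mem x hx =>
    rcases hx with ⟨a, rfl⟩ | ⟨l, rfl⟩
    · exact ⟨Finsupp.single 0 a, by rw [hsingle, uPow_zero, map_one, mul_one]⟩
    · exact ⟨Finsupp.single l 1, by rw [hsingle, map_one, one_mul]⟩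
  | zero => exact ⟨0, rfl⟩
  | one => exact ⟨Finsupp.single 0 1, by rw [hsingle, uPow_zero, map_one, map_one, mul_one]⟩
  | add x y _ _ hx hy =>
    obtain ⟨a, rfl⟩ := hx
    obtain ⟨b, rfl⟩ := hy
    exact ⟨a + b, (hadd a b).symm⟩
  | neg x _ hx =>
    obtain ⟨a, rfl⟩ := hx
    refine ⟨-a, ?_⟩
    have := hadd a (-a)
    rw [add_neg_cancel, Finsupp.sum_zero_index] at this
    exact (eq_neg_of_add_eq_zero_right this.symm).symm
  | mul x y _ _ hx hy =>
    obtain ⟨a, rfl⟩ := hx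
    obtain ⟨b, rfl⟩ := hy
    exact hmul a b

theorem residue_hom_uPow (j : ℕ) (l : ℤ) :
    residue ϖ ((σ.hom ^ j) (uPow ϖ l)) = HahnSeries.single ((p : ℤ) ^ j * l) 1 := by
  rw [σ.residue_hom_pow, residue_uPow, HahnSeries.single_pow, one_pow, nsmul_eq_mul]
  push_cast
  rfl

theorem residue_finsupp_coeff (j : ℕ) (a : ℤ →₀ O) (i : ℤ) :
    (residue ϖ (a.sum fun l b ↦ const ϖ b * (σ.hom ^ j) (uPow ϖ l))).coeff i =
      ∑ l ∈ a.support, if i = (p : ℤ) ^ j * l then IsLocalRing.residue O (a l) else 0 := by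
  rw [Finsupp.sum, map_sum, HahnSeries.coeff_sum]
  refine Finset.sum_congr rfl fun l _ ↦ ?_
  rw [map_mul, residue_const, residue_hom_uPow, HahnSeries.C_mul_eq_smul, HahnSeries.coeff_smul]
  split_ifs with h
  · rw [h, HahnSeries.coeff_single_same, smul_eq_mul, mul_one]
  · rw [HahnSeries.coeff_single_of_ne h, smul_zero]

theorem p_pow_pos (j : ℕ) : (0 : ℤ) < (p : ℤ) ^ j :=
  pow_pos (by exact_mod_cast (Fact.out : p.Prime).pos) j

/-- The residue of a series in `σ^j(u)` is a series in `t^(p^j)`. -/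
theorem residue_series_coeff {j : ℕ} {x : GammaLaurent ϖ} (hx : x ∈ σ.seriesSubring j) {i : ℤ}
    (h : (residue ϖ x).coeff i ≠ 0) : (p : ℤ) ^ j ∣ i := by
  obtain ⟨y, hy, hxy⟩ := hx 0 i
  obtain ⟨a, rfl⟩ := σ.exists_finsupp_of_mem_polysIn hy
  have h1 := residue_coeff_of_mem_levelNhd hxy le_rfl
  rw [map_sub, HahnSeries.coeff_sub, sub_eq_zero] at h1
  rw [h1, residue_finsupp_coeff] at h
  obtain ⟨l, _, hl⟩ := Finset.exists_ne_zero_of_sum_ne_zero h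
  exact ⟨l, by by_contra h2; exact hl (if_neg h2)⟩

/-- `seriesIn j` is saturated. -/
theorem series_of_mul {j : ℕ} {x : GammaLaurent ϖ} (hx : const ϖ ϖ * x ∈ σ.seriesSubring j) :
    x ∈ σ.seriesSubring j := by
  classical
  intro n c
  obtain ⟨n', c', h⟩ := σ.hom_pow_continuous j (n + 1) c
  set C := max c ((p : ℤ) ^ j * c') with hC
  obtain ⟨y, hy, hxy⟩ := hx (n + 1) C
  obtain ⟨a, rfl⟩ := σ.exists_finsupp_of_mem_polysIn hy
  have hdvd : ∀ l, (p : ℤ) ^ j * l ≤ C → ϖ ∣ a l := by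
    intro l hl
    have h1 := residue_coeff_of_mem_levelNhd hxy hl
    rw [map_sub, HahnSeries.coeff_sub, (isResidueUniformizer.dvd_iff _).2 ⟨x, rfl⟩,
      residue_finsupp_coeff, HahnSeries.coeff_zero, zero_sub, neg_eq_zero] at h1
    rw [← residue_eq_zero_iff_dvd]
    by_cases hla : l ∈ a.support
    · rw [Finset.sum_eq_single_of_mem l hla, if_pos rfl] at h1
      · exact h1
      · intro l' _ hl'
        exact if_neg fun h2 ↦ hl' (mul_left_cancel₀ (p_pow_pos (p := p) j).ne' h2).symm
    · rw [Finsupp.notMem_support_iff.1 hla, map_zero]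
  choose! b hb using hdvd
  set y' := ∑ l ∈ a.support.filter (fun l ↦ (p : ℤ) ^ j * l ≤ C),
    const ϖ (b l) * (σ.hom ^ j) (uPow ϖ l) with hy'
  refine ⟨y', sum_mem fun l _ ↦ (σ.polysIn j).mul_mem (σ.const_mem_polysIn j _)
    (σ.hom_uPow_mem_polysIn j l), mem_levelNhd_of_mul ?_⟩
  have hsplit : (a.sum fun l b ↦ const ϖ b * (σ.hom ^ j) (uPow ϖ l)) = const ϖ ϖ * y' +
      ∑ l ∈ a.support.filter (fun l ↦ ¬ (p : ℤ) ^ j * l ≤ C),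
        const ϖ (a l) * (σ.hom ^ j) (uPow ϖ l) := by
    rw [Finsupp.sum, ← Finset.sum_filter_add_sum_filter_not _ (fun l ↦ (p : ℤ) ^ j * l ≤ C)]
    congr 1
    rw [hy', Finset.mul_sum]
    refine Finset.sum_congr rfl fun l hl ↦ ?_
    rw [hb l (Finset.mem_filter.1 hl).2, map_mul, mul_assoc]
  have hrest : ∑ l ∈ a.support.filter (fun l ↦ ¬ (p : ℤ) ^ j * l ≤ C),
      const ϖ (a l) * (σ.hom ^ j) (uPow ϖ l) ∈ levelNhd ϖ (n + 1) c := by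
    refine Finset.sum_induction _ (· ∈ levelNhd ϖ (n + 1) c) (fun _ _ ↦ add_mem_levelNhd)
      (zero_mem_levelNhd _ _) fun l hl ↦ ?_
    have h1 : c' < l := by
      have h2 := (Finset.mem_filter.1 hl).2
      have h3 : (p : ℤ) ^ j * c' < (p : ℤ) ^ j * l := by
        have := le_max_right c ((p : ℤ) ^ j * c')
        omega
      exact lt_of_mul_lt_mul_left h3 (p_pow_pos (p := p) j).le
    have h4 := h _ (uPow_mem_levelNhd (ϖ := ϖ) h1 n')
    obtain ⟨f, hf, z, hz⟩ := mem_levelNhd_iff.1 h4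
    refine mem_levelNhd_iff.2 ⟨HahnSeries.C (a l) * f, fun i hi ↦ ?_, const ϖ (a l) * z, ?_⟩
    · rw [HahnSeries.C_mul_eq_smul, HahnSeries.coeff_smul, hf i hi, smul_zero]
    · rw [map_mul]
      have h5 : of ϖ (HahnSeries.C (a l)) = const ϖ (a l) := rfl
      rw [h5]
      linear_combination const ϖ (a l) * hz
  have h6 : const ϖ ϖ * (x - y') = (const ϖ ϖ * x - a.sum fun l b ↦
      const ϖ b * (σ.hom ^ j) (uPow ϖ l)) + ∑ l ∈ a.support.filter (fun l ↦ ¬ (p : ℤ) ^ j * l ≤ C),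
        const ϖ (a l) * (σ.hom ^ j) (uPow ϖ l) := by
    rw [hsplit]
    ring
  rw [h6]
  exact add_mem_levelNhd (levelNhd_anti (le_max_left _ _) hxy) hrest

end FrobeniusLift

end Levelwise

section Lifts

variable {p : ℕ} [Fact p.Prime] {O : Type u} [CommRing O] [IsDomain O] [IsDiscreteValuationRing O]
  [CharZero O] [CharP (IsLocalRing.ResidueField O) p] {ϖ : O} [hϖ : Fact (Irreducible ϖ)]

namespace FrobeniusLift

variable (σ : FrobeniusLift p ϖ)

theorem exists_inv_one_sub (z : σ.GammaAlg) : ∃ L, (1 - σ.unif * z) * L = 1 ∧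
    ∀ n, σ.unif ^ n ∣ ∑ i ∈ Finset.range n, (σ.unif * z) ^ i - L := by
  obtain ⟨L, hL⟩ := σ.exists_limit_alg (fun n ↦ ∑ i ∈ Finset.range n, (σ.unif * z) ^ i) fun n ↦ by
    rw [Finset.sum_range_succ, add_sub_cancel_left, mul_pow]
    exact dvd_mul_right _ _
  refine ⟨L, sub_eq_zero.1 (σ.eq_zero_of_forall_unif_pow_dvd fun n ↦ ?_), hL⟩
  obtain ⟨y, hy⟩ := hL n
  refine ⟨-(z ^ n) - (1 - σ.unif * z) * y, ?_⟩
  have h := mul_neg_geom_sum (σ.unif * z) n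
  rw [mul_pow] at h
  linear_combination h - (1 - σ.unif * z) * hy

theorem isUnit_of_residueAlg_ne_zero {x : σ.GammaAlg} (hx : σ.residueAlg x ≠ 0) : IsUnit x := by
  have h : σ.residueAlg (1 - x * σ.teich (σ.residueAlg x)⁻¹) = 0 := by
    rw [map_sub, map_one, map_mul, σ.residueAlg_teich, mul_inv_cancel₀ hx, sub_self]
  obtain ⟨z, hz⟩ := (σ.isResidueUniformizer_alg.dvd_iff _).1 h
  obtain ⟨L, hL, -⟩ := σ.exists_inv_one_sub z
  refine IsUnit.of_mul_eq_one (σ.teich (σ.residueAlg x)⁻¹ * L) ?_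
  linear_combination hL - L * hz

variable {K : IntermediateField (LaurentSeries (IsLocalRing.ResidueField O))
    (LaurentAlg (IsLocalRing.ResidueField O))}

variable (K) in
/-- Subrings of `Γ^alg` that are saturated with respect to the uniformizer, with residues in `K`. -/
structure IsSaturated (D : Subring σ.GammaAlg) : Prop where
  unif_mem : σ.unif ∈ D
  of_mul : ∀ x, σ.unif * x ∈ D → x ∈ D
  residue_mem : ∀ x ∈ D, σ.residueAlg x ∈ K

theorem IsSaturated.exists_maximal {D₀ : Subring σ.GammaAlg} (h₀ : σ.IsSaturated K D₀) :
    ∃ D, D₀ ≤ D ∧ Maximal (σ.IsSaturated K) D := by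
  refine zorn_le_nonempty₀ {D | σ.IsSaturated K D} (fun c hc hchain D hD ↦ ?_) D₀ h₀
  have hmem : ∀ x, x ∈ sSup c ↔ ∃ D ∈ c, x ∈ D := fun x ↦
    Subring.mem_sSup_of_directedOn ⟨D, hD⟩ hchain.directedOn
  refine ⟨sSup c, ⟨(hmem _).2 ⟨D, hD, (hc hD).unif_mem⟩, fun x hx ↦ ?_, fun x hx ↦ ?_⟩,
    fun E hE ↦ le_sSup hE⟩
  · obtain ⟨E, hE, hx⟩ := (hmem _).1 hx
    exact (hmem _).2 ⟨E, hE, (hc hE).of_mul x hx⟩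
  · obtain ⟨E, hE, hx⟩ := (hmem _).1 hx
    exact (hc hE).residue_mem x hx

variable {σ}

theorem inv_mem_of_maximal {D : Subring σ.GammaAlg} (hD : Maximal (σ.IsSaturated K) D)
    {u x : σ.GammaAlg} (hu : u ∈ D) (h : σ.residueAlg u ≠ 0) (hx : u * x ∈ D) : x ∈ D := by
  let E : Subring σ.GammaAlg :=
    { carrier := {x | ∃ u ∈ D, σ.residueAlg u ≠ 0 ∧ u * x ∈ D}
      mul_mem' := by
        rintro x y ⟨u, hu, h, hx⟩ ⟨v, hv, h', hy⟩
        refine ⟨u * v, D.mul_mem hu hv, by rw [map_mul]; exact mul_ne_zero h h', ?_⟩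
        rw [mul_mul_mul_comm]
        exact D.mul_mem hx hy
      one_mem' := ⟨1, D.one_mem, by rw [map_one]; exact one_ne_zero, by
        rw [one_mul]; exact D.one_mem⟩
      add_mem' := by
        rintro x y ⟨u, hu, h, hx⟩ ⟨v, hv, h', hy⟩
        refine ⟨u * v, D.mul_mem hu hv, by rw [map_mul]; exact mul_ne_zero h h', ?_⟩
        have : u * v * (x + y) = v * (u * x) + u * (v * y) := by ring
        rw [this]
        exact D.add_mem (D.mul_mem hv hx) (D.mul_mem hu hy)
      zero_mem' := ⟨1, D.one_mem, by rw [map_one]; exact one_ne_zero, by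
        rw [one_mul]; exact D.zero_mem⟩
      neg_mem' := by
        rintro x ⟨u, hu, h, hx⟩
        exact ⟨u, hu, h, by rw [mul_neg]; exact D.neg_mem hx⟩ }
  have hDE : D ≤ E := fun x hx ↦ ⟨1, D.one_mem, by rw [map_one]; exact one_ne_zero, by rwa [one_mul]⟩
  have hE : σ.IsSaturated K E := by
    refine ⟨hDE hD.prop.unif_mem, ?_, ?_⟩
    · rintro x ⟨u, hu, h, hx⟩
      exact ⟨u, hu, h, hD.prop.of_mul _ (by rwa [mul_left_comm] at hx)⟩
    · rintro x ⟨u, hu, h, hx⟩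
      have h1 := hD.prop.residue_mem _ hu
      have h2 := hD.prop.residue_mem _ hx
      rw [map_mul] at h2
      have h3 := K.mul_mem (K.inv_mem h1) h2
      rwa [inv_mul_cancel_left₀ h] at h3
  exact hD.le_of_ge hE hDE ⟨u, hu, h, hx⟩

open Polynomial in
/-- A maximal saturated subring contains the simple roots of its monic polynomials. -/
theorem mem_of_maximal_of_root {D : Subring σ.GammaAlg} (hD : Maximal (σ.IsSaturated K) D)
    {x : σ.GammaAlg} (hx : σ.residueAlg x ∈ K) {f : D[X]} (hf : aeval x f = 0)
    (hf' : σ.residueAlg (aeval x (derivative f)) ≠ 0) : x ∈ D := by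
  -- the residue field of `D`
  let ρ : D →+* ResAlg O := σ.residueAlg.comp D.subtype
  let κ := D ⧸ RingHom.ker ρ
  have hmax : (RingHom.ker ρ).IsMaximal := by
    rw [Ideal.isMaximal_iff]
    refine ⟨fun h ↦ one_ne_zero (RingHom.mem_ker.1 h |>.symm.trans (map_one ρ)).symm, ?_⟩
    intro J y hJ hy hyJ
    obtain ⟨v, hv⟩ := (σ.isUnit_of_residueAlg_ne_zero (x := y) hy).exists_right_inv
    have hvD : v ∈ D := inv_mem_of_maximal hD y.2 hy (by rw [hv]; exact D.one_mem)
    have h1 : y * ⟨v, hvD⟩ = 1 := Subtype.ext hv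
    rw [← h1]
    exact J.mul_mem_right _ hyJ
  let _ : Field κ := Ideal.Quotient.field (RingHom.ker ρ)
  let ρ' : κ →+* ResAlg O := RingHom.kerLift ρ
  let _ : Algebra κ (ResAlg O) := ρ'.toAlgebra
  have hρ : ∀ g : D[X], aeval (σ.residueAlg x) (g.map (Ideal.Quotient.mk (RingHom.ker ρ))) =
      σ.residueAlg (aeval x g) := by
    intro g
    rw [aeval_def, eval₂_map, aeval_def, hom_eval₂]
    rfl
  have hint : aeval (σ.residueAlg x) (f.map (Ideal.Quotient.mk (RingHom.ker ρ))) = 0 := by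
    rw [hρ, hf, map_zero]
  have hlift : ∀ g : κ[X], ∃ g' : D[X], g'.map (Ideal.Quotient.mk (RingHom.ker ρ)) = g :=
    Polynomial.map_surjective _ Ideal.Quotient.mk_surjective
  have hzero : ∀ g : D[X], g.map (Ideal.Quotient.mk (RingHom.ker ρ)) = 0 →
      ∃ g' : D[X], aeval x g = σ.unif * aeval x g' := by
    intro g hg
    have h1 : ∀ i, ∃ c : D, (g.coeff i : σ.GammaAlg) = σ.unif * c := by
      intro i
      have h2 : ρ (g.coeff i) = 0 := by
        have h3 := congrArg (fun g ↦ g.coeff i) hg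
        simp only [coeff_map, coeff_zero] at h3
        exact RingHom.mem_ker.1 (Ideal.Quotient.eq_zero_iff_mem.1 h3)
      obtain ⟨c, hc⟩ := (σ.isResidueUniformizer_alg.dvd_iff _).1 h2
      exact ⟨⟨c, hD.prop.of_mul c (by rw [← hc]; exact (g.coeff i).2)⟩, hc⟩
    choose c hc using h1
    refine ⟨∑ i ∈ Finset.range (g.natDegree + 1), C (c i) * X ^ i, ?_⟩
    rw [aeval_eq_sum_range, map_sum, Finset.mul_sum]
    refine Finset.sum_congr rfl fun i _ ↦ ?_
    rw [map_mul, aeval_C, map_pow, aeval_X, Algebra.smul_def, ← mul_assoc]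
    congr 1
    exact hc i
  obtain ⟨h, hh⟩ := minpoly.dvd κ (σ.residueAlg x) hint
  obtain ⟨m', hm'⟩ := hlift (minpoly κ (σ.residueAlg x))
  obtain ⟨h', hh'⟩ := hlift h
  have hhx : σ.residueAlg (aeval x h') ≠ 0 := by
    intro h0
    apply hf'
    rw [← hρ, ← derivative_map, hh, derivative_mul, map_add, map_mul, map_mul, minpoly.aeval,
      ← hh', hρ, h0, zero_mul, mul_zero, add_zero]
  obtain ⟨f₁, hf₁⟩ := hzero (f - m' * h') (by
    rw [Polynomial.map_sub, Polynomial.map_mul, hm', hh', hh, sub_self])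
  rw [map_sub, map_mul, hf, zero_sub] at hf₁
  have hKeval : ∀ g : D[X], σ.residueAlg (aeval x g) ∈ K := by
    intro g
    rw [aeval_eq_sum_range, map_sum]
    refine sum_mem fun i _ ↦ ?_
    rw [Algebra.smul_def, map_mul, map_pow]
    exact K.mul_mem (hD.prop.residue_mem _ (g.coeff i).2) (pow_mem hx i)
  let E : Subring σ.GammaAlg :=
    { carrier := {y | ∃ g h : D[X], σ.residueAlg (aeval x h) ≠ 0 ∧ aeval x h * y = aeval x g}
      mul_mem' := by
        rintro y z ⟨g, h, h0, e⟩ ⟨g', h', h0', e'⟩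
        refine ⟨g * g', h * h', by rw [map_mul, map_mul]; exact mul_ne_zero h0 h0', ?_⟩
        rw [map_mul, map_mul, mul_mul_mul_comm, e, e']
      one_mem' := ⟨1, 1, by rw [map_one, map_one]; exact one_ne_zero, mul_one _⟩
      add_mem' := by
        rintro y z ⟨g, h, h0, e⟩ ⟨g', h', h0', e'⟩
        refine ⟨g * h' + h * g', h * h', by rw [map_mul, map_mul]; exact mul_ne_zero h0 h0', ?_⟩
        rw [map_add, map_mul, map_mul, map_mul]
        linear_combination aeval x h' * e + aeval x h * e'
      zero_mem' := ⟨0, 1, by rw [map_one, map_one]; exact one_ne_zero, by rw [mul_zero, map_zero]⟩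
      neg_mem' := by
        rintro y ⟨g, h, h0, e⟩
        exact ⟨-g, h, h0, by rw [mul_neg, e, map_neg]⟩ }
  have hDE : D ≤ E := fun y hy ↦ ⟨C ⟨y, hy⟩, 1, by rw [map_one, map_one]; exact one_ne_zero, by
    rw [map_one, one_mul, aeval_C]; rfl⟩
  have hE : σ.IsSaturated K E := by
    refine ⟨hDE hD.prop.unif_mem, ?_, ?_⟩
    · rintro y ⟨g, k, hk, e⟩
      have hg : aeval (σ.residueAlg x) (g.map (Ideal.Quotient.mk (RingHom.ker ρ))) = 0 := by
        rw [hρ, ← e, map_mul, map_mul, (σ.isResidueUniformizer_alg.dvd_iff _).2 dvd_rfl, zero_mul,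
          mul_zero]
      obtain ⟨q, hq⟩ := minpoly.dvd κ (σ.residueAlg x) hg
      obtain ⟨q', hq'⟩ := hlift q
      obtain ⟨g₁, hg₁⟩ := hzero (g - m' * q') (by
        rw [Polynomial.map_sub, Polynomial.map_mul, hm', hq', hq, sub_self])
      rw [map_sub, map_mul] at hg₁
      refine ⟨h' * g₁ - f₁ * q', h' * k, by rw [map_mul, map_mul]; exact mul_ne_zero hhx hk,
        sub_eq_zero.1 (σ.isResidueUniformizer_alg.regular _ ?_)⟩
      rw [map_sub, map_mul, map_mul, map_mul]
      linear_combination aeval x h' * e + aeval x h' * hg₁ - aeval x q' * hf₁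
    · rintro y ⟨g, k, hk, e⟩
      have h1 := congrArg σ.residueAlg e
      rw [map_mul] at h1
      have h2 := K.mul_mem (K.inv_mem (hKeval k)) (hKeval g)
      rwa [← h1, inv_mul_cancel_left₀ hk] at h2
  refine hD.le_of_ge hE hDE ⟨X, 1, by rw [map_one, map_one]; exact one_ne_zero, ?_⟩
  rw [map_one, one_mul, aeval_X]

/-- The adic closure of a saturated subring is saturated. -/
theorem IsSaturated.adicClosure {D : Subring σ.GammaAlg} (hD : σ.IsSaturated K D) :
    σ.IsSaturated K (σ.adicClosure D) := by
  refine ⟨fun N ↦ ⟨_, hD.unif_mem, by simp⟩, fun x hx N ↦ ?_, fun x hx ↦ ?_⟩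
  · obtain ⟨y, hy, z, hz⟩ := hx (N + 1)
    have h1 : y = σ.unif * (x - σ.unif ^ N * z) := by
      rw [pow_succ'] at hz
      linear_combination -hz
    refine ⟨x - σ.unif ^ N * z, hD.of_mul _ (h1 ▸ hy), z, by ring⟩
  · obtain ⟨y, hy, hxy⟩ := hx 1
    rw [pow_one, ← σ.isResidueUniformizer_alg.dvd_sub_iff] at hxy
    rw [hxy]
    exact hD.residue_mem y hy

variable (V : ValuedFieldChain p K)

variable (σ) in
/-- The union of the rings `levelL`. -/
def baseSubring : Subring σ.GammaAlg where
  carrier := {x | ∃ i j : ℕ, (i : ℕ∞) ≤ V.n ∧ (j : ℕ∞) ≤ V.m ∧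
    ∃ a ∈ σ.seriesSubring j, x = σ.emb (i + j) a}
  mul_mem' := by
    rintro _ _ ⟨i, j, hi, hj, a, ha, rfl⟩ ⟨i', j', hi', hj', b, hb, rfl⟩
    refine ⟨max i i', max j j', ?_, ?_, (σ.hom ^ (max i i' + max j j' - (i + j))) a *
      (σ.hom ^ (max i i' + max j j' - (i' + j'))) b, ?_, ?_⟩
    · rcases max_cases i i' with h | h <;> rw [h.1] <;> assumption
    · rcases max_cases j j' with h | h <;> rw [h.1] <;> assumption
    · exact (σ.seriesSubring _).mul_mem
        (σ.seriesSubring_anti (by omega) (σ.hom_pow_mem_series_add ha _))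
        (σ.seriesSubring_anti (by omega) (σ.hom_pow_mem_series_add hb _))
    · have h1 := σ.emb_hom_pow (i + j) (max i i' + max j j' - (i + j)) a
      have h2 := σ.emb_hom_pow (i' + j') (max i i' + max j j' - (i' + j')) b
      rw [show i + j + (max i i' + max j j' - (i + j)) = max i i' + max j j' by omega] at h1
      rw [show i' + j' + (max i i' + max j j' - (i' + j')) = max i i' + max j j' by omega] at h2
      rw [map_mul, h1, h2]
  one_mem' := ⟨0, 0, by simp, by simp, 1, Subring.one_mem _, (map_one _).symm⟩
  add_mem' := by
    rintro _ _ ⟨i, j, hi, hj, a, ha, rfl⟩ ⟨i', j', hi', hj', b, hb, rfl⟩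
    refine ⟨max i i', max j j', ?_, ?_, (σ.hom ^ (max i i' + max j j' - (i + j))) a +
      (σ.hom ^ (max i i' + max j j' - (i' + j'))) b, ?_, ?_⟩
    · rcases max_cases i i' with h | h <;> rw [h.1] <;> assumption
    · rcases max_cases j j' with h | h <;> rw [h.1] <;> assumption
    · exact (σ.seriesSubring _).add_mem
        (σ.seriesSubring_anti (by omega) (σ.hom_pow_mem_series_add ha _))
        (σ.seriesSubring_anti (by omega) (σ.hom_pow_mem_series_add hb _))
    · have h1 := σ.emb_hom_pow (i + j) (max i i' + max j j' - (i + j)) a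
      have h2 := σ.emb_hom_pow (i' + j') (max i i' + max j j' - (i' + j')) b
      rw [show i + j + (max i i' + max j j' - (i + j)) = max i i' + max j j' by omega] at h1
      rw [show i' + j' + (max i i' + max j j' - (i' + j')) = max i i' + max j j' by omega] at h2
      rw [map_add, h1, h2]
  zero_mem' := ⟨0, 0, by simp, by simp, 0, Subring.zero_mem _, (map_zero _).symm⟩
  neg_mem' := by
    rintro _ ⟨i, j, hi, hj, a, ha, rfl⟩
    exact ⟨i, j, hi, hj, -a, (σ.seriesSubring _).neg_mem ha, (map_neg _ _).symm⟩

theorem const_mem_seriesSubring (j : ℕ) (a : O) : GammaLaurent.const ϖ a ∈ σ.seriesSubring j :=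
  σ.polysIn_le j (σ.const_mem_polysIn j a)

theorem isSaturated_baseSubring : σ.IsSaturated K (σ.baseSubring V) := by
  refine ⟨⟨0, 0, by simp, by simp, _, const_mem_seriesSubring 0 ϖ, rfl⟩, ?_, ?_⟩
  · rintro x ⟨i, j, hi, hj, a, ha, h⟩
    have h0 : GammaLaurent.residue ϖ a = 0 := by
      have h1 := residueLevel_pow (p := p) (i + j) a
      rw [← σ.residueAlg_emb, ← h, map_mul, (σ.isResidueUniformizer_alg.dvd_iff _).2 dvd_rfl,
        zero_mul, zero_pow (pow_pos (Fact.out : p.Prime).pos _).ne'] at h1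
      exact (map_eq_zero _).1 h1.symm
    obtain ⟨b, rfl⟩ := (GammaLaurent.isResidueUniformizer.dvd_iff _).1 h0
    obtain ⟨v, hv⟩ := σ.exists_unit_emb_unif (i + j)
    refine ⟨i, j, hi, hj, GammaLaurent.const ϖ v * b, (σ.seriesSubring j).mul_mem
      (const_mem_seriesSubring j v) (σ.series_of_mul ha),
      sub_eq_zero.1 (σ.isResidueUniformizer_alg.regular _ ?_)⟩
    rw [map_mul] at h ⊢
    linear_combination h + σ.emb (i + j) b * hv
  · rintro _ ⟨i, j, hi, hj, a, ha, rfl⟩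
    refine V.N_le_K ((V.mem_N _).2 ⟨i, hi, ?_⟩)
    have hL : σ.residueAlg (σ.emb (i + j) a) ^ p ^ i ∈ V.L := by
      refine (V.mem_L _).2 ⟨j, hj, GammaLaurent.residue ϖ a, fun l hl ↦
        σ.residue_series_coeff ha hl, ?_⟩
      rw [← pow_mul, ← pow_add, σ.residueAlg_emb, residueLevel_pow]
    rw [V.M_eq]
    exact (le_sup_left : V.L ≤ _) hL

variable (σ) in
theorem exists_saturated_ge_gammaK : ∃ D, σ.IsSaturated K D ∧ σ.GammaK V ≤ D := by
  obtain ⟨D, h₀, hD⟩ := (isSaturated_baseSubring (σ := σ) V).exists_maximal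
  refine ⟨σ.adicClosure D, hD.prop.adicClosure, ?_⟩
  have h : Subring.closure {x | σ.residueAlg x ∈ K ∧ ∃ i : ℕ, (i : ℕ∞) ≤ V.n ∧
      σ.IsEtaleOver (σ.levelL V.m i) x} ≤ D := by
    rw [Subring.closure_le]
    rintro x ⟨hx, i, hi, f, -, hfc, hf, hf'⟩
    have hcoeff : ∀ l, f.coeff l ∈ D := by
      intro l
      obtain ⟨j, hj, a, ha, hfa⟩ := hfc l
      exact h₀ ⟨i, j, hi, hj, a, ha, hfa⟩
    have hlift : ∃ g : Polynomial D, g.map D.subtype = f := by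
      have h1 : f ∈ Polynomial.lifts D.subtype := by
        rw [Polynomial.lifts_iff_coeff_lifts]
        exact fun l ↦ ⟨⟨f.coeff l, hcoeff l⟩, rfl⟩
      exact (Polynomial.mem_lifts f).1 h1
    obtain ⟨g, rfl⟩ := hlift
    refine mem_of_maximal_of_root hD hx (f := g) ?_ ?_
    · rw [Polynomial.aeval_def, ← hf, Polynomial.eval_map]
      rfl
    · rw [Polynomial.derivative_map, Polynomial.eval_map] at hf'
      exact (hf'.map σ.residueAlg).ne_zero
  exact fun x hx N ↦ by
    obtain ⟨y, hy, hxy⟩ := hx N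
    exact ⟨y, h hy, hxy⟩

theorem IsSaturated.of_unif_pow_mul {D : Subring σ.GammaAlg} (hD : σ.IsSaturated K D) {x} (n : ℕ)
    (h : σ.unif ^ n * x ∈ D) : x ∈ D := by
  induction n with
  | zero => rwa [pow_zero, one_mul] at h
  | succ n ih =>
    rw [pow_succ', mul_assoc] at h
    exact ih (hD.of_mul _ h)

theorem residue_mem_of_natCast_pow_mul_mem {x : σ.GammaAlg} {n : ℕ}
    (h : ((p : ℕ) : σ.GammaAlg) ^ n * x ∈ σ.GammaK V) : σ.residueAlg x ∈ K := by
  obtain ⟨D, hD, hle⟩ := σ.exists_saturated_ge_gammaK V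
  obtain ⟨v, hv⟩ := σ.exists_unit_natCast_alg
  have hvD : (v : σ.GammaAlg) ∈ D := by
    refine hD.of_unif_pow_mul (ramIndex p ϖ) ?_
    rw [mul_comm, ← hv]
    exact natCast_mem D p
  have h1 : (v : σ.GammaAlg) ^ n * x ∈ D := by
    refine hD.of_unif_pow_mul (ramIndex p ϖ * n) ?_
    have h2 := hle h
    rw [hv, mul_pow, ← pow_mul] at h2
    rwa [← mul_assoc, mul_comm (σ.unif ^ _)]
  have h3 := hD.residue_mem _ h1
  have h4 := hD.residue_mem _ hvD
  have hv0 : σ.residueAlg (v : σ.GammaAlg) ≠ 0 := (v.isUnit.map σ.residueAlg).ne_zero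
  rw [map_mul, map_pow] at h3
  have h5 := K.mul_mem (K.inv_mem (pow_mem h4 n)) h3
  rwa [inv_mul_cancel_left₀ (pow_ne_zero n hv0)] at h5

theorem monotone_bound_of_le {r : ℝ} (hr : 0 < r) {ψ : ℕ → ℝ} (h0 : ∀ i, 0 ≤ ψ i)
    (h : ∀ i, thet p ϖ * ψ i ≤ ψ (i + 1)) : Monotone fun i : ℕ ↦ (ψ i / thet p ϖ ^ i) ^ r⁻¹ := by
  refine monotone_nat_of_le_succ fun i ↦ ?_
  refine Real.rpow_le_rpow (div_nonneg (h0 i) (thet_pow_pos i).le) ?_ (inv_pos.2 hr).le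
  rw [div_le_div_iff₀ (thet_pow_pos i) (thet_pow_pos (i + 1)), pow_succ]
  have := mul_le_mul_of_nonneg_right (h i) (thet_pow_pos (p := p) (ϖ := ϖ) i).le
  linarith

/-- The Gauss terms of a sum are bounded by a bound of the Gauss terms of the summands that does
not decrease too fast. -/
theorem gterm_add_le_of_bound {r : ℝ} (hr : 0 < r) {ψ : ℕ → ℝ} (h0 : ∀ i, 0 ≤ ψ i)
    (h : ∀ i, thet p ϖ * ψ i ≤ ψ (i + 1)) {x y : σ.GammaAlg} (hx : ∀ i, σ.gterm r x i ≤ ψ i)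
    (hy : ∀ i, σ.gterm r y i ≤ ψ i) (i : ℕ) : σ.gterm r (x + y) i ≤ ψ i :=
  (gterm_le_iff hr (h0 i)).2 (σ.lnorm_coefA_add_le (monotone_bound_of_le hr h0 h)
    (Real.rpow_nonneg (div_nonneg (h0 0) (thet_pow_pos 0).le) _)
    (fun j ↦ (gterm_le_iff hr (h0 j)).1 (hx j)) (fun j ↦ (gterm_le_iff hr (h0 j)).1 (hy j)) i)

theorem gterm_neg_le_of_bound {r : ℝ} (hr : 0 < r) {ψ : ℕ → ℝ} (h0 : ∀ i, 0 ≤ ψ i)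
    (h : ∀ i, thet p ϖ * ψ i ≤ ψ (i + 1)) {x : σ.GammaAlg} (hx : ∀ i, σ.gterm r x i ≤ ψ i)
    (i : ℕ) : σ.gterm r (-x) i ≤ ψ i :=
  (gterm_le_iff hr (h0 i)).2 (σ.lnorm_coefA_neg_le (monotone_bound_of_le hr h0 h)
    (Real.rpow_nonneg (div_nonneg (h0 0) (thet_pow_pos 0).le) _)
    (fun j ↦ (gterm_le_iff hr (h0 j)).1 (hx j)) i)

theorem gterm_mul_le_of_bound {r : ℝ} (hr : 0 < r) {φ ψ χ : ℕ → ℝ} (hφ : ∀ i, 0 ≤ φ i)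
    (hψ : ∀ i, 0 ≤ ψ i) (hχ : ∀ i, 0 ≤ χ i) (h : ∀ i, thet p ϖ * χ i ≤ χ (i + 1))
    (hm : ∀ i j, φ i * ψ j ≤ χ (i + j)) {x y : σ.GammaAlg} (hx : ∀ i, σ.gterm r x i ≤ φ i)
    (hy : ∀ i, σ.gterm r y i ≤ ψ i) (i : ℕ) : σ.gterm r (x * y) i ≤ χ i := by
  refine (gterm_le_iff hr (hχ i)).2 (σ.lnorm_coefA_mul_le (monotone_bound_of_le hr hχ h)
    (Real.rpow_nonneg (div_nonneg (hχ 0) (thet_pow_pos 0).le) _) (fun i j ↦ ?_)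
    (fun j ↦ (gterm_le_iff hr (hφ j)).1 (hx j)) (fun j ↦ (gterm_le_iff hr (hψ j)).1 (hy j)) i)
  rw [← Real.mul_rpow (div_nonneg (hφ i) (thet_pow_pos i).le)
    (div_nonneg (hψ j) (thet_pow_pos j).le), div_mul_div_comm, ← pow_add]
  refine Real.rpow_le_rpow (div_nonneg (mul_nonneg (hφ i) (hψ j)) (thet_pow_pos _).le) ?_
    (inv_pos.2 hr).le
  exact div_le_div_of_nonneg_right (hm i j) (thet_pow_pos _).le

/-- A step function. -/
def step (η : ℝ) (n i : ℕ) : ℝ := if i < n then 1 else η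

theorem step_nonneg {η : ℝ} (hη : 0 ≤ η) (n i : ℕ) : 0 ≤ step η n i := by
  unfold step; split_ifs <;> linarith

theorem le_step {η : ℝ} (hη1 : η ≤ 1) (n i : ℕ) : η ≤ step η n i := by
  unfold step; split_ifs <;> linarith

theorem step_le_one {η : ℝ} (hη1 : η ≤ 1) (n i : ℕ) : step η n i ≤ 1 := by
  unfold step; split_ifs <;> linarith

theorem mul_step_le {η C : ℝ} (hC : 0 ≤ C) (hη : thet p ϖ ≤ η) (hη1 : η ≤ 1) (n i : ℕ) :
    thet p ϖ * (C * step η n i) ≤ C * step η n (i + 1) := by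
  have h : thet p ϖ * step η n i ≤ step η n (i + 1) := by
    have h0 := thet_pos (p := p) (ϖ := ϖ)
    refine (mul_le_of_le_one_right h0.le (step_le_one hη1 n i)).trans ?_
    exact hη.trans (le_step hη1 _ _)
  nlinarith

theorem step_mul_step_le {η : ℝ} (hη : 0 ≤ η) (hη1 : η ≤ 1) (m n i j : ℕ) :
    step η m i * step η n j ≤ step η (m + n) (i + j) := by
  rcases lt_or_ge (i + j) (m + n) with h | h
  · rw [step, step, step, if_pos h]
    split_ifs <;> nlinarith
  · rw [step, step, step, if_neg h.not_gt]
    split_ifs <;> first | omega | nlinarith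

theorem gnorm_one {s : ℝ} (hs : 0 < s) : σ.gnorm s 1 = 1 := by
  rw [← σ.teich_one, gnorm_teich hs, lnorm_one, Real.one_rpow]

theorem isGauss_one {s : ℝ} (hs : 0 < s) : σ.IsGauss s 1 := by
  rw [← σ.teich_one]; exact isGauss_teich hs 1

theorem IsGauss.sub {s : ℝ} (hs : 0 < s) {x y : σ.GammaAlg} (hx : σ.IsGauss s x)
    (hy : σ.IsGauss s y) : σ.IsGauss s (x - y) := by
  rw [sub_eq_add_neg]; exact hx.add hs (hy.neg hs)

theorem IsGauss.gnorm_sub_le {s : ℝ} (hs : 0 < s) {x y : σ.GammaAlg} (hx : σ.IsGauss s x)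
    (hy : σ.IsGauss s y) : σ.gnorm s (x - y) ≤ max (σ.gnorm s x) (σ.gnorm s y) := by
  rw [sub_eq_add_neg, ← hy.gnorm_neg hs]; exact hx.gnorm_add_le hs (hy.neg hs)

/-- The Gauss norm of a unit is the norm of its residue. -/
theorem IsGauss.gnorm_of_mul_eq_one {s : ℝ} (hs : 0 < s) {x y : σ.GammaAlg} (hx : σ.IsGauss s x)
    (hy : σ.IsGauss s y) (h : x * y = 1) : σ.gnorm s x = lnorm (σ.residueAlg x) ^ s := by
  have h1 : σ.gnorm s x * σ.gnorm s y = 1 := by rw [← hx.gnorm_mul hs hy, h, gnorm_one hs]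
  have h2 : lnorm (σ.residueAlg x) ^ s * lnorm (σ.residueAlg y) ^ s = 1 := by
    rw [← Real.mul_rpow (lnorm_nonneg _) (lnorm_nonneg _), ← lnorm_mul, ← map_mul, h, map_one,
      lnorm_one, Real.one_rpow]
  refine le_antisymm ?_ (lnorm_residueAlg_le hx)
  have h3 := lnorm_residueAlg_le hy
  have h4 : 0 ≤ lnorm (σ.residueAlg y) ^ s := Real.rpow_nonneg (lnorm_nonneg _) _
  have h5 : 0 < lnorm (σ.residueAlg y) ^ s := lt_of_le_of_ne h4 fun h ↦ by
    rw [← h, mul_zero] at h2; exact zero_ne_one h2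
  refine le_of_mul_le_mul_right ?_ h5
  rw [h2, ← h1]
  exact mul_le_mul_of_nonneg_left h3 gnorm_nonneg

/-- The last index at which the Gauss norm is attained. -/
theorem IsGauss.exists_last {s : ℝ} (hs : 0 < s) {x : σ.GammaAlg} (hx : σ.IsGauss s x)
    (h0 : x ≠ 0) : ∃ (a : ℕ) (η : ℝ), η < 1 ∧ σ.gterm s x a = σ.gnorm s x ∧
      ∀ i, a < i → σ.gterm s x i ≤ σ.gnorm s x * η := by
  have hA : 0 < σ.gnorm s x := lt_of_le_of_ne gnorm_nonneg fun h ↦ h0 ((hx.gnorm_eq_zero hs).1 h.symm)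
  obtain ⟨n, hn⟩ := eventually_atTop.1 (hx.eventually_lt_const hA)
  have hne : {i | σ.gterm s x i = σ.gnorm s x}.Nonempty := hx.exists_eq
  have hbdd : BddAbove {i | σ.gterm s x i = σ.gnorm s x} := ⟨n, fun i hi ↦ by
    by_contra h
    exact (hn i (not_le.1 h).le).ne hi⟩
  have hmem := Nat.sSup_mem hne hbdd
  set a := sSup {i | σ.gterm s x i = σ.gnorm s x} with ha
  obtain ⟨i₀, hi₀⟩ := exists_forall_le_of_tendsto_zero (fun i ↦ σ.gterm_nonneg s x (i + (a + 1)))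
    ((tendsto_add_atTop_iff_nat (a + 1)).2 hx)
  refine ⟨a, σ.gterm s x (i₀ + (a + 1)) / σ.gnorm s x, ?_, hmem, fun i hi ↦ ?_⟩
  · rw [div_lt_one hA]
    refine lt_of_le_of_ne (hx.le_gnorm _) fun h ↦ ?_
    have := le_csSup hbdd h
    omega
  · rw [mul_div_cancel₀ _ hA.ne']
    obtain ⟨j, rfl⟩ := Nat.exists_eq_add_of_lt hi
    have := hi₀ j
    rwa [show a + j + 1 = j + (a + 1) by ring]

theorem gterm_of_coefA_zero {s : ℝ} (hs : 0 < s) {x : σ.GammaAlg} {i : ℕ}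
    (h : σ.coefA x i = 0) : σ.gterm s x i = 0 := (gterm_eq_zero hs).2 h

/-- Removing the last dominant term. -/
theorem gterm_sub_le_step {s : ℝ} (hs : 0 < s) {x : σ.GammaAlg} {a : ℕ} {η A : ℝ}
    (hη : thet p ϖ ≤ η) (hη1 : η ≤ 1) (hA : 0 ≤ A) (hx : ∀ i, σ.gterm s x i ≤ A)
    (h : ∀ i, a < i → σ.gterm s x i ≤ A * η) (i : ℕ) :
    σ.gterm s (x - σ.unif ^ a * σ.teich (σ.coefA x a)) i ≤ A * step η a i := by
  have h0 : ∀ i, 0 ≤ A * step η a i :=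
    fun i ↦ mul_nonneg hA (step_nonneg (thet_pos.le.trans hη) a i)
  have heq : x - σ.unif ^ a * σ.teich (σ.coefA x a) =
      ∑ i ∈ Finset.range a, σ.unif ^ i * σ.teich (σ.coefA x i) +
        σ.unif ^ (a + 1) * σ.shift^[a + 1] x := by
    have := σ.eq_sum_add_iterate_shift (a + 1) x
    rw [Finset.sum_range_succ] at this
    linear_combination this
  rw [heq]
  refine gterm_add_le_of_bound hs h0 (mul_step_le hA hη hη1 a) (fun j ↦ ?_) (fun j ↦ ?_) i
  · have hc := σ.coefA_sum a (σ.coefA x) j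
    by_cases hj : j < a
    · rw [if_pos hj] at hc
      rw [step, if_pos hj, mul_one, gterm, hc]
      exact hx j
    · rw [if_neg hj] at hc
      rw [gterm_of_coefA_zero hs hc]
      exact h0 j
  · have hc := coefA_unif_pow_mul (a + 1) (σ.shift^[a + 1] x) j
    by_cases hj : j < a + 1
    · rw [if_pos hj] at hc
      rw [gterm_of_coefA_zero hs hc]
      exact h0 j
    · rw [if_neg hj, coefA_iterate_shift, Nat.sub_add_cancel (not_lt.1 hj)] at hc
      rw [step, if_neg (by omega), gterm, hc]
      exact h j (by omega)

theorem gterm_unif_pow_mul_teich {s : ℝ} (hs : 0 < s) (a : ℕ) (c : ResAlg O) (i : ℕ) :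
    σ.gterm s (σ.unif ^ a * σ.teich c) i = if i = a then thet p ϖ ^ a * lnorm c ^ s else 0 := by
  have hc := coefA_unif_pow_mul (σ := σ) a (σ.teich c) i
  split_ifs with h
  · subst h
    rw [if_neg (lt_irrefl _), Nat.sub_self, coefA_teich_zero] at hc
    rw [gterm, hc]
  · refine gterm_of_coefA_zero hs (hc.trans ?_)
    split_ifs with h1
    · rfl
    · obtain ⟨j, hj⟩ := Nat.exists_eq_succ_of_ne_zero (n := i - a) (by omega)
      rw [hj, coefA_teich_succ]

/-- The leading term of a unit strictly dominates the others. -/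
theorem IsGauss.gnorm_sub_teich_lt {s : ℝ} (hs : 0 < s) {x y : σ.GammaAlg} (hx : σ.IsGauss s x)
    (hy : σ.IsGauss s y) (h : x * y = 1) :
    σ.gnorm s (x - σ.teich (σ.residueAlg x)) < lnorm (σ.residueAlg x) ^ s := by
  have : Nontrivial σ.GammaAlg := σ.residueAlg.domain_nontrivial
  have hx0 : x ≠ 0 := left_ne_zero_of_mul_eq_one h
  have hy0 : y ≠ 0 := right_ne_zero_of_mul_eq_one h
  obtain ⟨a, η₁, hη₁, ha, hax⟩ := hx.exists_last hs hx0
  obtain ⟨b, η₂, hη₂, hb, hby⟩ := hy.exists_last hs hy0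
  have h1 : σ.gnorm s x * σ.gnorm s y = 1 := by rw [← hx.gnorm_mul hs hy, h, gnorm_one hs]
  have hA : 0 < σ.gnorm s x := lt_of_le_of_ne gnorm_nonneg fun e ↦ by
    rw [← e, zero_mul] at h1; exact zero_ne_one h1
  have hB : 0 < σ.gnorm s y := lt_of_le_of_ne gnorm_nonneg fun e ↦ by
    rw [← e, mul_zero] at h1; exact zero_ne_one h1
  set A := σ.gnorm s x with hAdef
  set B := σ.gnorm s y with hBdef
  set η := max (thet p ϖ) (max η₁ η₂) with hηdef
  have hη : thet p ϖ ≤ η := le_max_left _ _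
  have hη1 : η < 1 := max_lt thet_lt_one (max_lt hη₁ hη₂)
  have hη0 : 0 ≤ η := thet_pos.le.trans hη
  have hu := gterm_sub_le_step hs hη hη1.le hA.le hx.le_gnorm (fun i hi ↦ (hax i hi).trans
    (mul_le_mul_of_nonneg_left ((le_max_left _ _).trans (le_max_right _ _)) hA.le))
  have hv := gterm_sub_le_step hs hη hη1.le hB.le hy.le_gnorm (fun i hi ↦ (hby i hi).trans
    (mul_le_mul_of_nonneg_left ((le_max_right _ _).trans (le_max_right _ _)) hB.le))
  set u := x - σ.unif ^ a * σ.teich (σ.coefA x a) with hudef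
  set v := y - σ.unif ^ b * σ.teich (σ.coefA y b) with hvdef
  have hab : a + b = 0 := by
    by_contra hne
    have key : σ.unif ^ (a + b) * σ.teich (σ.coefA x a * σ.coefA y b) =
        1 + -(u * v + (u * (σ.unif ^ b * σ.teich (σ.coefA y b)) +
          (σ.unif ^ a * σ.teich (σ.coefA x a)) * v)) := by
      rw [← h, hudef, hvdef, σ.teich_mul, pow_add]
      ring
    have hχ0 : ∀ i, 0 ≤ (1 : ℝ) * step η (a + b) i :=
      fun i ↦ mul_nonneg zero_le_one (step_nonneg hη0 _ i)
    have hχ : ∀ i, thet p ϖ * (1 * step η (a + b) i) ≤ 1 * step η (a + b) (i + 1) :=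
      mul_step_le zero_le_one hη hη1.le (a + b)
    have e1 : ∀ i, σ.gterm s (u * v) i ≤ 1 * step η (a + b) i :=
      gterm_mul_le_of_bound hs (fun i ↦ mul_nonneg hA.le (step_nonneg hη0 a i))
        (fun i ↦ mul_nonneg hB.le (step_nonneg hη0 b i)) hχ0 hχ (fun i j ↦ by
          rw [mul_mul_mul_comm, h1, one_mul, one_mul]
          exact step_mul_step_le hη0 hη1.le a b i j) hu hv
    have e2 : ∀ i, σ.gterm s (u * (σ.unif ^ b * σ.teich (σ.coefA y b))) i ≤
        1 * step η (a + b) i :=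
      gterm_mul_le_of_bound hs (ψ := fun j ↦ if j = b then B else 0)
        (fun i ↦ mul_nonneg hA.le (step_nonneg hη0 a i))
        (fun i ↦ by split_ifs <;> linarith) hχ0 hχ (fun i j ↦ by
          split_ifs with hj
          · rw [mul_right_comm, h1, hj, step, step]
            simp only [Nat.add_lt_add_iff_right, le_refl]
          · rw [mul_zero]; exact hχ0 _) hu (fun j ↦ by
          rw [gterm_unif_pow_mul_teich hs]
          split_ifs
          · exact hb.le
          · exact le_rfl)
    have e3 : ∀ i, σ.gterm s ((σ.unif ^ a * σ.teich (σ.coefA x a)) * v) i ≤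
        1 * step η (a + b) i :=
      gterm_mul_le_of_bound hs (φ := fun j ↦ if j = a then A else 0)
        (fun i ↦ by split_ifs <;> linarith)
        (fun i ↦ mul_nonneg hB.le (step_nonneg hη0 b i)) hχ0 hχ (fun i j ↦ by
          split_ifs with hi
          · rw [← mul_assoc, h1, hi, step, step]
            simp only [Nat.add_lt_add_iff_left, le_refl]
          · rw [zero_mul]; exact hχ0 _) (fun j ↦ by
          rw [gterm_unif_pow_mul_teich hs]
          split_ifs
          · exact ha.le
          · exact le_rfl) hv
    have e0 : ∀ i, σ.gterm s 1 i ≤ 1 * step η (a + b) i := fun i ↦ by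
      have := gterm_unif_pow_mul_teich (σ := σ) hs 0 1 i
      rw [pow_zero, one_mul, σ.teich_one, lnorm_one, Real.one_rpow, pow_zero, one_mul] at this
      rw [this]
      split_ifs with hi
      · rw [hi, step, if_pos (Nat.pos_of_ne_zero hne), one_mul]
      · exact hχ0 _
    have e := gterm_add_le_of_bound hs hχ0 hχ e0 (gterm_neg_le_of_bound hs hχ0 hχ
      (gterm_add_le_of_bound hs hχ0 hχ e1 (gterm_add_le_of_bound hs hχ0 hχ e2 e3))) (a + b)
    rw [← key, gterm_unif_pow_mul_teich hs, if_pos rfl, step, if_neg (lt_irrefl _), one_mul,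
      lnorm_mul, Real.mul_rpow (lnorm_nonneg _) (lnorm_nonneg _), pow_add, mul_mul_mul_comm] at e
    have e' : σ.gterm s x a * σ.gterm s y b ≤ η := e
    rw [ha, hb, h1] at e'
    exact absurd e' (not_le.2 hη1)
  obtain ⟨rfl, -⟩ := Nat.add_eq_zero_iff.1 hab
  have hA' : lnorm (σ.residueAlg x) ^ s = A := (hx.gnorm_of_mul_eq_one hs hy h).symm
  have hu' : ∀ i, σ.gterm s (x - σ.teich (σ.residueAlg x)) i ≤ A * η := fun i ↦ by
    have := hu i
    rwa [hudef, pow_zero, one_mul, step, if_neg (Nat.not_lt_zero _)] at this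
  rw [hA']
  refine (gnorm_le hu').trans_lt ?_
  exact mul_lt_of_lt_one_right hA hη1

theorem residueAlg_emb_const (a : O) : σ.residueAlg (σ.emb 0 (GammaLaurent.const ϖ a)) =
    algebraMap (LaurentSeries (IsLocalRing.ResidueField O)) (ResAlg O)
      (HahnSeries.C (IsLocalRing.residue O a)) := by
  have h := residueLevel_pow (p := p) 0 (GammaLaurent.const ϖ a)
  rw [pow_zero, pow_one, GammaLaurent.residue_const] at h
  rw [σ.residueAlg_emb, h]

theorem emb_const_mem_gammaK (a : O) : σ.emb 0 (GammaLaurent.const ϖ a) ∈ σ.GammaK V := by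
  have hle : ∀ S : Subring σ.GammaAlg, S ≤ σ.adicClosure S := fun S x hx N ↦ ⟨x, hx, by simp⟩
  refine hle _ (Subring.subset_closure ⟨?_, 0, by simp,
    Polynomial.X - Polynomial.C (σ.emb 0 (GammaLaurent.const ϖ a)), Polynomial.monic_X_sub_C _,
    fun i ↦ ?_, by simp, by simp⟩)
  · rw [residueAlg_emb_const]
    exact K.algebraMap_mem _
  · have h : ∃ b : O, (Polynomial.X - Polynomial.C (σ.emb 0 (GammaLaurent.const ϖ a))).coeff i =
        σ.emb 0 (GammaLaurent.const ϖ b) := by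
      rw [Polynomial.coeff_sub, Polynomial.coeff_X, Polynomial.coeff_C]
      rcases i with _ | _ | i
      · exact ⟨-a, by simp⟩
      · exact ⟨1, by simp⟩
      · exact ⟨0, by simp⟩
    obtain ⟨b, hb⟩ := h
    exact ⟨0, by simp, GammaLaurent.const ϖ b, const_mem_seriesSubring 0 b, hb⟩

theorem unif_mem_gammaK : σ.unif ∈ σ.GammaK V := emb_const_mem_gammaK V ϖ

theorem mem_gammaK_of_dvd {x : σ.GammaAlg}
    (h : ∀ N : ℕ, ∃ y ∈ σ.GammaK V, σ.unif ^ N ∣ x - y) : x ∈ σ.GammaK V := by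
  intro N
  obtain ⟨y, hy, hxy⟩ := h N
  obtain ⟨z, hz, hyz⟩ := hy N
  exact ⟨z, hz, by simpa using dvd_add hxy hyz⟩

variable (σ) in
theorem exists_natCast_eq_emb_const : ∃ v w : O, v * w = 1 ∧ ((p : ℕ) : σ.GammaAlg) =
    σ.emb 0 (GammaLaurent.const ϖ v) * σ.unif ^ ramIndex p ϖ := by
  obtain ⟨v, hv⟩ := exists_natCast_eq_unit_mul_pow (p := p) (ϖ := ϖ)
  refine ⟨v, (v⁻¹ : Oˣ), v.mul_inv, ?_⟩
  have h := congrArg (fun a ↦ σ.emb 0 (GammaLaurent.const ϖ a)) hv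
  simpa [unif] using h

theorem exists_natCast_pow_mul_mem {x : σ.GammaAlg} {n : ℕ} (h : σ.unif ^ n * x ∈ σ.GammaK V) :
    ((p : ℕ) : σ.GammaAlg) ^ n * x ∈ σ.GammaK V := by
  obtain ⟨v, w, hvw, hv⟩ := σ.exists_natCast_eq_emb_const
  obtain ⟨e, he⟩ := Nat.exists_eq_add_of_lt (ramIndex_pos (p := p) (ϖ := ϖ))
  have h1 : ((p : ℕ) : σ.GammaAlg) ^ n * x =
      (σ.emb 0 (GammaLaurent.const ϖ v) * σ.unif ^ e) ^ n * (σ.unif ^ n * x) := by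
    rw [hv, he]; ring
  rw [h1]
  exact (σ.GammaK V).mul_mem (pow_mem ((σ.GammaK V).mul_mem (emb_const_mem_gammaK V v)
    (pow_mem (unif_mem_gammaK V) e)) n) h

theorem mem_gammaKR {r : ℝ} (hr : 0 < r) {x : σ.GammaAlg} :
    x ∈ σ.GammaKR V r ↔ σ.IsGauss r x ∧ x ∈ σ.GammaK V :=
  and_congr_left' (mem_GammaAlgR hr)

variable (σ) in
/-- The elements of `Γ^alg_r` that have a multiple by a power of the uniformizer in `Γ^K`. -/
def satSubring {r : ℝ} (hr : 0 < r) : Subring σ.GammaAlg where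
  carrier := {x | σ.IsGauss r x ∧ ∃ n, σ.unif ^ n * x ∈ σ.GammaK V}
  mul_mem' := by
    rintro x y ⟨hx, m, hm⟩ ⟨hy, n, hn⟩
    refine ⟨hx.mul hr hy, m + n, ?_⟩
    rw [pow_add, mul_mul_mul_comm]
    exact (σ.GammaK V).mul_mem hm hn
  one_mem' := ⟨isGauss_one hr, 0, by rw [pow_zero, one_mul]; exact (σ.GammaK V).one_mem⟩
  add_mem' := by
    rintro x y ⟨hx, m, hm⟩ ⟨hy, n, hn⟩
    refine ⟨hx.add hr hy, m + n, ?_⟩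
    have h : σ.unif ^ (m + n) * (x + y) =
      σ.unif ^ n * (σ.unif ^ m * x) + σ.unif ^ m * (σ.unif ^ n * y) := by ring
    rw [h]
    exact (σ.GammaK V).add_mem ((σ.GammaK V).mul_mem (pow_mem (unif_mem_gammaK V) _) hm)
      ((σ.GammaK V).mul_mem (pow_mem (unif_mem_gammaK V) _) hn)
  zero_mem' := ⟨(σ.gaussSubring hr).zero_mem, 0, by
    rw [mul_zero]; exact (σ.GammaK V).zero_mem⟩
  neg_mem' := by
    rintro x ⟨hx, m, hm⟩
    exact ⟨hx.neg hr, m, by rw [mul_neg]; exact (σ.GammaK V).neg_mem hm⟩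

theorem gammaKR_le_satSubring {r : ℝ} (hr : 0 < r) : σ.GammaKR V r ≤ σ.satSubring V hr :=
  fun x hx ↦ ⟨((mem_gammaKR V hr).1 hx).1, 0, by
    rw [pow_zero, one_mul]; exact ((mem_gammaKR V hr).1 hx).2⟩

theorem residue_mem_of_mem_satSubring {r : ℝ} {hr : 0 < r} {x : σ.GammaAlg}
    (h : x ∈ σ.satSubring V hr) : σ.residueAlg x ∈ K := by
  obtain ⟨-, n, hn⟩ := h
  exact residue_mem_of_natCast_pow_mul_mem V (exists_natCast_pow_mul_mem V hn)

theorem satSubring_of_unif_mul {r : ℝ} {hr : 0 < r} {x : σ.GammaAlg}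
    (h : σ.unif * x ∈ σ.satSubring V hr) : x ∈ σ.satSubring V hr := by
  obtain ⟨h, n, hn⟩ := h
  refine ⟨isGauss_of_unif_pow_mul (n := 1) (by rwa [pow_one]), n + 1, ?_⟩
  rwa [pow_succ, mul_assoc]

theorem isGauss_of_approx {s : ℝ} (hs : 0 < s) {x : σ.GammaAlg}
    (h : ∀ ε > 0, ∃ z, σ.IsGauss s z ∧ ∀ i, σ.gterm s (x - z) i ≤ ε) : σ.IsGauss s x := by
  refine tendsto_order.2 ⟨fun a ha ↦ Eventually.of_forall fun i ↦
    ha.trans_le (σ.gterm_nonneg s x i), fun ε hε ↦ ?_⟩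
  obtain ⟨z, hz, hxz⟩ := h (ε / 2) (half_pos hε)
  obtain ⟨n, hn⟩ := eventually_atTop.1 (hz.eventually_lt_const (half_pos hε))
  set D := ∑ i ∈ Finset.range n, lnorm (σ.coefA z i) ^ s with hD
  have hD0 : 0 ≤ D := Finset.sum_nonneg fun i _ ↦ Real.rpow_nonneg (lnorm_nonneg _) _
  have hlim : Tendsto (fun i ↦ thet p ϖ ^ i * D) atTop (𝓝 0) := by
    have := (tendsto_pow_atTop_nhds_zero_of_lt_one (thet_pos (p := p) (ϖ := ϖ)).le
      thet_lt_one).mul_const D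
    rwa [zero_mul] at this
  have hb : ∀ i, σ.gterm s (z + (x - z)) i ≤ max (ε / 2) (thet p ϖ ^ i * D) := by
    refine gterm_add_le_of_bound hs (ψ := fun i ↦ max (ε / 2) (thet p ϖ ^ i * D))
      (fun i ↦ le_max_of_le_left (half_pos hε).le) (fun i ↦ ?_) (fun i ↦ ?_)
      (fun i ↦ (hxz i).trans (le_max_left _ _))
    · rw [mul_max_of_nonneg _ _ thet_pos.le, pow_succ', mul_assoc]
      exact max_le_max (mul_le_of_le_one_left (half_pos hε).le thet_lt_one.le) le_rfl
    · rcases lt_or_ge i n with h | h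
      · refine le_max_of_le_right (mul_le_mul_of_nonneg_left ?_ (thet_pow_pos i).le)
        exact Finset.single_le_sum (f := fun i ↦ lnorm (σ.coefA z i) ^ s)
          (fun i _ ↦ Real.rpow_nonneg (lnorm_nonneg _) _) (Finset.mem_range.2 h)
      · exact le_max_of_le_left (hn i h).le
  rw [add_sub_cancel] at hb
  filter_upwards [hlim.eventually_lt_const hε] with i hi
  exact (hb i).trans_lt (max_lt (half_lt_self hε) hi)

theorem isGauss_pow {s : ℝ} (hs : 0 < s) {x : σ.GammaAlg} (hx : σ.IsGauss s x) (n : ℕ) :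
    σ.IsGauss s (x ^ n) ∧ σ.gnorm s (x ^ n) = σ.gnorm s x ^ n := by
  induction n with
  | zero => rw [pow_zero, pow_zero]; exact ⟨isGauss_one hs, gnorm_one hs⟩
  | succ n ih =>
    rw [pow_succ, pow_succ, ih.1.gnorm_mul hs hx, ih.2]
    exact ⟨ih.1.mul hs hx, rfl⟩

/-- The geometric series in `Γ^K_r`. -/
theorem exists_inv_one_sub_gammaKR {r : ℝ} (hr : 0 < r) {z : σ.GammaAlg}
    (hz : σ.unif * z ∈ σ.GammaKR V r) (hz1 : σ.gnorm r (σ.unif * z) < 1) :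
    ∃ L ∈ σ.GammaKR V r, (1 - σ.unif * z) * L = 1 := by
  obtain ⟨L, hL, hLn⟩ := σ.exists_inv_one_sub z
  rw [mem_gammaKR V hr] at hz
  set y := σ.unif * z
  have hS : ∀ n, ∑ i ∈ Finset.range n, y ^ i ∈ σ.GammaK V :=
    fun n ↦ sum_mem fun i _ ↦ pow_mem hz.2 i
  refine ⟨L, (mem_gammaKR V hr).2 ⟨?_, mem_gammaK_of_dvd V fun N ↦ ⟨_, hS N, ?_⟩⟩, hL⟩
  · refine isGauss_of_approx hr fun ε hε ↦ ?_
    obtain ⟨m, hm⟩ := exists_pow_lt_of_lt_one hε hz1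
    refine ⟨∑ i ∈ Finset.range m, y ^ i, (σ.gaussSubring hr).sum_mem fun i _ ↦
      (isGauss_pow hr hz.1 i).1, fun j ↦ ?_⟩
    have hdvd : σ.unif ^ (m + j + 1) ∣ (L - ∑ i ∈ Finset.range m, y ^ i) -
        y ^ m * ∑ i ∈ Finset.range (j + 1), y ^ i := by
      have h1 := hLn (m + j + 1)
      have h2 : ∑ i ∈ Finset.range (m + j + 1), y ^ i = ∑ i ∈ Finset.range m, y ^ i +
          y ^ m * ∑ i ∈ Finset.range (j + 1), y ^ i := by
        rw [add_assoc, Finset.sum_range_add, Finset.mul_sum]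
        exact congrArg _ (Finset.sum_congr rfl fun i _ ↦ pow_add y m i)
      rw [h2, ← dvd_neg] at h1
      convert h1 using 1
      ring
    have hc := σ.coefA_congr hdvd (i := j) (by omega)
    rw [gterm, hc]
    have hsum : ∀ n, ∀ i, σ.gterm r (∑ i ∈ Finset.range n, y ^ i) i ≤ 1 := by
      intro n
      induction n with
      | zero =>
        intro i
        rw [Finset.sum_range_zero]
        refine le_trans ?_ (zero_le_one (α := ℝ))
        rw [← gnorm_zero (σ := σ) hr]
        exact ((σ.gaussSubring hr).zero_mem : σ.IsGauss r 0).le_gnorm i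
      | succ n ih =>
        rw [Finset.sum_range_succ]
        refine gterm_add_le hr ih fun i ↦ ?_
        have h := isGauss_pow hr hz.1 n
        refine (h.1.le_gnorm i).trans ?_
        rw [h.2]
        exact pow_le_one₀ gnorm_nonneg hz1.le
    have h := isGauss_pow hr hz.1 m
    have h3 := gterm_mul_le hr h.1.le_gnorm (hsum (j + 1)) j
    rw [h.2, mul_one] at h3
    exact h3.trans hm.le
  · rw [← dvd_neg, neg_sub]
    exact hLn N

variable (σ) in
/-- The units of `Γ^K_r` that are close to the Teichmüller lift of their residue. -/
structure IsGoodUnit (r θ : ℝ) (x : σ.GammaAlg) : Prop where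
  mem : x ∈ σ.GammaKR V r
  exists_inv : ∃ y ∈ σ.GammaKR V r, x * y = 1
  le : σ.gnorm r (x - σ.teich (σ.residueAlg x)) ≤ θ * lnorm (σ.residueAlg x) ^ r

variable {V}

theorem IsGoodUnit.mono {r θ θ' : ℝ} {x : σ.GammaAlg} (h : σ.IsGoodUnit V r θ x) (hθ : θ ≤ θ') :
    σ.IsGoodUnit V r θ' x :=
  ⟨h.mem, h.exists_inv, h.le.trans (mul_le_mul_of_nonneg_right hθ
    (Real.rpow_nonneg (lnorm_nonneg _) _))⟩

theorem IsGoodUnit.isGauss {r θ : ℝ} (hr : 0 < r) {x : σ.GammaAlg} (h : σ.IsGoodUnit V r θ x) :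
    σ.IsGauss r x := ((mem_gammaKR V hr).1 h.mem).1

theorem IsGoodUnit.residue_ne_zero {r θ : ℝ} {x : σ.GammaAlg} (h : σ.IsGoodUnit V r θ x) :
    σ.residueAlg x ≠ 0 := by
  obtain ⟨y, -, hy⟩ := h.exists_inv
  have := congrArg σ.residueAlg hy
  rw [map_mul, map_one] at this
  exact left_ne_zero_of_mul_eq_one this

theorem IsGoodUnit.gnorm_eq {r θ s : ℝ} {x : σ.GammaAlg} (h : σ.IsGoodUnit V r θ x) (hs : 0 < s)
    (hsr : s ≤ r) : σ.gnorm s x = lnorm (σ.residueAlg x) ^ s := by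
  obtain ⟨y, hy, hxy⟩ := h.exists_inv
  exact ((h.isGauss (hs.trans_le hsr)).mono hs hsr).gnorm_of_mul_eq_one hs
    (((mem_gammaKR V (hs.trans_le hsr)).1 hy).1.mono hs hsr) hxy

theorem exists_isGoodUnit_of_unit {r : ℝ} (hr : 0 < r) {x y : σ.GammaAlg}
    (hx : x ∈ σ.GammaKR V r) (hy : y ∈ σ.GammaKR V r) (h : x * y = 1) :
    ∃ θ < 1, σ.IsGoodUnit V r θ x := by
  have hlt := ((mem_gammaKR V hr).1 hx).1.gnorm_sub_teich_lt hr ((mem_gammaKR V hr).1 hy).1 h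
  have hpos : 0 < lnorm (σ.residueAlg x) ^ r := gnorm_nonneg.trans_lt hlt
  refine ⟨_, (div_lt_one hpos).2 hlt, hx, ⟨y, hy, h⟩, ?_⟩
  rw [div_mul_cancel₀ _ hpos.ne']

theorem IsGoodUnit.mul {r θ : ℝ} (hr : 0 < r) {x y : σ.GammaAlg}
    (hx : σ.IsGoodUnit V r θ x) (hy : σ.IsGoodUnit V r θ y) : σ.IsGoodUnit V r θ (x * y) := by
  obtain ⟨x', hx', hxx⟩ := hx.exists_inv
  obtain ⟨y', hy', hyy⟩ := hy.exists_inv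
  refine ⟨Subring.mul_mem _ hx.mem hy.mem, ⟨x' * y', Subring.mul_mem _ hx' hy', by
    rw [mul_mul_mul_comm, hxx, hyy, one_mul]⟩, ?_⟩
  have gx := hx.isGauss hr
  have gy := hy.isGauss hr
  have tx := isGauss_teich (σ := σ) hr (σ.residueAlg x)
  have ty := isGauss_teich (σ := σ) hr (σ.residueAlg y)
  rw [map_mul, σ.teich_mul, lnorm_mul, Real.mul_rpow (lnorm_nonneg _) (lnorm_nonneg _)]
  have h : x * y - σ.teich (σ.residueAlg x) * σ.teich (σ.residueAlg y) =
    (x - σ.teich (σ.residueAlg x)) * y +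
      σ.teich (σ.residueAlg x) * (y - σ.teich (σ.residueAlg y)) := by ring
  rw [h]
  refine (((gx.sub hr tx).mul hr gy).gnorm_add_le hr (tx.mul hr (gy.sub hr ty))).trans ?_
  rw [(gx.sub hr tx).gnorm_mul hr gy, tx.gnorm_mul hr (gy.sub hr ty), gnorm_teich hr,
    hy.gnorm_eq hr le_rfl]
  have n1 := Real.rpow_nonneg (lnorm_nonneg (σ.residueAlg x)) r
  have n2 := Real.rpow_nonneg (lnorm_nonneg (σ.residueAlg y)) r
  refine max_le ((mul_le_mul_of_nonneg_right hx.le n2).trans_eq (by ring))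
    ((mul_le_mul_of_nonneg_left hy.le n1).trans_eq (by ring))

theorem IsGoodUnit.exists_inverse {r θ : ℝ} (hr : 0 < r) {x : σ.GammaAlg}
    (hx : σ.IsGoodUnit V r θ x) : ∃ y, σ.IsGoodUnit V r θ y ∧ x * y = 1 := by
  obtain ⟨y, hy, hxy⟩ := hx.exists_inv
  have gx := hx.isGauss hr
  have gy := ((mem_gammaKR V hr).1 hy).1
  have ty := isGauss_teich (σ := σ) hr (σ.residueAlg y)
  have tx := isGauss_teich (σ := σ) hr (σ.residueAlg x)
  have hr1 : σ.residueAlg x * σ.residueAlg y = 1 := by rw [← map_mul, hxy, map_one]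
  refine ⟨y, ⟨hy, ⟨x, hx.mem, by rw [mul_comm, hxy]⟩, ?_⟩, hxy⟩
  have h : y - σ.teich (σ.residueAlg y) =
      -((x - σ.teich (σ.residueAlg x)) * (y * σ.teich (σ.residueAlg y))) := by
    have h1 : σ.teich (σ.residueAlg x) * σ.teich (σ.residueAlg y) = 1 := by
      rw [← σ.teich_mul, hr1, σ.teich_one]
    linear_combination σ.teich (σ.residueAlg y) * hxy - y * h1
  have e1 : σ.gnorm r y = lnorm (σ.residueAlg y) ^ r :=
    gy.gnorm_of_mul_eq_one hr gx (by rw [mul_comm, hxy])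
  have n1 : lnorm (σ.residueAlg x) ^ r * lnorm (σ.residueAlg y) ^ r = 1 := by
    rw [← Real.mul_rpow (lnorm_nonneg _) (lnorm_nonneg _), ← lnorm_mul, hr1, lnorm_one,
      Real.one_rpow]
  rw [h, ((gx.sub hr tx).mul hr (gy.mul hr ty)).gnorm_neg hr,
    (gx.sub hr tx).gnorm_mul hr (gy.mul hr ty), gy.gnorm_mul hr ty, gnorm_teich hr, e1]
  have n2 := Real.rpow_nonneg (lnorm_nonneg (σ.residueAlg y)) r
  refine (mul_le_mul_of_nonneg_right hx.le (mul_nonneg n2 n2)).trans_eq ?_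
  linear_combination θ * lnorm (σ.residueAlg y) ^ r * n1

theorem isGoodUnit_one {r θ : ℝ} (hr : 0 < r) (hθ : 0 ≤ θ) : σ.IsGoodUnit V r θ 1 := by
  refine ⟨Subring.one_mem _, ⟨1, Subring.one_mem _, one_mul 1⟩, ?_⟩
  rw [map_one, σ.teich_one, sub_self, gnorm_zero hr, lnorm_one, Real.one_rpow, mul_one]
  exact hθ

theorem coefA_sub_teich_zero (z : σ.GammaAlg) :
    σ.coefA (z - σ.teich (σ.residueAlg z)) 0 = 0 := by
  have h : z - σ.teich (σ.residueAlg z) = σ.unif * σ.shift z := by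
    linear_combination σ.eq_teich_add_shift z
  rw [h, σ.coefA_unif_mul_zero]

theorem coefA_sub_teich_succ (z : σ.GammaAlg) (i : ℕ) :
    σ.coefA (z - σ.teich (σ.residueAlg z)) (i + 1) = σ.coefA z (i + 1) := by
  have h : z - σ.teich (σ.residueAlg z) = σ.unif * σ.shift z := by
    linear_combination σ.eq_teich_add_shift z
  rw [h, σ.coefA_unif_mul_succ]
  exact coefA_iterate_shift z 1 i

theorem gterm_sub_teich_le {r M : ℝ} (hr : 0 < r) {z : σ.GammaAlg}
    (h : ∀ i, lnorm (σ.coefA z i) ≤ M) (i : ℕ) :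
    σ.gterm r (z - σ.teich (σ.residueAlg z)) i ≤ thet p ϖ * M ^ r := by
  have hM : 0 ≤ M := (lnorm_nonneg _).trans (h 0)
  rcases i with _ | i
  · rw [gterm_of_coefA_zero hr (coefA_sub_teich_zero z)]
    exact mul_nonneg thet_pos.le (Real.rpow_nonneg hM _)
  · rw [gterm, coefA_sub_teich_succ]
    refine mul_le_mul ?_ (Real.rpow_le_rpow (lnorm_nonneg _) (h _) hr.le)
      (Real.rpow_nonneg (lnorm_nonneg _) _) thet_pos.le
    rw [pow_succ]
    exact mul_le_of_le_one_left thet_pos.le (pow_le_one₀ thet_pos.le thet_lt_one.le)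

theorem lnorm_coefA_teich_le {M : ℝ} {a : ResAlg O} (h : lnorm a ≤ M) (i : ℕ) :
    lnorm (σ.coefA (σ.teich a) i) ≤ M := by
  rcases i with _ | i
  · rwa [coefA_teich_zero]
  · rw [coefA_teich_succ, lnorm_zero]; exact (lnorm_nonneg _).trans h

theorem gnorm_teich_add_sub_le {r M : ℝ} (hr : 0 < r) {a b : ResAlg O} (ha : lnorm a ≤ M)
    (hb : lnorm b ≤ M) :
    σ.gnorm r (σ.teich a + σ.teich b - σ.teich (a + b)) ≤ thet p ϖ * M ^ r := by
  have h := gterm_sub_teich_le hr (σ.lnorm_coefA_add_le (φ := fun _ ↦ M) monotone_const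
    ((lnorm_nonneg _).trans ha) (lnorm_coefA_teich_le ha) (lnorm_coefA_teich_le (σ := σ) hb))
  rw [map_add, σ.residueAlg_teich, σ.residueAlg_teich] at h
  exact gnorm_le h

/-- The Teichmüller lifts of elements of a perfect valued field. -/
theorem isGoodUnit_teich_of_perfectField [PerfectField K] {r : ℝ} (hr : 0 < r)
    (hl : ∀ a ∈ K, a ≠ 0 → ∃ x ∈ σ.GammaKR V r, ∃ y ∈ σ.GammaKR V r,
      x * y = 1 ∧ σ.residueAlg x = a) {a : ResAlg O} (ha : a ∈ K) (h0 : a ≠ 0) :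
    σ.IsGoodUnit V r (thet p ϖ) (σ.teich a) := by
  have key : ∀ b ∈ K, b ≠ 0 → σ.teich b ∈ σ.GammaKR V r := by
    intro b hb hb0
    refine (mem_gammaKR V hr).2 ⟨isGauss_teich hr b, mem_gammaK_of_dvd V fun N ↦ ?_⟩
    have : CharP K p := charP_of_injective_algebraMap
      (algebraMap (LaurentSeries (IsLocalRing.ResidueField O)) K).injective p
    have : ExpChar K p := ExpChar.prime Fact.out
    have : PerfectRing K p := PerfectField.toPerfectRing p
    set c := (iterateFrobeniusEquiv K p N).symm ⟨b, hb⟩ with hc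
    have hcp : (c : ResAlg O) ^ p ^ N = b := by
      have h := (iterateFrobeniusEquiv K p N).apply_symm_apply ⟨b, hb⟩
      rw [iterateFrobeniusEquiv_def] at h
      exact congrArg (fun x : K ↦ (x : ResAlg O)) h
    have hc0 : (c : ResAlg O) ≠ 0 := by
      intro h
      rw [h, zero_pow (pow_pos (Fact.out : p.Prime).pos N).ne'] at hcp
      exact hb0 hcp.symm
    obtain ⟨x, hx, -, -, -, hxc⟩ := hl c c.2 hc0
    refine ⟨x ^ p ^ N, pow_mem ((mem_gammaKR V hr).1 hx).2 _, ?_⟩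
    have h1 : σ.unif ∣ σ.teich (c : ResAlg O) - x := by
      rw [← σ.isResidueUniformizer_alg.dvd_sub_iff, σ.residueAlg_teich, hxc]
    have h2 := pow_dvd_pow_sub_pow σ.unif_dvd_natCast h1 N
    rw [← σ.teich_pow, hcp] at h2
    exact (pow_dvd_pow _ (Nat.le_succ N)).trans h2
  refine ⟨key a ha h0, ⟨_, key _ (K.inv_mem ha) (inv_ne_zero h0), ?_⟩, ?_⟩
  · rw [← σ.teich_mul, mul_inv_cancel₀ h0, σ.teich_one]
  · rw [σ.residueAlg_teich, sub_self, gnorm_zero hr]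
    exact mul_nonneg thet_pos.le (Real.rpow_nonneg (lnorm_nonneg _) _)

variable (σ V) in
/-- The integral elements of `Γ^K_r` that are close to the Teichmüller lift of their residue. -/
structure IsGoodInt (r θ : ℝ) (x : σ.GammaAlg) : Prop where
  mem : x ∈ σ.GammaKR V r
  lnorm_le : lnorm (σ.residueAlg x) ≤ 1
  le : σ.gnorm r (x - σ.teich (σ.residueAlg x)) ≤ θ

theorem IsGoodInt.add {r θ : ℝ} (hr : 0 < r) (hθ : thet p ϖ ≤ θ) {x y : σ.GammaAlg}
    (hx : σ.IsGoodInt V r θ x) (hy : σ.IsGoodInt V r θ y) : σ.IsGoodInt V r θ (x + y) := by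
  have gx := ((mem_gammaKR V hr).1 hx.mem).1
  have gy := ((mem_gammaKR V hr).1 hy.mem).1
  have t := fun a ↦ isGauss_teich (σ := σ) hr a
  refine ⟨Subring.add_mem _ hx.mem hy.mem, ?_, ?_⟩
  · rw [map_add]
    exact (lnorm_add_le _ _).trans (max_le hx.lnorm_le hy.lnorm_le)
  · have h : x + y - σ.teich (σ.residueAlg (x + y)) =
        (x - σ.teich (σ.residueAlg x)) + (y - σ.teich (σ.residueAlg y)) +
          (σ.teich (σ.residueAlg x) + σ.teich (σ.residueAlg y) -
            σ.teich (σ.residueAlg x + σ.residueAlg y)) := by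
      rw [map_add]; ring
    rw [h]
    refine ((((gx.sub hr (t _)).add hr (gy.sub hr (t _))).gnorm_add_le hr
      (((t _).add hr (t _)).sub hr (t _))).trans (max_le (((gx.sub hr (t _)).gnorm_add_le hr
        (gy.sub hr (t _))).trans (max_le hx.le hy.le)) ?_))
    refine (gnorm_teich_add_sub_le hr hx.lnorm_le hy.lnorm_le).trans ?_
    rw [Real.one_rpow, mul_one]
    exact hθ

theorem isGoodInt_zero {r θ : ℝ} (hr : 0 < r) (hθ : 0 ≤ θ) : σ.IsGoodInt V r θ 0 := by
  refine ⟨Subring.zero_mem _, ?_, ?_⟩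
  · rw [map_zero, lnorm_zero]; exact zero_le_one
  · have h : (0 : σ.GammaAlg) - σ.teich (σ.residueAlg 0) = 0 := by
      rw [map_zero, zero_sub, σ.teich_zero, neg_zero]
    rw [h, gnorm_zero hr]
    exact hθ

theorem isGoodInt_sum {ι : Type*} {r θ : ℝ} (hr : 0 < r) (hθ : thet p ϖ ≤ θ) (s : Finset ι)
    {x : ι → σ.GammaAlg} (h : ∀ i ∈ s, σ.IsGoodInt V r θ (x i)) :
    σ.IsGoodInt V r θ (∑ i ∈ s, x i) :=
  Finset.sum_induction x (σ.IsGoodInt V r θ) (fun _ _ ↦ IsGoodInt.add hr hθ)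
    (isGoodInt_zero hr (thet_pos.le.trans hθ)) h

theorem isGauss_emb_const {r : ℝ} (hr : 0 < r) (a : O) :
    σ.IsGauss r (σ.emb 0 (GammaLaurent.const ϖ a)) ∧
      σ.gnorm r (σ.emb 0 (GammaLaurent.const ϖ a)) ≤ 1 := by
  have h : ∀ i, σ.gterm r (σ.emb 0 (GammaLaurent.const ϖ a)) i ≤ thet p ϖ ^ i := fun i ↦
    mul_le_of_le_one_right (thet_pow_pos i).le
      (Real.rpow_le_one (lnorm_nonneg _) (σ.lnorm_coefA_emb_const_le i 0 a) hr.le)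
  exact ⟨squeeze_zero (fun i ↦ σ.gterm_nonneg _ _ i) h
    (tendsto_pow_atTop_nhds_zero_of_lt_one thet_pos.le thet_lt_one),
    gnorm_le fun i ↦ (h i).trans (pow_le_one₀ thet_pos.le thet_lt_one.le)⟩

theorem IsGoodInt.const_mul {r θ : ℝ} (hr : 0 < r) (hθ : thet p ϖ ≤ θ) {x : σ.GammaAlg}
    (hx : σ.IsGoodInt V r θ x) (a : O) :
    σ.IsGoodInt V r θ (σ.emb 0 (GammaLaurent.const ϖ a) * x) := by
  have gx := ((mem_gammaKR V hr).1 hx.mem).1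
  obtain ⟨ga, na⟩ := isGauss_emb_const (σ := σ) hr a
  have la : lnorm (σ.residueAlg (σ.emb 0 (GammaLaurent.const ϖ a))) ≤ 1 :=
    σ.lnorm_coefA_emb_const_le 0 0 a
  have da := gterm_sub_teich_le hr (fun i ↦ σ.lnorm_coefA_emb_const_le i 0 a)
  have t := fun a ↦ isGauss_teich (σ := σ) hr a
  refine ⟨Subring.mul_mem _ ((mem_gammaKR V hr).2 ⟨ga, emb_const_mem_gammaK V a⟩) hx.mem, ?_, ?_⟩
  · rw [map_mul, lnorm_mul]
    exact mul_le_one₀ la (lnorm_nonneg _) hx.lnorm_le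
  · set l := σ.emb 0 (GammaLaurent.const ϖ a)
    have h : l * x - σ.teich (σ.residueAlg (l * x)) = l * (x - σ.teich (σ.residueAlg x)) +
        (l - σ.teich (σ.residueAlg l)) * σ.teich (σ.residueAlg x) := by
      rw [map_mul, σ.teich_mul]; ring
    rw [h]
    refine ((ga.mul hr (gx.sub hr (t _))).gnorm_add_le hr ((ga.sub hr (t _)).mul hr (t _))).trans ?_
    rw [ga.gnorm_mul hr (gx.sub hr (t _)), (ga.sub hr (t _)).gnorm_mul hr (t _), gnorm_teich hr]
    refine max_le ((mul_le_of_le_one_left gnorm_nonneg na).trans hx.le)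
      ((mul_le_of_le_one_right gnorm_nonneg (Real.rpow_le_one (lnorm_nonneg _) hx.lnorm_le
        hr.le)).trans ((gnorm_le da).trans ?_))
    rw [Real.one_rpow, mul_one]
    exact hθ

theorem IsGoodUnit.exists_zpow {r θ : ℝ} (hr : 0 < r) (hθ : 0 ≤ θ) {x : σ.GammaAlg}
    (hx : σ.IsGoodUnit V r θ x) (j : ℤ) :
    ∃ y, σ.IsGoodUnit V r θ y ∧ σ.residueAlg y = σ.residueAlg x ^ j := by
  have hpow : ∀ n : ℕ, ∃ y, σ.IsGoodUnit V r θ y ∧ σ.residueAlg y = σ.residueAlg x ^ n := by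
    intro n
    induction n with
    | zero => exact ⟨1, isGoodUnit_one hr hθ, by rw [map_one, pow_zero]⟩
    | succ n ih =>
      obtain ⟨y, hy, hyn⟩ := ih
      exact ⟨y * x, hy.mul hr hx, by rw [map_mul, hyn, pow_succ]⟩
  rcases Int.eq_nat_or_neg j with ⟨n, rfl | rfl⟩
  · simpa using hpow n
  · obtain ⟨y, hy, hyn⟩ := hpow n
    obtain ⟨z, hz, hyz⟩ := hy.exists_inverse hr
    refine ⟨z, hz, ?_⟩
    have h := congrArg σ.residueAlg hyz
    rw [map_mul, map_one, hyn] at h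
    rw [zpow_neg, zpow_natCast]
    exact eq_inv_of_mul_eq_one_right h

/-- Uniformly good lifts of the elements of a finite extension of `k((t))`. -/
theorem exists_good_lift_of_finiteDimensional
    [FiniteDimensional (LaurentSeries (IsLocalRing.ResidueField O)) K] {r : ℝ} (hr : 0 < r)
    (hl : ∀ a ∈ K, a ≠ 0 → ∃ x ∈ σ.GammaKR V r, ∃ y ∈ σ.GammaKR V r,
      x * y = 1 ∧ σ.residueAlg x = a) :
    ∃ θ, thet p ϖ ≤ θ ∧ θ < 1 ∧
      ∀ a ∈ K, a ≠ 0 → ∃ x, σ.IsGoodUnit V r θ x ∧ σ.residueAlg x = a := by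
  obtain ⟨P, hP, hP0, hP1, hPgen⟩ := exists_lnorm_generator K
  obtain ⟨n, e, he, hgen⟩ := exists_residue_generators K
  have hlift : ∀ i, ∃ θ : {x : ℝ // x < 1}, ∃ x, σ.IsGoodInt V r θ x ∧ σ.residueAlg x = e i := by
    intro i
    by_cases h0 : e i = 0
    · exact ⟨⟨0, zero_lt_one⟩, 0, isGoodInt_zero hr le_rfl, by rw [map_zero, h0]⟩
    · obtain ⟨x, hx, y, hy, hxy, hxe⟩ := hl _ (he i).1 h0
      obtain ⟨θ, hθ, hg⟩ := exists_isGoodUnit_of_unit hr hx hy hxy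
      have hle : lnorm (σ.residueAlg x) ≤ 1 := by rw [hxe]; exact (he i).2
      refine ⟨⟨max θ 0, max_lt hθ zero_lt_one⟩, x, ⟨hx, hle, hg.le.trans ?_⟩, hxe⟩
      exact (mul_le_mul_of_nonneg_right (le_max_left θ 0) (Real.rpow_nonneg (lnorm_nonneg _) _)).trans
        (mul_le_of_le_one_right (le_max_right _ _) (Real.rpow_le_one (lnorm_nonneg _) hle hr.le))
  choose θe E hE hEe using hlift
  have : Nonempty {x : ℝ // x < 1} := ⟨⟨0, zero_lt_one⟩⟩
  obtain ⟨⟨θ₁, hθ₁⟩, hM⟩ := Finite.exists_le θe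
  obtain ⟨u, hu, u', hu', huu, huP⟩ := hl P hP hP0
  obtain ⟨θ₂, hθ₂, hgu⟩ := exists_isGoodUnit_of_unit hr hu hu' huu
  have hPr : lnorm P ^ r < 1 := Real.rpow_lt_one (lnorm_nonneg _) hP1 hr
  refine ⟨max (thet p ϖ) (max θ₁ (max θ₂ (lnorm P ^ r))), le_max_left _ _,
    max_lt thet_lt_one (max_lt hθ₁ (max_lt hθ₂ hPr)), ?_⟩
  set θ := max (thet p ϖ) (max θ₁ (max θ₂ (lnorm P ^ r))) with hθdef
  have hθ : thet p ϖ ≤ θ := le_max_left _ _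
  have hθ1 : θ < 1 := max_lt thet_lt_one (max_lt hθ₁ (max_lt hθ₂ hPr))
  have h1θ : θ₁ ≤ θ := (le_max_left _ _).trans (le_max_right _ _)
  have h2θ : θ₂ ≤ θ := (le_max_left _ _).trans ((le_max_right _ _).trans (le_max_right _ _))
  have h3θ : lnorm P ^ r ≤ θ :=
    (le_max_right _ _).trans ((le_max_right _ _).trans (le_max_right _ _))
  have t := fun a ↦ isGauss_teich (σ := σ) hr a
  have hone : ∀ a ∈ K, lnorm a = 1 → ∃ x, σ.IsGoodUnit V r θ x ∧ σ.residueAlg x = a := by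
    intro a ha ha1
    have ha0 : a ≠ 0 := by
      rintro rfl
      rw [lnorm_zero] at ha1
      exact zero_ne_one ha1
    obtain ⟨c, hc⟩ := hgen a ha ha1.le
    choose b hb using fun i ↦ IsLocalRing.residue_surjective (c i)
    set x₁ := ∑ i, σ.emb 0 (GammaLaurent.const ϖ (b i)) * E i with hx₁
    have hx₁g : σ.IsGoodInt V r θ x₁ := isGoodInt_sum hr hθ _ fun i _ ↦
      IsGoodInt.const_mul hr hθ ⟨(hE i).mem, (hE i).lnorm_le, (hE i).le.trans
        (le_trans (hM i) h1θ)⟩ (b i)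
    have hx₁r : σ.residueAlg x₁ = ∑ i, algebraMap (LaurentSeries (IsLocalRing.ResidueField O))
        (ResAlg O) (HahnSeries.C (c i)) * e i := by
      rw [hx₁, map_sum]
      refine Finset.sum_congr rfl fun i _ ↦ ?_
      rw [map_mul, residueAlg_emb_const, hb, hEe]
    rw [← hx₁r] at hc
    have hrest : ∃ y, σ.IsGoodInt V r θ y ∧ σ.residueAlg y = a - σ.residueAlg x₁ := by
      by_cases h0 : a - σ.residueAlg x₁ = 0
      · exact ⟨0, isGoodInt_zero hr (thet_pos.le.trans hθ), by rw [map_zero, h0]⟩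
      · have hK : a - σ.residueAlg x₁ ∈ K := by
          refine K.sub_mem ha ?_
          rw [hx₁r]
          exact sum_mem fun i _ ↦ K.mul_mem (K.algebraMap_mem _) (he i).1
        obtain ⟨y, hy, z, hz, hyz, hya⟩ := hl _ hK h0
        have gy := ((mem_gammaKR V hr).1 hy).1
        have hyn := gy.gnorm_of_mul_eq_one hr ((mem_gammaKR V hr).1 hz).1 hyz
        obtain ⟨j, hj⟩ := hPgen _ hK h0
        have hj1 : lnorm (a - σ.residueAlg x₁) ≤ lnorm P := by
          rw [hj] at hc ⊢
          have hjpos : 0 < j := by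
            by_contra hj0
            exact absurd hc (not_lt.2 (one_le_zpow_of_nonpos₀ (lnorm_pos hP0) hP1.le (not_lt.1 hj0)))
          calc lnorm P ^ j ≤ lnorm P ^ (1 : ℤ) :=
                zpow_le_zpow_right_of_le_one₀ (lnorm_pos hP0) hP1.le (by omega)
            _ = lnorm P := zpow_one _
        refine ⟨y, ⟨hy, by rw [hya]; exact hc.le, ?_⟩, hya⟩
        refine (gy.gnorm_sub_teich_lt hr ((mem_gammaKR V hr).1 hz).1 hyz).le.trans ?_
        rw [hya]
        exact (Real.rpow_le_rpow (lnorm_nonneg _) hj1 hr.le).trans h3θ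
    obtain ⟨y, hy, hya⟩ := hrest
    have hx := hx₁g.add hr hθ hy
    have hxa : σ.residueAlg (x₁ + y) = a := by rw [map_add, hya]; ring
    set x := x₁ + y
    obtain ⟨w, hw, v, hv, hwv, hwa⟩ := hl a ha ha0
    have gw := ((mem_gammaKR V hr).1 hw).1
    have gv := ((mem_gammaKR V hr).1 hv).1
    have gx := ((mem_gammaKR V hr).1 hx.mem).1
    have hva : lnorm (σ.residueAlg v) = 1 := by
      have h := congrArg (fun z ↦ lnorm (σ.residueAlg z)) hwv
      simpa only [map_mul, lnorm_mul, hwa, ha1, one_mul, map_one, lnorm_one] using h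
    have hvn : σ.gnorm r v = 1 := by
      rw [gv.gnorm_of_mul_eq_one hr gw (by rw [mul_comm, hwv]), hva, Real.one_rpow]
    have hres : σ.residueAlg (1 - v * x) = 0 := by
      have h := congrArg σ.residueAlg hwv
      rw [map_mul, map_one, hwa] at h
      rw [map_sub, map_one, map_mul, hxa, mul_comm, h, sub_self]
    obtain ⟨z, hz⟩ := (σ.isResidueUniformizer_alg.dvd_iff _).1 hres
    have hzmem : σ.unif * z ∈ σ.GammaKR V r := by
      rw [← hz]
      exact Subring.sub_mem _ (Subring.one_mem _) (Subring.mul_mem _ hv hx.mem)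
    have hzlt : σ.gnorm r (σ.unif * z) < 1 := by
      have h1 : σ.unif * z = v * ((w - σ.teich a) - (x - σ.teich a)) := by
        rw [← hz, ← hwv]; ring
      have h2 := gw.gnorm_sub_teich_lt hr gv hwv
      rw [hwa, ha1, Real.one_rpow] at h2
      have h3 := hx.le
      rw [hxa] at h3
      rw [h1, gv.gnorm_mul hr ((gw.sub hr (t _)).sub hr (gx.sub hr (t _))), hvn, one_mul]
      exact ((gw.sub hr (t _)).gnorm_sub_le hr (gx.sub hr (t _))).trans_lt
        (max_lt h2 (h3.trans_lt hθ1))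
    obtain ⟨L, hL, hzL⟩ := exists_inv_one_sub_gammaKR V hr hzmem hzlt
    rw [← hz, sub_sub_cancel] at hzL
    refine ⟨x, ⟨hx.mem, ⟨v * L, Subring.mul_mem _ hv hL, by linear_combination hzL⟩, ?_⟩, hxa⟩
    have h3 := hx.le
    rwa [hxa, ← mul_one θ, ← Real.one_rpow r, ← ha1, ← hxa] at h3
  intro a ha ha0
  obtain ⟨j, hj⟩ := hPgen a ha ha0
  obtain ⟨y, hy, hyP⟩ := (hgu.mono h2θ).exists_zpow hr (thet_pos.le.trans hθ) j
  rw [huP] at hyP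
  have hPj : P ^ j ≠ 0 := zpow_ne_zero j hP0
  obtain ⟨x, hx, hxa⟩ := hone (a / P ^ j) (K.div_mem ha (zpow_mem hP j)) (by
    rw [lnorm_div, lnorm_zpow, ← hj, div_self (lnorm_pos ha0).ne'])
  exact ⟨x * y, hx.mul hr hy, by rw [map_mul, hxa, hyP, div_mul_cancel₀ _ hPj]⟩

/-- Uniformly good lifts. -/
theorem exists_good_lift
    (hK : FiniteDimensional (LaurentSeries (IsLocalRing.ResidueField O)) K ∨ PerfectField K)
    {r : ℝ} (hr : 0 < r)
    (hl : ∀ a ∈ K, a ≠ 0 → ∃ x ∈ σ.GammaKR V r, ∃ y ∈ σ.GammaKR V r,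
      x * y = 1 ∧ σ.residueAlg x = a) :
    ∃ θ, thet p ϖ ≤ θ ∧ θ < 1 ∧
      ∀ a ∈ K, a ≠ 0 → ∃ x, σ.IsGoodUnit V r θ x ∧ σ.residueAlg x = a := by
  rcases hK with h | h
  · exact exists_good_lift_of_finiteDimensional hr hl
  · exact ⟨thet p ϖ, le_rfl, thet_lt_one, fun a ha h0 ↦ ⟨σ.teich a,
      isGoodUnit_teich_of_perfectField hr hl ha h0, σ.residueAlg_teich a⟩⟩

variable (σ V) in
/-- The coefficients of approximating sums: good units and zero. -/
def IsGoodCoef (r θ : ℝ) (x : σ.GammaAlg) : Prop := x = 0 ∨ σ.IsGoodUnit V r θ x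

theorem isGauss_zero {s : ℝ} (hs : 0 < s) : σ.IsGauss s 0 := (σ.gaussSubring hs).zero_mem

theorem IsGoodCoef.mem {r θ : ℝ} {x : σ.GammaAlg} (hx : σ.IsGoodCoef V r θ x) :
    x ∈ σ.GammaKR V r := by
  rcases hx with rfl | hx
  · exact Subring.zero_mem _
  · exact hx.mem

theorem IsGoodCoef.isGauss {r θ : ℝ} (hr : 0 < r) {x : σ.GammaAlg}
    (hx : σ.IsGoodCoef V r θ x) : σ.IsGauss r x := ((mem_gammaKR V hr).1 hx.mem).1

theorem IsGoodCoef.gnorm_eq {r θ s : ℝ} (hs : 0 < s) (hsr : s ≤ r) {x : σ.GammaAlg}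
    (hx : σ.IsGoodCoef V r θ x) : σ.gnorm s x = lnorm (σ.residueAlg x) ^ s := by
  rcases hx with rfl | hx
  · rw [gnorm_zero hs, map_zero, lnorm_zero, Real.zero_rpow hs.ne']
  · exact hx.gnorm_eq hs hsr

theorem IsGoodCoef.le {r θ : ℝ} (hr : 0 < r) {x : σ.GammaAlg} (hx : σ.IsGoodCoef V r θ x) :
    σ.gnorm r (x - σ.teich (σ.residueAlg x)) ≤ θ * lnorm (σ.residueAlg x) ^ r := by
  rcases hx with rfl | hx
  · rw [map_zero, σ.teich_zero, sub_zero, gnorm_zero hr, lnorm_zero, Real.zero_rpow hr.ne',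
      mul_zero]
  · exact hx.le

theorem IsGoodCoef.le_rpow {r θ s : ℝ} (hs : 0 < s) (hsr : s ≤ r) (hθ : 0 ≤ θ) {x : σ.GammaAlg}
    (hx : σ.IsGoodCoef V r θ x) : σ.gnorm s (x - σ.teich (σ.residueAlg x)) ≤
      θ ^ (s / r) * lnorm (σ.residueAlg x) ^ s := by
  have hr := hs.trans_le hsr
  refine (((hx.isGauss hr).sub hr (isGauss_teich hr _)).gnorm_le_rpow hs hsr).trans ?_
  refine (Real.rpow_le_rpow gnorm_nonneg (hx.le hr) (div_pos hs hr).le).trans_eq ?_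
  rw [Real.mul_rpow hθ (Real.rpow_nonneg (lnorm_nonneg _) _), ← Real.rpow_mul (lnorm_nonneg _),
    mul_div_cancel₀ _ hr.ne']

theorem gnorm_sum_le {ι : Type*} {s : ℝ} (hs : 0 < s) {F : Finset ι} {x : ι → σ.GammaAlg} {C : ℝ}
    (hC : 0 ≤ C) (h : ∀ i ∈ F, σ.IsGauss s (x i) ∧ σ.gnorm s (x i) ≤ C) :
    σ.IsGauss s (∑ i ∈ F, x i) ∧ σ.gnorm s (∑ i ∈ F, x i) ≤ C :=
  Finset.sum_induction x (fun x ↦ σ.IsGauss s x ∧ σ.gnorm s x ≤ C)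
    (fun _ _ ha hb ↦ ⟨ha.1.add hs hb.1, (ha.1.gnorm_add_le hs hb.1).trans (max_le ha.2 hb.2)⟩)
    ⟨isGauss_zero hs, by rw [gnorm_zero hs]; exact hC⟩ h

theorem coefA_finset_sum {F : Finset ℕ} {c : ℕ → ResAlg O} {i : ℕ} (hi : i ∈ F) :
    σ.coefA (∑ j ∈ F, σ.unif ^ j * σ.teich (c j)) i = c i := by
  have hF : F ⊆ Finset.range (F.sup id + 1) := fun j hj ↦
    Finset.mem_range.2 (Nat.lt_succ_of_le (Finset.le_sup (f := id) hj))
  have h : ∑ j ∈ F, σ.unif ^ j * σ.teich (c j) = ∑ j ∈ Finset.range (F.sup id + 1),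
      σ.unif ^ j * σ.teich (if j ∈ F then c j else 0) := by
    rw [← Finset.sum_subset hF (fun j _ hj ↦ by rw [if_neg hj, σ.teich_zero, mul_zero])]
    exact Finset.sum_congr rfl fun j hj ↦ by rw [if_pos hj]
  have h2 := σ.coefA_sum (F.sup id + 1) (fun j ↦ if j ∈ F then c j else 0) i
  rw [if_pos (Finset.mem_range.1 (hF hi)), if_pos hi] at h2
  rw [h]
  exact h2

/-- The Gauss norm of a sum with good coefficients is the maximum of the norms of its terms. -/
theorem gnorm_term_le_gnorm_sum {r θ s : ℝ} (hs : 0 < s) (hsr : s ≤ r) (hθ : 0 ≤ θ) (hθ1 : θ < 1)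
    {F : Finset ℕ} {c : ℕ → σ.GammaAlg} (hc : ∀ i ∈ F, σ.IsGoodCoef V r θ (c i)) {i : ℕ}
    (hi : i ∈ F) :
    σ.gnorm s (σ.unif ^ i * c i) ≤ σ.gnorm s (∑ j ∈ F, σ.unif ^ j * c j) := by
  have hr := hs.trans_le hsr
  have g : ∀ j ∈ F, σ.IsGauss s (c j) := fun j hj ↦ ((hc j hj).isGauss hr).mono hs hsr
  have t := fun a ↦ isGauss_teich (σ := σ) hs a
  obtain ⟨i₀, hi₀, hmax⟩ := Finset.exists_max_image F
    (fun j ↦ thet p ϖ ^ j * lnorm (σ.residueAlg (c j)) ^ s) ⟨i, hi⟩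
  set M := thet p ϖ ^ i₀ * lnorm (σ.residueAlg (c i₀)) ^ s with hM
  have hM0 : 0 ≤ M := mul_nonneg (thet_pow_pos _).le (Real.rpow_nonneg (lnorm_nonneg _) _)
  have h1 : σ.gnorm s (σ.unif ^ i * c i) ≤ M := by
    rw [((g i hi).unif_pow_mul hs i).2, (hc i hi).gnorm_eq hs hsr]
    exact hmax i hi
  refine h1.trans ?_
  have hη0 : 0 ≤ θ ^ (s / r) := Real.rpow_nonneg hθ _
  have hη1 : θ ^ (s / r) < 1 := Real.rpow_lt_one hθ hθ1 (div_pos hs hr)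
  have hS := gnorm_sum_le (σ := σ) (F := F) (x := fun j ↦ σ.unif ^ j * c j) hs hM0 fun j hj ↦ by
    refine ⟨((g j hj).unif_pow_mul hs j).1, ?_⟩
    rw [((g j hj).unif_pow_mul hs j).2, (hc j hj).gnorm_eq hs hsr]
    exact hmax j hj
  have hD := gnorm_sum_le (σ := σ) (F := F)
    (x := fun j ↦ σ.unif ^ j * (c j - σ.teich (σ.residueAlg (c j)))) hs
    (mul_nonneg hη0 hM0) fun j hj ↦ by
      have hg := (g j hj).sub hs (t (σ.residueAlg (c j)))
      refine ⟨(hg.unif_pow_mul hs j).1, ?_⟩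
      rw [(hg.unif_pow_mul hs j).2]
      refine (mul_le_mul_of_nonneg_left ((hc j hj).le_rpow hs hsr hθ) (thet_pow_pos j).le).trans ?_
      rw [mul_left_comm]
      exact mul_le_mul_of_nonneg_left (hmax j hj) hη0
  have hT : ∑ j ∈ F, σ.unif ^ j * σ.teich (σ.residueAlg (c j)) =
      ∑ j ∈ F, σ.unif ^ j * c j - ∑ j ∈ F, σ.unif ^ j * (c j - σ.teich (σ.residueAlg (c j))) := by
    rw [← Finset.sum_sub_distrib]
    exact Finset.sum_congr rfl fun j _ ↦ by ring
  have h2 : M ≤ σ.gnorm s (∑ j ∈ F, σ.unif ^ j * σ.teich (σ.residueAlg (c j))) := by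
    have hg : σ.IsGauss s (∑ j ∈ F, σ.unif ^ j * σ.teich (σ.residueAlg (c j))) := by
      rw [hT]; exact hS.1.sub hs hD.1
    refine le_trans (le_of_eq ?_) (hg.le_gnorm i₀)
    have h := coefA_finset_sum (σ := σ) (c := fun j ↦ σ.residueAlg (c j)) hi₀
    rw [gterm, h]
  rcases hM0.eq_or_lt with h0 | h0
  · rw [← h0]; exact gnorm_nonneg
  · rw [hT] at h2
    rcases le_max_iff.1 (h2.trans (hS.1.gnorm_sub_le hs hD.1)) with h | h
    · exact h
    · exact absurd (h.trans hD.2) (not_le.2 (mul_lt_of_lt_one_left h0 hη1))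

section Lifts

variable {r θ : ℝ}

/-- The difference of good coefficients is close to a good coefficient. -/
theorem exists_isGoodCoef_sub (hr : 0 < r) (hθ : thet p ϖ ≤ θ)
    (hlift : ∀ a ∈ K, a ≠ 0 → ∃ x, σ.IsGoodUnit V r θ x ∧ σ.residueAlg x = a)
    {x y : σ.GammaAlg} (hx : σ.IsGoodCoef V r θ x) (hy : σ.IsGoodCoef V r θ y) :
    ∃ z, σ.IsGoodCoef V r θ z ∧
      σ.gnorm r (x - y - z) ≤ θ * max (σ.gnorm r x) (σ.gnorm r y) := by
  have hθ0 : 0 ≤ θ := thet_pos.le.trans hθ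
  have hK : ∀ x, σ.IsGoodCoef V r θ x → σ.residueAlg x ∈ K := fun x hx ↦
    residue_mem_of_mem_satSubring V (gammaKR_le_satSubring V hr hx.mem)
  have hz : ∃ z, σ.IsGoodCoef V r θ z ∧ σ.residueAlg z = σ.residueAlg x - σ.residueAlg y := by
    by_cases h0 : σ.residueAlg x - σ.residueAlg y = 0
    · exact ⟨0, Or.inl rfl, by rw [map_zero, h0]⟩
    · obtain ⟨z, hz, hzr⟩ := hlift _ (K.sub_mem (hK x hx) (hK y hy)) h0
      exact ⟨z, Or.inr hz, hzr⟩
  obtain ⟨z, hz, hzr⟩ := hz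
  refine ⟨z, hz, ?_⟩
  have gx := hx.isGauss hr
  have gy := hy.isGauss hr
  have gz := hz.isGauss hr
  have t := fun a ↦ isGauss_teich (σ := σ) hr a
  set a := σ.residueAlg x
  set b := σ.residueAlg y
  set M := max (lnorm a) (lnorm b) with hM
  have hMr : M ^ r = max (σ.gnorm r x) (σ.gnorm r y) := by
    rw [hx.gnorm_eq hr le_rfl, hy.gnorm_eq hr le_rfl, hM]
    rcases le_total (lnorm a) (lnorm b) with h | h
    · rw [max_eq_right h, max_eq_right (Real.rpow_le_rpow (lnorm_nonneg _) h hr.le)]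
    · rw [max_eq_left h, max_eq_left (Real.rpow_le_rpow (lnorm_nonneg _) h hr.le)]
  have hle : ∀ w, σ.IsGoodCoef V r θ w → lnorm (σ.residueAlg w) ≤ M →
      σ.gnorm r (w - σ.teich (σ.residueAlg w)) ≤ θ * M ^ r := fun w hw hwM ↦
    (hw.le hr).trans (mul_le_mul_of_nonneg_left
      (Real.rpow_le_rpow (lnorm_nonneg _) hwM hr.le) hθ0)
  have hzM : lnorm (σ.residueAlg z) ≤ M := by rw [hzr]; exact lnorm_sub_le _ _
  have h4 := gnorm_teich_add_sub_le (σ := σ) hr hzM (le_max_right (lnorm a) (lnorm b))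
  have e : σ.residueAlg z + b = a := by rw [hzr, sub_add_cancel]
  rw [e] at h4
  have h : x - y - z = (x - σ.teich a) - (y - σ.teich b) - (z - σ.teich (σ.residueAlg z)) -
      (σ.teich (σ.residueAlg z) + σ.teich b - σ.teich a) := by ring
  have g1 := gx.sub hr (t a)
  have g2 := gy.sub hr (t b)
  have g3 := gz.sub hr (t (σ.residueAlg z))
  have g4 := ((t (σ.residueAlg z)).add hr (t b)).sub hr (t a)
  rw [h, ← hMr]
  refine (((g1.sub hr g2).sub hr g3).gnorm_sub_le hr g4).trans (max_le
    (((g1.sub hr g2).gnorm_sub_le hr g3).trans (max_le ((g1.gnorm_sub_le hr g2).trans (max_le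
      (hle x hx (le_max_left _ _)) (hle y hy (le_max_right _ _)))) (hle z hz hzM)))
    (h4.trans (mul_le_mul_of_nonneg_right hθ (Real.rpow_nonneg (le_max_of_le_left
      (lnorm_nonneg _)) _))))

/-- One round of approximation by sums with good coefficients. -/
theorem exists_sum_sub_of_step (hr : 0 < r) (hθ : thet p ϖ ≤ θ) (hθ1 : θ < 1)
    (hlift : ∀ a ∈ K, a ≠ 0 → ∃ x, σ.IsGoodUnit V r θ x ∧ σ.residueAlg x = a) (n : ℕ) :
    ∀ (C : ℝ), 0 ≤ C → ∀ x ∈ σ.satSubring V hr, (∀ i, σ.gterm r x i ≤ C * step θ n i) →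
      ∃ c : ℕ → σ.GammaAlg, (∀ i, σ.IsGoodCoef V r θ (c i)) ∧ ∃ x' ∈ σ.satSubring V hr,
        x = ∑ i ∈ Finset.range n, σ.unif ^ i * c i + σ.unif ^ n * x' ∧
          thet p ϖ ^ n * σ.gnorm r x' ≤ θ * C := by
  have hθ0 : 0 ≤ θ := thet_pos.le.trans hθ
  induction n with
  | zero =>
    intro C hC x hx hxC
    refine ⟨fun _ ↦ 0, fun _ ↦ Or.inl rfl, x, hx, by simp, ?_⟩
    rw [pow_zero, one_mul, mul_comm]
    exact gnorm_le fun i ↦ by simpa [step] using hxC i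
  | succ n ih =>
    intro C hC x hx hxC
    have hc₀ : ∃ c₀, σ.IsGoodCoef V r θ c₀ ∧ σ.residueAlg c₀ = σ.residueAlg x := by
      by_cases h0 : σ.residueAlg x = 0
      · exact ⟨0, Or.inl rfl, by rw [map_zero, h0]⟩
      · obtain ⟨z, hz, hzr⟩ := hlift _ (residue_mem_of_mem_satSubring V hx) h0
        exact ⟨z, Or.inr hz, hzr⟩
    obtain ⟨c₀, hc₀, hcr⟩ := hc₀
    obtain ⟨x₁, hx₁⟩ := (σ.isResidueUniformizer_alg.dvd_sub_iff x c₀).1 hcr.symm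
    have hψ0 : ∀ i, 0 ≤ C * step θ (n + 1) i := fun i ↦ mul_nonneg hC (step_nonneg hθ0 _ i)
    have hψ := mul_step_le hC hθ hθ1.le (n + 1)
    have hx0 : lnorm (σ.residueAlg x) ^ r ≤ C := by
      have h := hxC 0
      rw [step, if_pos (Nat.succ_pos n), mul_one, gterm, pow_zero, one_mul, σ.coefA_zero] at h
      exact h
    have hb1 : ∀ i, σ.gterm r (x - σ.teich (σ.residueAlg x)) i ≤ C * step θ (n + 1) i := by
      intro i
      rcases i with _ | i
      · rw [gterm_of_coefA_zero hr (coefA_sub_teich_zero x)]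
        exact hψ0 0
      · rw [gterm, coefA_sub_teich_succ]
        exact hxC (i + 1)
    have hb2 : ∀ i, σ.gterm r (c₀ - σ.teich (σ.residueAlg x)) i ≤ C * step θ (n + 1) i := by
      intro i
      have h := hc₀.le hr
      rw [hcr] at h
      refine ((((hc₀.isGauss hr).sub hr (isGauss_teich hr _)).le_gnorm i).trans h).trans ?_
      rw [mul_comm]
      exact mul_le_mul hx0 (le_step hθ1.le _ _) hθ0 hC
    have hb : ∀ i, σ.gterm r (σ.unif * x₁) i ≤ C * step θ (n + 1) i := by
      have e : σ.unif * x₁ = (x - σ.teich (σ.residueAlg x)) +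
        -(c₀ - σ.teich (σ.residueAlg x)) := by rw [← hx₁]; ring
      rw [e]
      exact gterm_add_le_of_bound hr hψ0 hψ hb1 (gterm_neg_le_of_bound hr hψ0 hψ hb2)
    have hx₁D : x₁ ∈ σ.satSubring V hr := by
      refine satSubring_of_unif_mul V ?_
      rw [← hx₁]
      exact Subring.sub_mem _ hx (gammaKR_le_satSubring V hr hc₀.mem)
    obtain ⟨c, hc, x', hx', hxe, hxn⟩ := ih (C / thet p ϖ) (div_nonneg hC thet_pos.le) x₁ hx₁D
      fun i ↦ by
        have h := hb (i + 1)
        rw [gterm_unif_mul_succ, step] at h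
        simp only [Nat.add_lt_add_iff_right] at h
        rw [div_mul_eq_mul_div, le_div_iff₀ thet_pos, mul_comm]
        exact h
    refine ⟨fun i ↦ Nat.casesOn i c₀ c, fun i ↦ by cases i <;> [exact hc₀; exact hc _], x', hx',
      ?_, ?_⟩
    · rw [Finset.sum_range_succ']
      have e : ∑ i ∈ Finset.range n, σ.unif ^ (i + 1) * c i =
          σ.unif * ∑ i ∈ Finset.range n, σ.unif ^ i * c i := by
        rw [Finset.mul_sum]
        exact Finset.sum_congr rfl fun i _ ↦ by ring
      change x = ∑ i ∈ Finset.range n, σ.unif ^ (i + 1) * c i + σ.unif ^ 0 * c₀ +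
        σ.unif ^ (n + 1) * x'
      rw [e]
      linear_combination hx₁ + σ.unif * hxe
    · rw [← mul_div_assoc, le_div_iff₀ thet_pos] at hxn
      rw [pow_succ]
      linarith

theorem exists_sum_sub_pow_le (hr : 0 < r) (hθ : thet p ϖ ≤ θ) (hθ1 : θ < 1)
    (hlift : ∀ a ∈ K, a ≠ 0 → ∃ x, σ.IsGoodUnit V r θ x ∧ σ.residueAlg x = a)
    {x : σ.GammaAlg} (hx : x ∈ σ.satSubring V hr) (k : ℕ) :
    ∃ (n : ℕ) (c : ℕ → σ.GammaAlg), (∀ i, σ.IsGoodCoef V r θ (c i)) ∧ ∃ x' ∈ σ.satSubring V hr,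
      x = ∑ i ∈ Finset.range n, σ.unif ^ i * c i + σ.unif ^ n * x' ∧
        thet p ϖ ^ n * σ.gnorm r x' ≤ θ ^ k * σ.gnorm r x := by
  have hθ0 : 0 < θ := thet_pos.trans_le hθ
  induction k with
  | zero => exact ⟨0, fun _ ↦ 0, fun _ ↦ Or.inl rfl, x, hx, by simp, by simp⟩
  | succ k ih =>
    obtain ⟨n, c, hc, y, hy, hxy, hyn⟩ := ih
    have hstep : ∃ m, ∀ i, σ.gterm r y i ≤ σ.gnorm r y * step θ m i := by
      have gy : σ.IsGauss r y := hy.1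
      rcases (gnorm_nonneg : 0 ≤ σ.gnorm r y).eq_or_lt with h | h
      · refine ⟨0, fun i ↦ ?_⟩
        rw [← h, zero_mul, h]
        exact gy.le_gnorm i
      · obtain ⟨m, hm⟩ := eventually_atTop.1 (gy.eventually_lt_const (mul_pos h hθ0))
        refine ⟨m, fun i ↦ ?_⟩
        rw [step]
        split_ifs with hi
        · rw [mul_one]; exact gy.le_gnorm i
        · exact (hm i (not_lt.1 hi)).le
    obtain ⟨m, hm⟩ := hstep
    obtain ⟨d, hd, z, hz, hyz, hzn⟩ := exists_sum_sub_of_step hr hθ hθ1 hlift m _ gnorm_nonneg y hy hm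
    refine ⟨n + m, fun i ↦ if i < n then c i else d (i - n), fun i ↦ by
      dsimp only; split_ifs <;> [exact hc _; exact hd _], z, hz, ?_, ?_⟩
    · rw [Finset.sum_range_add]
      have e1 : ∑ i ∈ Finset.range n, σ.unif ^ i * (if i < n then c i else d (i - n)) =
          ∑ i ∈ Finset.range n, σ.unif ^ i * c i :=
        Finset.sum_congr rfl fun i hi ↦ by rw [if_pos (Finset.mem_range.1 hi)]
      have e2 : ∑ i ∈ Finset.range m, σ.unif ^ (n + i) *
          (if n + i < n then c (n + i) else d (n + i - n)) =
          σ.unif ^ n * ∑ i ∈ Finset.range m, σ.unif ^ i * d i := by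
        rw [Finset.mul_sum]
        refine Finset.sum_congr rfl fun i _ ↦ ?_
        rw [if_neg (by omega), Nat.add_sub_cancel_left, pow_add, mul_assoc]
      rw [e1, e2]
      linear_combination hxy + σ.unif ^ n * hyz
    · rw [pow_add, mul_assoc]
      refine (mul_le_mul_of_nonneg_left hzn (thet_pow_pos n).le).trans ?_
      rw [mul_left_comm, pow_succ', mul_assoc]
      exact mul_le_mul_of_nonneg_left hyn hθ0.le

/-- Elements of the saturation are approximated by sums with good coefficients. -/
theorem exists_sum_sub_le (hr : 0 < r) (hθ : thet p ϖ ≤ θ) (hθ1 : θ < 1)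
    (hlift : ∀ a ∈ K, a ≠ 0 → ∃ x, σ.IsGoodUnit V r θ x ∧ σ.residueAlg x = a)
    {x : σ.GammaAlg} (hx : x ∈ σ.satSubring V hr) {ε : ℝ} (hε : 0 < ε) :
    ∃ (n : ℕ) (c : ℕ → σ.GammaAlg), (∀ i, σ.IsGoodCoef V r θ (c i)) ∧
      σ.gnorm r (x - ∑ i ∈ Finset.range n, σ.unif ^ i * c i) ≤ ε := by
  have hlim : Tendsto (fun k : ℕ ↦ θ ^ k * σ.gnorm r x) atTop (𝓝 0) := by
    have := (tendsto_pow_atTop_nhds_zero_of_lt_one (thet_pos.le.trans hθ) hθ1).mul_const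
      (σ.gnorm r x)
    rwa [zero_mul] at this
  obtain ⟨k, hk⟩ := (hlim.eventually_lt_const hε).exists
  obtain ⟨n, c, hc, y, hy, hxy, hyn⟩ := exists_sum_sub_pow_le hr hθ hθ1 hlift hx k
  refine ⟨n, c, hc, ?_⟩
  have e : x - ∑ i ∈ Finset.range n, σ.unif ^ i * c i = σ.unif ^ n * y := by
    linear_combination hxy
  have gy : σ.IsGauss r y := hy.1
  rw [e, (gy.unif_pow_mul hr n).2]
  exact hyn.trans hk.le

end Lifts

variable (V)

theorem mem_gammaKRP {r : ℝ} (hr : 0 < r) {x : σ.GammaAlgP} : x ∈ σ.GammaKRP V r ↔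
    ∃ m, ∃ z ∈ σ.satSubring V hr, σ.toP (σ.unif ^ m) * x = σ.toP z := by
  obtain ⟨v, w, hvw, hv⟩ := σ.exists_natCast_eq_emb_const
  have hvw' : σ.emb 0 (GammaLaurent.const ϖ w) * σ.emb 0 (GammaLaurent.const ϖ v) = 1 := by
    rw [← map_mul, ← map_mul, mul_comm, hvw, map_one, map_one]
  constructor
  · rintro ⟨m, y, hy, h⟩
    refine ⟨ramIndex p ϖ * m, σ.emb 0 (GammaLaurent.const ϖ w) ^ m * y, Subring.mul_mem _ (pow_mem
      (gammaKR_le_satSubring V hr ((mem_gammaKR V hr).2 ⟨(isGauss_emb_const hr w).1,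
        emb_const_mem_gammaK V w⟩)) m) (gammaKR_le_satSubring V hr hy), ?_⟩
    have e : σ.unif ^ (ramIndex p ϖ * m) =
        σ.emb 0 (GammaLaurent.const ϖ w) ^ m * ((p : ℕ) : σ.GammaAlg) ^ m := by
      rw [hv, ← mul_pow, ← mul_assoc, hvw', one_mul, pow_mul]
    rw [e, map_mul, map_mul, mul_assoc, map_pow σ.toP (p : σ.GammaAlg), map_natCast, h]
  · rintro ⟨m, z, ⟨hz, n, hn⟩, h⟩
    obtain ⟨e, he⟩ := Nat.exists_eq_add_of_lt (ramIndex_pos (p := p) (ϖ := ϖ))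
    set t := σ.emb 0 (GammaLaurent.const ϖ v) * σ.unif ^ e
    have ht : ((p : ℕ) : σ.GammaAlg) = t * σ.unif := by rw [hv, he]; ring
    have gv := (isGauss_emb_const (σ := σ) hr v).1
    have gt : σ.IsGauss r t := by
      have := ((isGauss_one (σ := σ) hr).unif_pow_mul hr e).1
      rw [mul_one] at this
      exact gv.mul hr this
    have tK : t ∈ σ.GammaK V :=
      Subring.mul_mem _ (emb_const_mem_gammaK V v) (pow_mem (unif_mem_gammaK V) e)
    refine ⟨n + m, t ^ (n + m) * (σ.unif ^ n * z), (mem_gammaKR V hr).2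
      ⟨(isGauss_pow hr gt _).1.mul hr (hz.unif_pow_mul hr n).1,
        Subring.mul_mem _ (pow_mem tK _) hn⟩, ?_⟩
    have e1 : ((p : ℕ) : σ.GammaAlgP) ^ (n + m) =
        σ.toP (t ^ (n + m) * σ.unif ^ n) * σ.toP (σ.unif ^ m) := by
      rw [← map_mul, ← map_natCast σ.toP, ← map_pow]
      exact congrArg σ.toP (by rw [ht]; ring)
    rw [e1, mul_assoc, h, ← map_mul]
    exact congrArg σ.toP (by ring)

variable (σ) in
/-- The ring `Γ^K_r[1/p]`. -/
def gammaKRPSubring (r : ℝ) : Subring σ.GammaAlgP where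
  carrier := σ.GammaKRP V r
  mul_mem' := by
    rintro x y ⟨m, a, ha, h⟩ ⟨n, b, hb, h'⟩
    refine ⟨m + n, a * b, Subring.mul_mem _ ha hb, ?_⟩
    rw [pow_add, mul_mul_mul_comm, h, h', map_mul]
  one_mem' := ⟨0, 1, Subring.one_mem _, by rw [pow_zero, one_mul, map_one]⟩
  add_mem' := by
    rintro x y ⟨m, a, ha, h⟩ ⟨n, b, hb, h'⟩
    have hp : ((p : ℕ) : σ.GammaAlg) ∈ σ.GammaKR V r := natCast_mem _ p
    refine ⟨m + n, (p : σ.GammaAlg) ^ n * a + (p : σ.GammaAlg) ^ m * b, Subring.add_mem _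
      (Subring.mul_mem _ (pow_mem hp n) ha) (Subring.mul_mem _ (pow_mem hp m) hb), ?_⟩
    rw [map_add, map_mul, map_mul, map_pow, map_pow, map_natCast, ← h, ← h']
    ring
  zero_mem' := ⟨0, 0, Subring.zero_mem _, by rw [mul_zero, map_zero]⟩
  neg_mem' := by
    rintro x ⟨m, a, ha, h⟩
    exact ⟨m, -a, Subring.neg_mem _ ha, by rw [mul_neg, h, map_neg]⟩

theorem isGaussP_of_mem {r : ℝ} (hr : 0 < r) {x : σ.GammaAlgP} (hx : x ∈ σ.GammaKRP V r) {s : ℝ}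
    (hs : 0 < s) (hsr : s ≤ r) : σ.IsGaussP s x := by
  obtain ⟨m, z, hz, h⟩ := (mem_gammaKRP V hr).1 hx
  exact IsGaussP.mono hs hsr ⟨m, z, hz.1, h⟩

theorem isFrechetCauchy_iff {r : ℝ} (hr : 0 < r) {x : ℕ → σ.GammaAlgP}
    (hx : ∀ i, x i ∈ σ.GammaKRP V r) : σ.IsFrechetCauchy r x ↔ ∀ s : ℝ, 0 < s → s ≤ r →
      Tendsto (fun ij : ℕ × ℕ ↦ σ.pnorm s (x ij.1 - x ij.2)) atTop (𝓝 0) :=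
  forall₃_congr fun _ hs hsr ↦ tendsto_w_iff hs fun _ ↦
    isGaussP_of_mem V hr ((σ.gammaKRPSubring V r).sub_mem (hx _) (hx _)) hs hsr

theorem isFrechetNull_iff {r : ℝ} (hr : 0 < r) {x : ℕ → σ.GammaAlgP}
    (hx : ∀ i, x i ∈ σ.GammaKRP V r) : σ.IsFrechetNull r x ↔ ∀ s : ℝ, 0 < s → s ≤ r →
      Tendsto (fun i ↦ σ.pnorm s (x i)) atTop (𝓝 0) :=
  forall₃_congr fun _ hs hsr ↦ tendsto_w_iff hs fun _ ↦ isGaussP_of_mem V hr (hx _) hs hsr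

theorem IsGaussP.abs_sub_le {s : ℝ} (hs : 0 < s) {x y : σ.GammaAlgP} (hx : σ.IsGaussP s x)
    (hy : σ.IsGaussP s y) : |σ.pnorm s x - σ.pnorm s y| ≤ σ.pnorm s (x - y) := by
  have h1 := ((hx.sub hs hy).1.add hs hy).2
  have h2 := ((hx.sub hs hy).1.neg hs).2
  have h3 := (((hx.sub hs hy).1.neg hs).1.add hs hx).2
  rw [sub_add_cancel] at h1
  rw [h2, neg_sub, sub_add_cancel] at h3
  have h4 : 0 ≤ σ.pnorm s x := pnorm_nonneg _ _
  have h5 : 0 ≤ σ.pnorm s y := pnorm_nonneg _ _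
  have h6 : 0 ≤ σ.pnorm s (x - y) := pnorm_nonneg _ _
  rw [abs_sub_le_iff]
  rcases le_max_iff.1 h1 with h | h <;> rcases le_max_iff.1 h3 with h' | h' <;>
    constructor <;> linarith

theorem exists_tendsto_pnorm {s : ℝ} (hs : 0 < s) {x : ℕ → σ.GammaAlgP}
    (hx : ∀ i, σ.IsGaussP s (x i))
    (h : Tendsto (fun ij : ℕ × ℕ ↦ σ.pnorm s (x ij.1 - x ij.2)) atTop (𝓝 0)) :
    ∃ N, Tendsto (fun i ↦ σ.pnorm s (x i)) atTop (𝓝 N) := by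
  refine cauchySeq_tendsto_of_complete (cauchySeq_iff_tendsto_dist_atTop_0.2 ?_)
  exact squeeze_zero (fun _ ↦ dist_nonneg)
    (fun ij ↦ by rw [Real.dist_eq]; exact (hx ij.1).abs_sub_le hs (hx ij.2)) h

variable (σ) in
/-- The ring of Cauchy sequences in `Γ^K_r[1/p]`. -/
def frechetCauchySubring {r : ℝ} (hr : 0 < r) : Subring (ℕ → σ.GammaAlgP) where
  carrier := {x | (∀ i, x i ∈ σ.gammaKRPSubring V r) ∧ ∀ s : ℝ, 0 < s → s ≤ r →
    Tendsto (fun ij : ℕ × ℕ ↦ σ.pnorm s (x ij.1 - x ij.2)) atTop (𝓝 0)}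
  mul_mem' := by
    rintro x y ⟨hx, hxc⟩ ⟨hy, hyc⟩
    refine ⟨fun i ↦ mul_mem (hx i) (hy i), fun s hs hsr ↦ ?_⟩
    have gx := fun i ↦ isGaussP_of_mem V hr (hx i) hs hsr
    have gy := fun i ↦ isGaussP_of_mem V hr (hy i) hs hsr
    obtain ⟨X, hX⟩ := exists_tendsto_pnorm hs gx (hxc s hs hsr)
    obtain ⟨Y, hY⟩ := exists_tendsto_pnorm hs gy (hyc s hs hsr)
    have hc1 := hxc s hs hsr
    have hc2 := hyc s hs hsr
    rw [← prod_atTop_atTop_eq] at hc1 hc2 ⊢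
    have h1 := ((hX.comp tendsto_fst).mul hc2).max (hc1.mul (hY.comp tendsto_snd))
    rw [mul_zero, zero_mul, max_self] at h1
    refine squeeze_zero (fun _ ↦ pnorm_nonneg _ _) (fun ij ↦ ?_) h1
    have e : (x * y) ij.1 - (x * y) ij.2 =
        x ij.1 * (y ij.1 - y ij.2) + (x ij.1 - x ij.2) * y ij.2 := by
      simp only [Pi.mul_apply]; ring
    have g1 := (gx ij.1).mul hs ((gy ij.1).sub hs (gy ij.2)).1
    have g2 := ((gx ij.1).sub hs (gx ij.2)).1.mul hs (gy ij.2)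
    rw [e]
    refine (g1.1.add hs g2.1).2.trans ?_
    rw [g1.2, g2.2]
    exact le_rfl
  one_mem' := ⟨fun _ ↦ one_mem _, fun s hs _ ↦ by
    simpa only [Pi.one_apply, sub_self, pnorm_zero hs] using tendsto_const_nhds⟩
  add_mem' := by
    rintro x y ⟨hx, hxc⟩ ⟨hy, hyc⟩
    refine ⟨fun i ↦ add_mem (hx i) (hy i), fun s hs hsr ↦ ?_⟩
    have gx := fun i ↦ isGaussP_of_mem V hr (hx i) hs hsr
    have gy := fun i ↦ isGaussP_of_mem V hr (hy i) hs hsr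
    have h1 := (hxc s hs hsr).max (hyc s hs hsr)
    rw [max_self] at h1
    refine squeeze_zero (fun _ ↦ pnorm_nonneg _ _) (fun ij ↦ ?_) h1
    have e : (x + y) ij.1 - (x + y) ij.2 = (x ij.1 - x ij.2) + (y ij.1 - y ij.2) := by
      simp only [Pi.add_apply]; ring
    rw [e]
    exact (((gx ij.1).sub hs (gx ij.2)).1.add hs ((gy ij.1).sub hs (gy ij.2)).1).2
  zero_mem' := ⟨fun _ ↦ zero_mem _, fun s hs _ ↦ by
    simpa only [Pi.zero_apply, sub_self, pnorm_zero hs] using tendsto_const_nhds⟩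
  neg_mem' := by
    rintro x ⟨hx, hxc⟩
    refine ⟨fun i ↦ neg_mem (hx i), fun s hs hsr ↦ (hxc s hs hsr).congr fun ij ↦ ?_⟩
    have gx := fun i ↦ isGaussP_of_mem V hr (hx i) hs hsr
    have e : (-x) ij.1 - (-x) ij.2 = -(x ij.1 - x ij.2) := by
      simp only [Pi.neg_apply]; ring
    rw [e, (((gx ij.1).sub hs (gx ij.2)).1.neg hs).2]

theorem cauchySeq_eq {r : ℝ} (hr : 0 < r) : σ.cauchySeq V r = σ.frechetCauchySubring V hr := by
  have h : ∀ x : ℕ → σ.GammaAlgP, ((∀ i, x i ∈ σ.GammaKRP V r) ∧ σ.IsFrechetCauchy r x) ↔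
      x ∈ σ.frechetCauchySubring V hr := fun x ↦
    and_congr_right fun hx ↦ isFrechetCauchy_iff V hr hx
  refine le_antisymm (Subring.closure_le.2 fun x hx ↦ (h x).1 hx) fun x hx ↦
    Subring.subset_closure ((h x).2 hx)

theorem isGaussP_apply {r : ℝ} (hr : 0 < r) {s : ℝ} (hs : 0 < s) (hsr : s ≤ r)
    (x : σ.cauchySeq V r) (i : ℕ) : σ.IsGaussP s ((x : ℕ → σ.GammaAlgP) i) :=
  isGaussP_of_mem V hr (((cauchySeq_eq V hr).le x.2).1 i) hs hsr

theorem exists_tendsto_of_cauchySeq {r : ℝ} (hr : 0 < r) {s : ℝ} (hs : 0 < s) (hsr : s ≤ r)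
    (x : σ.cauchySeq V r) :
    ∃ N, Tendsto (fun i ↦ σ.pnorm s ((x : ℕ → σ.GammaAlgP) i)) atTop (𝓝 N) :=
  exists_tendsto_pnorm hs (isGaussP_apply V hr hs hsr x) (((cauchySeq_eq V hr).le x.2).2 s hs hsr)

theorem tendsto_of_mem_span {r : ℝ} (hr : 0 < r) {x : σ.cauchySeq V r}
    (hx : x ∈ (Ideal.span {x : σ.cauchySeq V r | σ.IsFrechetNull r x} : Ideal (σ.cauchySeq V r)))
    {s : ℝ} (hs : 0 < s) (hsr : s ≤ r) :
    Tendsto (fun i ↦ σ.pnorm s ((x : ℕ → σ.GammaAlgP) i)) atTop (𝓝 0) := by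
  have g := isGaussP_apply (σ := σ) V hr hs hsr
  induction hx using Submodule.span_induction with
  | mem x hx => exact (isFrechetNull_iff V hr ((cauchySeq_eq V hr).le x.2).1).1 hx s hs hsr
  | zero =>
    change Tendsto (fun _ : ℕ ↦ σ.pnorm s 0) atTop (𝓝 0)
    rw [pnorm_zero hs]
    exact tendsto_const_nhds
  | add x y _ _ ihx ihy =>
    have h := ihx.max ihy
    rw [max_self] at h
    exact squeeze_zero (fun _ ↦ pnorm_nonneg _ _) (fun i ↦ ((g x i).add hs (g y i)).2) h
  | smul a x _ ih =>
    obtain ⟨A, hA⟩ := exists_tendsto_of_cauchySeq V hr hs hsr a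
    have h := hA.mul ih
    rw [mul_zero] at h
    exact h.congr fun i ↦ ((g a i).mul hs (g x i)).2.symm

variable (σ) in
/-- The class of a Cauchy sequence in the Fréchet completion. -/
def toAnR (r : ℝ) : σ.cauchySeq V r →+* σ.GammaAnR V r := Ideal.Quotient.mk _

theorem toAnR_surjective (r : ℝ) : Function.Surjective (σ.toAnR V r) := Ideal.Quotient.mk_surjective

theorem toAnR_eq_zero_iff {r : ℝ} {x : σ.cauchySeq V r} : σ.toAnR V r x = 0 ↔
    x ∈ (Ideal.span {x : σ.cauchySeq V r | σ.IsFrechetNull r x} : Ideal (σ.cauchySeq V r)) :=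
  Ideal.Quotient.eq_zero_iff_mem

variable (σ) in
/-- The norm on the Fréchet completion. -/
def anorm (r s : ℝ) (x : σ.GammaAnR V r) : ℝ :=
  |limUnder atTop fun i ↦ σ.pnorm s (((toAnR_surjective V r x).choose : ℕ → σ.GammaAlgP) i)|

theorem tendsto_anorm {r : ℝ} (hr : 0 < r) {s : ℝ} (hs : 0 < s) (hsr : s ≤ r)
    (x : σ.cauchySeq V r) : Tendsto (fun i ↦ σ.pnorm s ((x : ℕ → σ.GammaAlgP) i)) atTop
      (𝓝 (σ.anorm V r s (σ.toAnR V r x))) := by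
  have hyx := (toAnR_surjective V r (σ.toAnR V r x)).choose_spec
  unfold anorm
  generalize (toAnR_surjective V r (σ.toAnR V r x)).choose = y at hyx
  obtain ⟨N, hN⟩ := exists_tendsto_of_cauchySeq V hr hs hsr y
  rw [hN.limUnder_eq, abs_of_nonneg (ge_of_tendsto' hN fun _ ↦ pnorm_nonneg _ _)]
  rw [← sub_eq_zero, ← map_sub, toAnR_eq_zero_iff] at hyx
  have h1 := tendsto_of_mem_span V hr hyx hs hsr
  have h2 := squeeze_zero (fun _ ↦ abs_nonneg _) (fun i ↦ (isGaussP_apply V hr hs hsr y i).abs_sub_le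
    hs (isGaussP_apply V hr hs hsr x i)) h1
  have h3 := hN.sub ((tendsto_zero_iff_abs_tendsto_zero _).2 h2)
  rw [sub_zero] at h3
  exact h3.congr fun i ↦ sub_sub_cancel _ _

variable (σ) in
/-- The constant sequences. -/
def constSeq {r : ℝ} (hr : 0 < r) : σ.gammaKRPSubring V r →+* σ.cauchySeq V r where
  toFun a := ⟨fun _ ↦ a, (cauchySeq_eq V hr).ge ⟨fun _ ↦ a.2, fun s hs _ ↦ by
    simpa only [sub_self, pnorm_zero hs] using tendsto_const_nhds⟩⟩
  map_one' := rfl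
  map_mul' _ _ := rfl
  map_zero' := rfl
  map_add' _ _ := rfl

variable (σ) in
/-- The map from `Γ^K_r[1/p]` to its completion. -/
def ofKRP {r : ℝ} (hr : 0 < r) : σ.gammaKRPSubring V r →+* σ.GammaAnR V r :=
  (σ.toAnR V r).comp (σ.constSeq V hr)

section Norm

variable {V} {r s : ℝ}

theorem anorm_ofKRP (hr : 0 < r) (hs : 0 < s) (hsr : s ≤ r) (a : σ.gammaKRPSubring V r) :
    σ.anorm V r s (σ.ofKRP V hr a) = σ.pnorm s (a : σ.GammaAlgP) :=
  tendsto_nhds_unique (tendsto_anorm V hr hs hsr (σ.constSeq V hr a)) tendsto_const_nhds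

theorem anorm_nonneg (x : σ.GammaAnR V r) : 0 ≤ σ.anorm V r s x := abs_nonneg _

theorem anorm_mul (hr : 0 < r) (hs : 0 < s) (hsr : s ≤ r) (x y : σ.GammaAnR V r) :
    σ.anorm V r s (x * y) = σ.anorm V r s x * σ.anorm V r s y := by
  obtain ⟨x, rfl⟩ := toAnR_surjective V r x
  obtain ⟨y, rfl⟩ := toAnR_surjective V r y
  rw [← map_mul]
  exact tendsto_nhds_unique ((tendsto_anorm V hr hs hsr (x * y)).congr fun i ↦
    ((isGaussP_apply V hr hs hsr x i).mul hs (isGaussP_apply V hr hs hsr y i)).2)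
    ((tendsto_anorm V hr hs hsr x).mul (tendsto_anorm V hr hs hsr y))

theorem anorm_add_le (hr : 0 < r) (hs : 0 < s) (hsr : s ≤ r) (x y : σ.GammaAnR V r) :
    σ.anorm V r s (x + y) ≤ max (σ.anorm V r s x) (σ.anorm V r s y) := by
  obtain ⟨x, rfl⟩ := toAnR_surjective V r x
  obtain ⟨y, rfl⟩ := toAnR_surjective V r y
  rw [← map_add]
  exact le_of_tendsto_of_tendsto' (tendsto_anorm V hr hs hsr (x + y))
    ((tendsto_anorm V hr hs hsr x).max (tendsto_anorm V hr hs hsr y)) fun i ↦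
    ((isGaussP_apply V hr hs hsr x i).add hs (isGaussP_apply V hr hs hsr y i)).2

theorem anorm_neg (hr : 0 < r) (hs : 0 < s) (hsr : s ≤ r)
    (x : σ.GammaAnR V r) : σ.anorm V r s (-x) = σ.anorm V r s x := by
  obtain ⟨x, rfl⟩ := toAnR_surjective V r x
  rw [← map_neg]
  exact tendsto_nhds_unique ((tendsto_anorm V hr hs hsr (-x)).congr fun i ↦
    ((isGaussP_apply V hr hs hsr x i).neg hs).2) (tendsto_anorm V hr hs hsr x)

theorem anorm_sub_comm (hr : 0 < r) (hs : 0 < s) (hsr : s ≤ r) (x y : σ.GammaAnR V r) :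
    σ.anorm V r s (x - y) = σ.anorm V r s (y - x) := by
  rw [← neg_sub, anorm_neg hr hs hsr]

theorem anorm_sub_le (hr : 0 < r) (hs : 0 < s) (hsr : s ≤ r) (x y z : σ.GammaAnR V r) :
    σ.anorm V r s (x - z) ≤ max (σ.anorm V r s (x - y)) (σ.anorm V r s (y - z)) := by
  rw [← sub_add_sub_cancel x y z]
  exact anorm_add_le hr hs hsr _ _

/-- Log-convexity of the norms. -/
theorem IsGaussP.exists_pnorm_le {s t r : ℝ} (hs : 0 < s) (hst : s ≤ t) (htr : t ≤ r) :
    ∃ a b : ℝ, 0 ≤ a ∧ 0 ≤ b ∧ a + b = 1 ∧ (t < r → 0 < a) ∧ (s < t → 0 < b) ∧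
      ∀ x : σ.GammaAlgP, σ.IsGaussP r x → σ.pnorm t x ≤ σ.pnorm s x ^ a * σ.pnorm r x ^ b := by
  rcases hst.eq_or_lt with rfl | hst'
  · refine ⟨1, 0, zero_le_one, le_rfl, add_zero 1, fun _ ↦ zero_lt_one, fun h ↦ (lt_irrefl _ h).elim,
      fun x hx ↦ hx.pnorm_le_rpow_mul_rpow hs le_rfl htr zero_le_one le_rfl (add_zero 1) (by ring)⟩
  · have h0 : 0 < r - s := by linarith
    have hab : (r - t) / (r - s) + (t - s) / (r - s) = 1 := by field_simp; ring
    refine ⟨(r - t) / (r - s), (t - s) / (r - s), div_nonneg (by linarith) h0.le,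
      div_nonneg (by linarith) h0.le, hab, fun h ↦ div_pos (by linarith) h0,
      fun h ↦ div_pos (by linarith) h0, fun x hx ↦ ?_⟩
    exact hx.pnorm_le_rpow_mul_rpow hs hst htr (div_nonneg (by linarith) h0.le)
      (div_nonneg (by linarith) h0.le) hab (by field_simp; ring)

theorem IsGaussP.pnorm_le_max {s t r : ℝ} (hs : 0 < s) (hst : s ≤ t) (htr : t ≤ r)
    {x : σ.GammaAlgP} (hx : σ.IsGaussP r x) : σ.pnorm t x ≤ max (σ.pnorm s x) (σ.pnorm r x) := by
  obtain ⟨a, b, ha, hb, hab, -, -, h⟩ := IsGaussP.exists_pnorm_le (σ := σ) hs hst htr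
  have hM : 0 ≤ max (σ.pnorm s x) (σ.pnorm r x) := le_max_of_le_left (pnorm_nonneg _ _)
  refine (h x hx).trans ((mul_le_mul (Real.rpow_le_rpow (pnorm_nonneg _ _) (le_max_left _ _) ha)
    (Real.rpow_le_rpow (pnorm_nonneg _ _) (le_max_right (σ.pnorm s x) _) hb) (Real.rpow_nonneg
      (pnorm_nonneg _ _) _) (Real.rpow_nonneg hM _)).trans_eq ?_)
  rcases hM.eq_or_lt with h0 | h0
  · rw [← h0]
    rcases eq_or_ne a 0 with rfl | ha0
    · rw [zero_add] at hab
      rw [hab, Real.rpow_one, mul_zero]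
    · rw [Real.zero_rpow ha0, zero_mul]
  · rw [← Real.rpow_add h0, hab, Real.rpow_one]

theorem anorm_le_max (hr : 0 < r) (hs : 0 < s) {t : ℝ} (hst : s ≤ t) (htr : t ≤ r) (x : σ.GammaAnR V r) :
    σ.anorm V r t x ≤ max (σ.anorm V r s x) (σ.anorm V r r x) := by
  obtain ⟨x, rfl⟩ := toAnR_surjective V r x
  exact le_of_tendsto_of_tendsto' (tendsto_anorm V hr (hs.trans_le hst) htr x)
    ((tendsto_anorm V hr hs (hst.trans htr) x).max (tendsto_anorm V hr hr le_rfl x)) fun i ↦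
    (isGaussP_apply V hr hr le_rfl x i).pnorm_le_max hs hst htr

/-- The norms are continuous from the left in the radius. -/
theorem IsGaussP.pnorm_le_of_forall_lt {s r C : ℝ} (hs : 0 < s) (hsr : s < r) {x : σ.GammaAlgP}
    (hx : σ.IsGaussP r x) (h : ∀ t, s ≤ t → t < r → σ.pnorm t x ≤ C) : σ.pnorm r x ≤ C := by
  have hr := hs.trans hsr
  obtain ⟨m, z, hz, e⟩ := hx
  rw [pnorm_eq hr hz e, div_le_iff₀ (thet_pow_pos m)]
  refine gnorm_le fun i ↦ ?_
  have hlim : Tendsto (fun t ↦ σ.gterm t z i) (𝓝[<] r) (𝓝 (σ.gterm r z i)) := by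
    refine Tendsto.mono_left (Tendsto.const_mul _ ?_) nhdsWithin_le_nhds
    exact (Real.continuousAt_const_rpow' hr.ne').tendsto
  have : (𝓝[<] r).NeBot := nhdsLT_neBot r
  refine le_of_tendsto hlim ?_
  filter_upwards [Ioo_mem_nhdsLT hsr] with t ht
  have hg := hz.mono (hs.trans ht.1) ht.2.le
  have h1 := h t ht.1.le ht.2
  rw [pnorm_eq (hs.trans ht.1) hg e, div_le_iff₀ (thet_pow_pos m)] at h1
  exact (hg.le_gnorm i).trans h1

theorem anorm_eq_zero_of_lt (hr : 0 < r) (hs : 0 < s) (hsr : s ≤ r)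
    {t : ℝ} (ht : 0 < t) (htr : t < r) {x : σ.GammaAnR V r}
    (h : σ.anorm V r s x = 0) : σ.anorm V r t x = 0 := by
  obtain ⟨x, rfl⟩ := toAnR_surjective V r x
  have h1 := tendsto_anorm V hr hs hsr x
  rw [h] at h1
  refine tendsto_nhds_unique (tendsto_anorm V hr ht htr.le x) ?_
  rcases le_total s t with hst | hts
  · obtain ⟨a, b, ha, hb, -, ha', -, hle⟩ := IsGaussP.exists_pnorm_le (σ := σ) hs hst htr.le
    have h2 := (h1.rpow_const (Or.inr ha)).mul
      ((tendsto_anorm V hr hr le_rfl x).rpow_const (Or.inr hb))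
    rw [Real.zero_rpow (ha' htr).ne', zero_mul] at h2
    exact squeeze_zero (fun _ ↦ pnorm_nonneg _ _)
      (fun i ↦ hle _ (isGaussP_apply V hr hr le_rfl x i)) h2
  · have ht2 : t / 2 < t := half_lt_self ht
    obtain ⟨a, b, ha, hb, -, -, hb', hle⟩ :=
      IsGaussP.exists_pnorm_le (σ := σ) (half_pos ht) ht2.le hts
    have h2 := ((tendsto_anorm V hr (half_pos ht) (ht2.le.trans htr.le) x).rpow_const
      (Or.inr ha)).mul (h1.rpow_const (Or.inr hb))
    rw [Real.zero_rpow (hb' ht2).ne', mul_zero] at h2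
    exact squeeze_zero (fun _ ↦ pnorm_nonneg _ _)
      (fun i ↦ hle _ (isGaussP_apply V hr hs hsr x i)) h2

theorem exists_anorm_sub_ofKRP_le (hr : 0 < r) (hs : 0 < s) (hsr : s ≤ r)
    (x : σ.GammaAnR V r) {ε : ℝ} (hε : 0 < ε) :
    ∃ a, σ.anorm V r s (x - σ.ofKRP V hr a) ≤ ε ∧ σ.anorm V r r (x - σ.ofKRP V hr a) ≤ ε := by
  obtain ⟨x, rfl⟩ := toAnR_surjective V r x
  have key : ∀ t, 0 < t → t ≤ r → ∃ n, ∀ i ≥ n, ∀ j ≥ n,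
      σ.pnorm t ((x : ℕ → σ.GammaAlgP) i - (x : ℕ → σ.GammaAlgP) j) ≤ ε := by
    intro t ht htr
    obtain ⟨⟨m, n⟩, h⟩ := eventually_atTop.1
      ((((cauchySeq_eq V hr).le x.2).2 t ht htr).eventually_lt_const hε)
    exact ⟨max m n, fun i hi j hj ↦ (h (i, j) ⟨(le_max_left _ _).trans hi,
      (le_max_right _ _).trans hj⟩).le⟩
  obtain ⟨n₁, h₁⟩ := key s hs hsr
  obtain ⟨n₂, h₂⟩ := key r hr le_rfl
  let a : σ.gammaKRPSubring V r := ⟨_, ((cauchySeq_eq V hr).le x.2).1 (max n₁ n₂)⟩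
  refine ⟨a, ?_, ?_⟩
  · refine le_of_tendsto (tendsto_anorm V hr hs hsr (x - σ.constSeq V hr a)) ?_
    filter_upwards [eventually_ge_atTop n₁] with i hi
    exact h₁ i hi _ (le_max_left _ _)
  · refine le_of_tendsto (tendsto_anorm V hr hr le_rfl (x - σ.constSeq V hr a)) ?_
    filter_upwards [eventually_ge_atTop n₂] with i hi
    exact h₂ i hi _ (le_max_right _ _)

theorem eq_zero_of_anorm_eq_zero (hr : 0 < r) (hs : 0 < s) (hsr : s ≤ r)
    {x : σ.GammaAnR V r} (h : σ.anorm V r s x = 0) : x = 0 := by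
  have hlt : ∀ t, 0 < t → t < r → σ.anorm V r t x = 0 :=
    fun t ht htr ↦ anorm_eq_zero_of_lt hr hs hsr ht htr h
  have hall : ∀ t, 0 < t → t ≤ r → σ.anorm V r t x = 0 := by
    intro t ht htr
    rcases htr.lt_or_eq with h1 | rfl
    · exact hlt t ht h1
    refine le_antisymm (le_of_forall_gt_imp_ge_of_dense fun ε hε ↦ ?_) (anorm_nonneg x)
    have h2 : t / 2 < t := half_lt_self ht
    obtain ⟨a, ha1, ha2⟩ := exists_anorm_sub_ofKRP_le hr (half_pos ht) h2.le x hε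
    have h3 : σ.anorm V t t (σ.ofKRP V hr a) ≤ ε := by
      rw [anorm_ofKRP hr ht le_rfl]
      refine (isGaussP_of_mem V hr a.2 ht le_rfl).pnorm_le_of_forall_lt (half_pos ht) h2
        fun t' h1 h2 ↦ ?_
      have ht' := (half_pos ht).trans_le h1
      rw [← anorm_ofKRP hr ht' h2.le, ← sub_zero (σ.ofKRP V hr a)]
      refine (anorm_sub_le hr ht' h2.le _ x _).trans (max_le ?_ ?_)
      · rw [anorm_sub_comm hr ht' h2.le]
        exact (anorm_le_max hr (half_pos ht) h1 h2.le _).trans (max_le ha1 ha2)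
      · rw [sub_zero, hlt t' ht' h2]
        exact hε.le
    rw [← sub_add_cancel x (σ.ofKRP V hr a)]
    exact (anorm_add_le hr ht le_rfl _ _).trans (max_le ha2 h3)
  obtain ⟨x, rfl⟩ := toAnR_surjective V r x
  rw [toAnR_eq_zero_iff]
  refine Ideal.subset_span ((isFrechetNull_iff V hr ((cauchySeq_eq V hr).le x.2).1).2 fun t ht htr ↦ ?_)
  have := tendsto_anorm V hr ht htr x
  rwa [hall t ht htr] at this

/-- The Fréchet completion is complete. -/
theorem exists_tendsto_anorm (hr : 0 < r) (x : ℕ → σ.GammaAnR V r)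
    (hx : ∀ s : ℝ, 0 < s → s ≤ r → ∀ ε > 0, ∃ M, ∀ m ≥ M, ∀ n ≥ M, σ.anorm V r s (x m - x n) ≤ ε) :
    ∃ y, ∀ s : ℝ, 0 < s → s ≤ r → Tendsto (fun n ↦ σ.anorm V r s (x n - y)) atTop (𝓝 0) := by
  have hrad : ∀ n : ℕ, 0 < r / (n + 1) ∧ r / (n + 1) ≤ r := fun n ↦ ⟨by positivity, by
    rw [div_le_iff₀ (by positivity)]; nlinarith [(Nat.cast_nonneg n : (0 : ℝ) ≤ n)]⟩
  choose a ha1 ha2 using fun n : ℕ ↦ exists_anorm_sub_ofKRP_le hr (hrad n).1 (hrad n).2 (x n)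
    (ε := 1 / ((n : ℝ) + 1)) (by positivity)
  have hclose : ∀ t : ℝ, 0 < t → t ≤ r → ∀ ε > 0, ∃ M, ∀ n ≥ M,
      σ.anorm V r t (x n - σ.ofKRP V hr (a n)) ≤ ε := by
    intro t ht htr ε hε
    have h1 : Tendsto (fun n : ℕ ↦ r / ((n : ℝ) + 1)) atTop (𝓝 0) := by
      simpa [div_eq_mul_inv] using (tendsto_one_div_add_atTop_nhds_zero_nat (𝕜 := ℝ)).const_mul r
    obtain ⟨M, hM⟩ := eventually_atTop.1 ((h1.eventually_lt_const ht).and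
      ((tendsto_one_div_add_atTop_nhds_zero_nat (𝕜 := ℝ)).eventually_lt_const hε))
    exact ⟨M, fun n hn ↦ ((anorm_le_max hr (hrad n).1 (hM n hn).1.le htr _).trans
      (max_le (ha1 n) (ha2 n))).trans (hM n hn).2.le⟩
  have hcauchy : ∀ t : ℝ, 0 < t → t ≤ r → ∀ ε > 0, ∃ M, ∀ m ≥ M, ∀ n ≥ M,
      σ.pnorm t ((a m : σ.GammaAlgP) - a n) ≤ ε := by
    intro t ht htr ε hε
    obtain ⟨M₁, h₁⟩ := hclose t ht htr ε hε
    obtain ⟨M₂, h₂⟩ := hx t ht htr ε hε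
    refine ⟨max M₁ M₂, fun m hm n hn ↦ ?_⟩
    have e := anorm_ofKRP hr ht htr (a m - a n)
    rw [map_sub] at e
    refine e.symm.le.trans ((anorm_sub_le hr ht htr _ (x m) _).trans (max_le ?_
      ((anorm_sub_le hr ht htr _ (x n) _).trans (max_le (h₂ m ((le_max_right _ _).trans hm) n
        ((le_max_right _ _).trans hn)) (h₁ n ((le_max_left _ _).trans hn))))))
    rw [anorm_sub_comm hr ht htr]
    exact h₁ m ((le_max_left _ _).trans hm)
  let y : σ.cauchySeq V r := ⟨fun n ↦ a n, (cauchySeq_eq V hr).ge ⟨fun n ↦ (a n).2,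
    fun t ht htr ↦ tendsto_order.2 ⟨fun b hb ↦ Eventually.of_forall fun ij ↦
      hb.trans_le (pnorm_nonneg _ _), fun ε hε ↦ by
        obtain ⟨M, hM⟩ := hcauchy t ht htr (ε / 2) (half_pos hε)
        filter_upwards [eventually_ge_atTop (M, M)] with ij hij
        exact (hM _ hij.1 _ hij.2).trans_lt (half_lt_self hε)⟩⟩⟩
  refine ⟨σ.toAnR V r y, fun t ht htr ↦ tendsto_order.2 ⟨fun b hb ↦ Eventually.of_forall fun n ↦
    hb.trans_le (anorm_nonneg _), fun ε hε ↦ ?_⟩⟩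
  obtain ⟨M₁, h₁⟩ := hclose t ht htr (ε / 2) (half_pos hε)
  obtain ⟨M₂, h₂⟩ := hcauchy t ht htr (ε / 2) (half_pos hε)
  filter_upwards [eventually_ge_atTop (max M₁ M₂)] with n hn
  refine lt_of_le_of_lt ((anorm_sub_le hr ht htr _ (σ.ofKRP V hr (a n)) _).trans (max_le
    (h₁ n ((le_max_left _ _).trans hn)) ?_)) (half_lt_self hε)
  refine le_of_tendsto (tendsto_anorm V hr ht htr (σ.constSeq V hr (a n) - y)) ?_
  filter_upwards [eventually_ge_atTop (max M₁ M₂)] with i hi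
  exact h₂ n ((le_max_right _ _).trans hn) i ((le_max_right _ _).trans hi)

end Norm

variable (σ) in
/-- The inclusion of the saturation in `Γ^K_r[1/p]`. -/
def satToKRP {r : ℝ} (hr : 0 < r) : σ.satSubring V hr →+* σ.gammaKRPSubring V r :=
  (σ.toP.comp (σ.satSubring V hr).subtype).codRestrict _ fun a ↦
    (mem_gammaKRP V hr).2 ⟨0, a, a.2, by rw [pow_zero, map_one, one_mul]; rfl⟩

variable (σ) in
/-- The map from the saturation to the Fréchet completion. -/
def ofSat {r : ℝ} (hr : 0 < r) : σ.satSubring V hr →+* σ.GammaAnR V r :=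
  (σ.ofKRP V hr).comp (σ.satToKRP V hr)

theorem anorm_ofSat {r s : ℝ} (hr : 0 < r) (hs : 0 < s) (hsr : s ≤ r) (a : σ.satSubring V hr) :
    σ.anorm V r s (σ.ofSat V hr a) = σ.gnorm s a :=
  (anorm_ofKRP hr hs hsr _).trans (pnorm_toP hs (IsGauss.mono hs hsr a.2.1))

variable (σ) in
/-- The uniformizer as an element of the saturation. -/
def unifSat {r : ℝ} (hr : 0 < r) : σ.satSubring V hr :=
  ⟨σ.unif, by rw [← mul_one σ.unif]; exact (isGauss_one hr).unif_mul, 0, by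
    rw [pow_zero, one_mul]; exact unif_mem_gammaK V⟩

theorem anorm_unifSat_pow {r s : ℝ} (hr : 0 < r) (hs : 0 < s) (hsr : s ≤ r) (n : ℕ) :
    σ.anorm V r s (σ.ofSat V hr (σ.unifSat V hr) ^ n) = thet p ϖ ^ n := by
  rw [← map_pow, anorm_ofSat V hr hs hsr]
  have h := ((isGauss_one (σ := σ) hs).unif_pow_mul hs n).2
  rwa [mul_one, gnorm_one hs, mul_one] at h

theorem isUnit_ofSat_unifSat {r : ℝ} (hr : 0 < r) : IsUnit (σ.ofSat V hr (σ.unifSat V hr)) := by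
  obtain ⟨w, hw⟩ := σ.isUnit_toP_unif.exists_right_inv
  have hwm : w ∈ σ.GammaKRP V r := (mem_gammaKRP V hr).2
    ⟨1, 1, Subring.one_mem _, by rw [pow_one, hw, map_one]⟩
  have h : σ.satToKRP V hr (σ.unifSat V hr) * ⟨w, hwm⟩ = 1 := Subtype.ext hw
  refine IsUnit.map (σ.ofKRP V hr) (IsUnit.of_mul_eq_one _ h)

variable (σ) in
/-- The uniformizer as a unit of the Fréchet completion. -/
def unifAn {r : ℝ} (hr : 0 < r) : (σ.GammaAnR V r)ˣ := (isUnit_ofSat_unifSat V hr).unit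

theorem unifAn_val {r : ℝ} (hr : 0 < r) :
    ((σ.unifAn V hr : (σ.GammaAnR V r)ˣ) : σ.GammaAnR V r) = σ.ofSat V hr (σ.unifSat V hr) := rfl

theorem unifAn_pow_mul_zpow {r : ℝ} (hr : 0 < r) {m : ℕ} {i : ℤ} (h : 0 ≤ i + m) :
    σ.ofSat V hr (σ.unifSat V hr) ^ m * ((σ.unifAn V hr ^ i : (σ.GammaAnR V r)ˣ) : σ.GammaAnR V r) =
      σ.ofSat V hr (σ.unifSat V hr) ^ (i + m).toNat := by
  rw [← unifAn_val, ← Units.val_pow_eq_pow_val, ← Units.val_pow_eq_pow_val, ← Units.val_mul,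
    ← zpow_natCast, ← zpow_natCast, Int.toNat_of_nonneg h, ← zpow_add, add_comm]

theorem anorm_le_iff_unifSat_pow {r s : ℝ} (hr : 0 < r) (hs : 0 < s) (hsr : s ≤ r) (m : ℕ)
    (x y : σ.GammaAnR V r) : σ.anorm V r s x ≤ σ.anorm V r s y ↔
      σ.anorm V r s (σ.ofSat V hr (σ.unifSat V hr) ^ m * x) ≤
        σ.anorm V r s (σ.ofSat V hr (σ.unifSat V hr) ^ m * y) := by
  rw [anorm_mul hr hs hsr, anorm_mul hr hs hsr _ y, anorm_unifSat_pow V hr hs hsr,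
    mul_le_mul_iff_right₀ (thet_pow_pos m)]

/-- Exactness of the norm of a finite sum with good coefficients. -/
theorem anorm_term_le {r θ s : ℝ} (hr : 0 < r) (hθ : 0 ≤ θ) (hθ1 : θ < 1) (hs : 0 < s)
    (hsr : s ≤ r) (F : Finset ℤ) (c : ℤ → σ.satSubring V hr)
    (hc : ∀ i, σ.IsGoodCoef V r θ (c i)) {i : ℤ} (hi : i ∈ F) :
    σ.anorm V r s (((σ.unifAn V hr ^ i : (σ.GammaAnR V r)ˣ) : σ.GammaAnR V r) * σ.ofSat V hr (c i)) ≤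
      σ.anorm V r s (∑ i ∈ F,
        ((σ.unifAn V hr ^ i : (σ.GammaAnR V r)ˣ) : σ.GammaAnR V r) * σ.ofSat V hr (c i)) := by
  set m := F.sup fun i ↦ (-i).toNat with hm
  have hF : ∀ j ∈ F, 0 ≤ j + m := fun j hj ↦ by
    have h : (-j).toNat ≤ m := Finset.le_sup (f := fun i : ℤ ↦ (-i).toNat) hj
    omega
  set U := σ.unifSat V hr
  have e1 : ∀ j ∈ F, σ.ofSat V hr U ^ m *
      (((σ.unifAn V hr ^ j : (σ.GammaAnR V r)ˣ) : σ.GammaAnR V r) * σ.ofSat V hr (c j)) =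
      σ.ofSat V hr (U ^ (j + m).toNat * c (((j + m).toNat : ℤ) - m)) := fun j hj ↦ by
    rw [← mul_assoc, unifAn_pow_mul_zpow V hr (hF j hj), map_mul, map_pow,
      Int.toNat_of_nonneg (hF j hj), add_sub_cancel_right]
  rw [anorm_le_iff_unifSat_pow V hr hs hsr m, Finset.mul_sum, e1 i hi, Finset.sum_congr rfl e1,
    ← map_sum, anorm_ofSat V hr hs hsr, anorm_ofSat V hr hs hsr]
  have hinj : Set.InjOn (fun j : ℤ ↦ (j + m).toNat) F := fun j hj l hl h ↦ by
    have h1 := hF j hj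
    have h2 := hF l hl
    dsimp only at h
    omega
  have e2 := Finset.sum_image (s := F) (g := fun j : ℤ ↦ (j + m).toNat)
    (f := fun n : ℕ ↦ σ.unif ^ n * (c ((n : ℤ) - m) : σ.GammaAlg)) hinj
  have h := gnorm_term_le_gnorm_sum (σ := σ) (V := V) hs hsr hθ hθ1
    (F := F.image fun j : ℤ ↦ (j + m).toNat)
    (c := fun n : ℕ ↦ (c ((n : ℤ) - m) : σ.GammaAlg)) (fun n _ ↦ hc _) (Finset.mem_image_of_mem _ hi)
  rw [e2] at h
  rw [AddSubmonoidClass.coe_finsetSum]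
  exact h

section Lifts

variable {V} {r θ : ℝ}

/-- Density of the sums with good coefficients. -/
theorem exists_anorm_sub_sum_le (hr : 0 < r) (hθ : thet p ϖ ≤ θ) (hθ1 : θ < 1)
    (hlift : ∀ a ∈ K, a ≠ 0 → ∃ x, σ.IsGoodUnit V r θ x ∧ σ.residueAlg x = a) {s : ℝ}
    (hs : 0 < s) (hsr : s ≤ r) (x : σ.GammaAnR V r) {ε : ℝ} (hε : 0 < ε) :
    ∃ (F : Finset ℤ) (c : ℤ → σ.satSubring V hr), (∀ i, σ.IsGoodCoef V r θ (c i)) ∧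
      ∀ t, t = s ∨ t = r → σ.anorm V r t (x - ∑ i ∈ F,
        ((σ.unifAn V hr ^ i : (σ.GammaAnR V r)ˣ) : σ.GammaAnR V r) * σ.ofSat V hr (c i)) ≤ ε := by
  obtain ⟨a, ha1, ha2⟩ := exists_anorm_sub_ofKRP_le hr hs hsr x hε
  obtain ⟨m, z, hz, hza⟩ := (mem_gammaKRP V hr).1 a.2
  set E := ε * thet p ϖ ^ m with hE
  have hE0 : 0 < E := mul_pos hε (thet_pow_pos m)
  obtain ⟨n, c, hc, hn⟩ := exists_sum_sub_le hr hθ hθ1 hlift hz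
    (ε := min E (E ^ (r / s))) (lt_min hE0 (Real.rpow_pos_of_pos hE0 _))
  have hcS : ∀ i, c i ∈ σ.satSubring V hr := fun i ↦ gammaKR_le_satSubring V hr (hc i).mem
  set U := σ.unifSat V hr
  set y : σ.satSubring V hr := ⟨z, hz⟩ - ∑ i ∈ Finset.range n, U ^ i * ⟨c i, hcS i⟩ with hy
  have hyc : (y : σ.GammaAlg) = z - ∑ i ∈ Finset.range n, σ.unif ^ i * c i := by
    rw [hy, AddSubgroupClass.coe_sub, AddSubmonoidClass.coe_finsetSum]
    rfl
  have hyr : σ.gnorm r y ≤ E := by rw [hyc]; exact hn.trans (min_le_left _ _)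
  have hys : σ.gnorm s y ≤ E := by
    refine (IsGauss.gnorm_le_rpow hs hsr y.2.1).trans ?_
    have h : σ.gnorm r y ≤ E ^ (r / s) := by rw [hyc]; exact hn.trans (min_le_right _ _)
    refine (Real.rpow_le_rpow gnorm_nonneg h (div_pos hs hr).le).trans_eq ?_
    rw [← Real.rpow_mul hE0.le, div_mul_div_cancel₀ hs.ne', div_self hr.ne', Real.rpow_one]
  have hinj : Function.Injective fun j : ℕ ↦ (j : ℤ) - m := fun j l h ↦ by
    dsimp only at h; omega
  refine ⟨(Finset.range n).image fun j : ℕ ↦ (j : ℤ) - m, fun i ↦ ⟨c (i + m).toNat, hcS _⟩,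
    fun i ↦ hc _, fun t ht ↦ ?_⟩
  have hmain : σ.ofSat V hr U ^ m * (σ.ofKRP V hr a - ∑ i ∈ (Finset.range n).image
      fun j : ℕ ↦ (j : ℤ) - m, ((σ.unifAn V hr ^ i : (σ.GammaAnR V r)ˣ) : σ.GammaAnR V r) *
        σ.ofSat V hr ⟨c (i + m).toNat, hcS _⟩) = σ.ofSat V hr y := by
    rw [Finset.sum_image hinj.injOn, mul_sub, hy, map_sub, map_sum, Finset.mul_sum]
    congr 1
    · rw [← map_pow]
      change σ.ofKRP V hr (σ.satToKRP V hr (U ^ m)) * _ = σ.ofKRP V hr (σ.satToKRP V hr ⟨z, hz⟩)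
      rw [← map_mul]
      exact congrArg _ (Subtype.ext hza)
    · refine Finset.sum_congr rfl fun j _ ↦ ?_
      have h0 : 0 ≤ (j : ℤ) - m + m := by omega
      rw [← mul_assoc, unifAn_pow_mul_zpow V hr h0, map_mul, map_pow]
      simp only [sub_add_cancel, Int.toNat_natCast]
      rfl
  have key : ∀ t, 0 < t → t ≤ r → σ.gnorm t y ≤ E → σ.anorm V r t (x - σ.ofKRP V hr a) ≤ ε →
      σ.anorm V r t (x - ∑ i ∈ (Finset.range n).image fun j : ℕ ↦ (j : ℤ) - m,
        ((σ.unifAn V hr ^ i : (σ.GammaAnR V r)ˣ) : σ.GammaAnR V r) *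
        σ.ofSat V hr ⟨c (i + m).toNat, hcS _⟩) ≤ ε := by
    intro t ht htr hty hta
    refine (anorm_sub_le hr ht htr _ (σ.ofKRP V hr a) _).trans (max_le hta ?_)
    have h := congrArg (σ.anorm V r t) hmain
    rw [anorm_mul hr ht htr, anorm_unifSat_pow V hr ht htr, anorm_ofSat V hr ht htr] at h
    refine le_of_mul_le_mul_left ?_ (thet_pow_pos (p := p) (ϖ := ϖ) m)
    rw [h, mul_comm]
    exact hty
  rcases ht with rfl | rfl
  · exact key t hs hsr hys ha1
  · exact key t hr le_rfl hyr ha2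

/-- The Fréchet completion is a ring of analytic functions on a punctured disc. -/
def annulusRing (hr : 0 < r) (hθ : thet p ϖ ≤ θ) (hθ1 : θ < 1)
    (hlift : ∀ a ∈ K, a ≠ 0 → ∃ x, σ.IsGoodUnit V r θ x ∧ σ.residueAlg x = a) :
    AnnulusRing (σ.GammaAnR V r) where
  r := r
  N s := σ.anorm V r s
  nonneg _ _ := anorm_nonneg _
  map_zero s hs hsr := by
    rw [← map_zero (σ.ofSat V hr), anorm_ofSat V hr hs hsr]
    exact gnorm_zero hs
  map_one s hs hsr := by
    rw [← map_one (σ.ofSat V hr), anorm_ofSat V hr hs hsr]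
    exact gnorm_one hs
  map_mul _ hs hsr := anorm_mul hr hs hsr
  add_le _ hs hsr := anorm_add_le hr hs hsr
  neg _ hs hsr := anorm_neg hr hs hsr
  eq_zero _ hs hsr _ := eq_zero_of_anorm_eq_zero hr hs hsr
  convex _ _ hs hst htr := anorm_le_max hr hs hst htr
  complete := exists_tendsto_anorm hr
  ϖ := σ.unifAn V hr
  κ := 1 / ramIndex p ϖ
  κ_pos := div_pos one_pos (Nat.cast_pos.2 ramIndex_pos)
  norm_ϖ s hs hsr := by
    have h := anorm_unifSat_pow (σ := σ) V hr hs hsr 1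
    rw [pow_one, pow_one, thet, vUnif_eq] at h
    push_cast
    exact h
  G := {x | ∃ c : σ.satSubring V hr, σ.IsGoodCoef V r θ c ∧ x = σ.ofSat V hr c}
  zero_mem := ⟨0, Or.inl rfl, (map_zero _).symm⟩
  one_mem := ⟨1, Or.inr (isGoodUnit_one hr (thet_pos.le.trans hθ)), (map_one _).symm⟩
  mul_mem := by
    rintro _ ⟨c, hc, rfl⟩ _ ⟨d, hd, rfl⟩
    refine ⟨c * d, ?_, (map_mul _ _ _).symm⟩
    rcases hc with hc | hc
    · exact Or.inl (by rw [Subring.coe_mul, hc, zero_mul])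
    · rcases hd with hd | hd
      · exact Or.inl (by rw [Subring.coe_mul, hd, mul_zero])
      · exact Or.inr (hc.mul hr hd)
  inv_mem := by
    rintro _ ⟨c, hc, rfl⟩ h0
    rcases hc with hc | hc
    · exact absurd (by rw [show c = 0 from Subtype.ext hc, map_zero]) h0
    · obtain ⟨d, hd, hcd⟩ := hc.exists_inverse hr
      refine ⟨_, ⟨⟨d, gammaKR_le_satSubring V hr hd.mem⟩, Or.inr hd, rfl⟩, ?_⟩
      rw [← map_mul, ← map_one (σ.ofSat V hr)]
      exact congrArg _ (Subtype.ext hcd)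
  norm_G := by
    rintro _ ⟨c, hc, rfl⟩ h0
    rcases hc with hc | hc
    · exact absurd (by rw [show c = 0 from Subtype.ext hc, map_zero]) h0
    · obtain ⟨q, hq⟩ := exists_lnorm_eq_exp hc.residue_ne_zero
      refine ⟨-q, fun s hs hsr ↦ ?_⟩
      rw [anorm_ofSat V hr hs hsr, hc.gnorm_eq hs hsr, hq, ← Real.exp_mul]
      push_cast
      congr 1
      ring
  A := (σ.ofSat V hr).range
  ϖ_mem := ⟨_, rfl⟩
  G_le := by
    rintro _ ⟨c, -, rfl⟩
    exact ⟨c, rfl⟩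
  norm_A := by
    rintro _ ⟨a, rfl⟩ s hs hsr
    rw [anorm_ofSat V hr hs hsr, anorm_ofSat V hr hr le_rfl]
    exact IsGauss.gnorm_le_rpow hs hsr a.2.1
  exact' s hs hsr F c hc i hi := by
    choose d hd hcd using hc
    simp only [hcd]
    exact anorm_term_le V hr (thet_pos.le.trans hθ) hθ1 hs hsr F d hd hi
  θ := θ
  θ_lt_one := hθ1
  sub_mem := by
    rintro _ ⟨c, hc, rfl⟩ _ ⟨d, hd, rfl⟩
    obtain ⟨e, he, hle⟩ := exists_isGoodCoef_sub hr hθ hlift hc hd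
    refine ⟨_, ⟨⟨e, gammaKR_le_satSubring V hr he.mem⟩, he, rfl⟩, ?_⟩
    rw [← map_sub, ← map_sub, anorm_ofSat V hr hr le_rfl, anorm_ofSat V hr hr le_rfl,
      anorm_ofSat V hr hr le_rfl]
    exact hle
  dense x s hs hsr ε hε := by
    obtain ⟨F, c, hc, h⟩ := exists_anorm_sub_sum_le hr hθ hθ1 hlift hs hsr x hε
    exact ⟨F, _, fun i ↦ ⟨c i, hc i, rfl⟩, h s (Or.inl rfl), h r (Or.inr rfl)⟩
  denseA := by
    rintro _ ⟨a, rfl⟩ ε hε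
    obtain ⟨n, c, hc, hn⟩ := exists_sum_sub_le hr hθ hθ1 hlift a.2 hε
    have hcS : ∀ i, c i ∈ σ.satSubring V hr := fun i ↦ gammaKR_le_satSubring V hr (hc i).mem
    refine ⟨n, fun i ↦ σ.ofSat V hr ⟨c i, hcS i⟩, fun i ↦ ⟨_, hc i, rfl⟩, ?_⟩
    have e : σ.ofSat V hr a - ∑ i ∈ Finset.range n, (σ.unifAn V hr : σ.GammaAnR V r) ^ i *
        σ.ofSat V hr ⟨c i, hcS i⟩ = σ.ofSat V hr
          (a - ∑ i ∈ Finset.range n, σ.unifSat V hr ^ i * ⟨c i, hcS i⟩) := by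
      rw [map_sub, map_sum]
      exact congrArg _ (Finset.sum_congr rfl fun i _ ↦ by rw [map_mul, map_pow]; rfl)
    rw [e, anorm_ofSat V hr hr le_rfl, AddSubgroupClass.coe_sub, AddSubmonoidClass.coe_finsetSum]
    exact hn

end Lifts

theorem isBezout_gammaAnR
    (hK : FiniteDimensional (LaurentSeries (IsLocalRing.ResidueField O)) K ∨ PerfectField K)
    {r : ℝ} (hr : 0 < r) (hl : ∀ a ∈ K, a ≠ 0 → ∃ x ∈ σ.GammaKR V r, ∃ y ∈ σ.GammaKR V r,
      x * y = 1 ∧ σ.residueAlg x = a) : IsBezout (σ.GammaAnR V r) := by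
  obtain ⟨θ, hθ, hθ1, hlift⟩ := exists_good_lift hK hr hl
  exact AnnulusRing.isBezout (annulusRing hr hθ hθ1 hlift) hr

theorem cauchySeq_anti {r s : ℝ} (hs : 0 < s) (hsr : s ≤ r) :
    σ.cauchySeq V r ≤ σ.cauchySeq V s := by
  have hr := hs.trans_le hsr
  rw [cauchySeq_eq V hr, cauchySeq_eq V hs]
  rintro x ⟨hx, hc⟩
  refine ⟨fun i ↦ ?_, fun t ht hts ↦ hc t ht (hts.trans hsr)⟩
  obtain ⟨m, y, hy, h⟩ := hx i
  exact ⟨m, y, (mem_gammaKR V hs).2 (((mem_gammaKR V hr).1 hy).imp (IsGauss.mono hs hsr) id), h⟩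

theorem mem_cauchySeqCon {x : ℕ → σ.GammaAlgP} :
    x ∈ σ.cauchySeqCon V ↔ ∃ r : ℝ, 0 < r ∧ x ∈ σ.cauchySeq V r := by
  have : Nonempty {r : ℝ // 0 < r} := ⟨⟨1, one_pos⟩⟩
  have hdir : Directed (· ≤ ·) fun r : {r : ℝ // 0 < r} ↦ σ.cauchySeq V r.1 := fun a b ↦
    ⟨⟨min a.1 b.1, lt_min a.2 b.2⟩, cauchySeq_anti V (lt_min a.2 b.2) (min_le_left _ _),
      cauchySeq_anti V (lt_min a.2 b.2) (min_le_right _ _)⟩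
  rw [cauchySeqCon, iSup_subtype', Subring.mem_iSup_of_directed hdir, Subtype.exists]
  simp only [exists_prop]

theorem isBezout_gammaAnCon
    (hK : FiniteDimensional (LaurentSeries (IsLocalRing.ResidueField O)) K ∨ PerfectField K)
    {r : ℝ} (hr : 0 < r) (hl : ∀ a ∈ K, a ≠ 0 → ∃ x ∈ σ.GammaKR V r, ∃ y ∈ σ.GammaKR V r,
      x * y = 1 ∧ σ.residueAlg x = a) : IsBezout (σ.GammaAnCon V) := by
  rw [IsBezout.iff_span_pair_isPrincipal]
  intro x y
  obtain ⟨⟨x, hx⟩, rfl⟩ := Ideal.Quotient.mk_surjective x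
  obtain ⟨⟨y, hy⟩, rfl⟩ := Ideal.Quotient.mk_surjective y
  obtain ⟨r₁, hr₁, hx₁⟩ := (mem_cauchySeqCon V).1 hx
  obtain ⟨r₂, hr₂, hy₂⟩ := (mem_cauchySeqCon V).1 hy
  obtain ⟨s, hs, hs₁, hs₂, hsr⟩ : ∃ s, 0 < s ∧ s ≤ r₁ ∧ s ≤ r₂ ∧ s ≤ r :=
    ⟨min r₁ (min r₂ r), lt_min hr₁ (lt_min hr₂ hr), min_le_left _ _,
      (min_le_right _ _).trans (min_le_left _ _), (min_le_right _ _).trans (min_le_right _ _)⟩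
  have hle : σ.GammaKR V r ≤ σ.GammaKR V s := fun z hz ↦
    (mem_gammaKR V hs).2 (((mem_gammaKR V hr).1 hz).imp (IsGauss.mono hs hsr) id)
  have hB : IsBezout (σ.GammaAnR V s) := isBezout_gammaAnR V hK hs fun a ha h0 ↦ by
    obtain ⟨x, hx, y, hy, h⟩ := hl a ha h0
    exact ⟨x, hle hx, y, hle hy, h⟩
  let ι : σ.cauchySeq V s →+* σ.cauchySeqCon V :=
    Subring.inclusion fun z hz ↦ (mem_cauchySeqCon V).2 ⟨s, hs, hz⟩
  let φ : σ.GammaAnR V s →+* σ.GammaAnCon V := Ideal.quotientMap _ ι (Ideal.span_le.2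
    fun z hz ↦ Ideal.subset_span ⟨s, hs, hz⟩)
  obtain ⟨g, hg⟩ := (IsBezout.iff_span_pair_isPrincipal.1 hB
    (σ.toAnR V s ⟨x, cauchySeq_anti V hs hs₁ hx₁⟩)
    (σ.toAnR V s ⟨y, cauchySeq_anti V hs hs₂ hy₂⟩)).principal
  refine ⟨φ g, ?_⟩
  have h := congrArg (Ideal.map φ) (hg : Ideal.span _ = Ideal.span {g})
  rw [Ideal.map_span, Ideal.map_span, Set.image_pair, Set.image_singleton] at h
  exact h

end FrobeniusLift

end Lifts

end Gamma

/-- Every finitely generated ideal of `Γ^K_{an,r}`, and of `Γ^K_{an,con}`, is principal. -/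
theorem mainTheorem3 {p : ℕ} [Fact p.Prime]
    {O : Type u} [CommRing O] [IsDomain O] [IsDiscreteValuationRing O] [CharZero O]
    [IsAdicComplete (IsLocalRing.maximalIdeal O) O] [CharP (IsLocalRing.ResidueField O) p]
    {ϖ : O} [Fact (Irreducible ϖ)]
    (σ : FrobeniusLift p ϖ)
    {K : IntermediateField (LaurentSeries (IsLocalRing.ResidueField O))
      (LaurentAlg (IsLocalRing.ResidueField O))}
    (V : ValuedFieldChain p K)
    (hK : FiniteDimensional (LaurentSeries (IsLocalRing.ResidueField O)) K ∨ PerfectField K)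
    {r : ℝ} (hr : 0 < r)
    (hunits : ∀ a ∈ K, a ≠ 0 → ∃ x : (σ.GammaKR V r)ˣ, σ.residueAlg (x : σ.GammaKR V r) = a) :
    (∀ I : Ideal (σ.GammaAnR V r), I.FG → I.IsPrincipal) ∧
      (∀ I : Ideal (σ.GammaAnCon V), I.FG → I.IsPrincipal) := by
  have hl : ∀ a ∈ K, a ≠ 0 → ∃ x ∈ σ.GammaKR V r, ∃ y ∈ σ.GammaKR V r,
      x * y = 1 ∧ σ.residueAlg x = a := fun a ha h0 ↦ by
    obtain ⟨x, hx⟩ := hunits a ha h0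
    exact ⟨(x : σ.GammaKR V r), (x : σ.GammaKR V r).2, ((x⁻¹ : (σ.GammaKR V r)ˣ) : σ.GammaKR V r),
      ((x⁻¹ : (σ.GammaKR V r)ˣ) : σ.GammaKR V r).2, congrArg Subtype.val x.mul_inv, hx⟩
  exact ⟨fun I hI ↦ (FrobeniusLift.isBezout_gammaAnR V hK hr hl).isPrincipal_of_FG I hI,
    fun I hI ↦ (FrobeniusLift.isBezout_gammaAnCon V hK hr hl).isPrincipal_of_FG I hI⟩
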